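/- \textbf{Theorem 1.} The model of computation is the word RAM: a program with finitely many registers and arrays (initially $0$ outside the input), unit-cost arithmetic, comparison, bitwise and indirect memory access instructions, on words of $O(\log N)$ bits, where $N$ is the size parameter of the input (equivalently, every value occurring in a run is at most $(N+2)^{k}$ for a constant $k$ that depends only on the program). Let $\ell(n)>0$ for all integers $n\ge 1$. Suppose that there is an algorithm that, given $n\ge 1$ and two $n\times n$ matrices $A,B$ with entries in $\{0,1,\dots,n\}$, computes their min-plus product $(A\star B)[i,j]=\min_{k}(A[i,k]+B[k,j])$ in $O(n^3/\ell(n))$ time. Then: 1. There is an algorithm that, given a binary string $T$ of length $n\ge 1$, computes for every $i=1,\dots,n$ the minimum and the maximum number of 1s in a substring of $T$ of length $i$, in $O\bigl(n^2/\ell(\lfloor\sqrt n\rfloor)\bigr)$ time. 2. There is an algorithm that, given a tree $T$ with $n$ nodes (as a list of its edges), a label $0$ or $1$ for each node, and any integer $r\ge 1$, computes for every $i=1,\dots,n$ the minimum and the maximum number of nodes labelled 1 in a connected subgraph of $T$ with $i$ nodes, in $O\bigl(nr+n^2/\ell(\lfloor\sqrt r\rfloor)\bigr)$ time (with $N=n+r$,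 and with a constant that does not depend on $n$, $r$ or the input). -/

import Mathlib

/-! ## A word RAM with unit-cost instructions

A machine state has registers and a bank of arrays of natural numbers; a program mentions only
finitely many registers and arrays (their names are constants of the program), while array indices
are computed at run time.  Every value that occurs in a run has to be at most a bound `B`; taking
`B` polynomial in the size of the input is the usual word length of `O(log n)` bits. -/

namespace WordRAM

/-- Machine states: the value of every register, and of every cell of every array. -/
@[ext] structure State where
  reg : ℕ → ℕ
  mem : ℕ → ℕ → ℕ

/-- The arithmetic, comparison and bitwise instructions. -/
inductive BinOp where
  | add | sub | mul | div | mod | lt | eq | land | lor | xor | shl | shr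

/-- Subtraction is truncated at `0`, and comparisons return `1` (true) or `0` (false). -/
def BinOp.apply : BinOp → ℕ → ℕ → ℕ
  | .add, a, b => a + b
  | .sub, a, b => a - b
  | .mul, a, b => a * b
  | .div, a, b => a / b
  | .mod, a, b => a % b
  | .lt, a, b => if a < b then 1 else 0
  | .eq, a, b => if a = b then 1 else 0
  | .land, a, b => a &&& b
  | .lor, a, b => a ||| b
  | .xor, a, b => a ^^^ b
  | .shl, a, b => a <<< b
  | .shr, a, b => a >>> b

/-- Expressions: constants, registers, array cells, and applied operations. -/
inductive Expr where
  | const (c : ℕ)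
  | reg (x : ℕ)
  | cell (a : ℕ) (index : Expr)
  | op (o : BinOp) (e₁ e₂ : Expr)

/-- The value of an expression in a state. -/
def Expr.val (s : State) : Expr → ℕ
  | .const c => c
  | .reg x => s.reg x
  | .cell a e => s.mem a (e.val s)
  | .op o e₁ e₂ => o.apply (e₁.val s) (e₂.val s)

/-- The time for evaluating an expression: one step for each node of the expression. -/
def Expr.cost : Expr → ℕ
  | .const _ => 1
  | .reg _ => 1
  | .cell _ e => e.cost + 1
  | .op _ e₁ e₂ => e₁.cost + e₂.cost + 1

/-- All values (and hence all addresses) that occur in evaluating the expression are at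
most `B`. -/
def Expr.Fits (B : ℕ) (s : State) : Expr → Prop
  | .const c => c ≤ B
  | .reg x => s.reg x ≤ B
  | .cell a e => e.Fits B s ∧ s.mem a (e.val s) ≤ B
  | .op o e₁ e₂ => e₁.Fits B s ∧ e₂.Fits B s ∧ o.apply (e₁.val s) (e₂.val s) ≤ B

/-- Programs.  A test succeeds when its value is nonzero. -/
inductive Program where
  | skip
  | assign (x : ℕ) (e : Expr)
  | store (a : ℕ) (index value : Expr)
  | seq (p q : Program)
  | ite (test : Expr) (p q : Program)
  | loop (test : Expr) (body : Program)

/-- Write the value `v` into register `x`. -/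
def State.setReg (s : State) (x v : ℕ) : State :=
  { s with reg := Function.update s.reg x v }

/-- Write the value `v` into cell `i` of array `a`. -/
def State.setMem (s : State) (a i v : ℕ) : State :=
  { s with mem := Function.update s.mem a (Function.update (s.mem a) i v) }

/-- `Exec B p s s' t`: started in state `s`, the program `p` halts in state `s'` after exactly `t`
steps, and all values that occur are at most `B`.  (If a value exceeds `B`, or if the program does
not halt, there is no such `s'`.) -/
inductive Exec (B : ℕ) : Program → State → State → ℕ → Prop
  | skip (s : State) : Exec B .skip s s 1
  | assign (s : State) (x : ℕ) (e : Expr) (he : e.Fits B s) :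
      Exec B (.assign x e) s (s.setReg x (e.val s)) (e.cost + 1)
  | store (s : State) (a : ℕ) (i e : Expr) (hi : i.Fits B s) (he : e.Fits B s) :
      Exec B (.store a i e) s (s.setMem a (i.val s) (e.val s)) (i.cost + e.cost + 1)
  | seq {p q : Program} {s₁ s₂ s₃ : State} {t₁ t₂ : ℕ}
      (hp : Exec B p s₁ s₂ t₁) (hq : Exec B q s₂ s₃ t₂) : Exec B (.seq p q) s₁ s₃ (t₁ + t₂)
  | iteTrue {e : Expr} {p q : Program} {s s' : State} {t : ℕ} (he : e.Fits B s)
      (htest : e.val s ≠ 0) (hp : Exec B p s s' t) : Exec B (.ite e p q) s s' (e.cost + 1 + t)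
  | iteFalse {e : Expr} {p q : Program} {s s' : State} {t : ℕ} (he : e.Fits B s)
      (htest : e.val s = 0) (hq : Exec B q s s' t) : Exec B (.ite e p q) s s' (e.cost + 1 + t)
  | loopDone {e : Expr} {p : Program} {s : State} (he : e.Fits B s)
      (htest : e.val s = 0) : Exec B (.loop e p) s s (e.cost + 1)
  | loopStep {e : Expr} {p : Program} {s₁ s₂ s₃ : State} {t₁ t₂ : ℕ} (he : e.Fits B s₁)
      (htest : e.val s₁ ≠ 0) (hp : Exec B p s₁ s₂ t₁) (hl : Exec B (.loop e p) s₂ s₃ t₂) :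
      Exec B (.loop e p) s₁ s₃ (e.cost + 1 + t₁ + t₂)

/-- Started in state `s`, the program `p` halts within `τ` steps, uses no value above `B`, and
ends in a state that satisfies `Post`. -/
def RunsWithin (B : ℕ) (p : Program) (s : State) (τ : ℝ) (Post : State → Prop) : Prop :=
  ∃ (s' : State) (t : ℕ), Exec B p s s' t ∧ (t : ℝ) ≤ τ ∧ Post s'

end WordRAM

namespace Jumbled

open WordRAM

/-! ### Min-plus products -/

/-- Input: `n` in register `0`, and the two matrices, row by row, in the arrays `0` and `1`.
Everything else is `0`. -/
def minPlusInput {n : ℕ} (A B : Matrix (Fin n) (Fin n) ℕ) : State where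
  reg x := if x = 0 then n else 0
  mem a i :=
    if h : i < n * n then
      let row : Fin n := ⟨i / n, Nat.div_lt_of_lt_mul h⟩
      let col : Fin n := ⟨i % n, Nat.mod_lt i (Nat.pos_of_lt_mul_left h)⟩
      if a = 0 then A row col else if a = 1 then B row col else 0
    else 0

/-- Output: array `2` holds, row by row, the matrix with entries `min_k (A i k + B k j)`. -/
def MinPlusOutput {n : ℕ} (A B : Matrix (Fin n) (Fin n) ℕ) (s : State) : Prop :=
  ∀ i j : Fin n, IsLeast (Set.range fun k : Fin n => A i k + B k j) (s.mem 2 (i * n + j))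

/-- `p` computes, with words of `O(log n)` bits, the min-plus product of any two `n × n` matrices
with entries in `{0, …, n}`, in time at most `time n`, for all `n ≥ 1`. -/
def ComputesMinPlus (p : Program) (time : ℕ → ℝ) : Prop :=
  ∃ k : ℕ, ∀ (n : ℕ) (A B : Matrix (Fin n) (Fin n) ℕ), 1 ≤ n →
    (∀ i j, A i j ≤ n) → (∀ i j, B i j ≤ n) →
    RunsWithin ((n + 2) ^ k) p (minPlusInput A B) (time n) (MinPlusOutput A B)

/-! ### Jumbled pattern matching on binary strings -/

/-- The numbers of 1s in the substrings of `T` of length `i`. -/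
def substringOnes (T : List Bool) (i : ℕ) : Set ℕ :=
  {m | ∃ u : List Bool, u <:+: T ∧ u.length = i ∧ u.count true = m}

/-- Input: the length of the string in register `0`, and its bits in array `0`.
Everything else is `0`. -/
def stringInput (T : List Bool) : State where
  reg x := if x = 0 then T.length else 0
  mem a i := if a = 0 then (T.getD i false).toNat else 0

/-- Output: cell `i` of array `1` (of array `2`) is the minimum (the maximum) number of 1s in a
substring of length `i`, for `i = 1, …, n`. -/
def StringOutput (T : List Bool) (s : State) : Prop :=
  ∀ i : ℕ, 1 ≤ i → i ≤ T.length →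
    IsLeast (substringOnes T i) (s.mem 1 i) ∧ IsGreatest (substringOnes T i) (s.mem 2 i)

/-- `p` solves, with words of `O(log n)` bits, jumbled pattern matching on every binary string of
length `n`, in time at most `time n`, for all `n ≥ 1`. -/
def SolvesStrings (p : Program) (time : ℕ → ℝ) : Prop :=
  ∃ k : ℕ, ∀ T : List Bool, 1 ≤ T.length →
    RunsWithin ((T.length + 2) ^ k) p (stringInput T) (time T.length) (StringOutput T)

/-! ### Jumbled pattern matching on node-labelled trees -/

/-- The numbers of nodes labelled 1 in the connected subgraphs of `G` with `i` nodes. -/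
def subgraphOnes {n : ℕ} (G : SimpleGraph (Fin n)) (lab : Fin n → Bool) (i : ℕ) : Set ℕ :=
  {m | ∃ H : G.Subgraph, H.Connected ∧ H.verts.ncard = i ∧
    {v | v ∈ H.verts ∧ lab v = true}.ncard = m}

/-- `E` lists every edge of `G` exactly once, in any order and with any order of its two ends. -/
def IsEdgeList {n : ℕ} (G : SimpleGraph (Fin n)) (E : List (Fin n × Fin n)) : Prop :=
  (E.map fun e => s(e.1, e.2)).Nodup ∧
    ∀ u v : Fin n, G.Adj u v ↔ s(u, v) ∈ E.map fun e => s(e.1, e.2)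

/-- Input: the number of nodes in register `0`, the parameter `r` in register `1`, the labels in
array `0`, and the two ends of the `i`-th edge in cell `i` of the arrays `1` and `2`.
Everything else is `0`. -/
def treeInput {n : ℕ} (r : ℕ) (lab : Fin n → Bool) (E : List (Fin n × Fin n)) : State where
  reg x := if x = 0 then n else if x = 1 then r else 0
  mem a i :=
    if a = 0 then (if h : i < n then (lab ⟨i, h⟩).toNat else 0)
    else if a = 1 then (E.map fun e => (e.1 : ℕ)).getD i 0
    else if a = 2 then (E.map fun e => (e.2 : ℕ)).getD i 0
    else 0

/-- Output: cell `i` of array `3` (of array `4`) is the minimum (the maximum) number of nodes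
labelled 1 in a connected subgraph with `i` nodes, for `i = 1, …, n`. -/
def TreeOutput {n : ℕ} (G : SimpleGraph (Fin n)) (lab : Fin n → Bool) (s : State) : Prop :=
  ∀ i : ℕ, 1 ≤ i → i ≤ n →
    IsLeast (subgraphOnes G lab i) (s.mem 3 i) ∧ IsGreatest (subgraphOnes G lab i) (s.mem 4 i)

/-- `p` solves, with words of `O(log (n + r))` bits, jumbled pattern matching on every
node-labelled tree with `n` nodes, in time at most `time n r`, for every parameter `r ≥ 1`, which
is given to `p` together with the tree. -/
def SolvesTrees (p : Program) (time : ℕ → ℕ → ℝ) : Prop :=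
  ∃ k : ℕ, ∀ (n r : ℕ) (G : SimpleGraph (Fin n)) (lab : Fin n → Bool)
    (E : List (Fin n × Fin n)), G.IsTree → IsEdgeList G E → 1 ≤ r →
    RunsWithin ((n + r + 2) ^ k) p (treeInput r lab E) (time n r) (TreeOutput G lab)

end Jumbled

namespace WordRAM

/-! ### Expressions -/

/-! Both parts reduce to min-plus convolutions of profiles: functions on the naturals that grow by 0
or 1 per step, and by exactly 1 beyond a threshold m.

Convolution. Let T be the time for products of n × n matrices, and q = n². For starting points x, y
the matrices f(x+an+k) - f(x+an) and g(y+bn-k) - g(y+bn-n), with a, b, k < n, have entries in {0, …,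
n}, because profiles are 1-Lipschitz. Their product, with the subtracted terms added back, is the
minimum over k of f(x+an+k) + g(y+bn-k), a candidate for index x+y+(a+b)n of the convolution. For
each pair of blocks of length q, n shifts of y reach every residue of the index sum modulo n. Hence
profiles with thresholds m₁, m₂ are convolved in time O((m₁+q)(m₂+2q)/q² · nT) (`Runs.convChunk`,
`Runs.convShifts`, `Runs.fastConv`).

Strings. Convolve the prefix counts with the suffix counts. At index N+i the candidates are the
total count plus the counts in the windows of length i (`isLeast_infix`). With n = ⌊√N⌋ the factor
of nT is constant, and nT is of order n⁴/ℓ(n) ≤ N²/ℓ(n). The maximal number of ones is i minus the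
minimal number of zeros.

Trees. Number the nodes so that parents come after their children (`rootTree_runs`). A family of
node sets is a set of pairs (size, ones), represented by its envelope `env`: the least number of
ones at size i when enlarging costs 1 per unit and shrinking is free. Envelopes are profiles, and
sums of families become convolutions (`isLeast_env_add`). Nothing is lost for the final answer: a
subtree can be enlarged by one node at cost at most 1, and shrunk by one node without gaining ones
(`exists_subtree_card`).

Convolving at every node would be too slow. So each component keeps fewer than r pending nodes on
top of a base, which is empty or has at least r nodes. It stores the choices P that avoid the base,
the choices Q to which the base family F may be attached, and the choices A whose combinations with
F are still owed to the answers; the whole family is P ∪ (Q + F). A node is added by quadratic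
convolutions of pending rows (`joinLight_runs`, `joinHeavy_runs`). The fast convolution with the
base runs only when r nodes are pending (`rebase_runs`) or when two nonempty bases meet
(`settle_runs`). With σ = ⌊√r⌋, q = σ² and V = σT, the potential `Rates.pot` pays for everything up
to O(q²r) per node: x x' is covered by the growth of a square or by r per node, and the merging of
bases of sizes m and m' by the cross term of V(m+m')². In total q² times the running time is O(q²rn
+ Vn²), and V/q² is of order 1/ℓ(σ).

On the machine, the given program is simulated on private registers and on arrays with time stamps,
so that it can be called again without clearing memory (`Program.sim_exec`, `Runs.callMinPlus`).
Every min-plus program needs at least n² steps (`ComputesMinPlus.sq_le`), which absorbs all copying.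
-/

instance (n : ℕ) : OfNat Expr n := ⟨.const n⟩
instance : Add Expr := ⟨.op .add⟩
instance : Sub Expr := ⟨.op .sub⟩
instance : Mul Expr := ⟨.op .mul⟩
instance : Div Expr := ⟨.op .div⟩
instance : Mod Expr := ⟨.op .mod⟩

@[simp] theorem Expr.val_zero (s : State) : (0 : Expr).val s = 0 := rfl
@[simp] theorem Expr.val_one (s : State) : (1 : Expr).val s = 1 := rfl
@[simp] theorem Expr.val_two (s : State) : (2 : Expr).val s = 2 := rfl
@[simp] theorem Expr.val_const (s : State) (n : ℕ) : (Expr.const n).val s = n := rfl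
@[simp] theorem Expr.val_reg (s : State) (x : ℕ) : (Expr.reg x).val s = s.reg x := rfl
@[simp] theorem Expr.val_cell (s : State) (a : ℕ) (e : Expr) :
    (Expr.cell a e).val s = s.mem a (e.val s) := rfl
@[simp] theorem Expr.val_add (s : State) (e f : Expr) : (e + f).val s = e.val s + f.val s := rfl
@[simp] theorem Expr.val_sub (s : State) (e f : Expr) : (e - f).val s = e.val s - f.val s := rfl
@[simp] theorem Expr.val_mul (s : State) (e f : Expr) : (e * f).val s = e.val s * f.val s := rfl
@[simp] theorem Expr.val_div (s : State) (e f : Expr) : (e / f).val s = e.val s / f.val s := rfl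
@[simp] theorem Expr.val_mod (s : State) (e f : Expr) : (e % f).val s = e.val s % f.val s := rfl
@[simp] theorem Expr.val_lt (s : State) (e f : Expr) :
    (Expr.op .lt e f).val s = if e.val s < f.val s then 1 else 0 := rfl
@[simp] theorem Expr.val_eq (s : State) (e f : Expr) :
    (Expr.op .eq e f).val s = if e.val s = f.val s then 1 else 0 := rfl

@[simp] theorem Expr.cost_zero : (0 : Expr).cost = 1 := rfl
@[simp] theorem Expr.cost_one : (1 : Expr).cost = 1 := rfl
@[simp] theorem Expr.cost_two : (2 : Expr).cost = 1 := rfl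
@[simp] theorem Expr.cost_const (n : ℕ) : (Expr.const n).cost = 1 := rfl
@[simp] theorem Expr.cost_reg (x : ℕ) : (Expr.reg x).cost = 1 := rfl
@[simp] theorem Expr.cost_cell (a : ℕ) (e : Expr) : (Expr.cell a e).cost = e.cost + 1 := rfl
@[simp] theorem Expr.cost_op (o : BinOp) (e f : Expr) :
    (Expr.op o e f).cost = e.cost + f.cost + 1 := rfl
@[simp] theorem Expr.cost_add (e f : Expr) : (e + f).cost = e.cost + f.cost + 1 := rfl
@[simp] theorem Expr.cost_sub (e f : Expr) : (e - f).cost = e.cost + f.cost + 1 := rfl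
@[simp] theorem Expr.cost_mul (e f : Expr) : (e * f).cost = e.cost + f.cost + 1 := rfl
@[simp] theorem Expr.cost_div (e f : Expr) : (e / f).cost = e.cost + f.cost + 1 := rfl
@[simp] theorem Expr.cost_mod (e f : Expr) : (e % f).cost = e.cost + f.cost + 1 := rfl

/-- Operations whose result is at most the product of two arguments that are at least `2`. -/
def BinOp.tame : BinOp → Bool
  | .add | .sub | .mul | .div | .mod | .lt | .eq => true
  | _ => false

def Expr.tame : Expr → Bool
  | .const c => c.ble 2
  | .reg _ => true
  | .cell _ e => e.tame
  | .op o e f => o.tame && (e.tame && f.tame)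

/-- Expressions all of whose values are polynomially bounded, with a fixed exponent, in the values
of the state. -/
def Expr.small (e : Expr) : Bool := e.tame && e.cost.ble 64

/-- All values in the state are at most `M`. -/
structure Bdd (M : ℕ) (s : State) : Prop where
  two_le : 2 ≤ M
  reg : ∀ x, s.reg x ≤ M
  mem : ∀ a i, s.mem a i ≤ M

/-- A tame operation yields at most twice the product of the bounds for its arguments, and the
factor 2 ≤ M is absorbed by the one extra node that `cost` counts for the operation. -/
theorem Expr.val_le_pow {M : ℕ} {s : State} (hs : Bdd M s) :
    ∀ e : Expr, e.tame = true → e.val s ≤ M ^ e.cost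
  | .const c, h => by
      have : c ≤ 2 := by simpa [Expr.tame] using h
      have := hs.two_le
      simp; omega
  | .reg x, _ => by simpa using hs.reg x
  | .cell a e, _ => by
      have := hs.two_le
      exact (hs.mem a _).trans (by simpa using Nat.le_self_pow (by omega) M)
  | .op o e f, h => by
      simp only [Expr.tame, Bool.and_eq_true] at h
      have he := Expr.val_le_pow hs e h.2.1
      have hf := Expr.val_le_pow hs f h.2.2
      have h2 := hs.two_le
      have hep : 1 ≤ M ^ e.cost := Nat.one_le_pow _ _ (by omega)
      have hfp : 1 ≤ M ^ f.cost := Nat.one_le_pow _ _ (by omega)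
      have hbig : 2 * (M ^ e.cost * M ^ f.cost) ≤ M ^ (e.cost + f.cost + 1) := by
        rw [pow_succ, pow_add, mul_comm]; exact Nat.mul_le_mul_left _ h2
      have h1 : M ^ e.cost ≤ M ^ e.cost * M ^ f.cost := Nat.le_mul_of_pos_right _ hfp
      have h1' : M ^ f.cost ≤ M ^ e.cost * M ^ f.cost := Nat.le_mul_of_pos_left _ hep
      simp only [Expr.cost_op]
      refine le_trans ?_ hbig
      cases o <;> simp only [BinOp.tame, Expr.val, BinOp.apply] at h ⊢ <;> try simp at h
      · omega
      · omega
      · exact (Nat.mul_le_mul he hf).trans (by omega)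
      · exact (Nat.div_le_self _ _).trans (by omega)
      · exact (Nat.mod_le _ _).trans (by omega)
      · split <;> omega
      · split <;> omega

theorem Expr.fits_of_tame {M : ℕ} {s : State} (hs : Bdd M s) {K : ℕ} :
    ∀ e : Expr, e.tame = true → e.cost ≤ K → e.Fits (M ^ K) s
  | .const c, h, hK => by
      have := Expr.val_le_pow hs _ h
      exact this.trans (Nat.pow_le_pow_right (by have := hs.two_le; omega) hK)
  | .reg x, h, hK => by
      have := Expr.val_le_pow hs _ h
      exact this.trans (Nat.pow_le_pow_right (by have := hs.two_le; omega) hK)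
  | .cell a e, h, hK => by
      have := Expr.val_le_pow hs _ h
      refine ⟨Expr.fits_of_tame hs e h (by simp at hK; omega), ?_⟩
      exact this.trans (Nat.pow_le_pow_right (by have := hs.two_le; omega) hK)
  | .op o e f, h, hK => by
      have := Expr.val_le_pow hs _ h
      simp only [Expr.tame, Bool.and_eq_true] at h
      simp only [Expr.cost_op] at hK
      refine ⟨Expr.fits_of_tame hs e h.2.1 (by omega),
        Expr.fits_of_tame hs f h.2.2 (by omega), ?_⟩
      exact this.trans (Nat.pow_le_pow_right (by have := hs.two_le; omega) hK)

/-- `small` is a Boolean computed from the syntax, so `rfl` settles it for concrete instructions.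
What remains to be proved about the word length is that the stored values are at most M;
intermediate values are then at most M ^ 64. -/
theorem Expr.fits_of_small {M : ℕ} {s : State} (hs : Bdd M s) {e : Expr} (h : e.small = true) :
    e.Fits (M ^ 64) s := by
  simp only [Expr.small, Bool.and_eq_true, Nat.ble_eq] at h
  exact Expr.fits_of_tame hs e h.1 h.2

theorem Expr.Fits.mono {B B' : ℕ} (hB : B ≤ B') {s : State} :
    ∀ {e : Expr}, e.Fits B s → e.Fits B' s
  | .const _, h => le_trans h hB
  | .reg _, h => le_trans h hB
  | .cell _ _, h => ⟨h.1.mono hB, h.2.trans hB⟩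
  | .op _ _ _, h => ⟨h.1.mono hB, h.2.1.mono hB, h.2.2.trans hB⟩

theorem Exec.mono {B B' : ℕ} (hB : B ≤ B') {p : Program} {s s' : State} {t : ℕ}
    (h : Exec B p s s' t) : Exec B' p s s' t := by
  induction h with
  | skip s => exact .skip s
  | assign s x e he => exact .assign s x e (he.mono hB)
  | store s a i e hi he => exact .store s a i e (hi.mono hB) (he.mono hB)
  | seq _ _ h1 h2 => exact .seq h1 h2
  | iteTrue he h _ h1 => exact .iteTrue (he.mono hB) h h1
  | iteFalse he h _ h1 => exact .iteFalse (he.mono hB) h h1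
  | loopDone he h => exact .loopDone (he.mono hB) h
  | loopStep he h _ _ h1 h2 => exact .loopStep (he.mono hB) h h1 h2

/-! ### States -/

@[simp] theorem State.setReg_reg (s : State) (x v y : ℕ) :
    (s.setReg x v).reg y = if y = x then v else s.reg y := by
  simp [State.setReg, Function.update_apply]

@[simp] theorem State.setReg_mem (s : State) (x v : ℕ) : (s.setReg x v).mem = s.mem := rfl

@[simp] theorem State.setMem_reg (s : State) (a i v : ℕ) : (s.setMem a i v).reg = s.reg := rfl

theorem State.setMem_mem (s : State) (a i v b : ℕ) :
    (s.setMem a i v).mem b = if b = a then Function.update (s.mem a) i v else s.mem b := by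
  simp only [State.setMem, Function.update_apply]

@[simp] theorem State.setMem_mem_same (s : State) (a i v : ℕ) :
    (s.setMem a i v).mem a = Function.update (s.mem a) i v := by simp [State.setMem_mem]

theorem State.setMem_mem_ne (s : State) {a b : ℕ} (i v : ℕ) (h : b ≠ a) :
    (s.setMem a i v).mem b = s.mem b := by simp [State.setMem_mem, h]

theorem Bdd.setReg {M : ℕ} {s : State} (h : Bdd M s) {x v : ℕ} (hv : v ≤ M) :
    Bdd M (s.setReg x v) := by
  refine ⟨h.two_le, fun y => ?_, h.mem⟩
  rw [State.setReg_reg]; split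
  · exact hv
  · exact h.reg y

theorem Bdd.setMem {M : ℕ} {s : State} (h : Bdd M s) {a i v : ℕ} (hv : v ≤ M) :
    Bdd M (s.setMem a i v) := by
  refine ⟨h.two_le, h.reg, fun b j => ?_⟩
  rw [State.setMem_mem]; split
  · rw [Function.update_apply]; split
    · exact hv
    · exact h.mem _ _
  · exact h.mem b j

/-! ### Registers and arrays that a program may change -/

def Program.regs : Program → List ℕ
  | .skip => []
  | .assign x _ => [x]
  | .store _ _ _ => []
  | .seq p q => p.regs ++ q.regs
  | .ite _ p q => p.regs ++ q.regs
  | .loop _ p => p.regs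

def Program.arrs : Program → List ℕ
  | .skip => []
  | .assign _ _ => []
  | .store a _ _ => [a]
  | .seq p q => p.arrs ++ q.arrs
  | .ite _ p q => p.arrs ++ q.arrs
  | .loop _ p => p.arrs

/-- The two states differ only in what `p` may change. -/
structure Frame (p : Program) (s s' : State) : Prop where
  reg : ∀ x, x ∉ p.regs → s'.reg x = s.reg x
  mem : ∀ a, a ∉ p.arrs → s'.mem a = s.mem a

theorem Frame.refl (p : Program) (s : State) : Frame p s s := ⟨fun _ _ => rfl, fun _ _ => rfl⟩

theorem Frame.trans {p : Program} {s₁ s₂ s₃ : State} (h : Frame p s₁ s₂) (h' : Frame p s₂ s₃) :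
    Frame p s₁ s₃ :=
  ⟨fun x hx => (h'.reg x hx).trans (h.reg x hx), fun a ha => (h'.mem a ha).trans (h.mem a ha)⟩

theorem Frame.weaken {p q : Program} {s s' : State} (h : Frame p s s')
    (hr : p.regs ⊆ q.regs) (ha : p.arrs ⊆ q.arrs) : Frame q s s' :=
  ⟨fun x hx => h.reg x fun h' => hx (hr h'), fun a hx => h.mem a fun h' => hx (ha h')⟩

/-- Invariants may thus leave out everything that a program does not write: the lists `regs` and
`arrs` take care of it. -/
theorem Exec.frame {B : ℕ} {p : Program} {s s' : State} {t : ℕ} (h : Exec B p s s' t) :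
    Frame p s s' := by
  induction h with
  | skip s => exact .refl _ _
  | assign s x e he =>
      refine ⟨fun y hy => ?_, fun _ _ => rfl⟩
      simp only [Program.regs, List.mem_singleton] at hy
      simp [hy]
  | store s a i e hi he =>
      refine ⟨fun _ _ => rfl, fun b hb => ?_⟩
      simp only [Program.arrs, List.mem_singleton] at hb
      exact s.setMem_mem_ne _ _ hb
  | seq _ _ h1 h2 =>
      exact (h1.weaken (by simp [Program.regs]) (by simp [Program.arrs])).trans
        (h2.weaken (by simp [Program.regs]) (by simp [Program.arrs]))
  | iteTrue _ _ _ h1 => exact h1.weaken (by simp [Program.regs]) (by simp [Program.arrs])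
  | iteFalse _ _ _ h1 => exact h1.weaken (by simp [Program.regs]) (by simp [Program.arrs])
  | loopDone _ _ => exact .refl _ _
  | loopStep _ _ _ _ h1 h2 =>
      exact (h1.weaken (by simp [Program.regs]) (by simp [Program.arrs])).trans h2

/-! ### Total correctness with time -/

/-- Started in `s`, the program halts after `t` steps in a state `s'` with `Q s' t`; all values stored
are at most `M` at the end, and at most `M ^ 64` on the way. -/
def Runs (M : ℕ) (p : Program) (s : State) (Q : State → ℕ → Prop) : Prop :=
  ∃ (s' : State) (t : ℕ), Exec (M ^ 64) p s s' t ∧ Bdd M s' ∧ Q s' t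

infixr:60 " ;; " => Program.seq

theorem Runs.mono {M : ℕ} {p : Program} {s : State} {Q Q' : State → ℕ → Prop}
    (h : Runs M p s Q) (hQ : ∀ s' t, Bdd M s' → Frame p s s' → Q s' t → Q' s' t) :
    Runs M p s Q' := by
  obtain ⟨s', t, he, hb, hq⟩ := h
  exact ⟨s', t, he, hb, hQ s' t hb he.frame hq⟩

theorem Runs.skip {M : ℕ} {s : State} {Q : State → ℕ → Prop} (hB : Bdd M s) (h : Q s 1) :
    Runs M .skip s Q := ⟨s, 1, .skip s, hB, h⟩

theorem Runs.assign {M : ℕ} {s : State} {x : ℕ} {e : Expr} {Q : State → ℕ → Prop}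
    (hB : Bdd M s) (hv : e.val s ≤ M) (h : Q (s.setReg x (e.val s)) (e.cost + 1))
    (he : e.small = true := by rfl) : Runs M (.assign x e) s Q :=
  ⟨_, _, .assign s x e (Expr.fits_of_small hB he), hB.setReg hv, h⟩

theorem Runs.store {M : ℕ} {s : State} {a : ℕ} {i e : Expr} {Q : State → ℕ → Prop}
    (hB : Bdd M s) (hv : e.val s ≤ M)
    (h : Q (s.setMem a (i.val s) (e.val s)) (i.cost + e.cost + 1))
    (hi : i.small = true := by rfl) (he : e.small = true := by rfl) :
    Runs M (.store a i e) s Q :=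
  ⟨_, _, .store s a i e (Expr.fits_of_small hB hi) (Expr.fits_of_small hB he), hB.setMem hv, h⟩

theorem Runs.seq {M : ℕ} {p q : Program} {s : State} {Q₁ Q : State → ℕ → Prop}
    (hp : Runs M p s Q₁)
    (hq : ∀ s₁ t₁, Bdd M s₁ → Frame p s s₁ → Q₁ s₁ t₁ →
      Runs M q s₁ fun s₂ t₂ => Q s₂ (t₁ + t₂)) : Runs M (p ;; q) s Q := by
  obtain ⟨s₁, t₁, he₁, hb₁, h₁⟩ := hp
  obtain ⟨s₂, t₂, he₂, hb₂, h₂⟩ := hq s₁ t₁ hb₁ he₁.frame h₁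
  exact ⟨s₂, _, .seq he₁ he₂, hb₂, h₂⟩

theorem Runs.assign_seq {M : ℕ} {s : State} {x : ℕ} {e : Expr} {q : Program}
    {Q : State → ℕ → Prop} (hB : Bdd M s) (hv : e.val s ≤ M)
    (hq : Bdd M (s.setReg x (e.val s)) →
      Runs M q (s.setReg x (e.val s)) fun s₂ t₂ => Q s₂ (e.cost + 1 + t₂))
    (he : e.small = true := by rfl) : Runs M (.assign x e ;; q) s Q :=
  Runs.seq (Runs.assign (Q := fun s₁ t₁ => s₁ = s.setReg x (e.val s) ∧ t₁ = e.cost + 1)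
    hB hv ⟨rfl, rfl⟩ he) (by rintro s₁ t₁ hb - ⟨rfl, rfl⟩; exact hq hb)

theorem Runs.store_seq {M : ℕ} {s : State} {a : ℕ} {i e : Expr} {q : Program}
    {Q : State → ℕ → Prop} (hB : Bdd M s) (hv : e.val s ≤ M)
    (hq : Bdd M (s.setMem a (i.val s) (e.val s)) →
      Runs M q (s.setMem a (i.val s) (e.val s)) fun s₂ t₂ => Q s₂ (i.cost + e.cost + 1 + t₂))
    (hi : i.small = true := by rfl) (he : e.small = true := by rfl) :
    Runs M (.store a i e ;; q) s Q :=
  Runs.seq (Runs.store (Q := fun s₁ t₁ => s₁ = s.setMem a (i.val s) (e.val s) ∧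
      t₁ = i.cost + e.cost + 1) hB hv ⟨rfl, rfl⟩ hi he)
    (by rintro s₁ t₁ hb - ⟨rfl, rfl⟩; exact hq hb)

theorem Runs.ite {M : ℕ} {s : State} {e : Expr} {p q : Program} {Q : State → ℕ → Prop}
    (hB : Bdd M s) (hp : e.val s ≠ 0 → Runs M p s fun s' t => Q s' (e.cost + 1 + t))
    (hq : e.val s = 0 → Runs M q s fun s' t => Q s' (e.cost + 1 + t))
    (he : e.small = true := by rfl) : Runs M (.ite e p q) s Q := by
  by_cases h : e.val s = 0
  · obtain ⟨s', t, h1, h2, h3⟩ := hq h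
    exact ⟨s', _, .iteFalse (Expr.fits_of_small hB he) h h1, h2, h3⟩
  · obtain ⟨s', t, h1, h2, h3⟩ := hp h
    exact ⟨s', _, .iteTrue (Expr.fits_of_small hB he) h h1, h2, h3⟩

/-- The invariant `I` sees the time elapsed so far, and the decrease of `μ` gives termination. The
frame condition refers to the state before the loop, not to the previous round, and therefore
accumulates. -/
theorem Runs.loop {M : ℕ} {e : Expr} {p : Program} {Q : State → ℕ → Prop}
    (I : State → ℕ → Prop) (μ : State → ℕ) {s₀ : State} (hB₀ : Bdd M s₀) (h₀ : I s₀ 0)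
    (hstep : ∀ s t, Bdd M s → Frame p s₀ s → I s t → e.val s ≠ 0 →
      Runs M p s fun s' t' => I s' (t + (e.cost + 1 + t')) ∧ μ s' < μ s)
    (hdone : ∀ s t, Bdd M s → Frame p s₀ s → I s t → e.val s = 0 → Q s (t + (e.cost + 1)))
    (he : e.small = true := by rfl) : Runs M (.loop e p) s₀ Q := by
  have key : ∀ (m : ℕ) (s : State) (t : ℕ), μ s ≤ m → Bdd M s → Frame p s₀ s → I s t →
      Runs M (.loop e p) s fun s' t' => Q s' (t + t') := by
    intro m
    induction m with
    | zero =>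
      intro s t hm hB hF hI
      by_cases h : e.val s = 0
      · exact ⟨s, _, .loopDone (Expr.fits_of_small hB he) h, hB, hdone s t hB hF hI h⟩
      · obtain ⟨_, _, _, _, _, h'⟩ := hstep s t hB hF hI h
        omega
    | succ m ih =>
      intro s t hm hB hF hI
      by_cases h : e.val s = 0
      · exact ⟨s, _, .loopDone (Expr.fits_of_small hB he) h, hB, hdone s t hB hF hI h⟩
      · obtain ⟨s₁, t₁, h1, hB1, hI1, h'⟩ := hstep s t hB hF hI h
        obtain ⟨s₂, t₂, h2, hB2, hQ⟩ := ih s₁ _ (by omega) hB1 (hF.trans h1.frame) hI1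
        refine ⟨s₂, _, .loopStep (Expr.fits_of_small hB he) h h1 h2, hB2, ?_⟩
        convert hQ using 1; ring
  simpa using key _ s₀ 0 le_rfl hB₀ (.refl _ _) h₀

/-- `for i < n do p`. -/
def Program.for_ (i : ℕ) (n : Expr) (p : Program) : Program :=
  .assign i 0 ;; .loop (.op .lt (.reg i) n) (p ;; .assign i (.reg i + 1))

theorem Program.mem_regs_for {i x : ℕ} {n : Expr} {p : Program} :
    x ∈ (Program.for_ i n p).regs ↔ x = i ∨ x ∈ p.regs := by
  simp [Program.for_, Program.regs]; tauto

theorem Program.arrs_for {i : ℕ} {n : Expr} {p : Program} :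
    (Program.for_ i n p).arrs = p.arrs := by
  simp [Program.for_, Program.arrs]

/-- Beyond the body, a round costs `n.cost + 3` for the test and 4 for the increment. The initial
assignment (2) and the failing last test (`n.cost + 3`) make up the final `n.cost + 5`. -/
theorem Runs.for_time {M : ℕ} {i : ℕ} {n : Expr} {p : Program} {Q : State → ℕ → Prop}
    {s₀ : State} (I : ℕ → State → ℕ → Prop) (N : ℕ) (hB₀ : Bdd M s₀) (hN : N ≤ M)
    (hi : i ∉ p.regs)
    (hn : ∀ s, Frame (.for_ i n p) s₀ s → n.val s = N)
    (h₀ : I 0 (s₀.setReg i 0) 0)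
    (hstep : ∀ j s t, j < N → Bdd M s → Frame (.for_ i n p) s₀ s → s.reg i = j → I j s t →
      Runs M p s fun s' t' => I (j + 1) (s'.setReg i (j + 1)) (t + t' + (n.cost + 7)))
    (hdone : ∀ s t, Bdd M s → Frame (.for_ i n p) s₀ s → s.reg i = N → I N s t →
      Q s (t + n.cost + 5))
    (he : (Expr.op .lt (.reg i) n).small = true := by rfl) : Runs M (.for_ i n p) s₀ Q := by
  have hfr : ∀ s, Frame (p ;; .assign i (.reg i + 1)) (s₀.setReg i 0) s →
      Frame (.for_ i n p) s₀ s := by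
    intro s hs
    refine ⟨fun x hx => ?_, fun a ha => ?_⟩
    · rw [Program.mem_regs_for] at hx
      push Not at hx
      rw [hs.reg x (by simp [Program.regs, hx])]
      simp [hx]
    · rw [Program.arrs_for] at ha
      rw [hs.mem a (by simpa [Program.arrs] using ha)]; rfl
  refine Runs.assign_seq hB₀ (by simp) fun hB1 => ?_
  refine Runs.loop (fun s t => ∃ j ≤ N, s.reg i = j ∧ I j s t) (fun s => N - s.reg i) hB1
    ⟨0, by simp, by simp, h₀⟩ ?_ ?_ he
  · rintro s t hB hF ⟨j, hj, hij, hI⟩ htest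
    have hv := hn s (hfr s hF)
    have hjN : j < N := by
      simp only [Expr.val_lt, Expr.val_reg, hv, hij, ne_eq, ite_eq_right_iff, not_forall] at htest
      exact htest.1
    refine Runs.seq (hstep j s t hjN hB (hfr s hF) hij hI) fun s₁ t₁ hB1 hF1 hI1 => ?_
    have hij1 : s₁.reg i = j := by rw [hF1.reg i hi, hij]
    refine Runs.assign hB1 (by simp [hij1]; omega) ?_
    refine ⟨⟨j + 1, by omega, by simp [hij1], ?_⟩, ?_⟩
    · simp only [Expr.val_add, Expr.val_reg, hij1, Expr.val_one, Expr.cost_add, Expr.cost_reg,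
        Expr.cost_one, Expr.cost_op]
      convert hI1 using 1; ring
    · simp [hij1, hij]; omega
  · rintro s t hB hF ⟨j, hj, hij, hI⟩ htest
    have hv := hn s (hfr s hF)
    have hjN : j = N := by
      simp only [Expr.val_lt, Expr.val_reg, hv, hij, ite_eq_right_iff] at htest
      omega
    subst hjN
    have := hdone s t hB (hfr s hF) hij hI
    simp only [Expr.cost_zero, Expr.cost_op, Expr.cost_reg]
    convert this using 1; ring

theorem Runs.for_unif {M : ℕ} {i : ℕ} {n : Expr} {p : Program} {Q : State → ℕ → Prop}
    {s₀ : State} (I : ℕ → State → Prop) (N c : ℕ) (hB₀ : Bdd M s₀) (hN : N ≤ M)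
    (hi : i ∉ p.regs)
    (hn : ∀ s, Frame (.for_ i n p) s₀ s → n.val s = N)
    (h₀ : I 0 (s₀.setReg i 0))
    (hstep : ∀ j s, j < N → Bdd M s → Frame (.for_ i n p) s₀ s → s.reg i = j → I j s →
      Runs M p s fun s' t' => I (j + 1) (s'.setReg i (j + 1)) ∧ t' ≤ c)
    (hdone : ∀ s t, Bdd M s → Frame (.for_ i n p) s₀ s → s.reg i = N → I N s →
      t ≤ N * (c + n.cost + 7) + n.cost + 5 → Q s t)
    (he : (Expr.op .lt (.reg i) n).small = true := by rfl) : Runs M (.for_ i n p) s₀ Q := by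
  refine Runs.for_time (fun j s t => I j s ∧ t ≤ j * (c + n.cost + 7)) N hB₀ hN hi hn
    ⟨h₀, by simp⟩ ?_ ?_ he
  · rintro j s t hj hB hF hij ⟨hI, ht⟩
    refine (hstep j s hj hB hF hij hI).mono ?_
    rintro s' t' - - ⟨h1, h2⟩
    exact ⟨h1, by rw [add_mul]; omega⟩
  · rintro s t hB hF hij ⟨hI, ht⟩
    exact hdone s _ hB hF hij hI (by omega)

/-! ### Filling a segment of an array -/

/-- `A` with the `m` cells from `d` on replaced by `g 0, …, g (m - 1)`. -/
def splice (A : ℕ → ℕ) (d m : ℕ) (g : ℕ → ℕ) (x : ℕ) : ℕ :=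
  if d ≤ x ∧ x < d + m then g (x - d) else A x

theorem splice_add (A : ℕ → ℕ) (d : ℕ) {m : ℕ} (g : ℕ → ℕ) {i : ℕ} (hi : i < m) :
    splice A d m g (d + i) = g i := by simp [splice, hi]

theorem splice_zero_left (A : ℕ → ℕ) {m : ℕ} (g : ℕ → ℕ) {i : ℕ} (hi : i < m) :
    splice A 0 m g i = g i := by simp [splice, hi]

theorem splice_of_lt (A : ℕ → ℕ) {d : ℕ} (m : ℕ) (g : ℕ → ℕ) {x : ℕ} (h : x < d) :
    splice A d m g x = A x := by simp [splice]; omega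

theorem splice_of_ge (A : ℕ → ℕ) {d m : ℕ} (g : ℕ → ℕ) {x : ℕ} (h : d + m ≤ x) :
    splice A d m g x = A x := by simp [splice]; omega

theorem splice_zero (A : ℕ → ℕ) (d : ℕ) (g : ℕ → ℕ) : splice A d 0 g = A := by
  funext x; simp [splice]

theorem splice_succ (A : ℕ → ℕ) (d m : ℕ) (g : ℕ → ℕ) :
    splice A d (m + 1) g = Function.update (splice A d m g) (d + m) (g m) := by
  funext x
  rw [Function.update_apply]
  rcases lt_trichotomy x (d + m) with h | h | h
  · rw [if_neg h.ne]
    simp only [splice]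
    split_ifs <;> first | rfl | omega
  · subst h; simp [splice]
  · rw [if_neg h.ne', splice_of_ge _ _ (by omega), splice_of_ge _ _ (by omega)]

/-- The state after the first `m` rounds of filling array `a` from cell `d` on with the values of
`g`, with `i` as the counter. -/
def State.fill (s : State) (i a d m : ℕ) (g : ℕ → ℕ) : State where
  reg := Function.update s.reg i m
  mem := Function.update s.mem a (splice (s.mem a) d m g)

@[simp] theorem State.fill_reg (s : State) (i a d m : ℕ) (g : ℕ → ℕ) (x : ℕ) :
    (s.fill i a d m g).reg x = if x = i then m else s.reg x := by
  simp [State.fill, Function.update_apply]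

theorem State.fill_mem (s : State) (i a d m : ℕ) (g : ℕ → ℕ) (b : ℕ) :
    (s.fill i a d m g).mem b = if b = a then splice (s.mem a) d m g else s.mem b := by
  simp [State.fill, Function.update_apply]

@[simp] theorem State.fill_mem_same (s : State) (i a d m : ℕ) (g : ℕ → ℕ) :
    (s.fill i a d m g).mem a = splice (s.mem a) d m g := by simp [State.fill_mem]

theorem State.fill_mem_ne (s : State) (i a d m : ℕ) (g : ℕ → ℕ) {b : ℕ} (h : b ≠ a) :
    (s.fill i a d m g).mem b = s.mem b := by simp [State.fill_mem, h]

/-- `for i < n do a[d + i] := e`. -/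
def Program.sweep (i a : ℕ) (d n e : Expr) : Program :=
  .for_ i n (.store a (d + .reg i) e)

/-- The expressions are evaluated in the partially filled states, so `e` may read the array that is
being filled. Recurrences such as prefix counts, and updates in place, are instances. -/
theorem Runs.sweep {M : ℕ} {i a : ℕ} {d n e : Expr} {Q : State → ℕ → Prop} {s : State}
    (D N : ℕ) (g : ℕ → ℕ) (hB : Bdd M s) (hN : N ≤ M)
    (hn : ∀ j ≤ N, n.val (s.fill i a D j g) = N)
    (hd : ∀ j < N, d.val (s.fill i a D j g) = D)
    (he : ∀ j < N, e.val (s.fill i a D j g) = g j)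
    (hg : ∀ j < N, g j ≤ M)
    (hQ : ∀ t, Bdd M (s.fill i a D N g) →
      t ≤ N * (d.cost + e.cost + n.cost + 10) + n.cost + 5 → Q (s.fill i a D N g) t)
    (hd' : (d + .reg i).small = true := by rfl) (he' : e.small = true := by rfl)
    (hn' : (Expr.op .lt (.reg i) n).small = true := by rfl) :
    Runs M (.sweep i a d n e) s Q := by
  have hfill0 : s.setReg i 0 = s.fill i a D 0 g := by
    ext
    · simp
    · simp [State.fill_mem, splice_zero]; split <;> simp_all
  have hfillS : ∀ j, ((s.fill i a D j g).setMem a (D + j) (g j)).setReg i (j + 1) =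
      s.fill i a D (j + 1) g := by
    intro j
    ext x y
    · simp; split <;> simp_all
    · simp only [State.setReg_mem, State.setMem_mem, State.fill_mem, if_true, splice_succ]
      split <;> rfl
  refine Runs.assign_seq hB (by simp) fun hB1 => ?_
  refine Runs.loop (fun s' t => ∃ j ≤ N, s' = s.fill i a D j g ∧
    t ≤ j * (d.cost + e.cost + n.cost + 10)) (fun s' => N - s'.reg i) hB1
    ⟨0, by simp, hfill0, by simp⟩ ?_ ?_ hn'
  · rintro s' t hB' - ⟨j, hj, rfl, ht⟩ htest
    have hv := hn j hj
    have hjN : j < N := by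
      simp only [Expr.val_lt, Expr.val_reg, hv, State.fill_reg, if_true, ne_eq,
        ite_eq_right_iff, not_forall] at htest
      exact htest.1
    refine Runs.store_seq hB' (by rw [he j hjN]; exact hg j hjN) ?_ hd' he'
    intro hB2
    refine Runs.assign hB2 (by simp; omega) ?_
    simp only [Expr.val_add, Expr.val_reg, he j hjN, hd j hjN, Expr.val_one, Expr.cost_add,
      Expr.cost_reg, Expr.cost_one, Expr.cost_op, State.fill_reg, if_true, State.setMem_reg,
      hfillS]
    refine ⟨⟨j + 1, by omega, rfl, ?_⟩, by omega⟩
    rw [add_mul]; omega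
  · rintro s' t hB' - ⟨j, hj, rfl, ht⟩ htest
    have hv := hn j hj
    have hjN : j = N := by
      simp only [Expr.val_lt, Expr.val_reg, hv, State.fill_reg, if_true,
        ite_eq_right_iff] at htest
      omega
    subst hjN
    refine hQ _ hB' ?_
    simp only [Expr.cost_zero, Expr.cost_op, Expr.cost_reg]
    omega

theorem Program.mem_regs_sweep {i a x : ℕ} {d n e : Expr} :
    x ∈ (Program.sweep i a d n e).regs ↔ x = i := by
  simp [Program.sweep, Program.mem_regs_for, Program.regs]

theorem Program.arrs_sweep {i a : ℕ} {d n e : Expr} : (Program.sweep i a d n e).arrs = [a] := by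
  simp [Program.sweep, Program.arrs_for, Program.arrs]

/-! ### Simulating a program on private registers and arrays

Register `x` of the simulated program is register `100 + x`, and array `a` is array `100 + 2 * a`,
where a cell counts as `0` unless its stamp, in array `101 + 2 * a`, is the current one, in
register `99`.  So increasing register `99` clears the arrays in one step. -/

def Expr.sim : Expr → Expr
  | .const c => .const c
  | .reg x => .reg (100 + x)
  | .cell a e => .op .mul (.cell (100 + 2 * a) e.sim)
      (.op .eq (.cell (101 + 2 * a) e.sim) (.reg 99))
  | .op o e f => .op o e.sim f.sim

/-- Index and value of a store are first put into registers 97 and 98: both the cell and its stamp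
have to be written, and the index expression may read the very cell that the first write changes. -/
def Program.sim : Program → Program
  | .skip => .skip
  | .assign x e => .assign (100 + x) e.sim
  | .store a i e => .assign 97 i.sim ;; .assign 98 e.sim ;;
      .store (100 + 2 * a) (.reg 97) (.reg 98) ;; .store (101 + 2 * a) (.reg 97) (.reg 99)
  | .seq p q => p.sim ;; q.sim
  | .ite e p q => .ite e.sim p.sim q.sim
  | .loop e p => .loop e.sim p.sim

/-- A strict upper bound for the registers that the expression reads. -/
def Expr.width : Expr → ℕ
  | .const _ => 0
  | .reg x => x + 1
  | .cell _ e => e.width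
  | .op _ e f => max e.width f.width

/-- A strict upper bound for the registers that the program reads. -/
def Program.width : Program → ℕ
  | .skip => 0
  | .assign _ e => e.width
  | .store _ i e => max i.width e.width
  | .seq p q => max p.width q.width
  | .ite e p q => max e.width (max p.width q.width)
  | .loop e p => max e.width p.width

/-- The factor by which the simulation is slower. -/
def Program.slowdown : Program → ℕ
  | .skip => 1
  | .assign _ e => e.sim.cost + 1
  | .store _ i e => i.sim.cost + e.sim.cost + 8
  | .seq p q => p.slowdown + q.slowdown
  | .ite e p q => e.sim.cost + 1 + p.slowdown + q.slowdown
  | .loop e p => e.sim.cost + 1 + p.slowdown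

/-- Only registers below `R` are related. A program reads only registers below its `width`, so just
finitely many have to be reset before a call. -/
structure SimRel (R : ℕ) (s σ : State) : Prop where
  reg : ∀ x < R, σ.reg (100 + x) = s.reg x
  mem : ∀ a i, s.mem a i = if σ.mem (101 + 2 * a) i = σ.reg 99 then σ.mem (100 + 2 * a) i else 0

/-- No stamp is newer than the current one. -/
def Fresh (σ : State) : Prop := ∀ a i, σ.mem (101 + 2 * a) i ≤ σ.reg 99

theorem Expr.sim_val {R : ℕ} {s σ : State} (h : SimRel R s σ) :
    ∀ e : Expr, e.width ≤ R → e.sim.val σ = e.val s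
  | .const _, _ => rfl
  | .reg x, hx => h.reg x hx
  | .cell a e, he => by
      have := Expr.sim_val h e he
      simp only [Expr.sim, Expr.val, this, h.mem a, BinOp.apply]
      split_ifs <;> simp
  | .op o e f, hx => by
      simp only [Expr.width, max_le_iff] at hx
      simp only [Expr.sim, Expr.val, Expr.sim_val h e hx.1, Expr.sim_val h f hx.2]

/-- The simulation multiplies the content of a cell by the outcome of the stamp comparison. This
product is the simulated value, hence at most B, and the remaining intermediate values are contents
of σ or bits. -/
theorem Expr.sim_fits {R B M : ℕ} {s σ : State} (h : SimRel R s σ) (hBM : B ≤ M)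
    (hσ : Bdd M σ) : ∀ e : Expr, e.width ≤ R → e.Fits B s → e.sim.Fits M σ
  | .const _, _, hf => le_trans hf hBM
  | .reg x, _, _ => hσ.reg _
  | .cell a e, he, hf => by
      have h1 := Expr.sim_fits h hBM hσ e he hf.1
      have h2 := Expr.sim_val h (.cell a e) he
      refine ⟨⟨h1, hσ.mem _ _⟩, ⟨⟨h1, hσ.mem _ _⟩, hσ.reg _, ?_⟩, ?_⟩
      · have := hσ.two_le
        simp only [BinOp.apply]; split <;> omega
      · exact h2.le.trans (hf.2.trans hBM)
  | .op o e f, he, hf => by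
      have h2 := Expr.sim_val h (.op o e f) he
      simp only [Expr.width, max_le_iff] at he
      refine ⟨Expr.sim_fits h hBM hσ e he.1 hf.1, Expr.sim_fits h hBM hσ f he.2 hf.2.1, ?_⟩
      exact h2.le.trans (hf.2.2.trans hBM)

theorem Expr.Fits.val_le {B : ℕ} {s : State} {e : Expr} (h : e.Fits B s) : e.val s ≤ B := by
  cases e with
  | const c => exact h
  | reg x => exact h
  | cell a e => exact h.2
  | op o e f => exact h.2.2

/-- By induction on the run. Every simulated step costs at most `slowdown`, which adds up the
overheads of all instructions of the program; the current stamp in register 99 never changes within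
a call. -/
theorem Program.sim_exec {R B M : ℕ} (hBM : B ≤ M) {p : Program} {s s' : State} {t : ℕ}
    (h : Exec B p s s' t) : p.width ≤ R → ∀ σ, Bdd M σ → SimRel R s σ → Fresh σ →
      ∃ σ' t', Exec M p.sim σ σ' t' ∧ Bdd M σ' ∧ SimRel R s' σ' ∧ Fresh σ' ∧
        σ'.reg 99 = σ.reg 99 ∧ t' ≤ p.slowdown * t := by
  induction h with
  | skip s => exact fun _ σ hσ hr hf => ⟨σ, 1, .skip σ, hσ, hr, hf, rfl, by simp [slowdown]⟩
  | assign s x e he =>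
    intro hw σ hσ hr hf
    refine ⟨_, _, .assign σ _ _ (e.sim_fits hr hBM hσ hw he), hσ.setReg ?_, ⟨?_, ?_⟩, ?_, ?_, ?_⟩
    · rw [e.sim_val hr hw]; exact he.val_le.trans hBM
    · intro y hy
      simp only [State.setReg_reg, e.sim_val hr hw, hr.reg y hy]
      congr 1; simp
    · intro a i
      have h99 : (99 : ℕ) ≠ 100 + x := by omega
      simpa [h99] using hr.mem a i
    · intro a i
      have h99 : (99 : ℕ) ≠ 100 + x := by omega
      simpa [h99] using hf a i
    · have h99 : (99 : ℕ) ≠ 100 + x := by omega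
      simp [h99]
    · simp only [slowdown]; exact Nat.le_mul_of_pos_right _ (by omega)
  | store s a i e hi he =>
    intro hw σ hσ hr hf
    simp only [width, max_le_iff] at hw
    have vi := i.sim_val hr hw.1
    have ve := e.sim_val hr hw.2
    have hr1 : SimRel R s (σ.setReg 97 (i.sim.val σ)) :=
      ⟨fun x hx => by simpa [show 100 + x ≠ 97 by omega] using hr.reg x hx,
        fun b j => by simpa using hr.mem b j⟩
    have hb1 : Bdd M (σ.setReg 97 (i.sim.val σ)) :=
      hσ.setReg (by rw [vi]; exact hi.val_le.trans hBM)
    have ve1 := e.sim_val hr1 hw.2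
    have hb2 := hb1.setReg (x := 98) (v := e.sim.val (σ.setReg 97 (i.sim.val σ)))
      (by rw [ve1]; exact he.val_le.trans hBM)
    obtain ⟨σ₂, hσ₂⟩ : ∃ σ₂, σ₂ = (σ.setReg 97 (i.sim.val σ)).setReg 98
      (e.sim.val (σ.setReg 97 (i.sim.val σ))) := ⟨_, rfl⟩
    have r97 : σ₂.reg 97 = i.val s := by simp [hσ₂, vi]
    have r98 : σ₂.reg 98 = e.val s := by simp [hσ₂, ve1]
    have r99 : σ₂.reg 99 = σ.reg 99 := by simp [hσ₂]
    have rr : ∀ x, σ₂.reg (100 + x) = σ.reg (100 + x) := by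
      intro x
      simp [hσ₂, show 100 + x ≠ 97 by omega, show 100 + x ≠ 98 by omega]
    have mm : σ₂.mem = σ.mem := by simp [hσ₂]
    have x2 : Exec M (.assign 98 e.sim) (σ.setReg 97 (i.sim.val σ)) σ₂ (e.sim.cost + 1) := by
      rw [hσ₂]; exact .assign _ 98 _ (e.sim_fits hr1 hBM hb1 hw.2 he)
    rw [← hσ₂] at hb2
    have hb3 := hb2.setMem (a := 100 + 2 * a) (i := σ₂.reg 97) (v := σ₂.reg 98) (hb2.reg _)
    have hb4 := hb3.setMem (a := 101 + 2 * a) (i := σ₂.reg 97) (v := σ₂.reg 99) (hb2.reg _)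
    refine ⟨(σ₂.setMem (100 + 2 * a) (σ₂.reg 97) (σ₂.reg 98)).setMem (101 + 2 * a) (σ₂.reg 97)
      (σ₂.reg 99), _, .seq (.assign σ _ _ (i.sim_fits hr hBM hσ hw.1 hi)) (.seq x2
        (.seq (.store _ _ (.reg 97) (.reg 98) (hb2.reg _) (hb2.reg _))
          (.store _ _ (.reg 97) (.reg 99) (hb2.reg _) (hb2.reg _)))), hb4, ⟨?_, ?_⟩, ?_, ?_, ?_⟩
    · intro x hx
      rw [State.setMem_reg, State.setMem_reg, rr]; exact hr.reg x hx
    · intro b j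
      have hm := hr.mem b j
      have e1 : 101 + 2 * b = 101 + 2 * a ↔ b = a := by omega
      have e2 : 100 + 2 * b = 100 + 2 * a ↔ b = a := by omega
      have e3 : 101 + 2 * b ≠ 100 + 2 * a := by omega
      have e4 : 100 + 2 * b ≠ 101 + 2 * a := by omega
      have e5 : 101 + 2 * a ≠ 100 + 2 * a := by omega
      simp only [State.setMem_mem, State.setMem_reg, e1, e2, e3, e4, e5, if_false, r97, r98, r99,
        mm]
      by_cases hba : b = a
      · subst hba
        by_cases hj : j = i.val s
        · subst hj; simp
        · simpa [Function.update_apply, hj] using hm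
      · simpa [hba] using hm
    · intro b j
      have hm := hf b j
      have e1 : 101 + 2 * b = 101 + 2 * a ↔ b = a := by omega
      have e3 : 101 + 2 * b ≠ 100 + 2 * a := by omega
      have e5 : 101 + 2 * a ≠ 100 + 2 * a := by omega
      simp only [State.setMem_mem, State.setMem_reg, e1, e3, e5, if_false, r97, r99, mm]
      by_cases hba : b = a
      · subst hba
        simp only [if_true, Function.update_apply]
        split
        · simp
        · simpa using hm
      · simpa [hba] using hm
    · exact r99
    · simp only [slowdown, Expr.cost_reg]
      have : 1 ≤ i.cost + e.cost + 1 := by omega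
      nlinarith
  | @seq p q s₁ s₂ s₃ t₁ t₂ _ _ ih1 ih2 =>
    intro hw σ hσ hr hf
    simp only [width, max_le_iff] at hw
    obtain ⟨σ1, u1, x1, b1, r1, f1, g1, c1⟩ := ih1 hw.1 σ hσ hr hf
    obtain ⟨σ2, u2, x2, b2, r2, f2, g2, c2⟩ := ih2 hw.2 σ1 b1 r1 f1
    refine ⟨σ2, _, .seq x1 x2, b2, r2, f2, g2.trans g1, ?_⟩
    simp only [slowdown]; nlinarith [Nat.zero_le (p.slowdown * t₂), Nat.zero_le (q.slowdown * t₁)]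
  | @iteTrue e p q s s' t he ht _ ih =>
    intro hw σ hσ hr hf
    simp only [width, max_le_iff] at hw
    obtain ⟨σ1, u1, x1, b1, r1, f1, g1, c1⟩ := ih hw.2.1 σ hσ hr hf
    refine ⟨σ1, _, .iteTrue (e.sim_fits hr hBM hσ hw.1 he) ?_ x1, b1, r1, f1, g1, ?_⟩
    · rwa [e.sim_val hr hw.1]
    · simp only [slowdown]
      nlinarith [Nat.zero_le (p.slowdown * e.cost), Nat.zero_le (q.slowdown * (e.cost + t)),
        Nat.zero_le (e.sim.cost * (e.cost + t)), Nat.zero_le (e.sim.cost)]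
  | @iteFalse e p q s s' t he ht _ ih =>
    intro hw σ hσ hr hf
    simp only [width, max_le_iff] at hw
    obtain ⟨σ1, u1, x1, b1, r1, f1, g1, c1⟩ := ih hw.2.2 σ hσ hr hf
    refine ⟨σ1, _, .iteFalse (e.sim_fits hr hBM hσ hw.1 he) ?_ x1, b1, r1, f1, g1, ?_⟩
    · rwa [e.sim_val hr hw.1]
    · simp only [slowdown]
      nlinarith [Nat.zero_le (q.slowdown * e.cost), Nat.zero_le (p.slowdown * (e.cost + t)),
        Nat.zero_le (e.sim.cost * (e.cost + t)), Nat.zero_le (e.sim.cost)]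
  | @loopDone e p s he ht =>
    intro hw σ hσ hr hf
    simp only [width, max_le_iff] at hw
    refine ⟨σ, _, .loopDone (e.sim_fits hr hBM hσ hw.1 he) ?_, hσ, hr, hf, rfl, ?_⟩
    · rwa [e.sim_val hr hw.1]
    · simp only [slowdown]
      nlinarith [Nat.zero_le (p.slowdown * (e.cost + 1)), Nat.zero_le (e.sim.cost * e.cost)]
  | @loopStep e p s₁ s₂ s₃ t₁ t₂ he ht _ _ ih1 ih2 =>
    intro hw σ hσ hr hf
    have hw' := hw
    simp only [width, max_le_iff] at hw
    obtain ⟨σ1, u1, x1, b1, r1, f1, g1, c1⟩ := ih1 hw.2 σ hσ hr hf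
    obtain ⟨σ2, u2, x2, b2, r2, f2, g2, c2⟩ := ih2 hw' σ1 b1 r1 f1
    refine ⟨σ2, _, .loopStep (e.sim_fits hr hBM hσ hw.1 he) ?_ x1 x2, b2, r2, f2,
      g2.trans g1, ?_⟩
    · rwa [e.sim_val hr hw.1]
    · simp only [slowdown] at c2 ⊢
      nlinarith [Nat.zero_le (p.slowdown * (e.cost + 1)), Nat.zero_le (e.sim.cost * e.cost),
        Nat.zero_le ((e.sim.cost + 1) * t₁)]

theorem Program.sim_regs (p : Program) : ∀ x ∈ p.sim.regs, 97 ≤ x ∧ x ≠ 99 := by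
  induction p with
  | skip => simp [sim, regs]
  | assign x e => simp [sim, regs]; omega
  | store a i e => simp [sim, regs]
  | seq p q hp hq =>
    intro x hx
    simp only [sim, regs, List.mem_append] at hx
    exact hx.elim (hp x) (hq x)
  | ite e p q hp hq =>
    intro x hx
    simp only [sim, regs, List.mem_append] at hx
    exact hx.elim (hp x) (hq x)
  | loop e p hp => exact hp

theorem Program.sim_arrs (p : Program) : ∀ a ∈ p.sim.arrs, 100 ≤ a := by
  induction p with
  | skip => simp [sim, arrs]
  | assign x e => simp [sim, arrs]
  | store a i e => simp [sim, arrs]; omega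
  | seq p q hp hq =>
    intro x hx
    simp only [sim, arrs, List.mem_append] at hx
    exact hx.elim (hp x) (hq x)
  | ite e p q hp hq =>
    intro x hx
    simp only [sim, arrs, List.mem_append] at hx
    exact hx.elim (hp x) (hq x)
  | loop e p hp => exact hp

/-! ### Calling a min-plus product -/

/-- Clear the first `k` simulated registers. -/
def clearRegs : ℕ → Program
  | 0 => .skip
  | k + 1 => clearRegs k ;; .assign (100 + k) 0

theorem clearRegs_regs (k : ℕ) : ∀ x ∈ (clearRegs k).regs, 100 ≤ x := by
  induction k with
  | zero => simp [clearRegs, Program.regs]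
  | succ k ih =>
    intro x hx
    simp only [clearRegs, Program.regs, List.mem_append, List.mem_singleton] at hx
    rcases hx with h | h
    · exact ih x h
    · omega

theorem clearRegs_arrs (k : ℕ) : (clearRegs k).arrs = [] := by
  induction k with
  | zero => rfl
  | succ k ih => simp [clearRegs, Program.arrs, ih]

theorem Runs.clearRegs {M : ℕ} {s : State} (hB : Bdd M s) (k : ℕ) :
    Runs M (clearRegs k) s fun s' t => (∀ x < k, s'.reg (100 + x) = 0) ∧ t ≤ 2 * k + 1 := by
  induction k with
  | zero => exact Runs.skip hB (by simp)
  | succ k ih =>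
    refine Runs.seq ih fun s₁ t₁ hB1 hF h => Runs.assign hB1 (by simp) ⟨?_, ?_⟩
    · intro x hx
      rcases Nat.lt_succ_iff_lt_or_eq.mp hx with h' | rfl
      · simp [h.1 x h']
      · simp
    · simp; omega

/-- Multiply the matrices in arrays `50` and `51`, of the size in register `80`, into array `52`,
by a simulation of `p`. -/
def Program.callMinPlus (p : Program) : Program :=
  .assign 99 (.reg 99 + 1) ;; clearRegs p.width ;; .assign 100 (.reg 80) ;;
  .sweep 96 100 0 (.reg 80 * .reg 80) (.cell 50 (.reg 96)) ;;
  .sweep 96 101 0 (.reg 80 * .reg 80) (.reg 99) ;;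
  .sweep 96 102 0 (.reg 80 * .reg 80) (.cell 51 (.reg 96)) ;;
  .sweep 96 103 0 (.reg 80 * .reg 80) (.reg 99) ;;
  p.sim ;;
  .sweep 96 52 0 (.reg 80 * .reg 80)
    (.cell 104 (.reg 96) * .op .eq (.cell 105 (.reg 96)) (.reg 99))

theorem Program.callMinPlus_regs (p : Program) : ∀ x ∈ p.callMinPlus.regs, 96 ≤ x := by
  intro x hx
  simp only [callMinPlus, regs, List.mem_append, List.mem_singleton, mem_regs_sweep] at hx
  rcases hx with h | h | h | h | h | h | h | h | h <;> try omega
  · have := clearRegs_regs _ x h; omega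
  · have := p.sim_regs x h; omega

theorem Program.callMinPlus_arrs (p : Program) :
    ∀ a ∈ p.callMinPlus.arrs, a = 52 ∨ 100 ≤ a := by
  intro x hx
  simp only [callMinPlus, arrs, List.mem_append, List.mem_singleton, arrs_sweep,
    clearRegs_arrs, List.not_mem_nil, false_or] at hx
  rcases hx with h | h | h | h | h | h <;> try omega
  have := p.sim_arrs x h; omega

def Program.callFactor (p : Program) : ℕ := p.slowdown + 2 * p.width + 200

/-- Increasing the stamp empties all simulated arrays in one step, so a call costs O(n²) for copying
the matrices in and out, a constant for the registers, and the simulated run. As n² ≤ T, this is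
linear in T. -/
theorem Runs.callMinPlus {p : Program} {n k T M : ℕ}
    (hp : ∀ A B : Matrix (Fin n) (Fin n) ℕ, (∀ i j, A i j ≤ n) → (∀ i j, B i j ≤ n) →
      RunsWithin ((n + 2) ^ k) p (Jumbled.minPlusInput A B) T (Jumbled.MinPlusOutput A B))
    (hn : 1 ≤ n) (hT : n * n ≤ T) (hk : (n + 2) ^ k ≤ M) (hnM : n * n ≤ M) {s : State}
    (hB : Bdd M s) (hF : Fresh s) (h80 : s.reg 80 = n) (h99 : s.reg 99 + 1 ≤ M)
    (hA : ∀ i < n * n, s.mem 50 i ≤ n) (hB' : ∀ i < n * n, s.mem 51 i ≤ n) :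
    Runs M p.callMinPlus s fun s' t =>
      (∀ i < n, ∀ j < n, IsLeast {x | ∃ k < n, x = s.mem 50 (i * n + k) + s.mem 51 (k * n + j)}
        (s'.mem 52 (i * n + j))) ∧
      Fresh s' ∧ s'.reg 99 = s.reg 99 + 1 ∧ t ≤ p.callFactor * T := by
  have hlt : ∀ i j, i < n → j < n → i * n + j < n * n := by
    intro i j hi hj
    calc i * n + j < i * n + n := by omega
      _ = (i + 1) * n := by ring
      _ ≤ n * n := Nat.mul_le_mul_right _ hi
  let A : Matrix (Fin n) (Fin n) ℕ := fun i j => s.mem 50 (i * n + j)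
  let B : Matrix (Fin n) (Fin n) ℕ := fun i j => s.mem 51 (i * n + j)
  obtain ⟨s', t, hex, ht, hout⟩ := hp A B (fun i j => hA _ (hlt _ _ i.2 j.2))
    (fun i j => hB' _ (hlt _ _ i.2 j.2))
  have ht' : t ≤ T := by exact_mod_cast ht
  refine Runs.assign_seq hB (by simpa using h99) fun hB1 => ?_
  refine Runs.seq (Runs.clearRegs hB1 p.width) fun s₁ t₁ hB₁ hF₁ h₁ => ?_
  have r1 : ∀ x, x < 100 → s₁.reg x = if x = 99 then s.reg 99 + 1 else s.reg x := by
    intro x hx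
    rw [hF₁.reg x fun h => by have := clearRegs_regs _ x h; omega]
    simp
  have m1 : s₁.mem = s.mem := by
    funext a; rw [hF₁.mem a (by simp [clearRegs_arrs])]; rfl
  have h80₁ := r1 80 (by omega)
  have h99₁ := r1 99 (by omega)
  norm_num at h80₁ h99₁
  refine Runs.assign_seq hB₁ (by simpa using hB₁.reg 80) fun hB₂ => ?_
  refine Runs.seq (Runs.sweep (Q := fun s' t => s' = _ ∧ t ≤ _) 0 (n * n) (s.mem 50) hB₂ hnM
    (by intros; simp [h80₁, h80]) (by simp)
    (by intros; simp [State.fill_mem, m1]) (fun j hj => hB.mem _ _)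
    (fun t _ ht => ⟨rfl, ht⟩)) ?_
  rintro s₃ t₃ hB₃ - ⟨e₃, ht₃⟩
  refine Runs.seq (Runs.sweep (Q := fun s' t => s' = _ ∧ t ≤ _) 0 (n * n)
    (fun _ => s.reg 99 + 1) hB₃ hnM
    (by intros; simp [e₃, h80₁, h80]) (by simp)
    (by intros; simp [e₃, h99₁]) (fun j hj => h99)
    (fun t _ ht => ⟨rfl, ht⟩)) ?_
  rintro s₄ t₄ hB₄ - ⟨e₄, ht₄⟩
  refine Runs.seq (Runs.sweep (Q := fun s' t => s' = _ ∧ t ≤ _) 0 (n * n) (s.mem 51) hB₄ hnM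
    (by intros; simp [e₄, e₃, h80₁, h80]) (by simp)
    (by intros; simp [e₄, e₃, State.fill_mem, m1]) (fun j hj => hB.mem _ _)
    (fun t _ ht => ⟨rfl, ht⟩)) ?_
  rintro s₅ t₅ hB₅ - ⟨e₅, ht₅⟩
  refine Runs.seq (Runs.sweep (Q := fun s' t => s' = _ ∧ t ≤ _) 0 (n * n)
    (fun _ => s.reg 99 + 1) hB₅ hnM
    (by intros; simp [e₅, e₄, e₃, h80₁, h80]) (by simp)
    (by intros; simp [e₅, e₄, e₃, h99₁]) (fun j hj => h99)
    (fun t _ ht => ⟨rfl, ht⟩)) ?_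
  rintro s₆ t₆ hB₆ - ⟨e₆, ht₆⟩
  have h99₆ : s₆.reg 99 = s.reg 99 + 1 := by simp [e₆, e₅, e₄, e₃, h99₁]
  have h80₆ : s₆.reg 80 = n := by simp [e₆, e₅, e₄, e₃, h80₁, h80]
  have m6 : ∀ a, s₆.mem a = if a = 103 then splice (s.mem 103) 0 (n * n) (fun _ => s.reg 99 + 1)
      else if a = 102 then splice (s.mem 102) 0 (n * n) (s.mem 51)
      else if a = 101 then splice (s.mem 101) 0 (n * n) (fun _ => s.reg 99 + 1)
      else if a = 100 then splice (s.mem 100) 0 (n * n) (s.mem 50) else s.mem a := by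
    intro a
    rw [e₆, State.fill_mem, e₅, State.fill_mem, State.fill_mem, e₄, State.fill_mem,
      State.fill_mem, State.fill_mem, e₃]
    simp only [State.fill_mem, State.setReg_mem, m1]
    norm_num
  have hrel : SimRel p.width (Jumbled.minPlusInput A B) s₆ := by
    constructor
    · intro x hx
      have h1 := h₁.1 x hx
      simp only [e₆, e₅, e₄, e₃, State.fill_reg, State.setReg_reg, Expr.val_reg, h80₁, h80, h1,
        Jumbled.minPlusInput]
      have e96 : 100 + x ≠ 96 := by omega
      rw [if_neg e96, if_neg e96, if_neg e96, if_neg e96]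
      simp
    · intro a i
      rw [h99₆, m6, m6]
      simp only [Jumbled.minPlusInput]
      -- All stamps from earlier calls are at most the old value of register 99. Hence every cell
      -- that was not loaded just now reads as 0, as `minPlusInput` requires.
      have hlow := hF a i
      have hdm : i / n * n + i % n = i := Nat.div_add_mod' i n
      rcases a with _ | _ | a
      · norm_num [splice, A]
        by_cases hi : i < n * n
        · simp [hi, hdm]
        · simp only [hi, if_false]
          simp at hlow
          split <;> omega
      · norm_num [splice, B]
        by_cases hi : i < n * n
        · simp [hi, hdm]
        · simp only [hi, if_false]
          simp at hlow
          split <;> omega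
      · have e1 : 101 + 2 * (a + 1 + 1) ≠ 103 := by omega
        have e2 : 101 + 2 * (a + 1 + 1) ≠ 102 := by omega
        have e3 : 101 + 2 * (a + 1 + 1) ≠ 101 := by omega
        have e4 : 101 + 2 * (a + 1 + 1) ≠ 100 := by omega
        simp only [e1, e2, e3, e4, if_false]
        rw [if_neg (by omega : s.mem (101 + 2 * (a + 1 + 1)) i ≠ s.reg 99 + 1)]
        simp
  have hfresh : Fresh s₆ := by
    intro a i
    rw [h99₆, m6]
    have hlow := hF a i
    split_ifs with c1 c2 c3 c4
    · obtain rfl : a = 1 := by omega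
      norm_num at hlow
      simp only [splice]; split <;> omega
    · omega
    · obtain rfl : a = 0 := by omega
      norm_num at hlow
      simp only [splice]; split <;> omega
    · omega
    · omega
  obtain ⟨s₇, t₇, x7, B7, rel7, f7, g7, c7⟩ :=
    Program.sim_exec hk hex le_rfl s₆ hB₆ hrel hfresh
  refine Runs.seq (Q₁ := fun s' t' => s₇ = s' ∧ t₇ = t')
    ⟨s₇, t₇, x7.mono (Nat.le_self_pow (by omega) M), B7, rfl, rfl⟩ ?_
  rintro _ _ hB₇ hF₇ ⟨rfl, rfl⟩
  have h80₇ : s₇.reg 80 = n := by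
    rw [hF₇.reg 80 fun h => by have := p.sim_regs _ h; omega, h80₆]
  have h99₇ : s₇.reg 99 = s.reg 99 + 1 := by rw [g7, h99₆]
  refine Runs.sweep 0 (n * n) (s'.mem 2) hB₇ hnM
    (by intros; simp [h80₇]) (by simp)
    (by
      intro j hj
      have := rel7.mem 2 j
      rw [h99₇] at this
      norm_num at this
      rw [this]
      simp [State.fill_mem, h99₇])
    (fun j hj => by
      rw [rel7.mem 2 j]; split
      · exact hB₇.mem _ _
      · omega) ?_
  intro t₈ _ ht₈
  refine ⟨?_, ?_, by simp [h99₇], ?_⟩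
  · intro i hi j hj
    have := hout ⟨i, hi⟩ ⟨j, hj⟩
    rw [State.fill_mem_same, splice_zero_left _ _ (hlt i j hi hj)]
    convert this using 1
    ext x
    simp only [Set.mem_ofPred_eq, Set.mem_range, A, B]
    constructor
    · rintro ⟨l, hl, rfl⟩; exact ⟨⟨l, hl⟩, rfl⟩
    · rintro ⟨l, rfl⟩; exact ⟨l, l.2, rfl⟩
  · intro a i
    have := f7 a i
    rw [State.fill_mem_ne _ _ _ _ _ _ (by omega)]
    simpa using this
  · have h1 := h₁.2
    have hT1 : 1 ≤ T := le_trans (Nat.one_le_iff_ne_zero.mpr (by positivity)) hT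
    have c8 : t₇ ≤ p.slowdown * T := c7.trans (Nat.mul_le_mul_left _ ht')
    have c9 : 2 * p.width ≤ 2 * p.width * T := Nat.le_mul_of_pos_right _ hT1
    simp only [Expr.cost_add, Expr.cost_reg, Expr.cost_one, Expr.cost_zero, Expr.cost_mul,
      Expr.cost_cell, Expr.cost_op] at *
    simp only [Program.callFactor, add_mul]
    omega

/-! ### A lower bound for min-plus products -/

/-- A store changes one cell and takes at least one step; no other instruction changes memory. -/
theorem Exec.card_changed {B : ℕ} {p : Program} {s s' : State} {t : ℕ} (h : Exec B p s s' t)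
    (a : ℕ) : ∃ U : Finset ℕ, U.card ≤ t ∧ ∀ i ∉ U, s'.mem a i = s.mem a i := by
  induction h with
  | skip s => exact ⟨∅, by simp, by simp⟩
  | assign s x e he => exact ⟨∅, by simp, by simp⟩
  | store s b i e hi he =>
    refine ⟨{i.val s}, by simp, fun j hj => ?_⟩
    rw [State.setMem_mem]
    split
    · subst_vars; simp at hj; simp [hj]
    · rfl
  | seq _ _ h1 h2 =>
    obtain ⟨U, hU, h1⟩ := h1
    obtain ⟨V, hV, h2⟩ := h2
    refine ⟨U ∪ V, (Finset.card_union_le _ _).trans (by omega), fun i hi => ?_⟩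
    simp only [Finset.mem_union, not_or] at hi
    rw [h2 i hi.2, h1 i hi.1]
  | iteTrue _ _ _ h1 => obtain ⟨U, hU, h1⟩ := h1; exact ⟨U, by omega, h1⟩
  | iteFalse _ _ _ h1 => obtain ⟨U, hU, h1⟩ := h1; exact ⟨U, by omega, h1⟩
  | loopDone _ _ => exact ⟨∅, by simp, by simp⟩
  | loopStep _ _ _ _ h1 h2 =>
    obtain ⟨U, hU, h1⟩ := h1
    obtain ⟨V, hV, h2⟩ := h2
    refine ⟨U ∪ V, (Finset.card_union_le _ _).trans (by omega), fun i hi => ?_⟩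
    simp only [Finset.mem_union, not_or] at hi
    rw [h2 i hi.2, h1 i hi.1]

/-- The product of the all-ones matrix and the zero matrix has only entries 1, whereas the output
array starts with zeros: all n² output cells have to be written. This absorbs the overhead of calls
into T, and it forces C / ℓ to be nonnegative. -/
theorem ComputesMinPlus.sq_le {p : Program} {time : ℕ → ℝ} (h : Jumbled.ComputesMinPlus p time)
    {n : ℕ} (hn : 1 ≤ n) : ((n * n : ℕ) : ℝ) ≤ time n := by
  obtain ⟨k, h⟩ := h
  obtain ⟨s', t, hex, ht, hout⟩ := h n (fun _ _ => 1) (fun _ _ => 0) hn (fun _ _ => hn)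
    (fun _ _ => by simp)
  refine le_trans ?_ ht
  obtain ⟨U, hU, hU'⟩ := hex.card_changed 2
  suffices Finset.range (n * n) ⊆ U by
    have := Finset.card_le_card this
    rw [Finset.card_range] at this
    exact_mod_cast this.trans hU
  intro i hi
  rw [Finset.mem_range] at hi
  by_contra hiU
  have h1 := hU' i hiU
  have hdm : i / n * n + i % n = i := Nat.div_add_mod' i n
  have h2 := (hout ⟨i / n, Nat.div_lt_of_lt_mul hi⟩ ⟨i % n, Nat.mod_lt i hn⟩).1
  simp only [hdm, h1, Jumbled.minPlusInput] at h2
  simp at h2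

/-! ### Profiles -/

/-- A function that grows by `0` or `1` in each step, and always by `1` from `m` on. -/
structure Profile (m : ℕ) (f : ℕ → ℕ) : Prop where
  le_succ : ∀ i, f i ≤ f (i + 1)
  succ_le : ∀ i, f (i + 1) ≤ f i + 1
  tail : ∀ t, f (m + t) = f m + t

theorem Profile.mono {m : ℕ} {f : ℕ → ℕ} (h : Profile m f) : Monotone f :=
  monotone_nat_of_le_succ h.le_succ

theorem Profile.lip {m : ℕ} {f : ℕ → ℕ} (h : Profile m f) (i t : ℕ) : f (i + t) ≤ f i + t := by
  induction t with
  | zero => simp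
  | succ t ih => have := h.succ_le (i + t); rw [← add_assoc]; omega

theorem Profile.lip' {m : ℕ} {f : ℕ → ℕ} (h : Profile m f) {i j t : ℕ} (hij : j ≤ i + t) :
    f j ≤ f i + t := (h.mono hij).trans (h.lip i t)

/-- Here i - (i - m) is the minimum of i and m. So a profile stored up to index m can be read at
every index. -/
theorem Profile.ext_eq {m : ℕ} {f : ℕ → ℕ} (h : Profile m f) (i : ℕ) :
    f (i - (i - m)) + (i - m) = f i := by
  rcases le_total i m with hi | hi
  · simp [Nat.sub_eq_zero_of_le hi]
  · obtain ⟨t, rfl⟩ := Nat.exists_eq_add_of_le hi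
    simp [h.tail t]

/-- The values whose minimum is the value at `i` of the min-plus convolution. -/
def convSet (f g : ℕ → ℕ) (i : ℕ) : Set ℕ := {x | ∃ j ≤ i, x = f j + g (i - j)}

/-- If one argument lies beyond its threshold, moving the excess to the other argument saves exactly
the excess on one side, since the slope there is 1, and costs at most the excess on the other. -/
theorem Profile.conv_restrict {m₁ m₂ : ℕ} {f g : ℕ → ℕ} (hf : Profile m₁ f) (hg : Profile m₂ g)
    {i j : ℕ} (hi : i ≤ m₁ + m₂) (hj : j ≤ i) :
    ∃ j' ≤ m₁, ∃ l ≤ m₂, j' + l = i ∧ f j' + g l ≤ f j + g (i - j) := by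
  by_cases h1 : j ≤ m₁
  · by_cases h2 : i - j ≤ m₂
    · exact ⟨j, h1, i - j, h2, by omega, le_rfl⟩
    · refine ⟨i - m₂, by omega, m₂, le_rfl, by omega, ?_⟩
      have h3 := hg.tail (i - j - m₂)
      rw [show m₂ + (i - j - m₂) = i - j by omega] at h3
      have h4 := hf.lip' (i := j) (j := i - m₂) (t := i - j - m₂) (by omega)
      omega
  · refine ⟨m₁, le_rfl, i - m₁, by omega, by omega, ?_⟩
    have h3 := hf.tail (j - m₁)
    rw [show m₁ + (j - m₁) = j by omega] at h3
    have h4 := hg.lip' (i := i - j) (j := i - m₁) (t := j - m₁) (by omega)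
    omega

theorem Profile.isLeast_conv {m₁ m₂ : ℕ} {f g : ℕ → ℕ} (hf : Profile m₁ f) (hg : Profile m₂ g)
    {i v : ℕ} (hi : i ≤ m₁ + m₂) (hv : v ∈ convSet f g i)
    (hle : ∀ j ≤ m₁, ∀ l ≤ m₂, j + l = i → v ≤ f j + g l) : IsLeast (convSet f g i) v := by
  refine ⟨hv, ?_⟩
  rintro _ ⟨j, hj, rfl⟩
  obtain ⟨j', hj', l, hl, he, hle'⟩ := hf.conv_restrict hg hi hj
  exact (hle j' hj' l hl he).trans hle'

/-- Truncated subtraction produces spurious candidates with j > i. They are harmless: by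
monotonicity of f, the genuine candidate j = i is at least as small. -/
theorem Profile.exists_conv_le {m₁ : ℕ} {f : ℕ → ℕ} (hf : Profile m₁ f) (g : ℕ → ℕ)
    (i j : ℕ) : ∃ v ∈ convSet f g i, v ≤ f j + g (i - j) := by
  rcases le_total j i with h | h
  · exact ⟨_, ⟨j, h, rfl⟩, le_rfl⟩
  · refine ⟨_, ⟨i, le_rfl, rfl⟩, ?_⟩
    have := hf.mono h
    simp only [Nat.sub_self, Nat.sub_eq_zero_of_le h]
    omega

/-! ### Relaxing a cell -/

/-- `a[i] := min a[i] e`. -/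
def Program.relax (a : ℕ) (i e : Expr) : Program :=
  .ite (.op .lt e (.cell a i)) (.store a i e) .skip

theorem Runs.relax {M : ℕ} {s : State} {a : ℕ} {i e : Expr} {Q : State → ℕ → Prop}
    (hB : Bdd M s)
    (h : ∀ t, t ≤ 2 * i.cost + 2 * e.cost + 5 →
      Q (s.setMem a (i.val s) (min (s.mem a (i.val s)) (e.val s))) t)
    (hi : i.small = true := by rfl) (he : e.small = true := by rfl)
    (ht : (Expr.op .lt e (.cell a i)).small = true := by rfl) :
    Runs M (.relax a i e) s Q := by
  refine Runs.ite hB (fun hlt => ?_) (fun hlt => ?_) ht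
  · have hlt : e.val s < s.mem a (i.val s) := by
      by_contra h; simp [h] at hlt
    refine Runs.store hB (hlt.le.trans (hB.mem _ _)) ?_ hi he
    have := h ((Expr.op .lt e (.cell a i)).cost + 1 + (i.cost + e.cost + 1)) (by simp; omega)
    rwa [min_eq_right hlt.le] at this
  · have hlt : s.mem a (i.val s) ≤ e.val s := by
      by_contra h
      push Not at h
      simp [h] at hlt
    refine Runs.skip hB ?_
    have := h ((Expr.op .lt e (.cell a i)).cost + 1 + 1) (by simp; omega)
    rw [min_eq_left hlt] at this
    convert this using 1
    ext x y
    · rfl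
    · simp only [State.setMem_mem]
      split
      · subst_vars; simp
      · rfl

theorem Program.regs_relax (a : ℕ) (i e : Expr) : (Program.relax a i e).regs = [] := rfl
theorem Program.arrs_relax (a : ℕ) (i e : Expr) : (Program.relax a i e).arrs = [a] := rfl

/-! ### Convolutions

The operands are in the arrays `53` and `54`, up to the indices in the registers `60` and `61`,
and the result goes to array `55`. -/

/-- A first upper bound for the convolution. -/
def Program.convInit : Program :=
  .sweep 67 55 0 (.reg 60 + .reg 61 + 1)
    (.cell 53 0 + (.cell 54 (.reg 67 - (.reg 67 - .reg 61)) + (.reg 67 - .reg 61)))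

theorem Runs.convInit {M m₁ m₂ : ℕ} {f g : ℕ → ℕ} {s : State} {Q : State → ℕ → Prop}
    (hB : Bdd M s) (hg : Profile m₂ g) (h60 : s.reg 60 = m₁) (h61 : s.reg 61 = m₂)
    (hX : s.mem 53 0 = f 0) (hY : ∀ i ≤ m₂, s.mem 54 i = g i) (hm : m₁ + m₂ + 1 ≤ M)
    (hM : ∀ i ≤ m₁ + m₂, f 0 + g i ≤ M)
    (hQ : ∀ t, t ≤ 50 * (m₁ + m₂ + 1) →
      Q (s.fill 67 55 0 (m₁ + m₂ + 1) fun i => f 0 + g i) t) :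
    Runs M .convInit s Q := by
  refine Runs.sweep 0 (m₁ + m₂ + 1) (fun i => f 0 + g i) hB hm (by intros; simp [h60, h61])
    (by simp) ?_ (fun j hj => hM j (by omega)) (fun t _ ht => hQ t ?_)
  · intro j hj
    simp only [Expr.val_add, Expr.val_cell, Expr.val_zero, Expr.val_sub, Expr.val_reg,
      State.fill_reg, State.fill_mem]
    norm_num
    rw [hX, h61, hY _ (by omega), hg.ext_eq j]
  · simp at ht; omega

/-- Convolution by the definition. -/
def Program.slowConv : Program :=
  .convInit ;;
  .for_ 62 (.reg 60 + 1) (.for_ 63 (.reg 61 + 1)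
    (.relax 55 (.reg 62 + .reg 63) (.cell 53 (.reg 62) + .cell 54 (.reg 63))))

theorem Runs.slowConv {M m₁ m₂ : ℕ} {f g : ℕ → ℕ} {s : State}
    (hB : Bdd M s) (hf : Profile m₁ f) (hg : Profile m₂ g) (h60 : s.reg 60 = m₁)
    (h61 : s.reg 61 = m₂) (hX : ∀ i ≤ m₁, s.mem 53 i = f i) (hY : ∀ i ≤ m₂, s.mem 54 i = g i)
    (hm : m₁ + m₂ + 1 ≤ M) (hM : ∀ i ≤ m₁ + m₂, f 0 + g i ≤ M) :
    Runs M .slowConv s fun s' t =>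
      (∀ i ≤ m₁ + m₂, IsLeast (convSet f g i) (s'.mem 55 i)) ∧
      t ≤ 200 * ((m₁ + 1) * (m₂ + 1)) := by
  refine Runs.seq (Runs.convInit (Q := fun s' t => s' = _ ∧ t ≤ 50 * (m₁ + m₂ + 1)) hB hg h60 h61
    (hX 0 (by omega)) hY hm hM (fun t ht => ⟨rfl, ht⟩)) ?_
  rintro s₁ t₁ hB₁ - ⟨e₁, ht₁⟩
  have h60₁ : s₁.reg 60 = m₁ := by simp [e₁, h60]
  have h61₁ : s₁.reg 61 = m₂ := by simp [e₁, h61]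
  have hX₁ : ∀ i ≤ m₁, s₁.mem 53 i = f i := by simpa [e₁, State.fill_mem] using hX
  have hY₁ : ∀ i ≤ m₂, s₁.mem 54 i = g i := by simpa [e₁, State.fill_mem] using hY
  have hZ₁ : ∀ i ≤ m₁ + m₂, s₁.mem 55 i = f 0 + g i := by
    intro i hi
    rw [e₁, State.fill_mem_same, splice_zero_left _ _ (by omega)]
  -- Cells always hold genuine candidates, starting with the one for j = 0, so it remains to relax
  -- over all restricted pairs.
  refine Runs.for_unif (fun j s => (∀ i ≤ m₁ + m₂, s.mem 55 i ∈ convSet f g i) ∧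
    ∀ j' < j, ∀ l ≤ m₂, s.mem 55 (j' + l) ≤ f j' + g l) (m₁ + 1) ((m₂ + 1) * 31 + 8) hB₁
    (by omega) (by decide) ?_ ?_ ?_ ?_
  · intro s' hF
    simp [hF.reg 60 (by decide), h60₁]
  · refine ⟨fun i hi => ?_, by simp⟩
    rw [State.setReg_mem, hZ₁ i hi]
    exact ⟨0, by omega, by simp⟩
  · rintro j s₂ hj hB₂ hF₂ h62 ⟨hin, hle⟩
    refine Runs.for_unif (fun l s => (∀ i ≤ m₁ + m₂, s.mem 55 i ∈ convSet f g i) ∧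
      (∀ j' < j, ∀ l ≤ m₂, s.mem 55 (j' + l) ≤ f j' + g l) ∧
      ∀ l' < l, s.mem 55 (j + l') ≤ f j + g l') (m₂ + 1) 21 hB₂
      (by omega) (by decide) ?_ ?_ ?_ ?_
    · intro s' hF
      simp [hF.reg 61 (by decide), hF₂.reg 61 (by decide), h61₁]
    · exact ⟨hin, hle, by simp⟩
    · rintro l s₃ hl hB₃ hF₃ h63 ⟨hin, hle, hle'⟩
      have e62 : s₃.reg 62 = j := by rw [hF₃.reg 62 (by decide), h62]
      have eX : s₃.mem 53 j = f j := by
        rw [hF₃.mem 53 (by decide), hF₂.mem 53 (by decide), hX₁ j (by omega)]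
      have eY : s₃.mem 54 l = g l := by
        rw [hF₃.mem 54 (by decide), hF₂.mem 54 (by decide), hY₁ l (by omega)]
      refine Runs.relax hB₃ fun t ht => ⟨?_, by simpa using ht⟩
      simp only [Expr.val_add, Expr.val_reg, Expr.val_cell, e62, h63, eX, eY, State.setReg_mem,
        State.setMem_mem_same]
      have hupd : ∀ i, Function.update (s₃.mem 55) (j + l) (min (s₃.mem 55 (j + l)) (f j + g l)) i
          ≤ s₃.mem 55 i := by
        intro i; rw [Function.update_apply]; split
        · subst_vars; exact min_le_left _ _
        · exact le_rfl
      refine ⟨fun i hi => ?_, fun j' hj' l' hl' => (hupd _).trans (hle j' hj' l' hl'), ?_⟩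
      · rw [Function.update_apply]; split
        · rename_i he
          subst he
          rcases min_choice (s₃.mem 55 (j + l)) (f j + g l) with h | h <;> rw [h]
          · exact hin _ hi
          · exact ⟨j, by omega, by simp⟩
        · exact hin i hi
      · intro l' hl'
        rcases Nat.lt_succ_iff_lt_or_eq.mp hl' with h | rfl
        · exact (hupd _).trans (hle' l' h)
        · rw [Function.update_self]; exact min_le_right _ _
    · rintro s₃ t hB₃ hF₃ - ⟨hin, hle, hle'⟩ ht
      refine ⟨⟨hin, fun j' hj' l hl => ?_⟩, ?_⟩
      · rcases Nat.lt_succ_iff_lt_or_eq.mp hj' with h | rfl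
        · exact hle j' h l hl
        · exact hle' l (by omega)
      · simp at ht; omega
  · rintro s₂ t hB₂ hF₂ - ⟨hin, hle⟩ ht
    refine ⟨fun i hi => hf.isLeast_conv hg hi (hin i hi) ?_, ?_⟩
    · rintro j hj l hl rfl
      exact hle j (by omega) l hl
    · simp at ht
      nlinarith

/-! ### Convolution by blocks, using min-plus products -/

/-- One product for the convolution: starting points in the registers `65` and `66`. -/
def Program.convChunk (p : Program) : Program :=
  .sweep 67 50 0 (.reg 80 * .reg 80)
    (.cell 53 (.reg 65 + .reg 67) - .cell 53 (.reg 65 + .reg 67 / .reg 80 * .reg 80)) ;;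
  .sweep 67 51 0 (.reg 80 * .reg 80)
    (.cell 54 (.reg 66 + .reg 67 % .reg 80 * .reg 80 - .reg 67 / .reg 80) -
      .cell 54 (.reg 66 + .reg 67 % .reg 80 * .reg 80 - .reg 80)) ;;
  p.callMinPlus ;;
  .for_ 67 (.reg 80 * .reg 80)
    (.relax 55 (.reg 65 + .reg 67 / .reg 80 * .reg 80 +
        (.reg 66 + .reg 67 % .reg 80 * .reg 80))
      (.cell 52 (.reg 67) + (.cell 53 (.reg 65 + .reg 67 / .reg 80 * .reg 80) +
        .cell 54 (.reg 66 + .reg 67 % .reg 80 * .reg 80 - .reg 80))))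

theorem Program.convChunk_regs (p : Program) : ∀ x ∈ p.convChunk.regs, x = 67 ∨ 96 ≤ x := by
  intro x hx
  simp only [convChunk, regs, List.mem_append, mem_regs_sweep, mem_regs_for, regs_relax,
    List.not_mem_nil, or_false] at hx
  rcases hx with h | h | h | h
  · exact .inl h
  · exact .inl h
  · exact .inr (p.callMinPlus_regs x h)
  · exact .inl h

theorem Program.convChunk_arrs (p : Program) :
    ∀ a ∈ p.convChunk.arrs, (50 ≤ a ∧ a ≤ 52) ∨ a = 55 ∨ 100 ≤ a := by
  intro a ha
  simp only [convChunk, arrs, List.mem_append, arrs_sweep, arrs_for, arrs_relax,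
    List.mem_singleton] at ha
  rcases ha with h | h | h | h
  · omega
  · omega
  · have := p.callMinPlus_arrs a h; omega
  · omega

theorem Fresh.of_eq {s s' : State} (h : Fresh s) (hm : ∀ a, 100 ≤ a → s'.mem a = s.mem a)
    (hr : s'.reg 99 = s.reg 99) : Fresh s' := by
  intro a i
  rw [hm _ (by omega), hr]
  exact h a i

/-- The assumption on the program for min-plus products that is used for size `n`. -/
structure CanMultiply (p : Program) (n T M : ℕ) : Prop where
  run : ∃ k, (n + 2) ^ k ≤ M ∧ ∀ A B : Matrix (Fin n) (Fin n) ℕ,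
    (∀ i j, A i j ≤ n) → (∀ i j, B i j ≤ n) →
      RunsWithin ((n + 2) ^ k) p (Jumbled.minPlusInput A B) T (Jumbled.MinPlusOutput A B)
  pos : 1 ≤ n
  sq_le_time : n * n ≤ T
  sq_le : n * n ≤ M

/-- Row a of the first matrix holds increments of f from x+an on, column b of the second holds
values of g at y+bn-k relative to y+bn-n; both lie in {0, …, n} by the Lipschitz property. The first
conclusion expresses soundness: a common lower bound of a cell and of the candidates for its index
remains a lower bound of the cell. -/
theorem Runs.convChunk {p : Program} {n T M x y m₁ m₂ : ℕ} {f g : ℕ → ℕ} {s : State}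
    (hp : CanMultiply p n T M) (hB : Bdd M s) (hF : Fresh s) (h99 : s.reg 99 + 1 ≤ M)
    (hf : Profile m₁ f) (hg : Profile m₂ g)
    (h80 : s.reg 80 = n) (h65 : s.reg 65 = x) (h66 : s.reg 66 = y)
    (hX : ∀ i < x + n * n, s.mem 53 i = f i) (hY : ∀ i < y + n * n, s.mem 54 i = g i) :
    Runs M p.convChunk s fun s' t =>
      (∀ i v, v ≤ s.mem 55 i → (∀ w ∈ convSet f g i, v ≤ w) → v ≤ s'.mem 55 i) ∧
      (∀ i, s'.mem 55 i ≤ s.mem 55 i) ∧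
      (∀ a < n, ∀ b < n, ∀ k < n,
        s'.mem 55 (x + a * n + (y + b * n)) ≤ f (x + a * n + k) + g (y + b * n - k)) ∧
      Fresh s' ∧ s'.reg 99 = s.reg 99 + 1 ∧ t ≤ (p.callFactor + 300) * T := by
  have hn := hp.pos
  have hlt : ∀ i j, i < n → j < n → i * n + j < n * n := by
    intro i j hi hj
    calc i * n + j < i * n + n := by omega
      _ = (i + 1) * n := by ring
      _ ≤ n * n := Nat.mul_le_mul_right _ hi
  have hdm : ∀ i, i / n * n + i % n = i := fun i => Nat.div_add_mod' i n
  have hmod : ∀ i, i % n < n := fun i => Nat.mod_lt i hn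
  have hdiv : ∀ i, i < n * n → i / n < n := fun i hi => Nat.div_lt_of_lt_mul hi
  have hmodn : ∀ i, i % n * n + n ≤ n * n := by
    intro i
    calc i % n * n + n = (i % n + 1) * n := by ring
      _ ≤ n * n := Nat.mul_le_mul_right _ (hmod i)
  have hX' : ∀ i < n * n, s.mem 53 (x + i) = f (x + i) ∧
      s.mem 53 (x + i / n * n) = f (x + i / n * n) := by
    intro i hi
    have := hdm i
    exact ⟨hX _ (by omega), hX _ (by omega)⟩
  have hY' : ∀ i k, s.mem 54 (y + i % n * n - k) = g (y + i % n * n - k) := by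
    intro i k
    have := hmodn i
    exact hY _ (by omega)
  refine Runs.seq (Runs.sweep (Q := fun s' t => s' = _ ∧ t ≤ _) 0 (n * n)
    (fun i => f (x + i) - f (x + i / n * n)) hB hp.sq_le (by intros; simp [h80]) (by simp)
    (by
      intro j hj
      simp [State.fill_mem, h80, h65, hX' j hj])
    (fun j hj => by
      rw [← (hX' j hj).1]; exact (Nat.sub_le _ _).trans (hB.mem _ _))
    (fun t _ ht => ⟨rfl, ht⟩)) ?_
  rintro s₁ t₁ hB₁ - ⟨e₁, ht₁⟩
  refine Runs.seq (Runs.sweep (Q := fun s' t => s' = _ ∧ t ≤ _) 0 (n * n)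
    (fun i => g (y + i % n * n - i / n) - g (y + i % n * n - n)) hB₁ hp.sq_le
    (by intros; simp [e₁, h80]) (by simp)
    (by
      intro j hj
      simp [e₁, State.fill_mem, h80, h66, hY'])
    (fun j hj => by
      rw [← hY' j]; exact (Nat.sub_le _ _).trans (hB.mem _ _))
    (fun t _ ht => ⟨rfl, ht⟩)) ?_
  rintro s₂ t₂ hB₂ - ⟨e₂, ht₂⟩
  have r2 : ∀ z, z ≠ 67 → s₂.reg z = s.reg z := by intro z hz; simp [e₂, e₁, hz]
  have m2 : ∀ a, a ≠ 50 → a ≠ 51 → s₂.mem a = s.mem a := by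
    intro a h h'; simp [e₂, e₁, State.fill_mem, h, h']
  have hA₂ : ∀ i < n * n, s₂.mem 50 i = f (x + i) - f (x + i / n * n) := by
    intro i hi
    simp [e₂, e₁, State.fill_mem, splice_zero_left _ _ hi]
  have hB'₂ : ∀ i < n * n, s₂.mem 51 i = g (y + i % n * n - i / n) - g (y + i % n * n - n) := by
    intro i hi
    simp [e₂, splice_zero_left _ _ hi]
  obtain ⟨k, hk, hrun⟩ := hp.run
  refine Runs.seq (Runs.callMinPlus hrun hn hp.sq_le_time hk hp.sq_le hB₂
    (hF.of_eq (fun a ha => m2 a (by omega) (by omega)) (r2 99 (by omega)))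
    (by rw [r2 80 (by omega), h80]) (by rw [r2 99 (by omega)]; exact h99) ?_ ?_) ?_
  · intro i hi
    rw [hA₂ i hi]
    have := hf.lip' (i := x + i / n * n) (j := x + i) (t := n)
      (by have := hdm i; have := hmod i; omega)
    omega
  · intro i hi
    rw [hB'₂ i hi]
    have := hg.lip' (i := y + i % n * n - n) (j := y + i % n * n - i / n) (t := n)
      (by generalize i / n = c, y + i % n * n = e; omega)
    omega
  rintro s₃ t₃ hB₃ hF₃ ⟨hC, hfr, h99₃, ht₃⟩
  have r3 : ∀ z, z ≠ 67 → z < 96 → s₃.reg z = s.reg z := by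
    intro z hz hz'
    rw [hF₃.reg z fun h => by have := p.callMinPlus_regs z h; omega, r2 z hz]
  have m3 : ∀ a, 53 ≤ a → a ≤ 99 → s₃.mem a = s.mem a := by
    intro a h h'
    rw [hF₃.mem a fun h => by have := p.callMinPlus_arrs a h; omega, m2 a (by omega) (by omega)]
  have hC' : ∀ a < n, ∀ b < n, ∃ v, v = s₃.mem 52 (a * n + b) + (f (x + a * n) + g (y + b * n - n))
      ∧ (∃ k < n, v = f (x + a * n + k) + g (y + b * n - k)) ∧
      ∀ k < n, v ≤ f (x + a * n + k) + g (y + b * n - k) := by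
    intro a ha b hb
    -- Monotonicity makes both truncated differences exact, so the reference values cancel. They do
    -- not depend on k, hence minimizing over k commutes with adding them.
    have key : ∀ k < n, s₂.mem 50 (a * n + k) + s₂.mem 51 (k * n + b) +
        (f (x + a * n) + g (y + b * n - n)) = f (x + a * n + k) + g (y + b * n - k) := by
      intro k hk
      rw [hA₂ _ (hlt a k ha hk), hB'₂ _ (hlt k b hk hb)]
      have d1 : (a * n + k) / n = a := by
        rw [mul_comm, Nat.mul_add_div hn, Nat.div_eq_of_lt hk, add_zero]
      have d2 : (k * n + b) / n = k := by
        rw [mul_comm, Nat.mul_add_div hn, Nat.div_eq_of_lt hb, add_zero]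
      have d3 : (k * n + b) % n = b := by
        rw [mul_comm, Nat.mul_add_mod, Nat.mod_eq_of_lt hb]
      rw [d1, d2, d3, show x + (a * n + k) = x + a * n + k by ring]
      have h1 := hf.mono (show x + a * n ≤ x + a * n + k by omega)
      have h2 := hg.mono (show y + b * n - n ≤ y + b * n - k by omega)
      omega
    refine ⟨_, rfl, ?_, fun k hk => ?_⟩
    · obtain ⟨k, hk, he⟩ := (hC a ha b hb).1
      exact ⟨k, hk, by rw [he, key k hk]⟩
    · rw [← key k hk]
      exact Nat.add_le_add_right ((hC a ha b hb).2 ⟨k, hk, rfl⟩) _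
  refine Runs.for_unif (fun j s' =>
      (∀ i v, v ≤ s.mem 55 i → (∀ w ∈ convSet f g i, v ≤ w) → v ≤ s'.mem 55 i) ∧
      (∀ i, s'.mem 55 i ≤ s.mem 55 i) ∧
      (∀ i < j, ∀ k < n, s'.mem 55 (x + i / n * n + (y + i % n * n)) ≤
        f (x + i / n * n + k) + g (y + i % n * n - k))) (n * n) 80 hB₃ hp.sq_le (by decide)
    ?_ ?_ ?_ ?_
  · intro s' hF'
    simp [hF'.reg 80 (by decide), r3 80, h80]
  · rw [State.setReg_mem, m3 55 (by omega) (by omega)]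
    exact ⟨fun _ _ h _ => h, fun _ => le_rfl, by simp⟩
  · rintro j s₄ hj hB₄ hF₄ h67 ⟨h1, h2, h3⟩
    have e80 : s₄.reg 80 = n := by rw [hF₄.reg 80 (by decide), r3 80 (by omega) (by omega), h80]
    have e65 : s₄.reg 65 = x := by rw [hF₄.reg 65 (by decide), r3 65 (by omega) (by omega), h65]
    have e66 : s₄.reg 66 = y := by rw [hF₄.reg 66 (by decide), r3 66 (by omega) (by omega), h66]
    have e52 : s₄.mem 52 = s₃.mem 52 := hF₄.mem 52 (by decide)
    have e53 : s₄.mem 53 = s.mem 53 := by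
      rw [hF₄.mem 53 (by decide), m3 53 (by omega) (by omega)]
    have e54 : s₄.mem 54 = s.mem 54 := by
      rw [hF₄.mem 54 (by decide), m3 54 (by omega) (by omega)]
    obtain ⟨v, hv, ⟨k, hk, hvk⟩, hle⟩ := hC' (j / n) (hdiv j hj) (j % n) (hmod j)
    rw [hdm] at hv
    refine Runs.relax hB₄ fun t ht => ⟨?_, by simp at ht; omega⟩
    simp only [Expr.val_add, Expr.val_sub, Expr.val_mul, Expr.val_div, Expr.val_mod, Expr.val_reg,
      Expr.val_cell, e80, e65, e66, e52, e53, e54, h67, State.setReg_mem,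
      State.setMem_mem_same, (hX' j hj).2, hY', ← hv]
    have hupd : ∀ i, Function.update (s₄.mem 55) (x + j / n * n + (y + j % n * n))
        (min (s₄.mem 55 (x + j / n * n + (y + j % n * n))) v) i ≤ s₄.mem 55 i := by
      intro i; rw [Function.update_apply]; split
      · subst_vars; exact min_le_left _ _
      · exact le_rfl
    refine ⟨?_, fun i => (hupd i).trans (h2 i), ?_⟩
    · intro i w hw hw'
      rw [Function.update_apply]; split
      · rename_i hi
        refine le_min (hi ▸ h1 i w hw hw') ?_
        -- The index y+bn-k may have been cut off at 0, so the relaxing value need not be a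
        -- candidate itself; a genuine candidate lies below it.
        obtain ⟨u, hu, hu'⟩ := hf.exists_conv_le g i (x + j / n * n + k)
        refine (hw' u hu).trans (hu'.trans ?_)
        rw [hvk, hi]
        exact Nat.add_le_add_left (hg.mono (by omega)) _
      · exact h1 i w hw hw'
    · intro i hi k' hk'
      rcases Nat.lt_succ_iff_lt_or_eq.mp hi with h | rfl
      · exact (hupd _).trans (h3 i h k' hk')
      · rw [Function.update_self]
        exact (min_le_right _ _).trans (hle k' hk')
  · rintro s₄ t₄ hB₄ hF₄ - ⟨h1, h2, h3⟩ ht₄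
    refine ⟨h1, h2, ?_, hfr.of_eq (fun a ha => hF₄.mem a ?_) (hF₄.reg 99 (by decide)), ?_, ?_⟩
    · intro a ha b hb k hk
      have := h3 (a * n + b) (hlt a b ha hb) k hk
      have d2 : (a * n + b) / n = a := by
        rw [mul_comm, Nat.mul_add_div hn, Nat.div_eq_of_lt hb, add_zero]
      have d3 : (a * n + b) % n = b := by
        rw [mul_comm, Nat.mul_add_mod, Nat.mod_eq_of_lt hb]
      rwa [d2, d3] at this
    · simp [Program.arrs_for, Program.arrs_relax]; omega
    · rw [hF₄.reg 99 (by decide), h99₃, r2 99 (by omega)]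
    · have hT := hp.sq_le_time
      have hT1 : 1 ≤ T := le_trans (Nat.one_le_iff_ne_zero.mpr (by positivity)) hT
      simp at ht₁ ht₂ ht₄
      rw [add_mul]
      omega

theorem Program.notMem_convChunk_regs (p : Program) {x : ℕ} (h : x < 96) (h' : x ≠ 67) :
    x ∉ p.convChunk.regs := fun hx => by have := p.convChunk_regs x hx; omega

/-- All products for the shifts `< n` of one pair of segments. -/
def Program.convShifts (p : Program) : Program :=
  .for_ 64 (.reg 80)
    (.assign 66 (.reg 63 * (.reg 80 * .reg 80) + .reg 64) ;; p.convChunk)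

/-- Convolution by min-plus products of the size in register `80`. -/
def Program.fastConv (p : Program) : Program :=
  .convInit ;;
  .for_ 62 (.reg 60 / (.reg 80 * .reg 80) + 1)
    (.assign 65 (.reg 62 * (.reg 80 * .reg 80)) ;;
      .for_ 63 ((.reg 61 + .reg 80) / (.reg 80 * .reg 80) + 1) p.convShifts)

theorem Program.convShifts_regs (p : Program) :
    ∀ x ∈ p.convShifts.regs, x = 64 ∨ x = 66 ∨ x = 67 ∨ 96 ≤ x := by
  intro x hx
  simp only [convShifts, mem_regs_for, regs, List.mem_append, List.mem_singleton] at hx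
  rcases hx with h | h | h
  · omega
  · omega
  · have := p.convChunk_regs x h; omega

theorem Program.convShifts_arrs (p : Program) :
    ∀ a ∈ p.convShifts.arrs, (50 ≤ a ∧ a ≤ 52) ∨ a = 55 ∨ 100 ≤ a := by
  intro a ha
  simp only [convShifts, arrs_for, arrs, List.nil_append] at ha
  exact p.convChunk_arrs a ha

theorem Program.fastConv_regs (p : Program) :
    ∀ x ∈ p.fastConv.regs, (62 ≤ x ∧ x ≤ 67) ∨ 96 ≤ x := by
  intro x hx
  simp only [fastConv, convInit, mem_regs_for, mem_regs_sweep, regs, List.mem_append,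
    List.mem_singleton] at hx
  rcases hx with h | h | h | h | h
  · omega
  · omega
  · omega
  · omega
  · have := p.convShifts_regs x h; omega

theorem Program.fastConv_arrs (p : Program) :
    ∀ a ∈ p.fastConv.arrs, (50 ≤ a ∧ a ≤ 52) ∨ a = 55 ∨ 100 ≤ a := by
  intro a ha
  simp only [fastConv, convInit, arrs_for, arrs_sweep, arrs, List.nil_append, List.mem_append,
    List.mem_singleton] at ha
  rcases ha with h | h
  · omega
  · exact p.convShifts_arrs a h

/-- What remains true of array `55`, and of the stamps, during a convolution. -/
structure ConvInv (f g : ℕ → ℕ) (E γ : ℕ) (s : State) : Prop where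
  lower : ∀ i ≤ E, ∀ v, (∀ w ∈ convSet f g i, v ≤ w) → v ≤ s.mem 55 i
  fresh : Fresh s
  stamp : s.reg 99 = γ

/-- The pairs of indices that are taken care of by one product. -/
def ConvDone (f g : ℕ → ℕ) (n : ℕ) (Z : ℕ → ℕ) (x y : ℕ) : Prop :=
  ∀ a < n, ∀ b < n, ∀ k < n, Z (x + a * n + (y + b * n)) ≤ f (x + a * n + k) + g (y + b * n - k)

theorem ConvDone.mono {f g : ℕ → ℕ} {n : ℕ} {Z Z' : ℕ → ℕ} {x y : ℕ}
    (h : ConvDone f g n Z x y) (hZ : ∀ i, Z' i ≤ Z i) : ConvDone f g n Z' x y :=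
  fun a ha b hb k hk => (hZ _).trans (h a ha b hb k hk)

/-- One product only reaches the indices congruent to x + y modulo n. The n shifts of the second
starting point reach all residues. Each product uses up one stamp. -/
theorem Runs.convShifts {p : Program} {n T M x y m₁ m₂ E γ : ℕ} {f g : ℕ → ℕ} {s : State}
    (hp : CanMultiply p n T M) (hB : Bdd M s) (hf : Profile m₁ f) (hg : Profile m₂ g)
    (hI : ConvInv f g E γ s) (hγ : γ + n ≤ M) (hyM : y * (n * n) + n ≤ M)
    (h80 : s.reg 80 = n) (h65 : s.reg 65 = x) (h63 : s.reg 63 = y)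
    (hX : ∀ i < x + n * n, s.mem 53 i = f i)
    (hY : ∀ i < y * (n * n) + n + n * n, s.mem 54 i = g i) :
    Runs M p.convShifts s fun s' t =>
      ConvInv f g E (γ + n) s' ∧ (∀ i, s'.mem 55 i ≤ s.mem 55 i) ∧
      (∀ d < n, ConvDone f g n (s'.mem 55) x (y * (n * n) + d)) ∧
      t ≤ n * ((p.callFactor + 300) * T + 22) := by
  have hnr : ∀ z, z < 96 → z ≠ 64 → z ≠ 66 → z ≠ 67 → z ∉ p.convShifts.regs :=
    fun z h1 h2 h3 h4 h => by have := p.convShifts_regs z h; omega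
  have hna : ∀ a, a = 53 ∨ a = 54 → a ∉ p.convShifts.arrs :=
    fun a h1 h => by have := p.convShifts_arrs a h; omega
  have hn := hp.pos
  refine Runs.for_unif (fun j s' => ConvInv f g E (γ + j) s' ∧
    (∀ i, s'.mem 55 i ≤ s.mem 55 i) ∧
      ∀ d < j, ConvDone f g n (s'.mem 55) x (y * (n * n) + d)) n ((p.callFactor + 300) * T + 8) hB
    (by omega) ?_ ?_ ?_ ?_ ?_
  · simp only [Program.regs, List.mem_append, List.mem_singleton, not_or]
    exact ⟨by decide, p.notMem_convChunk_regs (by omega) (by omega)⟩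
  · intro s' hF
    rw [Expr.val_reg, hF.reg 80 (hnr 80 (by omega) (by omega) (by omega) (by omega)), h80]
  · exact ⟨⟨hI.lower, hI.fresh.of_eq (fun _ _ => rfl) (by simp), by simpa using hI.stamp⟩,
      fun _ => le_rfl, by simp⟩
  · rintro j s₁ hj hB₁ hF₁ h64 ⟨hI₁, hle, hd⟩
    have r1 : ∀ z, z < 96 → z ≠ 64 → z ≠ 66 → z ≠ 67 → s₁.reg z = s.reg z :=
      fun z h1 h2 h3 h4 => hF₁.reg z (hnr z h1 h2 h3 h4)
    have e80 : s₁.reg 80 = n := by rw [r1 80, h80] <;> omega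
    have e65 : s₁.reg 65 = x := by rw [r1 65, h65] <;> omega
    have e63 : s₁.reg 63 = y := by rw [r1 63, h63] <;> omega
    have hv : (Expr.reg 63 * (.reg 80 * .reg 80) + .reg 64).val s₁ = y * (n * n) + j := by
      simp [e63, e80, h64]
    refine Runs.assign_seq hB₁ (by rw [hv]; omega) fun hB₂ => ?_
    rw [hv] at hB₂ ⊢
    refine (Runs.convChunk (x := x) (y := y * (n * n) + j) hp hB₂
      (hI₁.fresh.of_eq (fun _ _ => rfl) (by simp)) ?_ hf hg (by simp [e80]) (by simp [e65])
      (by simp) ?_ ?_).mono ?_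
    · simp [hI₁.stamp]; omega
    · intro i hi
      rw [State.setReg_mem, hF₁.mem 53 (hna 53 (by omega)), hX i hi]
    · intro i hi
      rw [State.setReg_mem, hF₁.mem 54 (hna 54 (by omega)), hY i (by omega)]
    · rintro s' t - - ⟨h1, h2, h3, h4, h5, h6⟩
      simp only [State.setReg_mem] at h1 h2
      refine ⟨⟨⟨?_, h4.of_eq (fun _ _ => rfl) (by simp), ?_⟩, ?_, ?_⟩, ?_⟩
      · exact fun i hi v hv => h1 i v (hI₁.lower i hi v hv) hv
      · simp [h5, hI₁.stamp]; omega
      · exact fun i => (h2 i).trans (hle i)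
      · intro d hd'
        rcases Nat.lt_succ_iff_lt_or_eq.mp hd' with h | rfl
        · exact (hd d h).mono h2
        · exact h3
      · simp; omega
  · rintro s₁ t hB₁ hF₁ - ⟨hI₁, hle, hd⟩ ht
    refine ⟨hI₁, hle, hd, ?_⟩
    simp at ht
    nlinarith

/-- α and β are the numbers of blocks, and each pair of blocks costs O(nT). Multiplying the claim by
q² avoids division: αq and βq are bounded by the thresholds plus a few q. -/
theorem fastConv_time {F n T q α β m₁ m₂ t₁ t : ℕ} (hn : 1 ≤ n) (hq : 1 ≤ q) (hT : q ≤ T)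
    (hα0 : 1 ≤ α) (hβ0 : 1 ≤ β) (hα1 : α * q ≤ m₁ + q) (hβ1 : β * q ≤ m₂ + 2 * q)
    (ht₁ : t₁ ≤ 50 * (m₁ + m₂ + 1))
    (ht : t ≤ α * (β * (n * ((F + 300) * T + 22) + 36) + 7 + 7) + 7 + 5) :
    q * q * (t₁ + t) ≤ (F + 500) * ((m₁ + q) * (m₂ + 2 * q) * (n * T)) := by
  have hT1 : 1 ≤ T := hq.trans hT
  have hnT : 1 ≤ n * T := Nat.one_le_iff_ne_zero.mpr (by positivity)
  have c1 : n * ((F + 300) * T + 22) ≤ (F + 322) * (n * T) := by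
    have : n ≤ n * T := Nat.le_mul_of_pos_right _ hT1
    nlinarith
  have c2 : β * (n * ((F + 300) * T + 22) + 36) ≤ (F + 358) * (β * (n * T)) := by
    have := Nat.mul_le_mul_left β c1
    nlinarith
  have hβn : 1 ≤ β * (n * T) := Nat.one_le_iff_ne_zero.mpr (by positivity)
  have c3 : t₁ + t ≤ 50 * (m₁ + m₂ + 1) + (F + 400) * (α * (β * (n * T))) := by
    have h1 := Nat.mul_le_mul_left α c2
    have h2 : α ≤ α * (β * (n * T)) := Nat.le_mul_of_pos_right _ hβn
    nlinarith
  have c4 : q * q * (α * (β * (n * T))) ≤ (m₁ + q) * (m₂ + 2 * q) * (n * T) := by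
    calc q * q * (α * (β * (n * T))) = (α * q) * (β * q) * (n * T) := by ring
      _ ≤ (m₁ + q) * (m₂ + 2 * q) * (n * T) :=
        Nat.mul_le_mul_right _ (Nat.mul_le_mul hα1 hβ1)
  have c5 : q * q * (m₁ + m₂ + 1) ≤ (m₁ + q) * (m₂ + 2 * q) * (n * T) := by
    have h1 : q ≤ n * T := hT.trans (Nat.le_mul_of_pos_left _ hn)
    calc q * q * (m₁ + m₂ + 1) = q * (m₁ + m₂ + 1) * q := by ring
      _ ≤ (m₁ + q) * (m₂ + 2 * q) * (n * T) := Nat.mul_le_mul (by nlinarith) h1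
  calc q * q * (t₁ + t)
      ≤ q * q * (50 * (m₁ + m₂ + 1) + (F + 400) * (α * (β * (n * T)))) :=
        Nat.mul_le_mul_left _ c3
    _ = 50 * (q * q * (m₁ + m₂ + 1)) + (F + 400) * (q * q * (α * (β * (n * T)))) := by ring
    _ ≤ 50 * ((m₁ + q) * (m₂ + 2 * q) * (n * T)) +
        (F + 400) * ((m₁ + q) * (m₂ + 2 * q) * (n * T)) := by gcongr
    _ ≤ _ := by nlinarith [Nat.zero_le ((m₁ + q) * (m₂ + 2 * q) * (n * T))]

theorem Runs.fastConv {p : Program} {n T M m₁ m₂ : ℕ} {f g : ℕ → ℕ} {s : State}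
    (hp : CanMultiply p n T M) (hB : Bdd M s) (hF : Fresh s) (hf : Profile m₁ f)
    (hg : Profile m₂ g) (h80 : s.reg 80 = n) (h60 : s.reg 60 = m₁) (h61 : s.reg 61 = m₂)
    (hX : ∀ i ≤ m₁ + 2 * (n * n), s.mem 53 i = f i)
    (hY : ∀ i ≤ m₂ + 3 * (n * n), s.mem 54 i = g i)
    (h99 : s.reg 99 + (m₁ + 1) * ((m₂ + n + 1) * n) ≤ M) (hm : m₁ + m₂ + 2 * n + 1 ≤ M)
    (hM : ∀ i ≤ m₁ + m₂, f 0 + g i ≤ M) :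
    Runs M p.fastConv s fun s' t =>
      (∀ i ≤ m₁ + m₂, IsLeast (convSet f g i) (s'.mem 55 i)) ∧
      Fresh s' ∧ s'.reg 99 ≤ s.reg 99 + (m₁ + 1) * ((m₂ + n + 1) * n) ∧
      n * n * (n * n) * t ≤
        (p.callFactor + 500) * ((m₁ + n * n) * (m₂ + 2 * (n * n)) * (n * T)) := by
  have hn := hp.pos
  have hq : 1 ≤ n * n := Nat.one_le_iff_ne_zero.mpr (by positivity)
  have hnq : n ≤ n * n := Nat.le_mul_of_pos_left n hn
  obtain ⟨q, hqdef⟩ : ∃ q, q = n * n := ⟨_, rfl⟩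
  obtain ⟨α, hα⟩ : ∃ α, α = m₁ / q + 1 := ⟨_, rfl⟩
  -- On the side of g the blocks must reach m₂ + n rather than m₂, since a pair (j, l) is located
  -- through l + j % n.
  obtain ⟨β, hβ⟩ : ∃ β, β = (m₂ + n) / q + 1 := ⟨_, rfl⟩
  have hα0 : 1 ≤ α := by rw [hα]; exact Nat.le_add_left 1 _
  have hβ0 : 1 ≤ β := by rw [hβ]; exact Nat.le_add_left 1 _
  have hα1 : α * q ≤ m₁ + q := by
    rw [hα, add_mul, one_mul]; have := Nat.div_mul_le_self m₁ q; omega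
  have hβ1 : β * q ≤ m₂ + n + q := by
    rw [hβ, add_mul, one_mul]; have := Nat.div_mul_le_self (m₂ + n) q; omega
  have hα2 : α ≤ m₁ + 1 := by have := Nat.div_le_self m₁ q; omega
  have hβ2 : β ≤ m₂ + n + 1 := by have := Nat.div_le_self (m₂ + n) q; omega
  -- Stamps have to fit into a word, so the number of products performed before each pair of blocks
  -- is tracked.
  have hγ : ∀ a < α, ∀ b < β, s.reg 99 + a * (β * n) + b * n + n ≤ M := by
    intro a ha b hb
    have h1 : b * n + n ≤ β * n := by
      calc b * n + n = (b + 1) * n := by ring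
        _ ≤ β * n := Nat.mul_le_mul_right _ hb
    have h2 : a * (β * n) + β * n ≤ α * (β * n) := by
      calc a * (β * n) + β * n = (a + 1) * (β * n) := by ring
        _ ≤ α * (β * n) := Nat.mul_le_mul_right _ ha
    have h3 : α * (β * n) ≤ (m₁ + 1) * ((m₂ + n + 1) * n) :=
      Nat.mul_le_mul hα2 (Nat.mul_le_mul_right _ hβ2)
    omega
  have hxq : ∀ a < α, a * q + q ≤ m₁ + q := by
    intro a ha
    calc a * q + q = (a + 1) * q := by ring
      _ ≤ α * q := Nat.mul_le_mul_right _ ha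
      _ ≤ _ := hα1
  have hyq : ∀ b < β, b * q + q ≤ m₂ + n + q := by
    intro a ha
    calc a * q + q = (a + 1) * q := by ring
      _ ≤ β * q := Nat.mul_le_mul_right _ ha
      _ ≤ _ := hβ1
  refine Runs.seq (Runs.convInit (Q := fun s' t => s' = _ ∧ t ≤ 50 * (m₁ + m₂ + 1)) hB hg h60 h61
    (hX 0 (by omega)) (fun i hi => hY i (by omega)) (by omega) hM (fun t ht => ⟨rfl, ht⟩)) ?_
  rintro s₁ t₁ hB₁ - ⟨e₁, ht₁⟩
  have r1 : ∀ x, x ≠ 67 → s₁.reg x = s.reg x := by intro x hx; simp [e₁, hx]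
  have m1 : ∀ a, a ≠ 55 → s₁.mem a = s.mem a := by intro a ha; simp [e₁, State.fill_mem, ha]
  have hI₁ : ConvInv f g (m₁ + m₂) (s.reg 99) s₁ := by
    refine ⟨fun i hi v hv => hv _ ⟨0, by omega, ?_⟩,
      hF.of_eq (fun a ha => m1 a (by omega)) (r1 99 (by omega)), r1 99 (by omega)⟩
    rw [e₁, State.fill_mem_same, splice_zero_left _ _ (by omega), Nat.sub_zero]
  have hdiag : ∀ i ≤ m₁ + m₂, s₁.mem 55 i ∈ convSet f g i ∧ s₁.mem 55 i ≤ f 0 + g i := by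
    intro i hi
    have : s₁.mem 55 i = f 0 + g i := by
      rw [e₁, State.fill_mem_same, splice_zero_left _ _ (by omega)]
    exact ⟨⟨0, by omega, by simpa using this⟩, this.le⟩
  clear e₁
  have hnr : ∀ z, z < 62 ∨ z = 80 ∨ z = 65 ∨ z = 62 → z ∉ p.convShifts.regs :=
    fun z h1 h => by have := p.convShifts_regs z h; omega
  have hna : ∀ a, a = 53 ∨ a = 54 → a ∉ p.convShifts.arrs :=
    fun a h1 h => by have := p.convShifts_arrs a h; omega
  refine Runs.for_unif (fun a s' => ConvInv f g (m₁ + m₂) (s.reg 99 + a * (β * n)) s' ∧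
    ∀ a' < a, ∀ b < β, ∀ d < n, ConvDone f g n (s'.mem 55) (a' * q) (b * q + d)) α
    (β * (n * ((p.callFactor + 300) * T + 22) + 36)) hB₁ (by omega) ?_ ?_ ?_ ?_ ?_
  · simp only [Program.regs, List.mem_append, List.mem_singleton, not_or, Program.mem_regs_for]
    exact ⟨by decide, by decide, hnr 62 (by omega)⟩
  · intro s' hF'
    have n60 := hnr 60 (by omega)
    have n80 := hnr 80 (by omega)
    simp only [Expr.val_add, Expr.val_div, Expr.val_mul, Expr.val_reg, Expr.val_one]
    rw [hF'.reg 60 (by simp [Program.mem_regs_for, Program.regs, n60]),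
      hF'.reg 80 (by simp [Program.mem_regs_for, Program.regs, n80]), r1 60 (by omega),
      r1 80 (by omega), h60, h80, hα, hqdef]
  · exact ⟨⟨hI₁.lower, hI₁.fresh.of_eq (fun _ _ => rfl) (by simp), by simpa using hI₁.stamp⟩,
      by simp⟩
  · rintro a s₂ ha hB₂ hF₂ h62 ⟨hI₂, hd₂⟩
    have r2 : ∀ z, z < 62 ∨ z = 80 → s₂.reg z = s.reg z := by
      intro z hz
      have := hnr z (by omega)
      rw [hF₂.reg z (by simp [Program.mem_regs_for, Program.regs, this]; omega), r1 z (by omega)]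
    have m2 : ∀ b, b = 53 ∨ b = 54 → s₂.mem b = s.mem b := by
      intro b hb
      have := hna b hb
      rw [hF₂.mem b (by simp [Program.arrs_for, Program.arrs, this]), m1 b (by omega)]
    have e80 : s₂.reg 80 = n := by rw [r2 80 (by omega), h80]
    have hv : (Expr.reg 62 * (.reg 80 * .reg 80)).val s₂ = a * q := by
      simp [e80, h62, hqdef]
    have haq := hxq a ha
    refine Runs.assign_seq hB₂ (by rw [hv]; omega) fun hB₃ => ?_
    rw [hv] at hB₃ ⊢
    refine Runs.for_unif (fun b s' =>
      ConvInv f g (m₁ + m₂) (s.reg 99 + a * (β * n) + b * n) s' ∧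
      (∀ a' < a, ∀ b < β, ∀ d < n, ConvDone f g n (s'.mem 55) (a' * q) (b * q + d)) ∧
      (∀ b' < b, ∀ d < n, ConvDone f g n (s'.mem 55) (a * q) (b' * q + d))) β
      (n * ((p.callFactor + 300) * T + 22)) hB₃ (by omega) ?_ ?_ ?_ ?_ ?_
    · intro h; have := p.convShifts_regs 63 h; omega
    · intro s' hF'
      simp only [Expr.val_add, Expr.val_div, Expr.val_mul, Expr.val_reg, Expr.val_one]
      rw [hF'.reg 61 (by simp [Program.mem_regs_for, hnr 61]),
        hF'.reg 80 (by simp [Program.mem_regs_for, hnr 80])]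
      simp [r2 61, e80, h61, hβ, hqdef]
    · exact ⟨⟨hI₂.lower, hI₂.fresh.of_eq (fun _ _ => rfl) (by simp), by simpa using hI₂.stamp⟩,
        hd₂, by simp⟩
    · rintro b s₃ hb hB₃' hF₃ h63 ⟨hI₃, hd₃, hd₃'⟩
      have hbq := hyq b hb
      have r3 : ∀ z, z < 62 ∨ z = 80 ∨ z = 65 → s₃.reg z = if z = 65 then a * q else s₂.reg z := by
        intro z hz
        rw [hF₃.reg z (by simp [Program.mem_regs_for, hnr z (by omega)]; omega)]
        simp
      have m3 : ∀ b, b = 53 ∨ b = 54 → s₃.mem b = s.mem b := by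
        intro b hb
        rw [hF₃.mem b (by simpa [Program.arrs_for] using hna b hb), State.setReg_mem, m2 b hb]
      refine (Runs.convShifts (x := a * q) (y := b) (E := m₁ + m₂) hp hB₃' hf hg hI₃
        (hγ a ha b hb) (by rw [← hqdef]; omega) (by simp [r3 80, e80]) (by simp [r3 65])
        h63 ?_ ?_).mono ?_
      · intro i hi
        rw [m3 53 (by omega), hX i (by omega)]
      · intro i hi
        rw [← hqdef] at hi
        rw [m3 54 (by omega), hY i (by omega)]
      · rintro s' t - - ⟨h1, h2, h3, h4⟩
        refine ⟨⟨⟨h1.lower, h1.fresh.of_eq (fun _ _ => rfl) (by simp), ?_⟩, ?_, ?_⟩, h4⟩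
        · simp [h1.stamp]; ring
        · exact fun a' ha' b' hb' d hd => (hd₃ a' ha' b' hb' d hd).mono h2
        · intro b' hb' d hd
          rcases Nat.lt_succ_iff_lt_or_eq.mp hb' with h | rfl
          · exact (hd₃' b' h d hd).mono h2
          · rw [hqdef]; rw [hqdef] at h3; exact h3 d hd
    · rintro s₃ t hB₃ hF₃ - ⟨hI₃, hd₃, hd₃'⟩ ht
      refine ⟨⟨⟨hI₃.lower, hI₃.fresh.of_eq (fun _ _ => rfl) (by simp), ?_⟩, ?_⟩, ?_⟩
      · simp [hI₃.stamp]; ring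
      · intro a' ha'
        rcases Nat.lt_succ_iff_lt_or_eq.mp ha' with h | rfl
        · exact hd₃ a' h
        · exact hd₃'
      · simp at ht
        simp
        nlinarith
  · rintro s₂ t hB₂ hF₂ - ⟨hI₂, hd₂⟩ ht
    refine ⟨?_, hI₂.fresh, ?_, ?_⟩
    · intro i hi
      have hle : ∀ j ≤ m₁, ∀ l ≤ m₂, j + l = i → s₂.mem 55 i ≤ f j + g l := by
        rintro j hj l hl rfl
        have hr1 : j % q / n < n := Nat.div_lt_of_lt_mul (by rw [hqdef]; exact Nat.mod_lt _ hq)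
        have hk : j % n < n := Nat.mod_lt _ hn
        have hjq : j / q * q + j % q = j := Nat.div_add_mod' j q
        have hjn : j % q / n * n + j % n = j % q := by
          have := Nat.div_add_mod' (j % q) n
          rwa [hqdef, Nat.mod_mul_right_mod, ← hqdef] at this
        -- The pair (j, l) occurs with inner index k = j % n. A product reads g at y+bn-k, so y+bn
        -- has to be l + k; the residue of this number modulo n is the shift.
        obtain ⟨l', hl'⟩ : ∃ l', l' = l + j % n := ⟨_, rfl⟩
        have hr2 : l' % q / n < n := Nat.div_lt_of_lt_mul (by rw [hqdef]; exact Nat.mod_lt _ hq)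
        have hd : l' % n < n := Nat.mod_lt _ hn
        have hlq : l' / q * q + l' % q = l' := Nat.div_add_mod' l' q
        have hln : l' % q / n * n + l' % n = l' % q := by
          have := Nat.div_add_mod' (l' % q) n
          rwa [hqdef, Nat.mod_mul_right_mod, ← hqdef] at this
        have h1 : j / q < α := by
          have := Nat.div_le_div_right (c := q) hj; omega
        have h2 : l' / q < β := by
          have := Nat.div_le_div_right (c := q) (show l' ≤ m₂ + n by omega); omega
        have := hd₂ _ h1 _ h2 _ hd _ hr1 _ hr2 _ hk
        convert this using 2
        · omega
        · congr 1; omega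
        · congr 1; omega
      -- Membership was not carried along, because of the spurious candidates. It follows now: the
      -- cell is at least the minimum of the candidates, and at most the values of all restricted
      -- pairs, one of which attains that minimum.
      refine hf.isLeast_conv hg hi ?_ hle
      obtain ⟨v, hv, hv'⟩ : ∃ v, v ∈ convSet f g i ∧ ∀ w ∈ convSet f g i, v ≤ w := by
        have hne : (convSet f g i).Nonempty := ⟨_, (hdiag i hi).1⟩
        exact ⟨sInf (convSet f g i), Nat.sInf_mem hne, fun w hw => Nat.sInf_le hw⟩
      have h1 := hI₂.lower i hi v hv'
      obtain ⟨j, hj, rfl⟩ := hv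
      obtain ⟨j', hj', l, hl, he, hle'⟩ := hf.conv_restrict hg hi hj
      have h2 := hle j' hj' l hl he
      exact ⟨j, hj, le_antisymm (h2.trans hle') h1⟩
    · rw [hI₂.stamp]
      exact Nat.add_le_add_left (Nat.mul_le_mul hα2 (Nat.mul_le_mul_right _ hβ2)) _
    · rw [← hqdef]
      have hT := hp.sq_le_time
      rw [← hqdef] at hT hq hnq
      simp at ht
      exact fastConv_time hn hq hT hα0 hβ0 hα1 (by omega) ht₁ ht

/-! ### Square roots -/

/-- Register `80` becomes the integer square root of register `x`. -/
def Program.sqrt (x : ℕ) : Program :=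
  .assign 80 0 ;; .for_ 70 (.reg x)
    (.ite (.op .lt ((.reg 80 + 1) * (.reg 80 + 1)) (.reg x + 1)) (.assign 80 (.reg 80 + 1)) .skip)

theorem Program.sqrt_regs (x : ℕ) : (Program.sqrt x).regs = [80, 70, 80, 70] := rfl
theorem Program.sqrt_arrs (x : ℕ) : (Program.sqrt x).arrs = [] := rfl

/-- After j rounds the register holds the minimum of j and the root. A linear scan is affordable, as
the argument is the length of the string or the parameter r. -/
theorem Runs.sqrt {M : ℕ} {s : State} (hB : Bdd M s) {x : ℕ} (hx : x < 70) :
    Runs M (.sqrt x) s fun s' t => s'.reg 80 = Nat.sqrt (s.reg x) ∧ t ≤ 40 * (s.reg x + 1) := by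
  have hx0 : x ≠ 80 := by omega
  refine Runs.assign_seq hB (by simp) fun hB₁ => ?_
  refine Runs.for_unif (fun j s' => s'.reg 80 = min j (Nat.sqrt (s.reg x))) (s.reg x) 20 hB₁
    (hB.reg x) (by simp [Program.regs]) ?_ (by simp) ?_ ?_
  · intro s' hF
    rw [Expr.val_reg, hF.reg x (by simp [Program.mem_regs_for, Program.regs]; omega)]
    simp [hx0]
  · rintro j s₁ hj hB₁ hF h70 h80
    have hxr : s₁.reg x = s.reg x := by
      rw [hF.reg x (by simp [Program.mem_regs_for, Program.regs]; omega)]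
      simp [hx0]
    have hle := Nat.sqrt_le_self (s.reg x)
    have hB1x := hB.reg x
    refine Runs.ite hB₁ (fun ht => ?_) (fun ht => ?_)
    · have ht' : (s₁.reg 80 + 1) * (s₁.reg 80 + 1) ≤ s.reg x := by
        by_contra h
        simp [hxr, h] at ht
      have h1 := Nat.le_sqrt.mpr ht'
      refine Runs.assign hB₁ (by simp; omega) ⟨?_, by simp⟩
      simp; omega
    · have ht' : ¬ (s₁.reg 80 + 1) * (s₁.reg 80 + 1) ≤ s.reg x := by
        intro h
        simp [hxr, h] at ht
      have h1 : ¬ s₁.reg 80 + 1 ≤ Nat.sqrt (s.reg x) := fun h => ht' (Nat.le_sqrt.mp h)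
      refine Runs.skip hB₁ ⟨?_, by simp⟩
      simp; omega
  · rintro s₁ t hB₁ hF - h80 ht
    refine ⟨?_, ?_⟩
    · rw [h80]; exact min_eq_right (Nat.sqrt_le_self _)
    · simp at ht ⊢; omega

end WordRAM

namespace Jumbled

open WordRAM

/-! ### Strings -/

/-- The number of letters `b` in the prefix of length `i`, if the string is continued by letters
`b`. -/
def prefixCount (T : List Bool) (b : Bool) (i : ℕ) : ℕ := (T.take i).count b + (i - T.length)

/-- The number of letters `b` in the suffix of length `i`, if the string is continued to the left
by letters `b`. -/
def suffixCount (T : List Bool) (b : Bool) (i : ℕ) : ℕ :=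
  prefixCount T b T.length - prefixCount T b (T.length - i) + (i - T.length)

theorem prefixCount_succ (T : List Bool) (b : Bool) (i : ℕ) :
    prefixCount T b (i + 1) = prefixCount T b i +
      if h : i < T.length then (if T[i] = b then 1 else 0) else 1 := by
  unfold prefixCount
  split
  · rename_i h
    rw [List.take_add_one, List.count_append, List.getElem?_eq_getElem h]
    simp [List.count_singleton, Nat.sub_eq_zero_of_le h.le]
    omega
  · rename_i h
    rw [List.take_of_length_le (by omega), List.take_of_length_le (by omega)]
    omega

theorem prefixCount_profile (T : List Bool) (b : Bool) :
    Profile T.length (prefixCount T b) := by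
  refine ⟨fun i => ?_, fun i => ?_, fun t => ?_⟩
  · rw [prefixCount_succ]; omega
  · rw [prefixCount_succ]; split_ifs <;> omega
  · unfold prefixCount
    rw [List.take_of_length_le (by omega), List.take_of_length_le (by omega)]
    omega

theorem suffixCount_profile (T : List Bool) (b : Bool) :
    Profile T.length (suffixCount T b) := by
  have hp := prefixCount_profile T b
  refine ⟨fun i => ?_, fun i => ?_, fun t => ?_⟩
  · unfold suffixCount
    have := hp.mono (show T.length - (i + 1) ≤ T.length - i by omega)
    omega
  · unfold suffixCount
    by_cases h : i < T.length
    · have h1 := hp.lip' (i := T.length - (i + 1)) (j := T.length - i) (t := 1) (by omega)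
      have h2 := hp.mono (show T.length - i ≤ T.length by omega)
      omega
    · have : T.length - (i + 1) = T.length - i := by omega
      rw [this]; omega
  · unfold suffixCount
    have : T.length - (T.length + t) = T.length - T.length := by omega
    rw [this]; omega

theorem prefixCount_infix (T : List Bool) (b : Bool) {i j : ℕ} (h : j + i ≤ T.length) :
    prefixCount T b (j + i) = prefixCount T b j + ((T.drop j).take i).count b := by
  unfold prefixCount
  rw [List.take_add, List.count_append]
  omega

theorem exists_infix_iff (T : List Bool) (b : Bool) (i m : ℕ) :
    (∃ u : List Bool, u <:+: T ∧ u.length = i ∧ u.count b = m) ↔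
      ∃ j, j + i ≤ T.length ∧ prefixCount T b (j + i) = prefixCount T b j + m := by
  constructor
  · rintro ⟨u, ⟨a, c, rfl⟩, rfl, rfl⟩
    refine ⟨a.length, by simp, ?_⟩
    rw [prefixCount_infix _ _ (by simp)]
    simp
  · rintro ⟨j, hj, h⟩
    refine ⟨(T.drop j).take i, ?_, by simp; omega, ?_⟩
    · exact (List.take_prefix _ _).isInfix.trans (List.drop_suffix _ _).isInfix
    · rw [prefixCount_infix _ _ hj] at h; omega

/-- Write P for the prefix counts and N for the length. If a + l = N + i, the suffix of length l
begins at position a - i, so the two counts add up to P(N) + (P(a) - P(a - i)): the total plus the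
count in the window of length i that ends at a. -/
theorem isLeast_infix {T : List Bool} {b : Bool} {i v : ℕ} (hi : i ≤ T.length)
    (h : IsLeast (convSet (prefixCount T b) (suffixCount T b) (T.length + i)) v) :
    IsLeast {m | ∃ u : List Bool, u <:+: T ∧ u.length = i ∧ u.count b = m}
      (v - prefixCount T b T.length) := by
  have hp := prefixCount_profile T b
  have hs := suffixCount_profile T b
  have key : ∀ a ≤ T.length, ∀ l ≤ T.length, a + l = T.length + i →
      i ≤ a ∧ prefixCount T b (a - i) ≤ prefixCount T b a ∧
      prefixCount T b a + suffixCount T b l =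
        prefixCount T b T.length + (prefixCount T b a - prefixCount T b (a - i)) := by
    intro a ha l hl hal
    have h1 : T.length - l = a - i := by omega
    have h2 := hp.mono (show a - i ≤ a by omega)
    have h3 := hp.mono ha
    refine ⟨by omega, h2, ?_⟩
    rw [suffixCount, h1]; omega
  constructor
  · obtain ⟨j, hj, hv⟩ := h.1
    -- An optimal pair may use arguments beyond N, where the string is continued artificially; it is
    -- replaced by a pair that describes an actual window.
    obtain ⟨a, ha, l, hl, hal, hle⟩ := hp.conv_restrict hs (by omega) hj
    have hle' := h.2 ⟨a, by omega, by rw [show T.length + i - a = l by omega]⟩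
    obtain ⟨k1, k2, k3⟩ := key a ha l hl hal
    rw [Set.mem_ofPred_eq, exists_infix_iff]
    refine ⟨a - i, by omega, ?_⟩
    rw [show a - i + i = a by omega]
    omega
  · intro m hm
    rw [Set.mem_ofPred_eq, exists_infix_iff] at hm
    obtain ⟨j, hj, hm⟩ := hm
    obtain ⟨k1, k2, k3⟩ := key (j + i) hj (T.length - j) (by omega) (by omega)
    have := h.2 ⟨j + i, by omega, by rw [show T.length + i - (j + i) = T.length - j by omega]⟩
    rw [show j + i - i = j by omega] at k2 k3
    omega

/-- Convolve the prefix counts and the suffix counts of the string; register `71` tells whether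
ones (`0`) or zeros (`1`) are counted. -/
def stringPass (p : Program) : Program :=
  .sweep 67 53 0 (.reg 0 + 2 * (.reg 80 * .reg 80) + 1)
    (.op .lt 0 (.reg 67) * (.cell 53 (.reg 67 - 1) +
      (.op .lt (.reg 67 - 1) (.reg 0) * ((.cell 0 (.reg 67 - 1) + .reg 71) % 2) +
        (1 - .op .lt (.reg 67 - 1) (.reg 0))))) ;;
  .sweep 67 54 0 (.reg 0 + 2 * (.reg 80 * .reg 80) + .reg 80 * .reg 80 + 1)
    (.cell 53 (.reg 0) - .cell 53 (.reg 0 - .reg 67) + (.reg 67 - .reg 0)) ;;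
  .assign 60 (.reg 0) ;; .assign 61 (.reg 0) ;; p.fastConv

theorem stringPass_regs (p : Program) :
    ∀ x ∈ (stringPass p).regs, (60 ≤ x ∧ x ≤ 67) ∨ 96 ≤ x := by
  intro x hx
  simp only [stringPass, Program.regs, List.mem_append, Program.mem_regs_sweep,
    List.mem_singleton] at hx
  rcases hx with h | h | h | h | h <;> try omega
  have := p.fastConv_regs x h; omega

theorem stringPass_arrs (p : Program) : ∀ a ∈ (stringPass p).arrs, 50 ≤ a := by
  intro x hx
  simp only [stringPass, Program.arrs, List.mem_append, Program.arrs_sweep, List.nil_append,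
    List.mem_singleton] at hx
  rcases hx with h | h | h <;> try omega
  have := p.fastConv_arrs x h; omega

theorem stringPass_runs {p : Program} {n τ M : ℕ} {T : List Bool} {b : Bool} {s : State}
    (hp : CanMultiply p n τ M) (hB : Bdd M s) (hF : Fresh s) (hn : n = Nat.sqrt T.length)
    (h0 : s.reg 0 = T.length) (h80 : s.reg 80 = n) (h71 : s.reg 71 = if b then 0 else 1)
    (hT : ∀ i, s.mem 0 i = (T.getD i false).toNat)
    (h99 : s.reg 99 + (T.length + 1) * ((T.length + n + 1) * n) ≤ M)
    (hM : 8 * T.length + 8 ≤ M) :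
    Runs M (stringPass p) s fun s' t =>
      (∀ i ≤ T.length, IsLeast {m | ∃ u : List Bool, u <:+: T ∧ u.length = i ∧ u.count b = m}
        (s'.mem 55 (T.length + i) - s'.mem 53 T.length)) ∧
      Fresh s' ∧ s'.reg 99 ≤ s.reg 99 + (T.length + 1) * ((T.length + n + 1) * n) ∧
      t ≤ (p.callFactor * 100 + 60000) * (n * τ) := by
  obtain ⟨N, hN⟩ : ∃ N, N = T.length := ⟨_, rfl⟩
  have hn1 := hp.pos
  have hq : n * n ≤ N := by rw [hn, hN]; exact Nat.sqrt_le _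
  have hnq : n ≤ n * n := Nat.le_mul_of_pos_left n hn1
  have hNq : N ≤ 3 * (n * n) := by
    have : N ≤ n * n + n + n := by rw [hn, hN]; exact Nat.sqrt_le_add _
    omega
  have hpp := prefixCount_profile T b
  have hsp := suffixCount_profile T b
  rw [← hN] at hpp hsp h0 h99 hM ⊢
  have hp0 : prefixCount T b 0 = 0 := by simp [prefixCount]
  have hs0 : suffixCount T b 0 = 0 := by simp [suffixCount]
  have hpM : ∀ j, prefixCount T b j ≤ j := by
    intro j; have := hpp.lip 0 j; rw [hp0] at this; simpa using this
  have hsM : ∀ j, suffixCount T b j ≤ j := by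
    intro j; have := hsp.lip 0 j; rw [hs0] at this; simpa using this
  -- Adding register 71 modulo 2 flips the bits when zeros are counted.
  have hbit : ∀ i < N, (s.mem 0 i + s.reg 71) % 2 =
      if h : i < T.length then (if T[i] = b then 1 else 0) else 1 := by
    intro i hi
    rw [hT, h71, dif_pos (hN ▸ hi), List.getD_eq_getElem _ _ (hN ▸ hi)]
    cases T[i]'(hN ▸ hi) <;> cases b <;> simp
  refine Runs.seq (Runs.sweep (Q := fun s' t => s' = _ ∧ t ≤ _) 0 (N + 2 * (n * n) + 1)
    (prefixCount T b) hB (by omega) (by intros; simp [h0, h80]) (by simp) ?_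
    (fun j hj => (hpM j).trans (by omega)) (fun t _ ht => ⟨rfl, ht⟩)) ?_
  · intro j hj
    rcases j with _ | j
    · simp [hp0]
    · rw [prefixCount_succ]
      simp only [Expr.val_mul, Expr.val_add, Expr.val_sub, Expr.val_lt, Expr.val_mod, Expr.val_reg,
        Expr.val_cell, Expr.val_zero, Expr.val_one, Expr.val_two, State.fill_reg, State.fill_mem,
        if_true, Nat.succ_pos, Nat.add_sub_cancel]
      norm_num [h0]
      rw [splice_zero_left _ _ (by omega)]
      congr 1
      by_cases hj' : j < N
      · rw [if_pos hj', if_pos hj', hbit j hj']; simp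
      · rw [if_neg hj', if_neg hj', dif_neg (hN ▸ hj')]
  rintro s₁ t₁ hB₁ - ⟨e₁, ht₁⟩
  have hX₁ : ∀ i ≤ N + 2 * (n * n), s₁.mem 53 i = prefixCount T b i := by
    intro i hi
    rw [e₁, State.fill_mem_same, splice_zero_left _ _ (by omega)]
  refine Runs.seq (Runs.sweep (Q := fun s' t => s' = _ ∧ t ≤ _) 0 (N + 3 * (n * n) + 1)
    (suffixCount T b) hB₁ (by omega) (by intros; simp [e₁, h0, h80]; ring) (by simp) ?_
    (fun j hj => (hsM j).trans (by omega)) (fun t _ ht => ⟨rfl, ht⟩)) ?_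
  · intro j hj
    have e0 : s₁.reg 0 = N := by simp [e₁, h0]
    simp only [Expr.val_add, Expr.val_sub, Expr.val_reg, Expr.val_cell, State.fill_reg,
      State.fill_mem]
    norm_num [e0]
    rw [hX₁ _ (by omega), hX₁ _ (by omega), suffixCount, ← hN]
  rintro s₂ t₂ hB₂ - ⟨e₂, ht₂⟩
  have r2 : ∀ x, x ≠ 67 → s₂.reg x = s.reg x := by intro x hx; simp [e₂, e₁, hx]
  have m2 : ∀ a, a ≠ 53 → a ≠ 54 → s₂.mem a = s.mem a := by
    intro a h h'; simp [e₂, e₁, State.fill_mem, h, h']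
  have hX₂ : ∀ i ≤ N + 2 * (n * n), s₂.mem 53 i = prefixCount T b i := by
    intro i hi; rw [e₂, State.fill_mem_ne _ _ _ _ _ _ (by omega), hX₁ i hi]
  have hY₂ : ∀ i ≤ N + 3 * (n * n), s₂.mem 54 i = suffixCount T b i := by
    intro i hi; rw [e₂, State.fill_mem_same, splice_zero_left _ _ (by omega)]
  refine Runs.assign_seq hB₂ (hB₂.reg 0) fun hB₃ => ?_
  refine Runs.assign_seq hB₃ (hB₃.reg 0) fun hB₄ => ?_
  refine (Runs.fastConv (m₁ := N) (m₂ := N) hp hB₄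
    (hF.of_eq (fun a ha => m2 a (by omega) (by omega)) (by simp [r2])) hpp hsp
    (by simp [r2, h80]) (by simp [r2, h0]) (by simp [r2, h0]) hX₂ hY₂ (by simpa [r2] using h99)
    (by omega) (fun i hi => by rw [hp0]; have := hsM i; omega)).mono ?_
  rintro s₅ t₅ hB₅ hF₅ ⟨h1, h2, h3, h4⟩
  refine ⟨fun i hi => ?_, h2, by simpa [r2] using h3, ?_⟩
  · have e53 : s₅.mem 53 N = prefixCount T b T.length := by
      rw [hF₅.mem 53 fun h => by have := p.fastConv_arrs _ h; omega]
      simpa [hN] using hX₂ N (by omega)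
    rw [e53]
    have := h1 (N + i) (by omega)
    rw [hN] at this ⊢
    exact isLeast_infix (hN ▸ hi) this
  · have hq1 : 1 ≤ n * n := hn1.trans hnq
    have hτ := hp.sq_le_time
    -- Since n² ≤ N ≤ 3n², both block factors are multiples of n² up to constants, and only a
    -- constant times nτ remains after cancelling n⁴.
    have h5 : n * n * (n * n) * t₅ ≤
        n * n * (n * n) * ((p.callFactor + 500) * (20 * (n * τ))) := by
      refine h4.trans ?_
      calc (p.callFactor + 500) * ((N + n * n) * (N + 2 * (n * n)) * (n * τ))
          ≤ (p.callFactor + 500) * ((4 * (n * n)) * (5 * (n * n)) * (n * τ)) := by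
            gcongr <;> omega
        _ = _ := by ring
    have h6 := Nat.le_of_mul_le_mul_left h5 (by positivity)
    have h7 : n * n ≤ n * τ := hτ.trans (Nat.le_mul_of_pos_left _ hn1)
    simp at ht₁ ht₂
    simp
    nlinarith

theorem ComputesMinPlus.canMultiply {p : Program} {time : ℕ → ℝ} (h : ComputesMinPlus p time) :
    ∃ k, ∀ n M, 1 ≤ n → (n + 2) ^ k ≤ M → n * n ≤ M →
      CanMultiply p n ⌊time n⌋₊ M := by
  have ⟨k, hk⟩ := h
  refine ⟨k, fun n M hn hM hM' => ⟨⟨k, hM, fun A B hA hB => ?_⟩, hn, ?_, hM'⟩⟩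
  · obtain ⟨s', t, hex, ht, hout⟩ := hk n A B hn hA hB
    exact ⟨s', t, hex, by exact_mod_cast Nat.le_floor ht, hout⟩
  · exact Nat.le_floor (WordRAM.ComputesMinPlus.sq_le h hn)

/-! ### The algorithm for strings and its time bound -/

/-- The algorithm for binary strings: one pass for the ones and one for the zeros. -/
def stringProgram (p : Program) : Program :=
  .sqrt 0 ;; .assign 71 0 ;; stringPass p ;;
  .sweep 67 1 0 (.reg 0 + 1) (.cell 55 (.reg 0 + .reg 67) - .cell 53 (.reg 0)) ;;
  .assign 71 1 ;; stringPass p ;;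
  .sweep 67 2 0 (.reg 0 + 1) (.reg 67 - (.cell 55 (.reg 0 + .reg 67) - .cell 53 (.reg 0)))

/-- In a window of length i the numbers of zeros and ones add up to i, so few zeros mean many ones.
-/
theorem isGreatest_substringOnes {T : List Bool} {i v : ℕ}
    (h : IsLeast {m | ∃ u : List Bool, u <:+: T ∧ u.length = i ∧ u.count false = m} v) :
    IsGreatest (substringOnes T i) (i - v) := by
  have hc : ∀ u : List Bool, u.count true + u.count false = u.length := by
    intro u
    induction u with
    | nil => rfl
    | cons a u ih => cases a <;> simp <;> omega
  constructor
  · obtain ⟨u, hu, hl, hv⟩ := h.1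
    exact ⟨u, hu, hl, by have := hc u; omega⟩
  · rintro m ⟨u, hu, hl, rfl⟩
    have := h.2 ⟨u, hu, hl, rfl⟩
    have := hc u
    omega

theorem stringProgram_runs {p : Program} {n τ M : ℕ} {T : List Bool}
    (hp : CanMultiply p n τ M) (hn : n = Nat.sqrt T.length)
    (h99 : 2 * ((T.length + 1) * ((T.length + n + 1) * n)) ≤ M) (hM : 8 * T.length + 8 ≤ M) :
    Runs M (stringProgram p) (stringInput T) fun s' t => StringOutput T s' ∧
      t ≤ (p.callFactor * 200 + 130000) * (n * τ) := by
  have hn1 := hp.pos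
  have hB : Bdd M (stringInput T) := by
    refine ⟨by omega, fun x => ?_, fun a i => ?_⟩
    · simp only [stringInput]; split <;> omega
    · simp only [stringInput]; split
      · have := Bool.toNat_le (T.getD i false); omega
      · omega
  have hF : Fresh (stringInput T) := fun a i => by simp [stringInput]
  refine Runs.seq (Runs.sqrt hB (by omega)) ?_
  rintro s₁ t₁ hB₁ hF₁ ⟨h80, ht₁⟩
  have h80₁ : s₁.reg 80 = n := by rw [h80, hn]; rfl
  have r1 : ∀ x, x ≠ 80 → x ≠ 70 → s₁.reg x = if x = 0 then T.length else 0 := by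
    intro x h h'; rw [hF₁.reg x (by simp [Program.sqrt_regs, h, h'])]; rfl
  have m1 : s₁.mem = (stringInput T).mem := by
    funext a; rw [hF₁.mem a (by simp [Program.sqrt_arrs])]
  refine Runs.assign_seq hB₁ (by simp) fun hB₂ => ?_
  refine Runs.seq (stringPass_runs (b := true) hp hB₂
    (hF.of_eq (fun a _ => by simp [m1]) (by simp [r1]; rfl)) hn (by simp [r1]) (by simp [h80₁])
    (by simp) (by intro i; simp [m1, stringInput]) (by simp [r1]; omega) hM) ?_
  rintro s₃ t₃ hB₃ hF₃ ⟨hout₃, hfr₃, h99₃, ht₃⟩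
  have hreg : ∀ x, x < 60 ∨ (67 < x ∧ x < 96) → x ∉ (stringPass p).regs :=
    fun x h h' => by have := stringPass_regs p x h'; omega
  have harr : ∀ x, x < 50 → x ∉ (stringPass p).arrs :=
    fun x h h' => by have := stringPass_arrs p x h'; omega
  have h0₃ : s₃.reg 0 = T.length := by rw [hF₃.reg 0 (hreg 0 (by omega))]; simp [r1]
  have h80₃ : s₃.reg 80 = n := by rw [hF₃.reg 80 (hreg 80 (by omega))]; simp [h80₁]
  have hT₃ : ∀ i, s₃.mem 0 i = (T.getD i false).toNat := by
    intro i; rw [hF₃.mem 0 (harr 0 (by omega))]; simp [m1, stringInput]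
  simp [r1] at h99₃
  refine Runs.seq (Runs.sweep (Q := fun s' t => s' = _ ∧ t ≤ _) 0 (T.length + 1)
    (fun i => s₃.mem 55 (T.length + i) - s₃.mem 53 T.length) hB₃ (by omega)
    (by intros; simp [h0₃]) (by simp) (by intros; simp [h0₃, State.fill_mem])
    (fun j hj => (Nat.sub_le _ _).trans (hB₃.mem _ _)) (fun t _ ht => ⟨rfl, ht⟩)) ?_
  rintro s₄ t₄ hB₄ - ⟨e₄, ht₄⟩
  refine Runs.assign_seq hB₄ (by have := hB₄.two_le; simp; omega) fun hB₅ => ?_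
  refine Runs.seq (stringPass_runs (b := false) hp hB₅
    (hfr₃.of_eq (fun a ha => by simp [e₄]; rw [State.fill_mem_ne _ _ _ _ _ _ (by omega)])
      (by simp [e₄])) hn (by simp [e₄, h0₃]) (by simp [e₄, h80₃])
    (by simp) (by intro i; simp [e₄, State.fill_mem, hT₃]) (by simp [e₄]; omega) hM) ?_
  rintro s₆ t₆ hB₆ hF₆ ⟨hout₆, -, -, ht₆⟩
  have h0₆ : s₆.reg 0 = T.length := by rw [hF₆.reg 0 (hreg 0 (by omega))]; simp [e₄, h0₃]
  refine Runs.sweep 0 (T.length + 1)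
    (fun i => i - (s₆.mem 55 (T.length + i) - s₆.mem 53 T.length)) hB₆ (by omega)
    (by intros; simp [h0₆]) (by simp) (by intros; simp [h0₆, State.fill_mem])
    (fun j hj => (Nat.sub_le _ _).trans (by omega)) ?_
  intro t₇ hB₇ ht₇
  refine ⟨fun i hi hiT => ⟨?_, ?_⟩, ?_⟩
  · rw [State.fill_mem_ne _ _ _ _ _ _ (by omega), hF₆.mem 1 (harr 1 (by omega)),
      State.setReg_mem, e₄, State.fill_mem_same, splice_zero_left _ _ (by omega)]
    exact hout₃ i hiT
  · rw [State.fill_mem_same, splice_zero_left _ _ (by omega)]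
    exact isGreatest_substringOnes (hout₆ i hiT)
  · have hnq : n ≤ n * n := Nat.le_mul_of_pos_left n hn1
    have hNq : T.length ≤ 3 * (n * n) := by
      have : T.length ≤ n * n + n + n := by rw [hn]; exact Nat.sqrt_le_add _
      omega
    have h7 : n * n ≤ n * τ := hp.sq_le_time.trans (Nat.le_mul_of_pos_left _ hn1)
    have e : (stringInput T).reg 0 = T.length := rfl
    rw [e] at ht₁
    simp at ht₄ ht₇
    simp
    nlinarith

theorem exists_solvesStrings {ℓ : ℕ → ℝ} (hℓ : ∀ n : ℕ, 1 ≤ n → 0 < ℓ n) {p : Program} {C : ℝ}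
    (h : ComputesMinPlus p fun n => C * ((n : ℝ) ^ 3 / ℓ n)) :
    ∃ (p : Program) (C : ℝ), SolvesStrings p fun n => C * ((n : ℝ) ^ 2 / ℓ (Nat.sqrt n)) := by
  obtain ⟨k, hk⟩ := h.canMultiply
  -- Stored values are bounded by M = (N+2)^(k+6), which leaves room for the given program and for
  -- the stamps; intermediate values may reach M ^ 64.
  refine ⟨stringProgram p, (p.callFactor * 200 + 130000 : ℕ) * C, (k + 6) * 64, fun T hT => ?_⟩
  obtain ⟨N, hN⟩ : ∃ N, N = T.length := ⟨_, rfl⟩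
  obtain ⟨n, hn⟩ : ∃ n, n = Nat.sqrt N := ⟨_, rfl⟩
  rw [← hN] at hT ⊢
  have hn1 : 1 ≤ n := by rw [hn]; exact Nat.le_sqrt.mpr (by omega)
  have hnN : n ≤ N := by rw [hn]; exact Nat.sqrt_le_self N
  have hnN2 : n * n ≤ N := by rw [hn]; exact Nat.sqrt_le N
  have hpow : ∀ j, j ≤ k + 6 → (N + 2) ^ j ≤ (N + 2) ^ (k + 6) := fun j hj =>
    Nat.pow_le_pow_right (by omega) hj
  have hM1 : (n + 2) ^ k ≤ (N + 2) ^ (k + 6) :=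
    (Nat.pow_le_pow_left (by omega) k).trans (hpow k (by omega))
  have hM2 : n * n ≤ (N + 2) ^ (k + 6) :=
    hnN2.trans ((by omega : N ≤ N + 2).trans ((pow_one (N + 2)).symm.le.trans (hpow 1 (by omega))))
  have hM3 : 8 * N + 8 ≤ (N + 2) ^ (k + 6) := by
    refine le_trans ?_ (hpow 4 (by omega))
    have : 8 ≤ (N + 2) ^ 3 := by calc 8 = 2 ^ 3 := rfl
      _ ≤ (N + 2) ^ 3 := Nat.pow_le_pow_left (by omega) 3
    rw [pow_succ]; nlinarith
  have hM4 : 2 * ((N + 1) * ((N + n + 1) * n)) ≤ (N + 2) ^ (k + 6) := by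
    refine le_trans ?_ (hpow 5 (by omega))
    calc 2 * ((N + 1) * ((N + n + 1) * n)) ≤ (N + 2) * ((N + 2) * (((N + 2) * (N + 2)) * (N + 2))) := by
          gcongr <;> nlinarith
      _ = (N + 2) ^ 5 := by ring
  obtain ⟨s', t, hex, -, hout, ht⟩ := stringProgram_runs (T := T) (hk n _ hn1 hM1 hM2)
    (hN ▸ hn) (hN ▸ hM4) (hN ▸ hM3)
  refine ⟨s', t, by rwa [pow_mul], ?_, hout⟩
  have hℓn := hℓ n hn1
  have hpos : 0 ≤ C * ((n : ℝ) ^ 3 / ℓ n) :=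
    le_trans (by positivity) (WordRAM.ComputesMinPlus.sq_le h hn1)
  have hfl := Nat.floor_le hpos
  -- The sign of C is not assumed. It follows from the lower bound for min-plus products, and is
  -- needed to replace n² by N.
  have hCn : 0 ≤ C / ℓ n := by
    have : 0 < (n : ℝ) ^ 3 := by positivity
    have e : C * ((n : ℝ) ^ 3 / ℓ n) = C / ℓ n * (n : ℝ) ^ 3 := by ring
    rw [e] at hpos
    exact nonneg_of_mul_nonneg_left hpos this
  calc (t : ℝ) ≤ ((p.callFactor * 200 + 130000 : ℕ) : ℝ) *
        (n * ⌊C * ((n : ℝ) ^ 3 / ℓ n)⌋₊) := by exact_mod_cast ht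
    _ ≤ ((p.callFactor * 200 + 130000 : ℕ) : ℝ) * (n * (C * ((n : ℝ) ^ 3 / ℓ n))) := by gcongr
    _ = ((p.callFactor * 200 + 130000 : ℕ) : ℝ) * (C / ℓ n * ((n * n : ℕ) : ℝ) ^ 2) := by
        push_cast; ring
    _ ≤ ((p.callFactor * 200 + 130000 : ℕ) : ℝ) * (C / ℓ n * (N : ℝ) ^ 2) := by gcongr
    _ = _ := by rw [hn]; ring

end Jumbled

open scoped Pointwise

namespace Jumbled

open WordRAM

/-! ### Envelopes of families of pairs (size, number of ones) -/

/-- The least number of ones at index `i`, where each member may be enlarged at cost `1` per unit,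
and shrunk for free. -/
noncomputable def env (𝓟 : Set (ℕ × ℕ)) (i : ℕ) : ℕ := sInf ((fun a => a.2 + (i - a.1)) '' 𝓟)

theorem env_le {𝓟 : Set (ℕ × ℕ)} {a : ℕ × ℕ} (ha : a ∈ 𝓟) (i : ℕ) :
    env 𝓟 i ≤ a.2 + (i - a.1) := Nat.sInf_le ⟨a, ha, rfl⟩

theorem exists_env {𝓟 : Set (ℕ × ℕ)} (h : 𝓟.Nonempty) (i : ℕ) :
    ∃ a ∈ 𝓟, env 𝓟 i = a.2 + (i - a.1) := by
  obtain ⟨a, ha, he⟩ := Nat.sInf_mem (h.image fun a : ℕ × ℕ => a.2 + (i - a.1))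
  exact ⟨a, ha, he.symm⟩

theorem le_env {𝓟 : Set (ℕ × ℕ)} (h : 𝓟.Nonempty) {i v : ℕ}
    (hv : ∀ a ∈ 𝓟, v ≤ a.2 + (i - a.1)) : v ≤ env 𝓟 i := by
  obtain ⟨a, ha, he⟩ := exists_env h i
  rw [he]; exact hv a ha

theorem env_anti {𝓟 𝓠 : Set (ℕ × ℕ)} (h : 𝓟.Nonempty) (hs : 𝓟 ⊆ 𝓠) (i : ℕ) :
    env 𝓠 i ≤ env 𝓟 i := le_env h fun _ ha => env_le (hs ha) i

theorem env_fst_le {𝓟 : Set (ℕ × ℕ)} {a : ℕ × ℕ} (ha : a ∈ 𝓟) : env 𝓟 a.1 ≤ a.2 := by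
  simpa using env_le ha a.1

theorem env_profile {𝓟 : Set (ℕ × ℕ)} (h : 𝓟.Nonempty) {m : ℕ} (hm : ∀ a ∈ 𝓟, a.1 ≤ m) :
    Profile m (env 𝓟) := by
  refine ⟨fun i => le_env h fun a ha => (env_le ha i).trans (by omega), fun i => ?_, fun t => ?_⟩
  · obtain ⟨a, ha, he⟩ := exists_env h i
    exact (env_le ha (i + 1)).trans (by omega)
  · apply le_antisymm
    · obtain ⟨a, ha, he⟩ := exists_env h m
      exact (env_le ha (m + t)).trans (by omega)
    · refine le_env h fun a ha => ?_
      have := hm a ha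
      have := env_le ha m
      omega

theorem env_union {𝓟 𝓠 : Set (ℕ × ℕ)} (h : 𝓟.Nonempty) (h' : 𝓠.Nonempty) (i : ℕ) :
    env (𝓟 ∪ 𝓠) i = min (env 𝓟 i) (env 𝓠 i) := by
  apply le_antisymm
  · exact le_min (env_anti h Set.subset_union_left i) (env_anti h' Set.subset_union_right i)
  · refine le_env (h.mono Set.subset_union_left) fun a ha => ?_
    rcases ha with ha | ha
    · exact (min_le_left _ _).trans (env_le ha i)
    · exact (min_le_right _ _).trans (env_le ha i)

/-- Combining members a and b, the excess of i over the joint size is at most the sum of the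
separate excesses, so no candidate is below the envelope of the sum. Equality needs a split of i
that creates no avoidable excess on either side. -/
theorem isLeast_env_add {𝓟 𝓠 : Set (ℕ × ℕ)} (h : 𝓟.Nonempty) (h' : 𝓠.Nonempty) (i : ℕ) :
    IsLeast (convSet (env 𝓟) (env 𝓠) i) (env (𝓟 + 𝓠) i) := by
  have hle : ∀ w ∈ convSet (env 𝓟) (env 𝓠) i, env (𝓟 + 𝓠) i ≤ w := by
    rintro _ ⟨j, hj, rfl⟩
    obtain ⟨a, ha, he⟩ := exists_env h j
    obtain ⟨b, hb, he'⟩ := exists_env h' (i - j)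
    refine (env_le (Set.add_mem_add ha hb) i).trans ?_
    rw [he, he', Prod.fst_add, Prod.snd_add]
    omega
  refine ⟨?_, hle⟩
  obtain ⟨c, ⟨a, ha, b, hb, rfl⟩, he⟩ := exists_env (h.add h') i
  have key : ∀ j ≤ i, env 𝓟 j + env 𝓠 (i - j) ≤ env (𝓟 + 𝓠) i → env (𝓟 + 𝓠) i ∈
      convSet (env 𝓟) (env 𝓠) i := fun j hj hj' =>
    ⟨j, hj, le_antisymm (hle _ ⟨j, hj, rfl⟩) hj'⟩
  simp only [Prod.fst_add, Prod.snd_add] at he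
  -- If i is at most the joint size, splitting at the minimum of a.1 and i makes both excesses
  -- vanish. Otherwise b receives exactly b.1, and all of the excess falls to a.
  by_cases hab : i ≤ a.1 + b.1
  · refine key (min a.1 i) (min_le_right _ _) ?_
    have h1 := env_le ha (min a.1 i)
    have h2 := env_le hb (i - min a.1 i)
    omega
  · refine key (i - b.1) (by omega) ?_
    have h1 := env_le ha (i - b.1)
    have h2 := env_le hb (i - (i - b.1))
    omega

theorem env_singleton (a : ℕ × ℕ) (i : ℕ) : env {a} i = a.2 + (i - a.1) := by
  simp [env]

theorem env_add_one {𝓟 : Set (ℕ × ℕ)} (h : 𝓟.Nonempty) (w i : ℕ) :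
    env ({(1, w)} + 𝓟) i = w + env 𝓟 (i - 1) := by
  apply le_antisymm
  · obtain ⟨a, ha, he⟩ := exists_env h (i - 1)
    have := env_le (Set.add_mem_add (Set.mem_singleton (1, w)) ha) i
    simp only [Prod.fst_add, Prod.snd_add] at this
    omega
  · refine le_env ((Set.singleton_nonempty _).add h) ?_
    rintro _ ⟨b, hb, a, ha, rfl⟩
    rw [Set.mem_singleton_iff] at hb
    subst hb
    have := env_le ha (i - 1)
    simp only [Prod.fst_add, Prod.snd_add]
    omega

/-- The optional extension by one more node with `w` ones. -/
def optional (w : ℕ) (𝓟 : Set (ℕ × ℕ)) : Set (ℕ × ℕ) := {0} ∪ ({(1, w)} + 𝓟)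

theorem zero_mem_optional (w : ℕ) (𝓟 : Set (ℕ × ℕ)) : (0 : ℕ × ℕ) ∈ optional w 𝓟 :=
  .inl rfl

theorem env_zero_mem {𝓟 : Set (ℕ × ℕ)} (h : (0 : ℕ × ℕ) ∈ 𝓟) (i : ℕ) : env 𝓟 i ≤ i := by
  simpa using env_le h i

/-- For i ≥ 1 the empty choice costs i, which the extended family also achieves, because it extends
the empty member at cost w ≤ 1 and then grows. So the option of leaving the node out matters only at
index 0. -/
theorem env_optional {𝓟 : Set (ℕ × ℕ)} (h : (0 : ℕ × ℕ) ∈ 𝓟) {w : ℕ} (hw : w ≤ 1) (i : ℕ) :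
    env (optional w 𝓟) i = if i = 0 then 0 else w + env 𝓟 (i - 1) := by
  have hne : 𝓟.Nonempty := ⟨0, h⟩
  rw [optional, env_union (Set.singleton_nonempty _) ((Set.singleton_nonempty _).add hne),
    env_singleton, env_add_one hne]
  have := env_zero_mem h (i - 1)
  simp only [Prod.fst_zero, Prod.snd_zero]
  split <;> omega

/-- Members of the family have at most as many ones as nodes. -/
def Tame (𝓟 : Set (ℕ × ℕ)) : Prop := ∀ a ∈ 𝓟, a.2 ≤ a.1

theorem Tame.add {𝓟 𝓠 : Set (ℕ × ℕ)} (h : Tame 𝓟) (h' : Tame 𝓠) : Tame (𝓟 + 𝓠) := by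
  rintro _ ⟨a, ha, b, hb, rfl⟩
  have := h a ha
  have := h' b hb
  simp only [Prod.fst_add, Prod.snd_add]; omega

theorem Tame.union {𝓟 𝓠 : Set (ℕ × ℕ)} (h : Tame 𝓟) (h' : Tame 𝓠) : Tame (𝓟 ∪ 𝓠) :=
  fun a ha => ha.elim (h a) (h' a)

theorem tame_one {w : ℕ} (hw : w ≤ 1) : Tame {(1, w)} := by
  rintro a rfl; exact hw

theorem tame_zero : Tame {0} := by rintro a rfl; exact le_rfl

theorem Tame.optional {𝓟 : Set (ℕ × ℕ)} (h : Tame 𝓟) {w : ℕ} (hw : w ≤ 1) :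
    Tame (optional w 𝓟) := tame_zero.union ((tame_one hw).add h)

def SizeLE (m : ℕ) (𝓟 : Set (ℕ × ℕ)) : Prop := ∀ a ∈ 𝓟, a.1 ≤ m

theorem SizeLE.add {m m' : ℕ} {𝓟 𝓠 : Set (ℕ × ℕ)} (h : SizeLE m 𝓟) (h' : SizeLE m' 𝓠) :
    SizeLE (m + m') (𝓟 + 𝓠) := by
  rintro _ ⟨a, ha, b, hb, rfl⟩
  have := h a ha
  have := h' b hb
  simp only [Prod.fst_add]; omega

theorem SizeLE.union {m : ℕ} {𝓟 𝓠 : Set (ℕ × ℕ)} (h : SizeLE m 𝓟) (h' : SizeLE m 𝓠) :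
    SizeLE m (𝓟 ∪ 𝓠) := fun a ha => ha.elim (h a) (h' a)

theorem SizeLE.mono {m m' : ℕ} {𝓟 : Set (ℕ × ℕ)} (h : SizeLE m 𝓟) (hm : m ≤ m') :
    SizeLE m' 𝓟 := fun a ha => (h a ha).trans hm

theorem SizeLE.one_add {m : ℕ} {𝓟 : Set (ℕ × ℕ)} (h : SizeLE m 𝓟) (w : ℕ) :
    SizeLE (m + 1) ({(1, w)} + 𝓟) := by
  rintro _ ⟨a, ha, b, hb, rfl⟩
  have := h b hb
  rw [Set.mem_singleton_iff] at ha
  subst ha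
  simp only [Prod.fst_add]; omega

theorem SizeLE.optional {m : ℕ} {𝓟 : Set (ℕ × ℕ)} (h : SizeLE m 𝓟) (w : ℕ) :
    SizeLE (m + 1) (optional w 𝓟) := by
  refine SizeLE.union ?_ (h.one_add w)
  rintro a rfl; simp

/-! ### Rows of arrays that hold envelopes -/

/-- The cells of `A` from `off` on, up to index `cap`, hold the envelope of `𝓟`. -/
structure Row (n : ℕ) (A : ℕ → ℕ) (off cap : ℕ) (𝓟 : Set (ℕ × ℕ)) : Prop where
  nonempty : 𝓟.Nonempty
  size_le : SizeLE cap 𝓟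
  low : ∃ a ∈ 𝓟, a.2 ≤ n
  val : ∀ i ≤ cap, A (off + i) = env 𝓟 i

theorem Row.profile {n off cap : ℕ} {A : ℕ → ℕ} {𝓟 : Set (ℕ × ℕ)} (h : Row n A off cap 𝓟) :
    Profile cap (env 𝓟) := env_profile h.nonempty h.size_le

/-- One member with at most n ones is enough to keep all entries within a word. The condition also
admits rows whose only member is the dummy pair (0, n). -/
theorem Row.env_le {n off cap : ℕ} {A : ℕ → ℕ} {𝓟 : Set (ℕ × ℕ)} (h : Row n A off cap 𝓟)
    (i : ℕ) : env 𝓟 i ≤ n + i := by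
  obtain ⟨a, ha, hn⟩ := h.low
  exact (Jumbled.env_le ha i).trans (by omega)

theorem Row.congr {n off cap : ℕ} {A A' : ℕ → ℕ} {𝓟 : Set (ℕ × ℕ)} (h : Row n A off cap 𝓟)
    (hA : ∀ i ≤ cap, A' (off + i) = A (off + i)) : Row n A' off cap 𝓟 :=
  ⟨h.nonempty, h.size_le, h.low, fun i hi => (hA i hi).trans (h.val i hi)⟩

theorem low_of_tame {n cap : ℕ} {𝓟 : Set (ℕ × ℕ)} (h : 𝓟.Nonempty) (ht : Tame 𝓟)
    (hs : SizeLE cap 𝓟) (hn : cap ≤ n) : ∃ a ∈ 𝓟, a.2 ≤ n := by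
  obtain ⟨a, ha⟩ := h
  exact ⟨a, ha, (ht a ha).trans ((hs a ha).trans hn)⟩

theorem splice_other_row (A : ℕ → ℕ) {n v id i j : ℕ} (g : ℕ → ℕ) (h : id ≠ v) (hi : i ≤ n)
    (hj : j ≤ n + 1) : splice A (v * (n + 1)) j g (id * (n + 1) + i) = A (id * (n + 1) + i) := by
  rcases lt_or_gt_of_ne h with h | h
  · apply splice_of_lt
    calc id * (n + 1) + i < id * (n + 1) + (n + 1) := by omega
      _ = (id + 1) * (n + 1) := by ring
      _ ≤ v * (n + 1) := Nat.mul_le_mul_right _ h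
  · apply splice_of_ge
    calc v * (n + 1) + j ≤ v * (n + 1) + (n + 1) := by omega
      _ = (v + 1) * (n + 1) := by ring
      _ ≤ id * (n + 1) := Nat.mul_le_mul_right _ h
      _ ≤ _ := Nat.le_add_right _ _

/-- The value at index `i` (in register `67`), or at `i - 1`, of a row, continued beyond the capacity
of the row, plus a constant. -/
def ldExpr (src off cap w : ℕ) (sh : Bool) : Expr :=
  .reg w + (.cell src (.reg off + (.reg 67 - .const sh.toNat -
      (.reg 67 - .const sh.toNat - .reg cap))) +
    (.reg 67 - .const sh.toNat - .reg cap))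

theorem ldExpr_val {n cap soff i w : ℕ} {s : State} {src rs rc rw : ℕ} {sh : Bool}
    {𝓟 : Set (ℕ × ℕ)} (h : Row n (s.mem src) soff cap 𝓟) (h67 : s.reg 67 = i)
    (hrs : s.reg rs = soff) (hrc : s.reg rc = cap) (hrw : s.reg rw = w) :
    (ldExpr src rs rc rw sh).val s = w + env 𝓟 (i - sh.toNat) := by
  simp only [ldExpr, Expr.val_add, Expr.val_sub, Expr.val_cell, Expr.val_reg, Expr.val_const, h67,
    hrs, hrc, hrw]
  rw [h.val _ (by omega), h.profile.ext_eq]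

/-- Copy a row. -/
def load (dst rd src rs rc rw : ℕ) (sh : Bool) (cnt : Expr) : Program :=
  .sweep 67 dst (.reg rd) cnt (ldExpr src rs rc rw sh)

/-- Replace the entries of a row by the minima with the entries of another row. -/
def relaxRow (dst rd src rs rc rw : ℕ) (sh : Bool) (cnt : Expr) : Program :=
  .sweep 67 dst (.reg rd) cnt
    (.cell dst (.reg rd + .reg 67) - (.cell dst (.reg rd + .reg 67) - ldExpr src rs rc rw sh))

theorem load_regs {dst rd src rs rc rw : ℕ} {sh : Bool} {cnt : Expr} :
    (load dst rd src rs rc rw sh cnt).regs = [67, 67] := rfl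
theorem load_arrs {dst rd src rs rc rw : ℕ} {sh : Bool} {cnt : Expr} :
    (load dst rd src rs rc rw sh cnt).arrs = [dst] := rfl
theorem relaxRow_regs {dst rd src rs rc rw : ℕ} {sh : Bool} {cnt : Expr} :
    (relaxRow dst rd src rs rc rw sh cnt).regs = [67, 67] := rfl
theorem relaxRow_arrs {dst rd src rs rc rw : ℕ} {sh : Bool} {cnt : Expr} :
    (relaxRow dst rd src rs rc rw sh cnt).arrs = [dst] := rfl

/-- Source and destination may lie in the same array if they are different rows, which is what
`halias` demands. -/
theorem load_runs {n M N cap soff doff w dst rd src rs rc rw : ℕ} {s : State} {sh : Bool}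
    {cnt : Expr} {𝓟 : Set (ℕ × ℕ)} {Q : State → ℕ → Prop} (hB : Bdd M s)
    (h : Row n (s.mem src) soff cap 𝓟) (hrd : s.reg rd = doff) (hrs : s.reg rs = soff)
    (hrc : s.reg rc = cap) (hrw : s.reg rw = w)
    (hcnt : ∀ j g, cnt.val (s.fill 67 dst doff j g) = N) (hM : w + n + N ≤ M)
    (halias : src = dst → cap ≤ n ∧ N ≤ n + 1 ∧
      ∃ id v, id ≠ v ∧ soff = id * (n + 1) ∧ doff = v * (n + 1))
    (hQ : ∀ t, Bdd M (s.fill 67 dst doff N fun i => w + env 𝓟 (i - sh.toNat)) →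
      t ≤ 100 * (N + 1) → Q (s.fill 67 dst doff N fun i => w + env 𝓟 (i - sh.toNat)) t)
    (hne : rd ≠ 67 ∧ rs ≠ 67 ∧ rc ≠ 67 ∧ rw ≠ 67 := by decide)
    (hcc : cnt.cost ≤ 20 := by decide)
    (hsm : (Expr.op .lt (.reg 67) cnt).small = true := by rfl) :
    Runs M (load dst rd src rs rc rw sh cnt) s Q := by
  refine Runs.sweep doff N (fun i => w + env 𝓟 (i - sh.toNat)) hB (by omega) (fun j _ => hcnt j _)
    (by intros; simp [hne, hrd]) ?_ ?_ ?_ (by rfl) (by cases sh <;> rfl) hsm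
  · intro j hj
    refine ldExpr_val (n := n) (soff := soff) (cap := cap) ?_ (by simp) (by simp [hne, hrs])
      (by simp [hne, hrc]) (by simp [hne, hrw])
    rw [State.fill_mem]
    split
    · rename_i e
      obtain ⟨h1, h2, id, v, hid, rfl, rfl⟩ := halias e
      subst e
      exact h.congr fun i hi => splice_other_row _ _ hid (by omega) (by omega)
    · exact h
  · intro j hj
    have := h.env_le (j - sh.toNat)
    omega
  · intro t hB' ht
    refine hQ t hB' (ht.trans ?_)
    simp only [ldExpr, Expr.cost_reg, Expr.cost_add, Expr.cost_cell, Expr.cost_sub, Expr.cost_const]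
    nlinarith

/-- With truncated subtraction a - (a - b) is the minimum of a and b, so the update needs no branch.
-/
theorem relaxRow_runs {n M N cap soff doff w dst rd src rs rc rw : ℕ} {s : State} {sh : Bool}
    {cnt : Expr} {𝓟 : Set (ℕ × ℕ)} {Q : State → ℕ → Prop} (hB : Bdd M s)
    (h : Row n (s.mem src) soff cap 𝓟) (hrd : s.reg rd = doff) (hrs : s.reg rs = soff)
    (hrc : s.reg rc = cap) (hrw : s.reg rw = w)
    (hcnt : ∀ j g, cnt.val (s.fill 67 dst doff j g) = N) (hM : N ≤ M) (hsd : src ≠ dst)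
    (hQ : ∀ t, Bdd M (s.fill 67 dst doff N fun i =>
        min (s.mem dst (doff + i)) (w + env 𝓟 (i - sh.toNat))) →
      t ≤ 100 * (N + 1) → Q (s.fill 67 dst doff N fun i =>
        min (s.mem dst (doff + i)) (w + env 𝓟 (i - sh.toNat))) t)
    (hne : rd ≠ 67 ∧ rs ≠ 67 ∧ rc ≠ 67 ∧ rw ≠ 67 := by decide)
    (hcc : cnt.cost ≤ 20 := by decide)
    (hsm : (Expr.op .lt (.reg 67) cnt).small = true := by rfl) :
    Runs M (relaxRow dst rd src rs rc rw sh cnt) s Q := by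
  refine Runs.sweep doff N (fun i => min (s.mem dst (doff + i)) (w + env 𝓟 (i - sh.toNat))) hB hM
    (fun j _ => hcnt j _) (by intros; simp [hne, hrd]) ?_ ?_ ?_ (by rfl) (by cases sh <;> rfl) hsm
  · intro j hj
    have e := ldExpr_val (n := n) (soff := soff) (cap := cap) (i := j) (w := w) (src := src)
      (s := s.fill 67 dst doff j fun i => min (s.mem dst (doff + i)) (w + env 𝓟 (i - sh.toNat)))
      (rs := rs) (rc := rc) (rw := rw) (sh := sh)
      (by rw [State.fill_mem_ne _ _ _ _ _ _ hsd]; exact h) (by simp) (by simp [hne, hrs])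
      (by simp [hne, hrc]) (by simp [hne, hrw])
    simp only [Expr.val_sub, Expr.val_cell, e, Expr.val_add, Expr.val_reg, State.fill_reg,
      State.fill_mem_same, hne, hrd, if_true, if_false]
    rw [splice_of_ge _ _ (by omega)]
    omega
  · intro j hj
    exact (min_le_left _ _).trans (hB.mem _ _)
  · intro t hB' ht
    refine hQ t hB' (ht.trans ?_)
    simp only [ldExpr, Expr.cost_reg, Expr.cost_add, Expr.cost_cell, Expr.cost_sub, Expr.cost_const]
    nlinarith

/-! ### The array of answers -/

/-- No entry of `G` is below the envelope. -/
def Sound (n : ℕ) (𝓐 : Set (ℕ × ℕ)) (G : ℕ → ℕ) : Prop := ∀ i ≤ n, env 𝓐 i ≤ G i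

/-- The pairs that are accounted for in `G`. -/
def done (G : ℕ → ℕ) : Set (ℕ × ℕ) := {a | G a.1 ≤ a.2}

theorem done_mono {G G' : ℕ → ℕ} (h : ∀ i, G' i ≤ G i) : done G ⊆ done G' :=
  fun _ ha => (h _).trans ha

/-- `G'` accounts for the members of `𝓧`, too. -/
structure Improved (n : ℕ) (𝓐 𝓧 : Set (ℕ × ℕ)) (G G' : ℕ → ℕ) : Prop where
  le : ∀ i, G' i ≤ G i
  sound : Sound n 𝓐 G → 𝓧 ⊆ 𝓐 → Sound n 𝓐 G'
  done : 𝓧 ⊆ done G'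

theorem Improved.trans {n : ℕ} {𝓐 𝓧 𝓨 : Set (ℕ × ℕ)} {G G' G'' : ℕ → ℕ}
    (h : Improved n 𝓐 𝓧 G G') (h' : Improved n 𝓐 𝓨 G' G'') : Improved n 𝓐 (𝓧 ∪ 𝓨) G G'' :=
  ⟨fun i => (h'.le i).trans (h.le i),
    fun hs hx => h'.sound (h.sound hs (Set.subset_union_left.trans hx))
      (Set.subset_union_right.trans hx),
    Set.union_subset (h.done.trans (done_mono h'.le)) h'.done⟩

theorem improved_splice {n N : ℕ} {𝓐 𝓧 : Set (ℕ × ℕ)} {G : ℕ → ℕ} (h : 𝓧.Nonempty)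
    (hs : SizeLE N 𝓧) :
    Improved n 𝓐 𝓧 G (splice G 0 (N + 1) fun i => min (G i) (env 𝓧 i)) := by
  refine ⟨fun i => ?_, fun hG hX i hi => ?_, fun a ha => ?_⟩
  · simp only [splice]; split
    · exact min_le_left _ _
    · exact le_rfl
  · simp only [splice]; split
    · exact le_min (hG i hi) (env_anti h hX i)
    · exact hG i hi
  · have := hs a ha
    simp only [done, Set.mem_ofPred_eq]
    rw [splice_zero_left _ _ (by omega)]
    exact (min_le_right _ _).trans (env_fst_le ha)

/-! ### Products of rows -/

/-- The extension of the members of a family by one more node with `w` ones, optional if `z`. -/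
def extend (z : Bool) (w : ℕ) (𝓧 : Set (ℕ × ℕ)) : Set (ℕ × ℕ) :=
  bif z then optional w 𝓧 else {(1, w)} + 𝓧

theorem extend_nonempty {z : Bool} {w : ℕ} {𝓧 : Set (ℕ × ℕ)} (h : 𝓧.Nonempty) :
    (extend z w 𝓧).Nonempty := by
  cases z
  · exact (Set.singleton_nonempty _).add h
  · exact ⟨0, zero_mem_optional _ _⟩

theorem SizeLE.extend {m : ℕ} {𝓧 : Set (ℕ × ℕ)} (h : SizeLE m 𝓧) (z : Bool) (w : ℕ) :
    SizeLE (m + 1) (extend z w 𝓧) := by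
  cases z
  · exact h.one_add w
  · exact h.optional w

theorem Tame.extend {𝓧 : Set (ℕ × ℕ)} (h : Tame 𝓧) {w : ℕ} (hw : w ≤ 1) (z : Bool) :
    Tame (extend z w 𝓧) := by
  cases z
  · exact (tame_one hw).add h
  · exact h.optional hw

theorem env_extend {𝓧 : Set (ℕ × ℕ)} {z : Bool} (hne : 𝓧.Nonempty) (h : z = true → (0 : ℕ × ℕ) ∈ 𝓧)
    {w : ℕ} (hw : w ≤ 1) (i : ℕ) :
    env (extend z w 𝓧) i = if z = true ∧ i = 0 then 0 else w + env 𝓧 (i - 1) := by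
  cases z
  · simpa [extend] using env_add_one hne w i
  · simp [extend, env_optional (h rfl) hw]

/-- Row `v` of `dst` becomes the convolution of the extension of row `c` of `aX` and row `s`
of `aY`. -/
def mulRow (aX aY dst : ℕ) (z : Bool) : Program :=
  load 53 9 aX 37 34 33 true (.reg 34 + 2) ;;
  (bif z then .store 53 0 0 else .skip) ;;
  load 54 9 aY 38 35 9 false (.reg 35 + 1) ;;
  .assign 60 (.reg 34 + 1) ;; .assign 61 (.reg 35) ;; .slowConv ;;
  load dst 36 55 9 39 9 false (.reg 39 + 1)

theorem mulRow_regs {aX aY dst : ℕ} {z : Bool} : ∀ x ∈ (mulRow aX aY dst z).regs, 60 ≤ x ∧ x ≤ 67 := by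
  intro x hx
  cases z <;> simp [mulRow, Program.regs, load_regs, Program.slowConv, Program.convInit,
    Program.mem_regs_for, Program.relax, Program.mem_regs_sweep] at hx <;> omega

theorem mulRow_arrs {aX aY dst : ℕ} {z : Bool} :
    ∀ a ∈ (mulRow aX aY dst z).arrs, a = dst ∨ (53 ≤ a ∧ a ≤ 55) := by
  intro a ha
  cases z <;> simp [mulRow, Program.arrs, load_arrs, Program.slowConv, Program.convInit,
    Program.arrs_for, Program.relax, Program.arrs_sweep] at ha <;> omega

theorem mulRow_runs {n M pc ps ov ox oy w aX aY dst : ℕ} {z : Bool} {s : State}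
    {𝓧 𝓨 : Set (ℕ × ℕ)} (hB : Bdd M s) (hX : Row n (s.mem aX) ox pc 𝓧)
    (hY : Row n (s.mem aY) oy ps 𝓨) (h9 : s.reg 9 = 0) (h33 : s.reg 33 = w)
    (h34 : s.reg 34 = pc) (h35 : s.reg 35 = ps) (h36 : s.reg 36 = ov) (h37 : s.reg 37 = ox)
    (h38 : s.reg 38 = oy) (h39 : s.reg 39 = pc + 1 + ps) (hw : w ≤ 1)
    (hz : z = true → (0 : ℕ × ℕ) ∈ 𝓧) (hlow : ∃ a ∈ extend z w 𝓧 + 𝓨, a.2 ≤ n)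
    (hn : pc + 1 + ps ≤ n) (hM : 8 * n + 8 ≤ M)
    (hd : aX ≠ 53 ∧ aY ≠ 53 ∧ aY ≠ 54 ∧ dst ≠ 53 ∧ dst ≠ 54 ∧ dst ≠ 55 := by decide) :
    Runs M (mulRow aX aY dst z) s fun s' t =>
      s'.mem dst = splice (s.mem dst) ov (pc + 1 + ps + 1) (env (extend z w 𝓧 + 𝓨)) ∧
      t ≤ 2000 * ((pc + 2) * (ps + 1)) := by
  have hXe := env_extend hX.nonempty hz hw
  have hXp := env_profile (extend_nonempty (z := z) (w := w) hX.nonempty) (hX.size_le.extend z w)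
  refine Runs.seq (load_runs (Q := fun s' t => s' = _ ∧ t ≤ _) (N := pc + 2) hB hX h9 h37 h34 h33
    (by intros; simp [h34]) (by omega) (by omega) (fun t _ ht => ⟨rfl, ht⟩)) ?_
  rintro s₁ t₁ hB₁ - ⟨e₁, ht₁⟩
  -- The row loaded is the envelope for a mandatory new node. If the node is optional, overwriting
  -- cell 0 by 0 is the only change, by `env_optional`.
  refine Runs.seq (Q₁ := fun s' t => (s'.reg = s₁.reg ∧ (∀ a, a ≠ 53 → s'.mem a = s.mem a) ∧
      ∀ i ≤ pc + 1, s'.mem 53 i = env (extend z w 𝓧) i) ∧ t ≤ 3) ?_ ?_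
  · clear hXp
    have h53 : ∀ i ≤ pc + 1, s₁.mem 53 i = w + env 𝓧 (i - 1) := by
      intro i hi; rw [e₁, State.fill_mem_same, splice_zero_left _ _ (by omega)]; rfl
    cases z
    · refine Runs.skip hB₁ ⟨⟨rfl, fun a ha => by rw [e₁, State.fill_mem_ne _ _ _ _ _ _ ha], ?_⟩,
        by omega⟩
      intro i hi; rw [h53 i hi, hXe]; simp
    · refine Runs.store hB₁ (by simp) ⟨⟨rfl, fun a ha => ?_, ?_⟩, by simp⟩
      · rw [State.setMem_mem_ne _ _ _ ha, e₁, State.fill_mem_ne _ _ _ _ _ _ ha]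
      · intro i hi
        rw [hXe, State.setMem_mem_same, Function.update_apply, h53 i hi]
        simp only [Expr.val_zero, true_and]
        congr
  rintro s₂ t₂ hB₂ - ⟨⟨r₂, m₂, h53₂⟩, ht₂⟩
  have r2 : ∀ x, x ≠ 67 → s₂.reg x = s.reg x := by intro x hx; simp [r₂, e₁, hx]
  refine Runs.seq (load_runs (Q := fun s' t => s' = _ ∧ t ≤ _) (doff := 0) (soff := oy)
    (cap := ps) (w := 0) (N := ps + 1) hB₂
    (by rw [m₂ _ hd.2.1]; exact hY) (by rw [r2 _ (by decide)]; exact h9)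
    (by rw [r2 _ (by decide)]; exact h38) (by rw [r2 _ (by decide)]; exact h35)
    (by rw [r2 _ (by decide)]; exact h9) (by intros; simp [r2, h35]) (by omega) (by omega)
    (fun t _ ht => ⟨rfl, ht⟩)) ?_
  rintro s₃ t₃ hB₃ - ⟨e₃, ht₃⟩
  have r3 : ∀ x, x ≠ 67 → s₃.reg x = s.reg x := by intro x hx; simp [e₃, hx, r2]
  have m3 : ∀ a, a ≠ 53 → a ≠ 54 → s₃.mem a = s.mem a := by
    intro a h h'; rw [e₃, State.fill_mem_ne _ _ _ _ _ _ h', m₂ a h]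
  refine Runs.assign_seq hB₃ (by simp [r3, h34]; omega) fun hB₄ => ?_
  refine Runs.assign_seq hB₄ (by simp [r3, h35]; omega) fun hB₅ => ?_
  have hX0 : env (extend z w 𝓧) 0 ≤ n + 1 := by
    rw [hXe]; have := hX.env_le (0 - 1); split <;> omega
  refine Runs.seq (Runs.slowConv (f := env (extend z w 𝓧)) (g := env 𝓨) (m₁ := pc + 1) (m₂ := ps)
    hB₅ hXp hY.profile (by simp [r3, h34]) (by simp [r3, h35])
    (by
      intro i hi
      simp only [State.setReg_mem, e₃]
      rw [State.fill_mem_ne _ _ _ _ _ _ (by decide), h53₂ i hi])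
    (by
      intro i hi
      simp only [State.setReg_mem, e₃]
      rw [State.fill_mem_same, splice_zero_left _ _ (by omega)]; simp)
    (by omega) (by intro i hi; have := hY.env_le i; omega)) ?_
  rintro s₆ t₆ hB₆ hF₆ ⟨h55, ht₆⟩
  have r6 : ∀ x, x < 60 → s₆.reg x = s.reg x := by
    intro x hx
    rw [hF₆.reg x (by simp [Program.slowConv, Program.regs, Program.convInit,
      Program.mem_regs_for, Program.relax, Program.mem_regs_sweep]; omega)]
    simp; rw [if_neg (by omega), if_neg (by omega), r3 x (by omega)]
  have hrow : Row n (s₆.mem 55) 0 (pc + 1 + ps) (extend z w 𝓧 + 𝓨) := by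
    refine ⟨(extend_nonempty hX.nonempty).add hY.nonempty,
      (hX.size_le.extend z w).add hY.size_le, hlow, fun i hi => ?_⟩
    rw [zero_add]
    exact (h55 i hi).unique (isLeast_env_add (extend_nonempty hX.nonempty) hY.nonempty i)
  refine load_runs (doff := ov) (w := 0) (N := pc + 1 + ps + 1) hB₆ hrow (by rw [r6 _ (by decide)]; exact h36)
    (by rw [r6 _ (by decide)]; exact h9) (by rw [r6 _ (by decide)]; exact h39)
    (by rw [r6 _ (by decide)]; exact h9) (by intros; simp [r6, h39]) (by omega) (by omega) ?_
  intro t₇ hB₇ ht₇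
  refine ⟨?_, ?_⟩
  · rw [State.fill_mem_same, hF₆.mem dst (by
      simp [Program.slowConv, Program.arrs, Program.convInit, Program.arrs_for, Program.relax,
        Program.arrs_sweep]; omega)]
    simp only [State.setReg_mem, m3 dst hd.2.2.2.1 hd.2.2.2.2.1]
    simp
  · simp only [Expr.cost_add, Expr.cost_reg, Expr.cost_one]
    nlinarith

/-! ### Convolution of a pending row with a base -/

/-- Convolve the row of `a` in registers `43` (offset) and `47` (capacity) with the row of array `20`
in registers `45` and `46`. -/
def pairConv (p : Program) (a : ℕ) : Program :=
  load 53 9 a 43 47 9 false (.reg 47 + 2 * .reg 49 + 1) ;;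
  load 54 9 20 45 46 9 false (.reg 46 + 2 * .reg 49 + .reg 49 + 1) ;;
  .assign 60 (.reg 47) ;; .assign 61 (.reg 46) ;; p.fastConv

theorem pairConv_regs {p : Program} {a : ℕ} :
    ∀ x ∈ (pairConv p a).regs, (60 ≤ x ∧ x ≤ 67) ∨ 96 ≤ x := by
  intro x hx
  simp only [pairConv, Program.regs, List.mem_append, load_regs, List.mem_cons, List.not_mem_nil,
    or_false] at hx
  rcases hx with (h | h) | (h | h) | h | h | h <;> try omega
  have := p.fastConv_regs x h; omega

theorem pairConv_arrs {p : Program} {a : ℕ} : ∀ x ∈ (pairConv p a).arrs, 50 ≤ x := by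
  intro x hx
  simp only [pairConv, Program.arrs, List.mem_append, load_arrs, List.mem_cons, List.not_mem_nil,
    or_false, List.nil_append] at hx
  rcases hx with h | h | h <;> try omega
  have := p.fastConv_arrs x h; omega

/-- A bound for the number of calls of the min-plus product in one convolution. -/
def calls (n σ : ℕ) : ℕ := (n + 1) * ((n + σ + 1) * σ)

/-- Loading the two rows takes time linear in x + m + 3q; the factor q ≤ V makes this a lower-order
term of the convolution. -/
theorem pairConv_time {q x m V K t u : ℕ} (hq : 1 ≤ q) (hV : q ≤ V)
    (ht : q * q * t ≤ K * ((x + q) * (m + 2 * q) * V)) (hu : u ≤ t + 1000 * (x + m + 3 * q)) :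
    q * q * u ≤ (K + 2000) * ((x + q) * (m + 2 * q) * V) := by
  have h1 : q * (m + 2 * q) ≤ (x + q) * (m + 2 * q) := Nat.mul_le_mul_right _ (by omega)
  have h2 : (x + q) * q ≤ (x + q) * (m + 2 * q) := Nat.mul_le_mul_left _ (by omega)
  have h3 : q * (x + m + 3 * q) ≤ 2 * ((x + q) * (m + 2 * q)) := by linarith
  have h4 : q * q * (x + m + 3 * q) ≤ 2 * ((x + q) * (m + 2 * q) * V) := by
    calc q * q * (x + m + 3 * q) = q * (x + m + 3 * q) * q := by ring
      _ ≤ 2 * ((x + q) * (m + 2 * q)) * V := Nat.mul_le_mul h3 hV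
      _ = _ := by ring
  calc q * q * u ≤ q * q * (t + 1000 * (x + m + 3 * q)) := Nat.mul_le_mul_left _ hu
    _ = q * q * t + 1000 * (q * q * (x + m + 3 * q)) := by ring
    _ ≤ K * ((x + q) * (m + 2 * q) * V) + 1000 * (2 * ((x + q) * (m + 2 * q) * V)) := by gcongr
    _ = _ := by ring

theorem pairConv_runs {p : Program} {n σ T M x m ox oy a : ℕ} {s : State} {𝓧 𝓨 : Set (ℕ × ℕ)}
    (hp : CanMultiply p σ T M) (hB : Bdd M s) (hF : Fresh s) (hX : Row n (s.mem a) ox x 𝓧)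
    (hY : Row n (s.mem 20) oy m 𝓨) (h9 : s.reg 9 = 0) (h43 : s.reg 43 = ox) (h47 : s.reg 47 = x)
    (h45 : s.reg 45 = oy) (h46 : s.reg 46 = m) (h49 : s.reg 49 = σ * σ) (h80 : s.reg 80 = σ)
    (hlow : ∃ a ∈ 𝓧 + 𝓨, a.2 ≤ n) (hn : x + m ≤ n) (h99 : s.reg 99 + calls n σ ≤ M)
    (hM : 8 * (n + σ * σ) + 8 ≤ M) (ha : a < 50) :
    Runs M (pairConv p a) s fun s' t => Row n (s'.mem 55) 0 (x + m) (𝓧 + 𝓨) ∧ Fresh s' ∧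
      s'.reg 99 ≤ s.reg 99 + calls n σ ∧
      σ * σ * (σ * σ) * t ≤ (p.callFactor + 2500) * ((x + σ * σ) * (m + 2 * (σ * σ)) * (σ * T)) := by
  have hσ := hp.pos
  have hσq : σ ≤ σ * σ := Nat.le_mul_of_pos_left σ hσ
  obtain ⟨q, hq⟩ : ∃ q, q = σ * σ := ⟨_, rfl⟩
  have hq1 : 1 ≤ q := hq ▸ hσ.trans hσq
  refine Runs.seq (load_runs (Q := fun s' t => s' = _ ∧ t ≤ _) (N := x + 2 * q + 1) hB hX h9 h43 h47
    h9 (by intros; simp [h47, h49, hq]) (by omega) (by omega) (fun t _ ht => ⟨rfl, ht⟩)) ?_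
  rintro s₁ t₁ hB₁ - ⟨e₁, ht₁⟩
  refine Runs.seq (load_runs (Q := fun s' t => s' = _ ∧ t ≤ _) (doff := 0) (soff := oy)
    (cap := m) (w := 0) (N := m + 2 * q + q + 1) hB₁
    (by rw [e₁, State.fill_mem_ne _ _ _ _ _ _ (by decide)]; exact hY) (by simp [e₁, h9])
    (by simp [e₁, h45]) (by simp [e₁, h46]) (by simp [e₁, h9])
    (by intros; simp [e₁, h46, h49, hq]) (by omega) (by omega) (fun t _ ht => ⟨rfl, ht⟩)) ?_
  rintro s₂ t₂ hB₂ - ⟨e₂, ht₂⟩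
  have r2 : ∀ x, x ≠ 67 → s₂.reg x = s.reg x := by intro x hx; simp [e₂, e₁, hx]
  have m2 : ∀ a, a ≠ 53 → a ≠ 54 → s₂.mem a = s.mem a := by
    intro a h h'; simp [e₂, e₁, State.fill_mem, h, h']
  refine Runs.assign_seq hB₂ (hB₂.reg _) fun hB₃ => ?_
  refine Runs.assign_seq hB₃ (hB₃.reg _) fun hB₄ => ?_
  have hle : (x + 1) * ((m + σ + 1) * σ) ≤ calls n σ := by
    unfold calls; gcongr <;> omega
  refine (Runs.fastConv (m₁ := x) (m₂ := m) hp hB₄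
    (hF.of_eq (fun a ha => m2 a (by omega) (by omega)) (by simp [r2])) hX.profile hY.profile
    (by simp [r2, h80]) (by simp [r2, h47]) (by simp [r2, h46]) (fun i hi => ?_) (fun i hi => ?_)
    ?_ (by omega) (fun i hi => ?_)).mono ?_
  · simp only [State.setReg_mem, e₂]
    rw [State.fill_mem_ne _ _ _ _ _ _ (by decide), e₁, State.fill_mem_same,
      splice_zero_left _ _ (by omega)]
    simp
  · simp only [State.setReg_mem, e₂]
    rw [State.fill_mem_same, splice_zero_left _ _ (by omega)]
    simp
  · simp [r2]; omega
  · have := hX.env_le 0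
    have := hY.env_le i
    omega
  rintro s₅ t₅ hB₅ hF₅ ⟨h1, h2, h3, h4⟩
  refine ⟨⟨hX.nonempty.add hY.nonempty, hX.size_le.add hY.size_le, hlow, fun i hi => ?_⟩, h2, ?_, ?_⟩
  · rw [zero_add]
    exact (h1 i hi).unique (isLeast_env_add hX.nonempty hY.nonempty i)
  · simp [r2] at h3; omega
  · rw [← hq] at h4 ⊢
    simp only [Expr.cost_reg]
    exact pairConv_time hq1 ((hq ▸ hp.sq_le_time).trans (Nat.le_mul_of_pos_left _ hσ)) h4 (by omega)

end Jumbled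

namespace WordRAM

/-! ### Assignments and stores of known values -/

theorem Runs.assign_eq {M : ℕ} {s : State} {x : ℕ} {e : Expr} {q : Program} (v : ℕ)
    {Q : State → ℕ → Prop} (hB : Bdd M s) (hv : e.val s = v) (hM : v ≤ M)
    (hq : Bdd M (s.setReg x v) → Runs M q (s.setReg x v) fun s₂ t₂ => Q s₂ (e.cost + 1 + t₂))
    (he : e.small = true := by rfl) : Runs M (.assign x e ;; q) s Q := by
  subst hv; exact Runs.assign_seq hB hM hq he

theorem Runs.store_eq {M : ℕ} {s : State} {a : ℕ} {i e : Expr} {q : Program} (o v : ℕ)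
    {Q : State → ℕ → Prop} (hB : Bdd M s) (ho : i.val s = o) (hv : e.val s = v) (hM : v ≤ M)
    (hq : Bdd M (s.setMem a o v) →
      Runs M q (s.setMem a o v) fun s₂ t₂ => Q s₂ (i.cost + e.cost + 1 + t₂))
    (hi : i.small = true := by rfl) (he : e.small = true := by rfl) :
    Runs M (.store a i e ;; q) s Q := by
  subst hv ho; exact Runs.store_seq hB hM hq hi he

end WordRAM

namespace Jumbled

open WordRAM

/-! ### Representation of the components -/

/-- The two states agree in all rows with a name outside `V`, and in the first `fc` base rows. -/
structure Keep (n fc : ℕ) (V : Set ℕ) (s s' : State) : Prop where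
  row : ∀ a, 21 ≤ a → a ≤ 23 → ∀ id ∉ V, ∀ i ≤ n,
    s'.mem a (id * (n + 1) + i) = s.mem a (id * (n + 1) + i)
  pend : ∀ id ∉ V, s'.mem 24 id = s.mem 24 id
  base : ∀ id ∉ V, s'.mem 26 id = s.mem 26 id
  full : ∀ f < fc, ∀ i ≤ n, s'.mem 20 (f * (n + 1) + i) = s.mem 20 (f * (n + 1) + i)
  size : ∀ f < fc, s'.mem 25 f = s.mem 25 f

theorem Keep.of_mem {n fc : ℕ} {V : Set ℕ} {s s' : State}
    (h : ∀ a, 20 ≤ a → a ≤ 26 → s'.mem a = s.mem a) : Keep n fc V s s' :=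
  ⟨fun a h1 h2 _ _ _ _ => by rw [h a (by omega) (by omega)],
    fun _ _ => by rw [h 24 (by omega) (by omega)], fun _ _ => by rw [h 26 (by omega) (by omega)],
    fun _ _ _ _ => by rw [h 20 (by omega) (by omega)], fun _ _ => by rw [h 25 (by omega) (by omega)]⟩

theorem Keep.trans {n fc fc' : ℕ} {V V' : Set ℕ} {s s' s'' : State} (h : Keep n fc V s s')
    (h' : Keep n fc' V' s' s'') (hf : fc ≤ fc') : Keep n fc (V ∪ V') s s'' :=
  ⟨fun a h1 h2 id hid i hi => (h'.row a h1 h2 id (fun hh => hid (.inr hh)) i hi).trans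
      (h.row a h1 h2 id (fun hh => hid (.inl hh)) i hi),
    fun id hid => (h'.pend id (fun hh => hid (.inr hh))).trans (h.pend id (fun hh => hid (.inl hh))),
    fun id hid => (h'.base id (fun hh => hid (.inr hh))).trans (h.base id (fun hh => hid (.inl hh))),
    fun f hlt i hi => (h'.full f (by omega) i hi).trans (h.full f hlt i hi),
    fun f hlt => (h'.size f (by omega)).trans (h.size f hlt)⟩

theorem Keep.mono {n fc : ℕ} {V V' : Set ℕ} {s s' : State} (h : Keep n fc V s s') (hV : V ⊆ V') :
    Keep n fc V' s s' :=
  ⟨fun a h1 h2 id hid => h.row a h1 h2 id fun hh => hid (hV hh),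
    fun id hid => h.pend id fun hh => hid (hV hh), fun id hid => h.base id fun hh => hid (hV hh),
    h.full, h.size⟩

/-- Row `id` represents a component with `x` pending nodes on top of base row `b` with `m` nodes:
`P` are the choices among the pending nodes, `Q` those to which the base is attached, with family
`Fb`; `A` are the choices whose combinations with the base are not yet in the array of answers. -/
structure NodeRep (n fc : ℕ) (s : State) (id x m b : ℕ) (P Q A Fb : Set (ℕ × ℕ)) : Prop where
  pend : s.mem 24 id = x
  base : s.mem 26 id = b
  base_lt : b < fc
  size : s.mem 25 b = m
  rowP : Row n (s.mem 21) (id * (n + 1)) x P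
  rowQ : Row n (s.mem 22) (id * (n + 1)) x Q
  rowA : Row n (s.mem 23) (id * (n + 1)) x A
  rowF : Row n (s.mem 20) (b * (n + 1)) m Fb
  le : x + m ≤ n
  zeroP : (0 : ℕ × ℕ) ∈ P
  zeroF : (0 : ℕ × ℕ) ∈ Fb
  tameP : Tame P
  tameQ : Tame Q
  tameF : Tame Fb
  light : b = 0 → m = 0 ∧ Fb = {0} ∧ P ⊆ Q

theorem NodeRep.keep {n fc fc' id x m b : ℕ} {s s' : State} {P Q A Fb : Set (ℕ × ℕ)} {V : Set ℕ}
    (h : NodeRep n fc s id x m b P Q A Fb) (hk : Keep n fc V s s') (hid : id ∉ V) (hf : fc ≤ fc') :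
    NodeRep n fc' s' id x m b P Q A Fb := by
  have hxm := h.le
  exact { h with
    pend := (hk.pend id hid).trans h.pend
    base := (hk.base id hid).trans h.base
    base_lt := h.base_lt.trans_le hf
    size := (hk.size b h.base_lt).trans h.size
    rowP := h.rowP.congr fun i hi => hk.row 21 (by omega) (by omega) id hid i (by omega)
    rowQ := h.rowQ.congr fun i hi => hk.row 22 (by omega) (by omega) id hid i (by omega)
    rowA := h.rowA.congr fun i hi => hk.row 23 (by omega) (by omega) id hid i (by omega)
    rowF := h.rowF.congr fun i hi => hk.full b h.base_lt i (by omega) }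

theorem row_zero {n : ℕ} {A : ℕ → ℕ} {o v : ℕ} (hv : v ≤ n) (h : A o = v) : Row n A o 0 {(0, v)} := by
  refine ⟨Set.singleton_nonempty _, ?_, ⟨_, rfl, hv⟩, fun i hi => ?_⟩
  · rintro a rfl; exact le_rfl
  · obtain rfl : i = 0 := by omega
    simp [env_singleton, h]

/-! ### Combining a component with its base -/

/-- Compute the family of component `reg 40`, account for its deferred pairs, and store the family as
the base row of the new component `reg 41` without pending nodes. -/
def rebase (p : Program) : Program :=
  .assign 43 (.reg 40 * .reg 2) ;; .assign 44 (.cell 26 (.reg 40)) ;;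
  .assign 45 (.reg 44 * .reg 2) ;; .assign 46 (.cell 25 (.reg 44)) ;;
  .assign 47 (.cell 24 (.reg 40)) ;; .assign 48 (.reg 47 + .reg 46) ;;
  .assign 49 (.reg 80 * .reg 80) ;; .assign 50 (.reg 41 * .reg 2) ;;
  .assign 51 (.reg 42 * .reg 2) ;;
  pairConv p 23 ;; relaxRow 28 9 55 9 48 9 false (.reg 48 + 1) ;;
  pairConv p 22 ;; relaxRow 55 9 21 43 47 9 false (.reg 48 + 1) ;;
  load 20 51 55 9 48 9 false (.reg 48 + 1) ;;
  .store 25 (.reg 42) (.reg 48) ;; .store 26 (.reg 41) (.reg 42) ;; .store 24 (.reg 41) 0 ;;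
  .store 21 (.reg 50) 0 ;; .store 22 (.reg 50) 0 ;; .store 23 (.reg 50) (.reg 0) ;;
  .assign 42 (.reg 42 + 1)

theorem rebase_regs {p : Program} : ∀ x ∈ (rebase p).regs, (42 ≤ x ∧ x ≤ 67) ∨ 96 ≤ x := by
  intro x hx
  simp only [rebase, Program.regs, List.mem_append, load_regs, relaxRow_regs, List.mem_cons,
    List.not_mem_nil, or_false, false_or] at hx
  rcases hx with h | h | h | h | h | h | h | h | h | h | (h | h) | h | (h | h) | (h | h) | h <;>
    first | omega | (have := pairConv_regs x h; omega)

theorem rebase_arrs {p : Program} :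
    ∀ x ∈ (rebase p).arrs, (20 ≤ x ∧ x ≤ 26) ∨ x = 28 ∨ 50 ≤ x := by
  intro x hx
  simp only [rebase, Program.arrs, List.mem_append, load_arrs, relaxRow_arrs, List.mem_cons,
    List.not_mem_nil, or_false, false_or] at hx
  rcases hx with h | h | h | h | h | h | h | h | h | h | h <;>
    first | omega | (have := pairConv_arrs x h; omega)

/-- The registers that stay fixed while the tree is processed. -/
structure Ctx (n σ : ℕ) (s : State) : Prop where
  reg0 : s.reg 0 = n
  reg2 : s.reg 2 = n + 1
  reg9 : s.reg 9 = 0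
  reg80 : s.reg 80 = σ
  fresh : Fresh s

theorem improved_fill {n N : ℕ} {𝓐 𝓧 : Set (ℕ × ℕ)} {G : ℕ → ℕ} (h : 𝓧.Nonempty)
    (hs : SizeLE N 𝓧) :
    Improved n 𝓐 𝓧 G (splice G 0 (N + 1) fun i => min (G (0 + i)) (0 + env 𝓧 (i - false.toNat))) := by
  simpa using improved_splice (n := n) (𝓐 := 𝓐) (G := G) h hs

theorem rebase_time {q x m V F t₁ t₂ u : ℕ} (hq : 1 ≤ q) (hV : q ≤ V)
    (h₁ : q * q * t₁ ≤ (F + 2500) * ((x + q) * (m + 2 * q) * V))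
    (h₂ : q * q * t₂ ≤ (F + 2500) * ((x + q) * (m + 2 * q) * V))
    (hu : u ≤ t₁ + t₂ + 1000 * (x + m + 3 * q)) :
    q * q * u ≤ (2 * F + 9000) * ((x + q) * (m + 2 * q) * V) := by
  have h : q * q * (t₁ + t₂) ≤ (2 * F + 5000) * ((x + q) * (m + 2 * q) * V) := by
    rw [mul_add]; exact (Nat.add_le_add h₁ h₂).trans_eq (by ring)
  exact (pairConv_time hq hV h hu).trans (Nat.mul_le_mul_right _ (by omega))

/-- Two fast convolutions with the base: A + F settles the deferred answers, and P ∪ (Q + F) becomes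
a new base row. Base rows are only appended, so other components remain valid. The new component has
nothing pending; its deferred row is the dummy {(0, n)}, whose combinations have at least n ones. -/
theorem rebase_runs {p : Program} {n σ T M fc id d x m b : ℕ} {s : State} (𝓐 : Set (ℕ × ℕ))
    {P Q A Fb : Set (ℕ × ℕ)} (hp : CanMultiply p σ T M) (hB : Bdd M s) (hc : Ctx n σ s)
    (h : NodeRep n fc s id x m b P Q A Fb) (h40 : s.reg 40 = id) (h41 : s.reg 41 = d)
    (h42 : s.reg 42 = fc) (h99 : s.reg 99 + 2 * calls n σ ≤ M) (hM : 8 * (n + σ * σ) + 8 ≤ M)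
    (hid : id ≤ n + 2) (hd : d ≤ n + 2) (hfc : (fc + n + 3) * (n + 1) ≤ M) :
    Runs M (rebase p) s fun s' t =>
      NodeRep n (fc + 1) s' d 0 (x + m) fc {0} {0} {(0, n)} (P ∪ (Q + Fb)) ∧
      Improved n 𝓐 (A + Fb) (s.mem 28) (s'.mem 28) ∧ Keep n fc {d} s s' ∧ s'.reg 42 = fc + 1 ∧
      Fresh s' ∧ s'.reg 99 ≤ s.reg 99 + 2 * calls n σ ∧
      σ * σ * (σ * σ) * t ≤
        (2 * p.callFactor + 9000) * ((x + σ * σ) * (m + 2 * (σ * σ)) * (σ * T)) := by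
  have hxm := h.le
  have hσ := hp.pos
  have hfcM : fc + n + 3 ≤ M := (Nat.le_mul_of_pos_right _ (by omega)).trans hfc
  have hmulM : ∀ y, y ≤ fc + n + 3 → y * (n + 1) ≤ M := fun y hy =>
    (Nat.mul_le_mul_right _ hy).trans hfc
  have hb := h.base_lt
  refine Runs.assign_eq (id * (n + 1)) hB (by simp [h40, hc.reg2]) (hmulM _ (by omega)) fun hB => ?_
  refine Runs.assign_eq b hB (by simp [h40, h.base]) (by omega) fun hB => ?_
  refine Runs.assign_eq (b * (n + 1)) hB (by simp [hc.reg2]) (hmulM _ (by omega)) fun hB => ?_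
  refine Runs.assign_eq m hB (by simp [h.size]) (by omega) fun hB => ?_
  refine Runs.assign_eq x hB (by simp [h40, h.pend]) (by omega) fun hB => ?_
  refine Runs.assign_eq (x + m) hB (by simp) (by omega) fun hB => ?_
  refine Runs.assign_eq (σ * σ) hB (by simp [hc.reg80]) (by omega) fun hB => ?_
  refine Runs.assign_eq (d * (n + 1)) hB (by simp [h41, hc.reg2]) (hmulM _ (by omega)) fun hB => ?_
  refine Runs.assign_eq (fc * (n + 1)) hB (by simp [h42, hc.reg2]) (hmulM _ (by omega)) fun hB => ?_
  generalize hs₁ : (((((((((s.setReg 43 _).setReg 44 _).setReg 45 _).setReg 46 _).setReg 47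
    _).setReg 48 _).setReg 49 _).setReg 50 _).setReg 51 _) = s₁ at hB ⊢
  have m1 : s₁.mem = s.mem := by simp [← hs₁]
  have r1 : ∀ y, (y < 43 ∨ 51 < y) → s₁.reg y = s.reg y := by
    intro y hy; simp only [← hs₁, State.setReg_reg]
    rw [if_neg (by omega), if_neg (by omega), if_neg (by omega), if_neg (by omega),
      if_neg (by omega), if_neg (by omega), if_neg (by omega), if_neg (by omega), if_neg (by omega)]
  have h43 : s₁.reg 43 = id * (n + 1) := by simp [← hs₁]
  have h45 : s₁.reg 45 = b * (n + 1) := by simp [← hs₁]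
  have h46 : s₁.reg 46 = m := by simp [← hs₁]
  have h47 : s₁.reg 47 = x := by simp [← hs₁]
  have h48 : s₁.reg 48 = x + m := by simp [← hs₁]
  have h49 : s₁.reg 49 = σ * σ := by simp [← hs₁]
  have h50 : s₁.reg 50 = d * (n + 1) := by simp [← hs₁]
  have h51 : s₁.reg 51 = fc * (n + 1) := by simp [← hs₁]
  clear hs₁
  have h9 : s₁.reg 9 = 0 := by rw [r1 _ (by omega), hc.reg9]
  have hAne := h.rowA.nonempty.add h.rowF.nonempty
  have hQne := h.rowQ.nonempty.add h.rowF.nonempty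
  have hPne := h.rowP.nonempty
  refine Runs.seq (pairConv_runs hp hB (hc.fresh.of_eq (by simp [m1]) (by rw [r1 _ (by omega)]))
    (m1 ▸ h.rowA) (m1 ▸ h.rowF) h9 h43 h47 h45 h46 h49
    (by rw [r1 _ (by omega), hc.reg80]) ?_ hxm (by rw [r1 _ (by omega)]; omega) hM
    (by omega)) ?_
  -- A need not be tame, as it may contain the dummy pair; the bound comes from its low member
  -- combined with the empty member of the base family.
  · obtain ⟨a, ha, hn⟩ := h.rowA.low
    exact ⟨a + 0, Set.add_mem_add ha h.zeroF, by simpa using hn⟩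
  rintro s₂ t₂ hB₂ hF₂ ⟨row₂, fr₂, g₂, ht₂⟩
  have r2 : ∀ y, y < 60 → s₂.reg y = s₁.reg y := fun y hy =>
    hF₂.reg y fun hh => by have := pairConv_regs y hh; omega
  have r2' : s₂.reg 80 = s₁.reg 80 := hF₂.reg _ fun hh => by have := pairConv_regs _ hh; omega
  have m2 : ∀ a, a < 50 → s₂.mem a = s₁.mem a := fun y hy =>
    hF₂.mem y fun hh => by have := pairConv_arrs y hh; omega
  rw [r1 _ (by omega)] at g₂
  refine Runs.seq (relaxRow_runs (Q := fun s' t => s' = _ ∧ t ≤ _) (doff := 0) (soff := 0) (w := 0)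
    (N := x + m + 1) hB₂ row₂
    (by rw [r2 _ (by omega), h9]) (by rw [r2 _ (by omega), h9]) (by rw [r2 _ (by omega), h48])
    (by rw [r2 _ (by omega), h9]) (by intros; simp [r2, h48]) (by omega) (by omega)
    (fun t _ ht => ⟨rfl, ht⟩)) ?_
  rintro s₃ t₃ hB₃ - ⟨e₃, ht₃⟩
  have r3 : ∀ y, y < 60 → s₃.reg y = s₁.reg y := by
    intro y hy; rw [e₃, State.fill_reg, if_neg (by omega), r2 y hy]
  have m3 : ∀ a, a < 50 → a ≠ 28 → s₃.mem a = s.mem a := by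
    intro a h1 h2; rw [e₃, State.fill_mem_ne _ _ _ _ _ _ h2, m2 a h1, m1]
  have hG : Improved n 𝓐 (A + Fb) (s.mem 28) (s₃.mem 28) := by
    rw [e₃, State.fill_mem_same, m2 _ (by omega), m1]
    exact improved_fill hAne (h.rowA.size_le.add h.rowF.size_le)
  have g₃ : s₃.reg 99 = s₂.reg 99 := by simp [e₃]
  refine Runs.seq (pairConv_runs (𝓧 := Q) (𝓨 := Fb) (x := x) (m := m) (ox := id * (n + 1))
    (oy := b * (n + 1)) hp hB₃ (fr₂.of_eq
      (fun a ha => by rw [e₃, State.fill_mem_ne _ _ _ _ _ _ (by omega)]) g₃)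
    (by rw [m3 _ (by omega) (by omega)]; exact h.rowQ)
    (by rw [m3 _ (by omega) (by omega)]; exact h.rowF) (by rw [r3 _ (by omega), h9])
    (by rw [r3 _ (by omega), h43]) (by rw [r3 _ (by omega), h47]) (by rw [r3 _ (by omega), h45])
    (by rw [r3 _ (by omega), h46]) (by rw [r3 _ (by omega), h49])
    (by rw [e₃, State.fill_reg, if_neg (by omega), r2', r1 _ (by omega), hc.reg80])
    (low_of_tame hQne (h.tameQ.add h.tameF) (h.rowQ.size_le.add h.rowF.size_le) hxm) hxm
    (by rw [g₃]; omega) hM (by omega)) ?_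
  rintro s₄ t₄ hB₄ hF₄ ⟨row₄, fr₄, g₄, ht₄⟩
  have r4 : ∀ y, y < 60 → s₄.reg y = s₁.reg y := fun y hy =>
    (hF₄.reg y fun hh => by have := pairConv_regs y hh; omega).trans (r3 y hy)
  have m4 : ∀ a, a < 50 → s₄.mem a = s₃.mem a := fun y hy =>
    hF₄.mem y fun hh => by have := pairConv_arrs y hh; omega
  refine Runs.seq (relaxRow_runs (Q := fun s' t => s' = _ ∧ t ≤ _) (𝓟 := P) (cap := x) (doff := 0)
    (soff := id * (n + 1)) (w := 0) (N := x + m + 1) hB₄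
    (by rw [m4 _ (by omega), m3 _ (by omega) (by omega)]; exact h.rowP)
    (by rw [r4 _ (by omega), h9]) (by rw [r4 _ (by omega), h43]) (by rw [r4 _ (by omega), h47])
    (by rw [r4 _ (by omega), h9]) (by intros; simp [r4, h48]) (by omega) (by omega)
    (fun t _ ht => ⟨rfl, ht⟩)) ?_
  rintro s₅ t₅ hB₅ - ⟨e₅, ht₅⟩
  have row₅ : Row n (s₅.mem 55) 0 (x + m) (P ∪ (Q + Fb)) := by
    refine ⟨hPne.mono Set.subset_union_left, (h.rowP.size_le.mono (by omega)).union
      (h.rowQ.size_le.add h.rowF.size_le), ⟨0, .inl h.zeroP, by simp⟩, fun i hi => ?_⟩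
    rw [e₅, State.fill_mem_same, zero_add, splice_zero_left _ _ (by omega), env_union hPne hQne,
      row₄.val i hi, min_comm]
    simp
  refine Runs.seq (load_runs (Q := fun s' t => s' = _ ∧ t ≤ _) (doff := fc * (n + 1)) (soff := 0)
    (w := 0) (N := x + m + 1) hB₅ row₅
    (by rw [e₅, State.fill_reg, if_neg (by omega), r4 _ (by omega), h51])
    (by rw [e₅, State.fill_reg, if_neg (by omega), r4 _ (by omega), h9])
    (by rw [e₅, State.fill_reg, if_neg (by omega), r4 _ (by omega), h48])
    (by rw [e₅, State.fill_reg, if_neg (by omega), r4 _ (by omega), h9])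
    (by intros; simp [e₅, r4, h48]) (by omega) (by omega) (fun t _ ht => ⟨rfl, ht⟩)) ?_
  rintro s₆ t₆ hB₆ - ⟨e₆, ht₆⟩
  have r6 : ∀ y, y < 60 → s₆.reg y = s₁.reg y := by
    intro y hy
    rw [e₆, State.fill_reg, if_neg (by omega), e₅, State.fill_reg, if_neg (by omega), r4 y hy]
  have m6 : ∀ a, a < 50 → a ≠ 28 → a ≠ 20 → s₆.mem a = s.mem a := by
    intro a h1 h2 h3
    rw [e₆, State.fill_mem_ne _ _ _ _ _ _ h3, e₅, State.fill_mem_ne _ _ _ _ _ _ (by omega),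
      m4 a h1, m3 a h1 h2]
  have m28 : s₆.mem 28 = s₃.mem 28 := by
    rw [e₆, State.fill_mem_ne _ _ _ _ _ _ (by omega), e₅, State.fill_mem_ne _ _ _ _ _ _ (by omega),
      m4 _ (by omega)]
  have m20 : s₆.mem 20 = splice (s.mem 20) (fc * (n + 1)) (x + m + 1) (env (P ∪ (Q + Fb))) := by
    rw [e₆, State.fill_mem_same, e₅, State.fill_mem_ne _ _ _ _ _ _ (by omega), m4 _ (by omega),
      m3 _ (by omega) (by omega)]
    simp
  have h42₆ : s₆.reg 42 = fc := by rw [r6 _ (by omega), r1 _ (by omega), h42]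
  have h41₆ : s₆.reg 41 = d := by rw [r6 _ (by omega), r1 _ (by omega), h41]
  have h0₆ : s₆.reg 0 = n := by rw [r6 _ (by omega), r1 _ (by omega), hc.reg0]
  have h48₆ : s₆.reg 48 = x + m := by rw [r6 _ (by omega), h48]
  have h50₆ : s₆.reg 50 = d * (n + 1) := by rw [r6 _ (by omega), h50]
  have fr₆ : Fresh s₆ := fr₄.of_eq (fun a ha => by
    rw [e₆, State.fill_mem_ne _ _ _ _ _ _ (by omega), e₅, State.fill_mem_ne _ _ _ _ _ _ (by omega)])
    (by simp [e₆, e₅])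
  have g₆ : s₆.reg 99 = s₄.reg 99 := by simp [e₆, e₅]
  refine Runs.store_eq fc (x + m) hB₆ h42₆ h48₆ (by omega) fun hB => ?_
  refine Runs.store_eq d fc hB h41₆ h42₆ (by omega) fun hB => ?_
  refine Runs.store_eq d 0 hB h41₆ (by simp) (by omega) fun hB => ?_
  refine Runs.store_eq (d * (n + 1)) 0 hB h50₆ (by simp) (by omega) fun hB => ?_
  refine Runs.store_eq (d * (n + 1)) 0 hB h50₆ (by simp) (by omega) fun hB => ?_
  refine Runs.store_eq (d * (n + 1)) n hB h50₆ h0₆ (by omega) fun hB => ?_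
  refine Runs.assign hB (by simp [h42₆]; omega) ?_
  simp only [Expr.val_add, Expr.val_reg, Expr.val_one, State.setMem_reg, h42₆,
    Expr.cost_reg, Expr.cost_zero, Expr.cost_add, Expr.cost_one, Expr.cost_mul, Expr.cost_cell]
  generalize hs' : ((((((((s₆.setMem 25 _ _).setMem 26 _ _).setMem 24 _ _).setMem 21 _ _).setMem 22 _
    _).setMem 23 _ _).setReg 42 _)) = s'
  have k20 : s'.mem 20 = splice (s.mem 20) (fc * (n + 1)) (x + m + 1) (env (P ∪ (Q + Fb))) := by
    simp [← hs', State.setMem_mem, m20]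
  have k21 : s'.mem 21 = Function.update (s.mem 21) (d * (n + 1)) 0 := by
    simp [← hs', State.setMem_mem, m6]
  have k22 : s'.mem 22 = Function.update (s.mem 22) (d * (n + 1)) 0 := by
    simp [← hs', State.setMem_mem, m6]
  have k23 : s'.mem 23 = Function.update (s.mem 23) (d * (n + 1)) n := by
    simp [← hs', State.setMem_mem, m6]
  have k24 : s'.mem 24 = Function.update (s.mem 24) d 0 := by
    simp [← hs', State.setMem_mem, m6]
  have k25 : s'.mem 25 = Function.update (s.mem 25) fc (x + m) := by
    simp [← hs', State.setMem_mem, m6]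
  have k26 : s'.mem 26 = Function.update (s.mem 26) d fc := by
    simp [← hs', State.setMem_mem, m6]
  have k28 : s'.mem 28 = s₃.mem 28 := by simp [← hs', State.setMem_mem, m28]
  have k99 : s'.reg 99 = s₄.reg 99 := by simp [← hs', g₆]
  have hother : ∀ (A : ℕ → ℕ) (v id i : ℕ), id ≠ d → i ≤ n →
      Function.update A (d * (n + 1)) v (id * (n + 1) + i) = A (id * (n + 1) + i) := by
    intro A v id i hid hi
    have := splice_other_row A (n := n) (j := 1) (fun _ => v) hid hi (by omega)
    rwa [← zero_add 1, splice_succ, splice_zero, add_zero] at this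
  refine ⟨?_, by rw [k28]; exact hG, ?_, by simp [← hs'], ?_, by omega, ?_⟩
  · exact {
      pend := by rw [k24]; simp
      base := by rw [k26]; simp
      base_lt := by omega
      size := by rw [k25]; simp
      rowP := row_zero (by omega) (by rw [k21]; simp)
      rowQ := row_zero (by omega) (by rw [k22]; simp)
      rowA := row_zero (by omega) (by rw [k23]; simp)
      rowF := ⟨row₅.nonempty, row₅.size_le, row₅.low, fun i hi => by
        rw [k20, splice_add _ _ _ (by omega)]⟩
      le := by omega
      zeroP := rfl
      zeroF := .inl h.zeroP
      tameP := tame_zero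
      tameQ := tame_zero
      tameF := h.tameP.union (h.tameQ.add h.tameF)
      light := by intro hh; omega }
  · refine ⟨fun a ha ha' id hid i hi => ?_, fun id hid => ?_, fun id hid => ?_, fun f hf i hi => ?_,
      fun f hf => ?_⟩
    · obtain rfl | rfl | rfl : a = 21 ∨ a = 22 ∨ a = 23 := by omega
      · rw [k21, hother _ _ _ _ hid hi]
      · rw [k22, hother _ _ _ _ hid hi]
      · rw [k23, hother _ _ _ _ hid hi]
    · rw [k24, Function.update_of_ne hid]
    · rw [k26, Function.update_of_ne hid]
    · rw [k20, splice_other_row _ _ (by omega) hi (by omega)]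
    · rw [k25, Function.update_of_ne (by omega)]
  · refine fr₆.of_eq (fun a ha => ?_) (by rw [k99, g₆])
    simp only [← hs', State.setReg_mem]
    rw [State.setMem_mem_ne _ _ _ (by omega), State.setMem_mem_ne _ _ _ (by omega),
      State.setMem_mem_ne _ _ _ (by omega), State.setMem_mem_ne _ _ _ (by omega),
      State.setMem_mem_ne _ _ _ (by omega), State.setMem_mem_ne _ _ _ (by omega)]
  · have hq : 1 ≤ σ * σ := by have := Nat.le_mul_of_pos_left σ hσ; omega
    have key := fun u => rebase_time (u := u) hq
      (hp.sq_le_time.trans (Nat.le_mul_of_pos_left _ hσ)) ht₂ ht₄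
    refine key _ ?_
    norm_num only [← add_assoc]; omega

/-! ### Joining two components -/

theorem optional_eq_extend (w : ℕ) (𝓧 : Set (ℕ × ℕ)) : optional w 𝓧 = extend true w 𝓧 := rfl

theorem add_eq_extend (w : ℕ) (𝓧 : Set (ℕ × ℕ)) : {(1, w)} + 𝓧 = extend false w 𝓧 := rfl

/-- Load the parameters of the components `reg 31` and `reg 32`, account for row `reg 31` of `aR`
with the new node, and compute the rows `reg 30` of the arrays `21` and `22`. -/
def joinRows (aR aY : ℕ) (z : Bool) : Program :=
  .assign 34 (.cell 24 (.reg 31)) ;; .assign 35 (.cell 24 (.reg 32)) ;;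
  .assign 36 (.reg 30 * .reg 2) ;; .assign 37 (.reg 31 * .reg 2) ;;
  .assign 38 (.reg 32 * .reg 2) ;; .assign 39 (.reg 34 + 1 + .reg 35) ;;
  relaxRow 28 9 aR 37 34 33 true (.reg 34 + 2) ;;
  mulRow aR aY 21 true ;; mulRow 22 22 22 z

theorem joinRows_regs {aR aY : ℕ} {z : Bool} :
    ∀ x ∈ (joinRows aR aY z).regs, (34 ≤ x ∧ x ≤ 39) ∨ (60 ≤ x ∧ x ≤ 67) := by
  intro x hx
  simp only [joinRows, Program.regs, List.mem_append, relaxRow_regs, List.mem_cons,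
    List.not_mem_nil, or_false] at hx
  rcases hx with h | h | h | h | h | h | (h | h) | h | h <;>
    first | omega | (have := mulRow_regs x h; omega)

theorem joinRows_arrs {aR aY : ℕ} {z : Bool} :
    ∀ a ∈ (joinRows aR aY z).arrs, a = 21 ∨ a = 22 ∨ a = 28 ∨ (53 ≤ a ∧ a ≤ 55) := by
  intro x hx
  simp only [joinRows, Program.arrs, List.mem_append, relaxRow_arrs, List.mem_cons,
    List.not_mem_nil, or_false, false_or] at hx
  rcases hx with h | h | h <;> first | omega | (have := mulRow_arrs x h; omega)

theorem improved_fill_shift {n N w : ℕ} {𝓐 𝓧 : Set (ℕ × ℕ)} {G : ℕ → ℕ} (h : 𝓧.Nonempty)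
    (hs : SizeLE N 𝓧) :
    Improved n 𝓐 ({(1, w)} + 𝓧) G
      (splice G 0 (N + 2) fun i => min (G (0 + i)) (w + env 𝓧 (i - true.toNat))) := by
  have := improved_splice (n := n) (𝓐 := 𝓐) (G := G) ((Set.singleton_nonempty _).add h)
    (hs.one_add w)
  simp only [env_add_one h] at this
  simpa using this

theorem joinRows_runs {n M fc v c d xc xd mc md bc bd w aR aY : ℕ} {z : Bool} {s : State}
    (𝓐 : Set (ℕ × ℕ)) {Pc Qc Ac Fc Pd Qd Ad Fd R Y : Set (ℕ × ℕ)} (hB : Bdd M s)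
    (h2 : s.reg 2 = n + 1) (h9 : s.reg 9 = 0)
    (hc : NodeRep n fc s c xc mc bc Pc Qc Ac Fc) (hd : NodeRep n fc s d xd md bd Pd Qd Ad Fd)
    (h30 : s.reg 30 = v) (h31 : s.reg 31 = c) (h32 : s.reg 32 = d) (h33 : s.reg 33 = w)
    (hw : w ≤ 1) (hn : xc + 1 + xd ≤ n) (hM : 8 * n + 8 ≤ M)
    (hcM : c * (n + 1) ≤ M) (hdM : d * (n + 1) ≤ M) (hvM : v * (n + 1) ≤ M)
    (hR : Row n (s.mem aR) (c * (n + 1)) xc R) (hR0 : (0 : ℕ × ℕ) ∈ R) (hRt : Tame R)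
    (hY : Row n (s.mem aY) (d * (n + 1)) xd Y) (hYt : Tame Y)
    (hz : z = true → (0 : ℕ × ℕ) ∈ Qc) (haR : aR < 28) (haY : aY < 28) :
    Runs M (joinRows aR aY z) s fun s' t =>
      Improved n 𝓐 ({(1, w)} + R) (s.mem 28) (s'.mem 28) ∧
      s'.mem 21 = splice (s.mem 21) (v * (n + 1)) (xc + 1 + xd + 1) (env (optional w R + Y)) ∧
      s'.mem 22 = splice (s.mem 22) (v * (n + 1)) (xc + 1 + xd + 1) (env (extend z w Qc + Qd)) ∧
      s'.reg 34 = xc ∧ s'.reg 35 = xd ∧ s'.reg 36 = v * (n + 1) ∧ s'.reg 37 = c * (n + 1) ∧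
      s'.reg 38 = d * (n + 1) ∧ s'.reg 39 = xc + 1 + xd ∧
      t ≤ 4500 * ((xc + 2) * (xd + 1)) := by
  refine Runs.assign_eq xc hB (by simp [h31, hc.pend]) (by omega) fun hB => ?_
  refine Runs.assign_eq xd hB (by simp [h32, hd.pend]) (by omega) fun hB => ?_
  refine Runs.assign_eq (v * (n + 1)) hB (by simp [h30, h2]) hvM fun hB => ?_
  refine Runs.assign_eq (c * (n + 1)) hB (by simp [h31, h2]) hcM fun hB => ?_
  refine Runs.assign_eq (d * (n + 1)) hB (by simp [h32, h2]) hdM fun hB => ?_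
  refine Runs.assign_eq (xc + 1 + xd) hB (by simp) (by omega) fun hB => ?_
  generalize hs₁ : ((((((s.setReg 34 _).setReg 35 _).setReg 36 _).setReg 37 _).setReg 38
    _).setReg 39 _) = s₁ at hB ⊢
  have m1 : s₁.mem = s.mem := by simp [← hs₁]
  have q9 : s₁.reg 9 = 0 := by simp [← hs₁, h9]
  have q33 : s₁.reg 33 = w := by simp [← hs₁, h33]
  have q34 : s₁.reg 34 = xc := by simp [← hs₁]
  have q35 : s₁.reg 35 = xd := by simp [← hs₁]
  have q36 : s₁.reg 36 = v * (n + 1) := by simp [← hs₁]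
  have q37 : s₁.reg 37 = c * (n + 1) := by simp [← hs₁]
  have q38 : s₁.reg 38 = d * (n + 1) := by simp [← hs₁]
  have q39 : s₁.reg 39 = xc + 1 + xd := by simp [← hs₁]
  clear hs₁
  refine Runs.seq (relaxRow_runs (Q := fun s' t => s' = _ ∧ t ≤ _) (doff := 0) (N := xc + 2) hB
    (m1 ▸ hR) q9 q37 q34 q33 (by intros; simp [q34]) (by omega) (by omega)
    (fun t _ ht => ⟨rfl, ht⟩)) ?_
  rintro s₂ t₂ hB₂ - ⟨e₂, ht₂⟩
  have r2 : ∀ y, y < 60 → s₂.reg y = s₁.reg y := by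
    intro y hy; rw [e₂, State.fill_reg, if_neg (by omega)]
  have m2 : ∀ a, a ≠ 28 → s₂.mem a = s.mem a := by
    intro a h; rw [e₂, State.fill_mem_ne _ _ _ _ _ _ h, m1]
  have hG : Improved n 𝓐 ({(1, w)} + R) (s.mem 28) (s₂.mem 28) := by
    rw [e₂, State.fill_mem_same, m1]
    exact improved_fill_shift hR.nonempty hR.size_le
  have hRne : R.Nonempty := ⟨0, hR0⟩
  refine Runs.seq (mulRow_runs (ov := v * (n + 1)) (z := true) hB₂
    (by rw [m2 _ (by omega)]; exact hR)
    (by rw [m2 _ (by omega)]; exact hY) (by rw [r2 _ (by omega), q9])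
    (by rw [r2 _ (by omega), q33]) (by rw [r2 _ (by omega), q34]) (by rw [r2 _ (by omega), q35])
    (by rw [r2 _ (by omega), q36]) (by rw [r2 _ (by omega), q37]) (by rw [r2 _ (by omega), q38])
    (by rw [r2 _ (by omega), q39]) hw (fun _ => hR0)
    (low_of_tame ((extend_nonempty hRne).add hY.nonempty) ((hRt.extend hw _).add hYt)
      ((hR.size_le.extend _ _).add hY.size_le) hn) hn hM (by omega)) ?_
  rintro s₃ t₃ hB₃ hF₃ ⟨e21, ht₃⟩
  have r3 : ∀ y, y < 60 → s₃.reg y = s₁.reg y := fun y hy =>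
    (hF₃.reg y fun hh => by have := mulRow_regs y hh; omega).trans (r2 y hy)
  have m3 : ∀ a, a < 50 → a ≠ 21 → s₃.mem a = s₂.mem a := fun y hy hy' =>
    hF₃.mem y fun hh => by have := mulRow_arrs y hh; omega
  refine (mulRow_runs (ov := v * (n + 1)) (𝓧 := Qc) (𝓨 := Qd) (ox := c * (n + 1))
    (oy := d * (n + 1)) (pc := xc) (ps := xd) (w := w) hB₃
    (by rw [m3 _ (by omega) (by omega), m2 _ (by omega)]; exact hc.rowQ)
    (by rw [m3 _ (by omega) (by omega), m2 _ (by omega)]; exact hd.rowQ)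
    (by rw [r3 _ (by omega), q9])
    (by rw [r3 _ (by omega), q33]) (by rw [r3 _ (by omega), q34]) (by rw [r3 _ (by omega), q35])
    (by rw [r3 _ (by omega), q36]) (by rw [r3 _ (by omega), q37]) (by rw [r3 _ (by omega), q38])
    (by rw [r3 _ (by omega), q39]) hw hz
    (low_of_tame ((extend_nonempty hc.rowQ.nonempty).add hd.rowQ.nonempty)
      ((hc.tameQ.extend hw _).add hd.tameQ)
      ((hc.rowQ.size_le.extend _ _).add hd.rowQ.size_le) hn) hn hM (by decide)).mono ?_
  rintro s₄ t₄ hB₄ hF₄ ⟨e22, ht₄⟩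
  have r4 : ∀ y, y < 60 → s₄.reg y = s₁.reg y := fun y hy =>
    (hF₄.reg y fun hh => by have := mulRow_regs y hh; omega).trans (r3 y hy)
  have m4 : ∀ a, a < 50 → a ≠ 22 → s₄.mem a = s₃.mem a := fun y hy hy' =>
    hF₄.mem y fun hh => by have := mulRow_arrs y hh; omega
  refine ⟨?_, ?_, ?_, by rw [r4 _ (by omega), q34], by rw [r4 _ (by omega), q35],
    by rw [r4 _ (by omega), q36], by rw [r4 _ (by omega), q37], by rw [r4 _ (by omega), q38],
    by rw [r4 _ (by omega), q39], ?_⟩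
  · rw [m4 _ (by omega) (by omega), m3 _ (by omega) (by omega)]; exact hG
  · rw [m4 _ (by omega) (by omega), e21, m2 _ (by omega)]; rfl
  · rw [e22, m3 _ (by omega) (by omega), m2 _ (by omega)]
  · simp only [Expr.cost_cell, Expr.cost_reg, Expr.cost_mul, Expr.cost_add, Expr.cost_one]
    have : xc + 2 ≤ (xc + 2) * (xd + 1) := Nat.le_mul_of_pos_right _ (by omega)
    norm_num only [← add_assoc]
    omega

theorem keep_of_rows {n fc v N : ℕ} {s s' : State} {P Q A : ℕ → ℕ} {x b : ℕ} (hN : N ≤ n + 1)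
    (h20 : s'.mem 20 = s.mem 20) (h25 : s'.mem 25 = s.mem 25)
    (h21 : s'.mem 21 = splice (s.mem 21) (v * (n + 1)) N P)
    (h22 : s'.mem 22 = splice (s.mem 22) (v * (n + 1)) N Q)
    (h23 : s'.mem 23 = splice (s.mem 23) (v * (n + 1)) N A)
    (h24 : s'.mem 24 = Function.update (s.mem 24) v x)
    (h26 : s'.mem 26 = Function.update (s.mem 26) v b) : Keep n fc {v} s s' := by
  refine ⟨fun a ha ha' id hid i hi => ?_, fun id hid => ?_, fun id hid => ?_, fun f hf i hi => ?_,
    fun f hf => ?_⟩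
  · obtain rfl | rfl | rfl : a = 21 ∨ a = 22 ∨ a = 23 := by omega
    · rw [h21, splice_other_row _ _ hid hi hN]
    · rw [h22, splice_other_row _ _ hid hi hN]
    · rw [h23, splice_other_row _ _ hid hi hN]
  · rw [h24, Function.update_of_ne hid]
  · rw [h26, Function.update_of_ne hid]
  · rw [h20]
  · rw [h25]

/-- Join the component `reg 31`, which has no base, extended by a node, to the component `reg 32`. -/
def joinLight : Program :=
  joinRows 22 21 true ;; load 23 36 23 38 35 9 false (.reg 39 + 1) ;;
  .store 24 (.reg 30) (.reg 39) ;; .store 26 (.reg 30) (.cell 26 (.reg 32))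

/-- Join the component `reg 31`, extended by a node, to the component `reg 32`, which has no base. -/
def joinHeavy : Program :=
  joinRows 21 22 false ;; load 23 36 23 37 34 9 false (.reg 39 + 1) ;;
  relaxRow 23 36 22 37 34 33 true (.reg 39 + 1) ;;
  .store 24 (.reg 30) (.reg 39) ;; .store 26 (.reg 30) (.cell 26 (.reg 31))

theorem joinLight_regs : ∀ x ∈ joinLight.regs, (34 ≤ x ∧ x ≤ 39) ∨ (60 ≤ x ∧ x ≤ 67) := by
  intro x hx
  simp only [joinLight, Program.regs, List.mem_append, load_regs, List.mem_cons,
    List.not_mem_nil, or_false] at hx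
  rcases hx with h | (h | h) <;> first | omega | (have := joinRows_regs x h; omega)

theorem joinHeavy_regs : ∀ x ∈ joinHeavy.regs, (34 ≤ x ∧ x ≤ 39) ∨ (60 ≤ x ∧ x ≤ 67) := by
  intro x hx
  simp only [joinHeavy, Program.regs, List.mem_append, load_regs, relaxRow_regs, List.mem_cons,
    List.not_mem_nil, or_false] at hx
  rcases hx with h | (h | h) | (h | h) <;> first | omega | (have := joinRows_regs x h; omega)

theorem joinLight_arrs : ∀ a ∈ joinLight.arrs,
    (21 ≤ a ∧ a ≤ 26) ∨ a = 28 ∨ (53 ≤ a ∧ a ≤ 55) := by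
  intro x hx
  simp only [joinLight, Program.arrs, List.mem_append, load_arrs, List.mem_cons,
    List.not_mem_nil, or_false] at hx
  rcases hx with h | h | h | h <;> first | omega | (have := joinRows_arrs x h; omega)

theorem joinHeavy_arrs : ∀ a ∈ joinHeavy.arrs,
    (21 ≤ a ∧ a ≤ 26) ∨ a = 28 ∨ (53 ≤ a ∧ a ≤ 55) := by
  intro x hx
  simp only [joinHeavy, Program.arrs, List.mem_append, load_arrs, relaxRow_arrs, List.mem_cons,
    List.not_mem_nil, or_false] at hx
  rcases hx with h | h | h | h | h <;> first | omega | (have := joinRows_arrs x h; omega)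

/-- Row 0 of the bases is the dummy family {0}, and b = 0 means that there is no base. As P ⊆ Q
then, Q alone is the family of c. The subtrees whose top is the new node are accounted for at once,
and adding the optional extension of c to both P and Q of d leaves the base and the deferred pairs
of d untouched. -/
theorem joinLight_runs {n M fc v c d xc xd mc md bc bd w : ℕ} {s : State}
    (𝓐 : Set (ℕ × ℕ)) {Pc Qc Ac Fc Pd Qd Ad Fd : Set (ℕ × ℕ)} (hB : Bdd M s)
    (h2 : s.reg 2 = n + 1) (h9 : s.reg 9 = 0)
    (hc : NodeRep n fc s c xc mc bc Pc Qc Ac Fc) (hd : NodeRep n fc s d xd md bd Pd Qd Ad Fd)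
    (h30 : s.reg 30 = v) (h31 : s.reg 31 = c) (h32 : s.reg 32 = d) (h33 : s.reg 33 = w)
    (hw : w ≤ 1) (hn : xc + 1 + xd + md ≤ n) (hM : 8 * n + 8 ≤ M)
    (hcM : c * (n + 1) ≤ M) (hdM : d * (n + 1) ≤ M) (hvM : v * (n + 1) ≤ M)
    (hdv : d ≠ v) (hb : bc = 0) :
    Runs M joinLight s fun s' t =>
      NodeRep n fc s' v (xc + 1 + xd) md bd (optional w Qc + Pd) (optional w Qc + Qd) Ad Fd ∧
      Improved n 𝓐 ({(1, w)} + Qc) (s.mem 28) (s'.mem 28) ∧ Keep n fc {v} s s' ∧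
      t ≤ 5000 * ((xc + 2) * (xd + 1)) := by
  obtain ⟨-, -, hPQ⟩ := hc.light hb
  have hQ0 := hPQ hc.zeroP
  have hB0 := hd.le
  refine Runs.seq (joinRows_runs (R := Qc) (Y := Pd) 𝓐 hB h2 h9 hc hd h30 h31 h32 h33 hw (by omega)
    hM hcM hdM hvM hc.rowQ hQ0 hc.tameQ hd.rowP hd.tameP (fun _ => hQ0) (by omega) (by omega)) ?_
  rintro s₁ t₁ hB₁ hF₁ ⟨hG, e21, e22, q34, q35, q36, q37, q38, q39, ht₁⟩
  have r1 : ∀ y, y < 34 → s₁.reg y = s.reg y := fun y hy =>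
    hF₁.reg y fun hh => by have := joinRows_regs y hh; omega
  have m1 : ∀ a, a ≠ 21 → a ≠ 22 → a < 28 → s₁.mem a = s.mem a := fun y hy _ _ =>
    hF₁.mem y fun hh => by have := joinRows_arrs y hh; omega
  refine Runs.seq (load_runs (Q := fun s' t => s' = _ ∧ t ≤ _) (doff := v * (n + 1))
    (soff := d * (n + 1)) (cap := xd) (w := 0) (N := xc + 1 + xd + 1) hB₁
    (by rw [m1 _ (by omega) (by omega) (by omega)]; exact hd.rowA) q36 q38 q35
    (by rw [r1 _ (by omega), h9]) (by intros; simp [q39]) (by omega)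
    (fun _ => ⟨by omega, by omega, d, v, hdv, rfl, rfl⟩) (fun t _ ht => ⟨rfl, ht⟩)) ?_
  rintro s₂ t₂ hB₂ - ⟨e₂, ht₂⟩
  have r2 : ∀ y, y < 60 → s₂.reg y = s₁.reg y := by
    intro y hy; rw [e₂, State.fill_reg, if_neg (by omega)]
  have m2 : ∀ a, a ≠ 23 → s₂.mem a = s₁.mem a := by
    intro a h; rw [e₂, State.fill_mem_ne _ _ _ _ _ _ h]
  have e23 : s₂.mem 23 = splice (s.mem 23) (v * (n + 1)) (xc + 1 + xd + 1) (env Ad) := by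
    rw [e₂, State.fill_mem_same, m1 _ (by omega) (by omega) (by omega)]; simp
  refine Runs.store_eq v (xc + 1 + xd) hB₂ (by simp [r2, r1, h30]) (by simp [r2, q39]) (by omega)
    fun hB => ?_
  refine Runs.store hB (hB.mem _ _) ?_
  have e26 : s₂.mem 26 d = bd := by
    rw [m2 _ (by omega), m1 _ (by omega) (by omega) (by omega), hd.base]
  simp only [Expr.val_cell, Expr.val_reg, State.setMem_reg, r2 30 (by omega), r1 30 (by omega), h30,
    r2 32 (by omega), r1 32 (by omega), h32, State.setMem_mem_ne _ _ _ (show 26 ≠ 24 by decide), e26,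
    Expr.cost_cell, Expr.cost_reg]
  generalize hs' : (s₂.setMem 24 _ _).setMem 26 _ _ = s'
  have k20 : s'.mem 20 = s.mem 20 := by simp [← hs', State.setMem_mem, m2, m1]
  have k25 : s'.mem 25 = s.mem 25 := by simp [← hs', State.setMem_mem, m2, m1]
  have k21 : s'.mem 21 = splice (s.mem 21) (v * (n + 1)) (xc + 1 + xd + 1)
    (env (optional w Qc + Pd)) := by simp [← hs', State.setMem_mem, m2, e21]
  have k22 : s'.mem 22 = splice (s.mem 22) (v * (n + 1)) (xc + 1 + xd + 1)
    (env (optional w Qc + Qd)) := by simp [← hs', State.setMem_mem, m2, e22, optional_eq_extend]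
  have k23 : s'.mem 23 = splice (s.mem 23) (v * (n + 1)) (xc + 1 + xd + 1) (env Ad) := by
    simp [← hs', State.setMem_mem, e23]
  have k24 : s'.mem 24 = Function.update (s.mem 24) v (xc + 1 + xd) := by
    simp [← hs', State.setMem_mem, m2, m1]
  have k26 : s'.mem 26 = Function.update (s.mem 26) v bd := by
    simp [← hs', State.setMem_mem, m2, m1]
  have k28 : s'.mem 28 = s₁.mem 28 := by simp [← hs', State.setMem_mem, m2]
  have hT := hc.tameQ.optional hw
  have hS := hc.rowQ.size_le.optional w
  have hne : (optional w Qc).Nonempty := ⟨0, zero_mem_optional _ _⟩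
  refine ⟨?_, by rw [k28]; exact hG, keep_of_rows (by omega) k20 k25 k21 k22 k23 k24 k26, ?_⟩
  · exact {
      pend := by rw [k24]; simp
      base := by rw [k26]; simp
      base_lt := hd.base_lt
      size := by rw [k25, hd.size]
      rowP := ⟨hne.add hd.rowP.nonempty, hS.add hd.rowP.size_le,
        low_of_tame (hne.add hd.rowP.nonempty) (hT.add hd.tameP) (hS.add hd.rowP.size_le) (by omega),
        fun i hi => by rw [k21, splice_add _ _ _ (by omega)]⟩
      rowQ := ⟨hne.add hd.rowQ.nonempty, hS.add hd.rowQ.size_le,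
        low_of_tame (hne.add hd.rowQ.nonempty) (hT.add hd.tameQ) (hS.add hd.rowQ.size_le) (by omega),
        fun i hi => by rw [k22, splice_add _ _ _ (by omega)]⟩
      rowA := ⟨hd.rowA.nonempty, hd.rowA.size_le.mono (by omega), hd.rowA.low,
        fun i hi => by rw [k23, splice_add _ _ _ (by omega)]⟩
      rowF := by rw [k20]; exact hd.rowF
      le := by omega
      zeroP := ⟨0, zero_mem_optional _ _, 0, hd.zeroP, by simp⟩
      zeroF := hd.zeroF
      tameP := hT.add hd.tameP
      tameQ := hT.add hd.tameQ
      tameF := hd.tameF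
      light := fun h => ⟨(hd.light h).1, (hd.light h).2.1, Set.add_subset_add_left (hd.light h).2.2⟩ }
  · have : xc + 2 ≤ (xc + 2) * (xd + 1) := Nat.le_mul_of_pos_right _ (by omega)
    have h' : xd + 1 ≤ (xc + 2) * (xd + 1) := Nat.le_mul_of_pos_left _ (by omega)
    norm_num only [← add_assoc]
    omega

/-- The base of c is attached only through the new node: choices in Q must contain it, whereas it is
optional in P. Of the subtrees with the new node as top, those from P are accounted for now, and
those from Q wait in A for the base. -/
theorem joinHeavy_runs {n M fc v c d xc xd mc md bc bd w : ℕ} {s : State}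
    (𝓐 : Set (ℕ × ℕ)) {Pc Qc Ac Fc Pd Qd Ad Fd : Set (ℕ × ℕ)} (hB : Bdd M s)
    (h2 : s.reg 2 = n + 1) (h9 : s.reg 9 = 0)
    (hc : NodeRep n fc s c xc mc bc Pc Qc Ac Fc) (hd : NodeRep n fc s d xd md bd Pd Qd Ad Fd)
    (h30 : s.reg 30 = v) (h31 : s.reg 31 = c) (h32 : s.reg 32 = d) (h33 : s.reg 33 = w)
    (hw : w ≤ 1) (hn : xc + 1 + xd + mc ≤ n) (hM : 8 * n + 8 ≤ M)
    (hcM : c * (n + 1) ≤ M) (hdM : d * (n + 1) ≤ M) (hvM : v * (n + 1) ≤ M)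
    (hcv : c ≠ v) (hb : bc ≠ 0) (hbd : bd = 0) :
    Runs M joinHeavy s fun s' t =>
      NodeRep n fc s' v (xc + 1 + xd) mc bc (optional w Pc + Qd) ({(1, w)} + Qc + Qd)
        (Ac ∪ ({(1, w)} + Qc)) Fc ∧
      Improved n 𝓐 ({(1, w)} + Pc) (s.mem 28) (s'.mem 28) ∧ Keep n fc {v} s s' ∧
      t ≤ 5000 * ((xc + 2) * (xd + 1)) := by
  obtain ⟨-, -, hPQ⟩ := hd.light hbd
  have hQ0 := hPQ hd.zeroP
  refine Runs.seq (joinRows_runs (R := Pc) (Y := Qd) 𝓐 hB h2 h9 hc hd h30 h31 h32 h33 hw (by omega)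
    hM hcM hdM hvM hc.rowP hc.zeroP hc.tameP hd.rowQ hd.tameQ (by simp) (by omega)
    (by omega)) ?_
  rintro s₁ t₁ hB₁ hF₁ ⟨hG, e21, e22, q34, q35, q36, q37, q38, q39, ht₁⟩
  have r1 : ∀ y, y < 34 → s₁.reg y = s.reg y := fun y hy =>
    hF₁.reg y fun hh => by have := joinRows_regs y hh; omega
  have m1 : ∀ a, a ≠ 21 → a ≠ 22 → a < 28 → s₁.mem a = s.mem a := fun y hy _ _ =>
    hF₁.mem y fun hh => by have := joinRows_arrs y hh; omega
  have rowQ₁ : Row n (s₁.mem 22) (c * (n + 1)) xc Qc := by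
    rw [e22]
    exact hc.rowQ.congr fun i hi => splice_other_row _ _ hcv (by omega) (by omega)
  refine Runs.seq (load_runs (Q := fun s' t => s' = _ ∧ t ≤ _) (doff := v * (n + 1))
    (soff := c * (n + 1)) (cap := xc) (w := 0) (N := xc + 1 + xd + 1) hB₁
    (by rw [m1 _ (by omega) (by omega) (by omega)]; exact hc.rowA) q36 q37 q34
    (by rw [r1 _ (by omega), h9]) (by intros; simp [q39]) (by omega)
    (fun _ => ⟨by omega, by omega, c, v, hcv, rfl, rfl⟩) (fun t _ ht => ⟨rfl, ht⟩)) ?_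
  rintro s₂ t₂ hB₂ - ⟨e₂, ht₂⟩
  have r2 : ∀ y, y < 60 → s₂.reg y = s₁.reg y := by
    intro y hy; rw [e₂, State.fill_reg, if_neg (by omega)]
  have m2 : ∀ a, a ≠ 23 → s₂.mem a = s₁.mem a := by
    intro a h; rw [e₂, State.fill_mem_ne _ _ _ _ _ _ h]
  refine Runs.seq (relaxRow_runs (Q := fun s' t => s' = _ ∧ t ≤ _) (doff := v * (n + 1))
    (soff := c * (n + 1)) (cap := xc) (w := w) (N := xc + 1 + xd + 1) hB₂
    (by rw [m2 _ (by omega)]; exact rowQ₁) (by rw [r2 _ (by omega), q36])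
    (by rw [r2 _ (by omega), q37]) (by rw [r2 _ (by omega), q34])
    (by rw [r2 _ (by omega), r1 _ (by omega), h33]) (by intros; simp [r2, q39]) (by omega)
    (by omega) (fun t _ ht => ⟨rfl, ht⟩)) ?_
  rintro s₃ t₃ hB₃ - ⟨e₃, ht₃⟩
  have r3 : ∀ y, y < 60 → s₃.reg y = s₁.reg y := by
    intro y hy; rw [e₃, State.fill_reg, if_neg (by omega), r2 y hy]
  have m3 : ∀ a, a ≠ 23 → s₃.mem a = s₁.mem a := by
    intro a h; rw [e₃, State.fill_mem_ne _ _ _ _ _ _ h, m2 a h]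
  have hQw : ({(1, w)} + Qc : Set (ℕ × ℕ)).Nonempty :=
    (Set.singleton_nonempty _).add hc.rowQ.nonempty
  have e23 : s₃.mem 23 = splice (s.mem 23) (v * (n + 1)) (xc + 1 + xd + 1)
      (env (Ac ∪ ({(1, w)} + Qc))) := by
    rw [e₃, State.fill_mem_same, e₂, State.fill_mem_same, m1 _ (by omega) (by omega) (by omega)]
    funext y
    simp only [splice]
    split
    · rename_i hy
      rw [env_union hc.rowA.nonempty hQw, env_add_one hc.rowQ.nonempty]
      simp [hy]
    · rfl
  refine Runs.store_eq v (xc + 1 + xd) hB₃ (by simp [r3, r1, h30]) (by simp [r3, q39]) (by omega)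
    fun hB => ?_
  refine Runs.store hB (hB.mem _ _) ?_
  have e26 : s₃.mem 26 c = bc := by
    rw [m3 _ (by omega), m1 _ (by omega) (by omega) (by omega), hc.base]
  simp only [Expr.val_cell, Expr.val_reg, State.setMem_reg, r3 30 (by omega), r1 30 (by omega), h30,
    r3 31 (by omega), r1 31 (by omega), h31, State.setMem_mem_ne _ _ _ (show 26 ≠ 24 by decide), e26,
    Expr.cost_cell, Expr.cost_reg]
  generalize hs' : (s₃.setMem 24 _ _).setMem 26 _ _ = s'
  have k20 : s'.mem 20 = s.mem 20 := by simp [← hs', State.setMem_mem, m3, m1]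
  have k25 : s'.mem 25 = s.mem 25 := by simp [← hs', State.setMem_mem, m3, m1]
  have k21 : s'.mem 21 = splice (s.mem 21) (v * (n + 1)) (xc + 1 + xd + 1)
    (env (optional w Pc + Qd)) := by simp [← hs', State.setMem_mem, m3, e21]
  have k22 : s'.mem 22 = splice (s.mem 22) (v * (n + 1)) (xc + 1 + xd + 1)
      (env ({(1, w)} + Qc + Qd)) := by
    rw [add_eq_extend]; simp [← hs', State.setMem_mem, m3, e22]
  have k23 : s'.mem 23 = splice (s.mem 23) (v * (n + 1)) (xc + 1 + xd + 1)
      (env (Ac ∪ ({(1, w)} + Qc))) := by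
    rw [← e23]; simp [← hs', State.setMem_mem]
  have k24 : s'.mem 24 = Function.update (s.mem 24) v (xc + 1 + xd) := by
    simp [← hs', State.setMem_mem, m3, m1]
  have k26 : s'.mem 26 = Function.update (s.mem 26) v bc := by
    simp [← hs', State.setMem_mem, m3, m1]
  have k28 : s'.mem 28 = s₁.mem 28 := by simp [← hs', State.setMem_mem, m3]
  have hT := hc.tameP.optional hw
  have hS := hc.rowP.size_le.optional w
  have hne : (optional w Pc).Nonempty := ⟨0, zero_mem_optional _ _⟩
  have hTQ := ((tame_one hw).add hc.tameQ).add hd.tameQ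
  have hSQ := (hc.rowQ.size_le.one_add w).add hd.rowQ.size_le
  refine ⟨?_, by rw [k28]; exact hG, keep_of_rows (by omega) k20 k25 k21 k22 k23 k24 k26, ?_⟩
  · exact {
      pend := by rw [k24]; simp
      base := by rw [k26]; simp
      base_lt := hc.base_lt
      size := by rw [k25, hc.size]
      rowP := ⟨hne.add hd.rowQ.nonempty, hS.add hd.rowQ.size_le,
        low_of_tame (hne.add hd.rowQ.nonempty) (hT.add hd.tameQ) (hS.add hd.rowQ.size_le) (by omega),
        fun i hi => by rw [k21, splice_add _ _ _ (by omega)]⟩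
      rowQ := ⟨hQw.add hd.rowQ.nonempty, hSQ,
        low_of_tame (hQw.add hd.rowQ.nonempty) hTQ hSQ (by omega),
        fun i hi => by rw [k22, splice_add _ _ _ (by omega)]⟩
      rowA := ⟨hc.rowA.nonempty.mono Set.subset_union_left, (hc.rowA.size_le.mono (by omega)).union
          ((hc.rowQ.size_le.one_add w).mono (by omega)),
        hc.rowA.low.imp fun a ha => ⟨.inl ha.1, ha.2⟩,
        fun i hi => by rw [k23, splice_add _ _ _ (by omega)]⟩
      rowF := by rw [k20]; exact hc.rowF
      le := by omega
      zeroP := ⟨0, zero_mem_optional _ _, 0, hQ0, by simp⟩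
      zeroF := hc.zeroF
      tameP := hT.add hd.tameQ
      tameQ := hTQ
      tameF := hc.tameF
      light := fun h => absurd h hb }
  · have : xc + 2 ≤ (xc + 2) * (xd + 1) := Nat.le_mul_of_pos_right _ (by omega)
    have h' : xd + 1 ≤ (xc + 2) * (xd + 1) := Nat.le_mul_of_pos_left _ (by omega)
    norm_num only [← add_assoc]
    omega

/-! ### Two components that both have a base -/

/-- Combine the components `reg 31` and `reg 32` with their bases; then all nodes of the former are
in the base, and all nodes of the latter are pending. -/
def settle (p : Program) : Program :=
  .assign 40 (.reg 31) ;; .assign 41 (.reg 0 + 1) ;; rebase p ;; .assign 31 (.reg 41) ;;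
  .assign 40 (.reg 32) ;; .assign 41 (.reg 0 + 2) ;; rebase p ;; .assign 32 (.reg 41) ;;
  .assign 46 (.cell 25 (.reg 42 - 1)) ;; .assign 43 (.reg 32 * .reg 2) ;;
  .assign 45 ((.reg 42 - 1) * .reg 2) ;;
  load 21 43 20 45 46 9 false (.reg 46 + 1) ;; load 22 43 20 45 46 9 false (.reg 46 + 1) ;;
  load 23 43 20 45 46 9 false (.reg 46 + 1) ;;
  .store 24 (.reg 32) (.reg 46) ;; .store 26 (.reg 32) 0

theorem settle_regs {p : Program} : ∀ x ∈ (settle p).regs,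
    x = 31 ∨ x = 32 ∨ (40 ≤ x ∧ x ≤ 67) ∨ 96 ≤ x := by
  intro x hx
  simp only [settle, Program.regs, List.mem_append, load_regs, List.mem_cons,
    List.not_mem_nil, or_false] at hx
  rcases hx with h | h | h | h | h | h | h | h | h | h | h | (h | h) | (h | h) | (h | h) <;>
    first | omega | (have := rebase_regs x h; omega)

theorem settle_arrs {p : Program} :
    ∀ x ∈ (settle p).arrs, (20 ≤ x ∧ x ≤ 26) ∨ x = 28 ∨ 50 ≤ x := by
  intro x hx
  simp only [settle, Program.arrs, List.mem_append, load_arrs, List.mem_cons,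
    List.not_mem_nil, or_false, false_or] at hx
  rcases hx with h | h | h | h | h | h | h <;>
    first | omega | (have := rebase_arrs x h; omega)

theorem settle_time {q x m x' m' V F t₁ t₂ u : ℕ} (hq : 1 ≤ q) (hV : q ≤ V)
    (h₁ : q * q * t₁ ≤ (2 * F + 9000) * ((x + q) * (m + 2 * q) * V))
    (h₂ : q * q * t₂ ≤ (2 * F + 9000) * ((x' + q) * (m' + 2 * q) * V))
    (hu : u ≤ t₁ + t₂ + 1000 * (x' + m' + 3 * q)) :
    q * q * u ≤ (2 * F + 11000) * ((x + q) * (m + 2 * q) * V + (x' + q) * (m' + 2 * q) * V) := by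
  have h := pairConv_time hq hV h₂ (u := t₂ + 1000 * (x' + m' + 3 * q)) le_rfl
  calc q * q * u ≤ q * q * t₁ + q * q * (t₂ + 1000 * (x' + m' + 3 * q)) := by
        rw [← mul_add]; exact Nat.mul_le_mul_left _ (by omega)
    _ ≤ (2 * F + 11000) * ((x + q) * (m + 2 * q) * V) + _ :=
        Nat.add_le_add (h₁.trans (Nat.mul_le_mul_right _ (by omega))) h
    _ = _ := by ring

/-- A join handles only one base. So c becomes a component with nothing pending, and the whole of d
is turned into pending nodes, however many. The scratch names n+1 and n+2 cannot clash, because c, d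
≤ n; the deferred row of the second component is a placeholder, as its base is the dummy one. -/
theorem settle_runs {p : Program} {n σ T M fc c d xc mc bc xd md bd : ℕ} {s : State}
    (𝓐 : Set (ℕ × ℕ)) {Pc Qc Ac Fc Pd Qd Ad Fd : Set (ℕ × ℕ)} (hp : CanMultiply p σ T M)
    (hB : Bdd M s) (hx : Ctx n σ s) (h0 : NodeRep n fc s 0 0 0 0 {0} {0} {(0, n)} {0})
    (hc : NodeRep n fc s c xc mc bc Pc Qc Ac Fc) (hd : NodeRep n fc s d xd md bd Pd Qd Ad Fd)
    (h31 : s.reg 31 = c) (h32 : s.reg 32 = d)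
    (h42 : s.reg 42 = fc) (h99 : s.reg 99 + 4 * calls n σ ≤ M) (hM : 8 * (n + σ * σ) + 8 ≤ M)
    (hcn : c ≤ n) (hdn : d ≤ n) (hfc : (fc + n + 4) * (n + 1) ≤ M) :
    Runs M (settle p) s fun s' t =>
      NodeRep n (fc + 2) s' (n + 1) 0 (xc + mc) fc {0} {0} {(0, n)} (Pc ∪ (Qc + Fc)) ∧
      NodeRep n (fc + 2) s' (n + 2) (xd + md) 0 0 (Pd ∪ (Qd + Fd)) (Pd ∪ (Qd + Fd))
        (Pd ∪ (Qd + Fd)) {0} ∧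
      Improved n 𝓐 ((Ac + Fc) ∪ (Ad + Fd)) (s.mem 28) (s'.mem 28) ∧
      Keep n fc {n + 1, n + 2} s s' ∧ s'.reg 31 = n + 1 ∧ s'.reg 32 = n + 2 ∧
      s'.reg 42 = fc + 2 ∧ Fresh s' ∧ s'.reg 99 ≤ s.reg 99 + 4 * calls n σ ∧
      σ * σ * (σ * σ) * t ≤ (2 * p.callFactor + 11000) *
        ((xc + σ * σ) * (mc + 2 * (σ * σ)) * (σ * T) +
          (xd + σ * σ) * (md + 2 * (σ * σ)) * (σ * T)) := by
  have hσ := hp.pos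
  have hfcM : fc + n + 4 ≤ M := (Nat.le_mul_of_pos_right _ (by omega)).trans hfc
  have hmulM : ∀ y, y ≤ fc + n + 4 → y * (n + 1) ≤ M := fun y hy =>
    (Nat.mul_le_mul_right _ hy).trans hfc
  have hxd := hd.le
  have hxc := hc.le
  refine Runs.assign_eq c hB h31 (by omega) fun hB => ?_
  refine Runs.assign_eq (n + 1) hB (by simp [hx.reg0]) (by omega) fun hB => ?_
  generalize hs₁ : (s.setReg 40 _).setReg 41 _ = s₁ at hB ⊢
  have m1 : s₁.mem = s.mem := by simp [← hs₁]
  have r1 : ∀ y, y ≠ 40 → y ≠ 41 → s₁.reg y = s.reg y := by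
    intro y h h'; simp [← hs₁, h, h']
  have k1 : Keep n fc ∅ s s₁ := .of_mem (by simp [m1])
  refine Runs.seq (rebase_runs (id := c) (d := n + 1) 𝓐 hp hB
    ⟨by simp [r1, hx.reg0], by simp [r1, hx.reg2], by simp [r1, hx.reg9], by simp [r1, hx.reg80],
      hx.fresh.of_eq (by simp [m1]) (by simp [r1])⟩ (hc.keep k1 (by simp) le_rfl)
    (by simp [← hs₁]) (by simp [← hs₁]) (by simp [r1, h42]) (by simp [r1]; omega) hM (by omega)
    (by omega) (hmulM _ (by omega))) ?_
  rintro s₂ t₂ hB₂ hF₂ ⟨hc₂, hG₂, k2, f42₂, fr₂, g₂, ht₂⟩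
  have r2 : ∀ y, y < 40 ∨ (67 < y ∧ y < 96) → s₂.reg y = s.reg y := fun y hy =>
    (hF₂.reg y fun hh => by have := rebase_regs y hh; omega).trans (r1 y (by omega) (by omega))
  have r2' : s₂.reg 41 = n + 1 :=
    (hF₂.reg _ fun hh => by have := rebase_regs _ hh; omega).trans (by simp [← hs₁])
  rw [m1] at hG₂
  rw [r1 99 (by omega) (by omega)] at g₂
  refine Runs.assign_eq (n + 1) hB₂ r2' (by omega) fun hB => ?_
  refine Runs.assign_eq d hB (by simp [r2, h32]) (by omega) fun hB => ?_
  refine Runs.assign_eq (n + 2) hB (by simp [r2, hx.reg0]) (by omega) fun hB => ?_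
  generalize hs₃ : ((s₂.setReg 31 _).setReg 40 _).setReg 41 _ = s₃ at hB ⊢
  have m3 : s₃.mem = s₂.mem := by simp [← hs₃]
  have r3 : ∀ y, y ≠ 31 → y ≠ 40 → y ≠ 41 → s₃.reg y = s₂.reg y := by
    intro y h h' h''; simp [← hs₃, h, h', h'']
  have k3 : Keep n (fc + 1) ∅ s₂ s₃ := .of_mem (by simp [m3])
  have k13 : Keep n fc {n + 1} s s₃ := ((k1.trans k2 le_rfl).trans k3 (by omega)).mono (by simp)
  refine Runs.seq (rebase_runs (id := d) (d := n + 2) (fc := fc + 1) 𝓐 hp hB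
    ⟨by simp [r3, r2, hx.reg0], by simp [r3, r2, hx.reg2], by simp [r3, r2, hx.reg9],
      by simp [r3, r2, hx.reg80], fr₂.of_eq (by simp [m3]) (by simp [r3])⟩
    (hd.keep k13 (by simp; omega) (Nat.le_succ _))
    (by simp [← hs₃]) (by simp [← hs₃]) (by simp [r3, f42₂]) (by simp [r3]; omega) hM (by omega)
    (by omega) (hmulM _ (by omega))) ?_
  rintro s₄ t₄ hB₄ hF₄ ⟨hd₄, hG₄, k4, f42₄, fr₄, g₄, ht₄⟩
  have r4 : ∀ y, y < 31 ∨ (31 < y ∧ y < 40) ∨ (67 < y ∧ y < 96) → s₄.reg y = s.reg y := fun y hy =>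
    (hF₄.reg y fun hh => by have := rebase_regs y hh; omega).trans
      ((r3 y (by omega) (by omega) (by omega)).trans (r2 y (by omega)))
  have r4' : s₄.reg 41 = n + 2 :=
    (hF₄.reg _ fun hh => by have := rebase_regs _ hh; omega).trans (by simp [← hs₃])
  have r4'' : s₄.reg 31 = n + 1 :=
    (hF₄.reg _ fun hh => by have := rebase_regs _ hh; omega).trans (by simp [← hs₃])
  rw [m3] at hG₄
  rw [r3 99 (by omega) (by omega) (by omega)] at g₄
  have k14 : Keep n fc {n + 1, n + 2} s s₄ := (k13.trans k4 (by omega)).mono (by simp [Set.pair_comm])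
  have hc₄ := (hc₂.keep (k3.trans k4 le_rfl) (by simp) (by omega) : NodeRep n (fc + 2) s₄ _ _ _ _ _ _ _ _)
  have h0₄ := (h0.keep k14 (by simp) (by omega) : NodeRep n (fc + 2) s₄ _ _ _ _ _ _ _ _)
  refine Runs.assign_eq (n + 2) hB₄ r4' (by omega) fun hB => ?_
  refine Runs.assign_eq (xd + md) hB (by simp [f42₄, hd₄.size]) (by omega) fun hB => ?_
  refine Runs.assign_eq ((n + 2) * (n + 1)) hB (by simp [r4, hx.reg2])
    (hmulM _ (by omega)) fun hB => ?_
  refine Runs.assign_eq ((fc + 1) * (n + 1)) hB (by simp [r4, hx.reg2, f42₄])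
    (hmulM _ (by omega)) fun hB => ?_
  generalize hs₅ : (((s₄.setReg 32 _).setReg 46 _).setReg 43 _).setReg 45 _ = s₅ at hB ⊢
  have m5 : s₅.mem = s₄.mem := by simp [← hs₅]
  have r5 : ∀ y, y ≠ 32 → y ≠ 46 → y ≠ 43 → y ≠ 45 → s₅.reg y = s₄.reg y := by
    intro y h h' h'' h'''; simp [← hs₅, h, h', h'', h''']
  have h43 : s₅.reg 43 = (n + 2) * (n + 1) := by simp [← hs₅]
  have h45 : s₅.reg 45 = (fc + 1) * (n + 1) := by simp [← hs₅]
  have h46 : s₅.reg 46 = xd + md := by simp [← hs₅]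
  have h32₅ : s₅.reg 32 = n + 2 := by simp [← hs₅]
  have h9 : s₅.reg 9 = 0 := by simp [r5, r4, hx.reg9]
  clear hs₅
  have rowF : Row n (s₄.mem 20) ((fc + 1) * (n + 1)) (xd + md) (Pd ∪ (Qd + Fd)) := hd₄.rowF
  refine Runs.seq (load_runs (Q := fun s' t => s' = _ ∧ t ≤ _) (w := 0) (N := xd + md + 1) hB
    (m5 ▸ rowF) h43 h45 h46 h9 (by intros; simp [h46]) (by omega) (by omega)
    (fun t _ ht => ⟨rfl, ht⟩)) ?_
  rintro s₆ t₆ hB₆ - ⟨e₆, ht₆⟩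
  have r6 : ∀ y, y ≠ 67 → s₆.reg y = s₅.reg y := by intro y hy; simp [e₆, hy]
  refine Runs.seq (load_runs (Q := fun s' t => s' = _ ∧ t ≤ _) (w := 0) (soff := (fc + 1) * (n + 1))
    (doff := (n + 2) * (n + 1)) (cap := xd + md) (N := xd + md + 1) hB₆
    (by rw [e₆, State.fill_mem_ne _ _ _ _ _ _ (by omega), m5]; exact rowF)
    (by rw [r6 _ (by omega), h43]) (by rw [r6 _ (by omega), h45]) (by rw [r6 _ (by omega), h46])
    (by rw [r6 _ (by omega), h9]) (by intros; simp [r6, h46]) (by omega) (by omega)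
    (fun t _ ht => ⟨rfl, ht⟩)) ?_
  rintro s₇ t₇ hB₇ - ⟨e₇, ht₇⟩
  have r7 : ∀ y, y ≠ 67 → s₇.reg y = s₅.reg y := by intro y hy; simp [e₇, hy, r6]
  refine Runs.seq (load_runs (Q := fun s' t => s' = _ ∧ t ≤ _) (w := 0) (soff := (fc + 1) * (n + 1))
    (doff := (n + 2) * (n + 1)) (cap := xd + md) (N := xd + md + 1) hB₇
    (by rw [e₇, State.fill_mem_ne _ _ _ _ _ _ (by omega), e₆,
      State.fill_mem_ne _ _ _ _ _ _ (by omega), m5]; exact rowF)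
    (by rw [r7 _ (by omega), h43]) (by rw [r7 _ (by omega), h45]) (by rw [r7 _ (by omega), h46])
    (by rw [r7 _ (by omega), h9]) (by intros; simp [r7, h46]) (by omega) (by omega)
    (fun t _ ht => ⟨rfl, ht⟩)) ?_
  rintro s₈ t₈ hB₈ - ⟨e₈, ht₈⟩
  have r8 : ∀ y, y ≠ 67 → s₈.reg y = s₅.reg y := by intro y hy; simp [e₈, hy, r7]
  have m8 : ∀ a, a ≠ 21 → a ≠ 22 → a ≠ 23 → s₈.mem a = s₄.mem a := by
    intro a h h' h''
    simp [e₈, e₇, e₆, State.fill_mem, h, h', h'', m5]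
  refine Runs.store_eq (n + 2) (xd + md) hB₈ (by simp [r8, h32₅]) (by simp [r8, h46]) (by omega)
    fun hB => ?_
  refine Runs.store hB (by simp) ?_
  simp only [Expr.val_zero, Expr.val_reg, State.setMem_reg, r8 32 (by omega), h32₅,
    Expr.cost_cell, Expr.cost_reg, Expr.cost_add, Expr.cost_one, Expr.cost_mul, Expr.cost_sub,
    Expr.cost_zero, Expr.cost_two]
  generalize hs' : (s₈.setMem 24 _ _).setMem 26 _ _ = s'
  have q' : ∀ y, y ≠ 67 → s'.reg y = s₅.reg y := by intro y hy; simp [← hs', r8 y hy]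
  have l20 : s'.mem 20 = s₄.mem 20 := by simp [← hs', State.setMem_mem, m8]
  have l25 : s'.mem 25 = s₄.mem 25 := by simp [← hs', State.setMem_mem, m8]
  have l28 : s'.mem 28 = s₄.mem 28 := by simp [← hs', State.setMem_mem, m8]
  have l21 : s'.mem 21 = splice (s₄.mem 21) ((n + 2) * (n + 1)) (xd + md + 1)
    (env (Pd ∪ (Qd + Fd))) := by simp [← hs', e₈, e₇, e₆, State.fill_mem, State.setMem_mem, m5]
  have l22 : s'.mem 22 = splice (s₄.mem 22) ((n + 2) * (n + 1)) (xd + md + 1)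
    (env (Pd ∪ (Qd + Fd))) := by simp [← hs', e₈, e₇, e₆, State.fill_mem, State.setMem_mem, m5]
  have l23 : s'.mem 23 = splice (s₄.mem 23) ((n + 2) * (n + 1)) (xd + md + 1)
    (env (Pd ∪ (Qd + Fd))) := by simp [← hs', e₈, e₇, e₆, State.fill_mem, State.setMem_mem, m5]
  have l24 : s'.mem 24 = Function.update (s₄.mem 24) (n + 2) (xd + md) := by
    simp [← hs', State.setMem_mem, m8]
  have l26 : s'.mem 26 = Function.update (s₄.mem 26) (n + 2) 0 := by
    simp [← hs', State.setMem_mem, m8]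
  have k4' : Keep n (fc + 2) {n + 2} s₄ s' :=
    keep_of_rows (by omega) l20 l25 l21 l22 l23 l24 l26
  refine ⟨hc₄.keep k4' (by simp) le_rfl, ?_, ?_, (k14.trans k4' (by omega)).mono (by simp),
    by simp [r8, r5, r4''], by simp, by simp [r8, r5, f42₄], ?_, ?_, ?_⟩
  · have hrow : ∀ A : ℕ → ℕ, Row n (splice A ((n + 2) * (n + 1)) (xd + md + 1)
        (env (Pd ∪ (Qd + Fd)))) ((n + 2) * (n + 1)) (xd + md) (Pd ∪ (Qd + Fd)) := fun A =>
      ⟨rowF.nonempty, rowF.size_le, rowF.low, fun i hi => by rw [splice_add _ _ _ (by omega)]⟩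
    exact {
      pend := by rw [l24]; simp
      base := by rw [l26]; simp
      base_lt := by omega
      size := by rw [l25, h0₄.size]
      rowP := by rw [l21]; exact hrow _
      rowQ := by rw [l22]; exact hrow _
      rowA := by rw [l23]; exact hrow _
      rowF := by rw [l20]; exact h0₄.rowF
      le := by omega
      zeroP := hd₄.zeroF
      zeroF := rfl
      tameP := hd₄.tameF
      tameQ := hd₄.tameF
      tameF := tame_zero
      light := fun _ => ⟨rfl, rfl, le_rfl⟩ }
  · rw [l28]; exact hG₂.trans hG₄
  · refine fr₄.of_eq (fun a ha => ?_) (by simp [q', r5])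
    simp only [← hs']
    rw [State.setMem_mem_ne _ _ _ (by omega), State.setMem_mem_ne _ _ _ (by omega),
      m8 a (by omega) (by omega) (by omega)]
  · simp [r8, r5]; omega
  · have hq : 1 ≤ σ * σ := by have := Nat.le_mul_of_pos_left σ hσ; omega
    have key := fun u => settle_time (u := u) hq
      (hp.sq_le_time.trans (Nat.le_mul_of_pos_left _ hσ)) ht₂ ht₄
    refine key _ ?_
    norm_num only [← add_assoc]; omega

/-! ### Amortized time -/

/-- The parameters of the time analysis: `q` is the square of the size of the matrices, `V` bounds the
time for a product times the size, `R` and `W` are constants. -/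
structure Rates where
  q : ℕ
  V : ℕ
  r : ℕ
  R : ℕ

namespace Rates

/-- The amount of time that may have been spent on a component with base `b`, with `x` pending
nodes and `m` nodes in the base. -/
def pot (κ : Rates) (b x m : ℕ) : ℕ :=
  if b = 0 then 5000 * (κ.q * κ.q * (x * x))
  else 10000 * (κ.q * κ.q * (κ.r * (x + m))) + 30 * κ.R * (κ.V * (m * m))

/-- For q = ⌊√r⌋² one has q ≤ r ≤ 3q, and q ≤ V reflects that a product takes at least quadratic
time. -/
structure Valid (κ : Rates) : Prop where
  one_le : 1 ≤ κ.q
  le_V : κ.q ≤ κ.V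
  le_r : κ.q ≤ κ.r
  r_le : κ.r ≤ 3 * κ.q
  le_R : 10000 ≤ κ.R

/-- The time `t` is paid for by the difference of the potentials, also when a rebase follows. -/
def Charge (κ : Rates) (x m b t φ : ℕ) : Prop :=
  (x < κ.r → κ.q * κ.q * t + φ ≤ κ.pot b x m + 40000 * (κ.q * κ.q * κ.r)) ∧
  (κ.r ≤ x → ∀ t', κ.q * κ.q * t' ≤ κ.R * ((x + κ.q) * (m + 2 * κ.q) * κ.V) →
    κ.q * κ.q * (t + t') + φ ≤ κ.pot 1 0 (x + m) + 40000 * (κ.q * κ.q * κ.r))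

theorem pot_zero (κ : Rates) (x m : ℕ) : κ.pot 0 x m = 5000 * (κ.q * κ.q * (x * x)) := if_pos rfl

theorem pot_of_ne (κ : Rates) {b : ℕ} (hb : b ≠ 0) (x m : ℕ) : κ.pot b x m =
    10000 * (κ.q * κ.q * (κ.r * (x + m))) + 30 * κ.R * (κ.V * (m * m)) := if_neg hb

/-- A rebase pays for itself. As q ≤ r ≤ x, its cost is covered by the growth of the quadratic term
from m² to (x+m)². For a component without base, the old term in x² becomes a linear one with factor
r, because x ≤ 2r. -/
theorem charge_of_le {κ : Rates} (hκ : κ.Valid) {x m b t φ : ℕ} (hb : b = 0 → m = 0)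
    (hb' : b ≠ 0 → κ.r ≤ m) (hx : b = 0 → x ≤ 2 * κ.r)
    (h : κ.q * κ.q * t + φ ≤ κ.pot b x m + 40000 * (κ.q * κ.q * κ.r)) : κ.Charge x m b t φ := by
  refine ⟨fun _ => h, fun hrx t' ht' => ?_⟩
  have h1 : κ.pot b x m + κ.R * ((x + κ.q) * (m + 2 * κ.q) * κ.V) ≤ κ.pot 1 0 (x + m) := by
    have hq := hκ.one_le
    have hr := hκ.le_r
    rw [pot_of_ne _ one_ne_zero]
    by_cases h0 : b = 0
    · obtain rfl := hb h0
      subst h0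
      rw [pot_zero]
      have hx := hx rfl
      have e1 : x * x ≤ 2 * (κ.r * (0 + (x + 0))) := by nlinarith
      have e2 : (x + κ.q) * (0 + 2 * κ.q) ≤ 30 * ((x + 0) * (x + 0)) := by nlinarith
      calc _ ≤ 5000 * (κ.q * κ.q * (2 * (κ.r * (0 + (x + 0))))) +
            κ.R * (30 * ((x + 0) * (x + 0)) * κ.V) := by gcongr
        _ = _ := by ring
    · have hm := hb' h0
      rw [pot_of_ne _ h0]
      have e2 : (x + κ.q) * (m + 2 * κ.q) + 30 * (m * m) ≤ 30 * ((x + m) * (x + m)) := by nlinarith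
      calc _ = 10000 * (κ.q * κ.q * (κ.r * (0 + (x + m)))) +
            κ.R * κ.V * ((x + κ.q) * (m + 2 * κ.q) + 30 * (m * m)) := by ring
        _ ≤ 10000 * (κ.q * κ.q * (κ.r * (0 + (x + m)))) +
            κ.R * κ.V * (30 * ((x + m) * (x + m))) := by gcongr
        _ = _ := by ring
  rw [mul_add]
  omega

/-- The main cost x x' is covered by the growth of the square if both components are without base,
and otherwise by the linear term, since x, x' < r. What remains is O(r) per node. -/
theorem charge_join {κ : Rates} (hκ : κ.Valid) {x x' m b t : ℕ} (hx : x < κ.r) (hx' : x' < κ.r)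
    (hb : b = 0 → m = 0) (hb' : b ≠ 0 → κ.r ≤ m)
    (ht : t ≤ 5000 * ((x + 2) * (x' + 1)) + 100 ∨ t ≤ 5000 * ((x' + 2) * (x + 1)) + 100) :
    κ.Charge (x + 1 + x') m b t (κ.pot 0 x 0 + κ.pot b x' m) := by
  have hq := hκ.one_le
  have hr := hκ.le_r
  have ht' : t ≤ 5000 * (x * x') + 30000 * κ.r := by
    rcases ht with h | h <;> nlinarith
  have ht2 : κ.q * κ.q * t ≤ 5000 * (κ.q * κ.q * (x * x')) + 30000 * (κ.q * κ.q * κ.r) := by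
    calc _ ≤ κ.q * κ.q * (5000 * (x * x') + 30000 * κ.r) := Nat.mul_le_mul_left _ ht'
      _ = _ := by ring
  refine charge_of_le hκ hb hb' (by omega) ?_
  rw [pot_zero]
  by_cases h0 : b = 0
  · subst h0
    rw [pot_zero, pot_zero]
    have e : x * x' + (x * x + x' * x') ≤ (x + 1 + x') * (x + 1 + x') := by nlinarith
    have := Nat.mul_le_mul_left (5000 * (κ.q * κ.q)) e
    linarith [Nat.zero_le (κ.q * κ.q * κ.r)]
  · rw [pot_of_ne _ h0, pot_of_ne _ h0]
    have e : x * x' + x * x + 2 * (κ.r * (x' + m)) ≤ 2 * (κ.r * (x + 1 + x' + m)) := by nlinarith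
    have := Nat.mul_le_mul_left (5000 * (κ.q * κ.q)) e
    linarith [Nat.zero_le (κ.q * κ.q * κ.r)]

/-- Both bases have at least r ≥ q nodes, so the two rebases, the join and the rebase that follows
all cost O(m m' V) after scaling by q². The cross term of the square of the total size pays for
them. -/
theorem charge_settle {κ : Rates} (hκ : κ.Valid) {x m x' m' b b' c t₁ t₂ t : ℕ} (hx : x < κ.r)
    (hx' : x' < κ.r) (hb : b ≠ 0) (hb' : b' ≠ 0) (hm : κ.r ≤ m) (hm' : κ.r ≤ m')
    (ht₁ : κ.q * κ.q * t₁ ≤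
      κ.R * ((x + κ.q) * (m + 2 * κ.q) * κ.V + (x' + κ.q) * (m' + 2 * κ.q) * κ.V))
    (ht₂ : t₂ ≤ 5000 * ((0 + 2) * (x' + m' + 1))) (ht : t ≤ t₁ + t₂ + 100) :
    κ.Charge (0 + 1 + (x' + m')) (x + m) c t (κ.pot b x m + κ.pot b' x' m') := by
  have hq := hκ.one_le
  have hr := hκ.le_r
  have hr' := hκ.r_le
  -- At least m' ≥ r nodes are pending now, so a rebase always follows and the other case is void.
  refine ⟨fun h => by omega, fun _ t' ht' => ?_⟩
  rw [pot_of_ne _ hb, pot_of_ne _ hb', pot_of_ne _ one_ne_zero]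
  obtain ⟨z, hz⟩ : ∃ z, z = m * m' := ⟨_, rfl⟩
  have e1 : (x + κ.q) * (m + 2 * κ.q) + (x' + κ.q) * (m' + 2 * κ.q) ≤ 24 * z := by
    have h1 : (x + κ.q) * (m + 2 * κ.q) ≤ (4 * κ.q) * (3 * m) := by gcongr <;> omega
    have h2 : (x' + κ.q) * (m' + 2 * κ.q) ≤ (4 * κ.q) * (3 * m') := by gcongr <;> omega
    have h3 : κ.q * m ≤ z := by rw [hz, mul_comm]; gcongr; omega
    have h4 : κ.q * m' ≤ z := by rw [hz]; gcongr; omega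
    linarith
  have e2 : (0 + 1 + (x' + m') + κ.q) * (x + m + 2 * κ.q) ≤ 16 * z := by
    calc _ ≤ (4 * m') * (4 * m) := by gcongr <;> omega
      _ = _ := by rw [hz]; ring
  have e3 : κ.q * κ.q * (t₂ + 100) ≤ 50000 * (z * κ.V) := by
    calc κ.q * κ.q * (t₂ + 100) ≤ κ.q * κ.q * (50000 * m') := by gcongr; omega
      _ = 50000 * (κ.q * m' * κ.q) := by ring
      _ ≤ 50000 * (m * m' * κ.V) := by gcongr <;> [omega; exact hκ.le_V]
      _ = _ := by rw [hz]
  have f1 : κ.q * κ.q * t₁ ≤ κ.R * (24 * z * κ.V) := by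
    refine ht₁.trans (Nat.mul_le_mul_left _ ?_)
    rw [← add_mul]; gcongr
  have f2 : κ.q * κ.q * t' ≤ κ.R * (16 * z * κ.V) := ht'.trans (by gcongr)
  have f3 : 50000 * (z * κ.V) ≤ 5 * κ.R * (z * κ.V) := by
    gcongr; have := hκ.le_R; omega
  have f4 : κ.q * κ.q * (t + t') ≤ 45 * κ.R * (z * κ.V) := by
    calc κ.q * κ.q * (t + t') ≤ κ.q * κ.q * (t₁ + (t₂ + 100) + t') := by gcongr; omega
      _ = κ.q * κ.q * t₁ + κ.q * κ.q * (t₂ + 100) + κ.q * κ.q * t' := by ring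
      _ ≤ κ.R * (24 * z * κ.V) + 5 * κ.R * (z * κ.V) + κ.R * (16 * z * κ.V) :=
          Nat.add_le_add (Nat.add_le_add f1 (e3.trans f3)) f2
      _ = _ := by ring
  have e4 : m * m + m' * m' + 2 * z ≤ (0 + 1 + (x' + m') + (x + m)) * (0 + 1 + (x' + m') + (x + m)) := by
    rw [hz]; nlinarith
  have f5 := Nat.mul_le_mul_left (30 * κ.R * κ.V) e4
  have f6 := Nat.mul_le_mul_left (10000 * (κ.q * κ.q * κ.r))
    (show x + m + (x' + m') ≤ 0 + (0 + 1 + (x' + m') + (x + m)) by omega)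
  linarith [Nat.zero_le (15 * κ.R * (z * κ.V))]

end Rates

end Jumbled

namespace WordRAM

/-! ### Branches whose test is known -/

theorem Runs.ite_pos {M : ℕ} {s : State} {e : Expr} {p q : Program} {Q : State → ℕ → Prop}
    (hB : Bdd M s) (h : e.val s ≠ 0) (hp : Runs M p s Q) (he : e.small = true := by rfl) :
    Runs M (.ite e p q) s fun s' t => ∃ t', t = e.cost + 1 + t' ∧ Q s' t' :=
  Runs.ite hB (fun _ => hp.mono fun _ t _ _ hQ => ⟨t, rfl, hQ⟩) (fun h' => absurd h' h) he

theorem Runs.ite_neg {M : ℕ} {s : State} {e : Expr} {p q : Program} {Q : State → ℕ → Prop}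
    (hB : Bdd M s) (h : e.val s = 0) (hq : Runs M q s Q) (he : e.small = true := by rfl) :
    Runs M (.ite e p q) s fun s' t => ∃ t', t = e.cost + 1 + t' ∧ Q s' t' :=
  Runs.ite hB (fun h' => absurd h h') (fun _ => hq.mono fun _ t _ _ hQ => ⟨t, rfl, hQ⟩) he

end WordRAM

namespace Jumbled

open WordRAM

/-! ### Adding a node -/

/-- Join the component `reg 31`, extended by the new node, to the component `reg 32`. -/
def join (p : Program) : Program :=
  .ite (.cell 26 (.reg 31) * .cell 26 (.reg 32)) (settle p) .skip ;;
  .ite (.cell 26 (.reg 31)) joinHeavy joinLight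

theorem joinIte_regs {e : Expr} : ∀ x ∈ (Program.ite e joinHeavy joinLight).regs,
    (34 ≤ x ∧ x ≤ 39) ∨ (60 ≤ x ∧ x ≤ 67) := by
  intro x hx
  simp only [Program.regs, List.mem_append] at hx
  exact hx.elim (joinHeavy_regs x) (joinLight_regs x)

theorem joinIte_arrs {e : Expr} : ∀ a ∈ (Program.ite e joinHeavy joinLight).arrs,
    (21 ≤ a ∧ a ≤ 26) ∨ a = 28 ∨ (53 ≤ a ∧ a ≤ 55) := by
  intro x hx
  simp only [Program.arrs, List.mem_append] at hx
  exact hx.elim (joinHeavy_arrs x) (joinLight_arrs x)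

theorem join_regs {p : Program} : ∀ x ∈ (join p).regs,
    x = 31 ∨ x = 32 ∨ (34 ≤ x ∧ x ≤ 67) ∨ 96 ≤ x := by
  intro x hx
  rw [join, Program.regs, List.mem_append] at hx
  rcases hx with h | h
  · simp only [Program.regs, List.append_nil] at h
    have := settle_regs x h; omega
  · have := joinIte_regs x h; omega

theorem join_arrs {p : Program} :
    ∀ x ∈ (join p).arrs, (20 ≤ x ∧ x ≤ 26) ∨ x = 28 ∨ 50 ≤ x := by
  intro x hx
  rw [join, Program.arrs, List.mem_append] at hx
  rcases hx with h | h
  · simp only [Program.arrs, List.append_nil] at h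
    have := settle_arrs x h; omega
  · have := joinIte_arrs x h; omega

/-- A represented component: its family, the pairs that are not yet accounted for, the numbers of
nodes that are pending and in the base, and the base. -/
def Comp (n : ℕ) (𝓐 : Set (ℕ × ℕ)) (r fc : ℕ) (s : State) (id : ℕ) (𝓕 𝓓 : Set (ℕ × ℕ))
    (x m b : ℕ) : Prop :=
  ∃ P Q A Fb, NodeRep n fc s id x m b P Q A Fb ∧ 𝓕 = P ∪ (Q + Fb) ∧
    (𝓓 = if b = 0 then ∅ else A + Fb) ∧ A + Fb ⊆ 𝓐 ∧ (b ≠ 0 → r ≤ m)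

theorem Comp.keep {n r fc fc' id x m b : ℕ} {s s' : State} {𝓐 𝓕 𝓓 : Set (ℕ × ℕ)} {V : Set ℕ}
    (h : Comp n 𝓐 r fc s id 𝓕 𝓓 x m b) (hk : Keep n fc V s s') (hid : id ∉ V) (hf : fc ≤ fc') :
    Comp n 𝓐 r fc' s' id 𝓕 𝓓 x m b := by
  obtain ⟨P, Q, A, Fb, hN, h⟩ := h
  exact ⟨P, Q, A, Fb, hN.keep hk hid hf, h⟩

/-- All of `𝓧` is accounted for in `G'`, or deferred. -/
structure Progress (n : ℕ) (𝓐 𝓧 𝓓 : Set (ℕ × ℕ)) (G G' : ℕ → ℕ) : Prop where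
  le : ∀ i, G' i ≤ G i
  sound : Sound n 𝓐 G → Sound n 𝓐 G'
  cover : 𝓧 ⊆ done G' ∪ 𝓓

theorem optional_union (w : ℕ) (𝓟 𝓠 : Set (ℕ × ℕ)) :
    optional w (𝓟 ∪ 𝓠) = optional w 𝓟 ∪ ({(1, w)} + 𝓠) := by
  rw [optional, optional, Set.add_union, Set.union_assoc]

/-- Leaving out the new node leaves only the empty choice, which can be listed under P. So the part
that uses the base may be taken with the new node mandatory. -/
theorem heavy_family (w : ℕ) (P Q F D : Set (ℕ × ℕ)) :
    optional w (P ∪ (Q + F)) + D = (optional w P + D) ∪ ({(1, w)} + Q + D + F) := by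
  rw [optional_union, Set.union_add]
  simp only [add_assoc, add_comm, add_left_comm]

theorem light_family (w : ℕ) {P Q : Set (ℕ × ℕ)} (h : P ⊆ Q) (P' Q' F' : Set (ℕ × ℕ)) :
    optional w (P ∪ (Q + {0})) + (P' ∪ (Q' + F')) =
      (optional w Q + P') ∪ (optional w Q + Q' + F') := by
  have e : P ∪ (Q + {0}) = Q := by simpa [Set.add_singleton] using h
  rw [e, Set.add_union, add_assoc]

theorem join_runs {p : Program} {n σ T M fc v c d xc xd mc md bc bd w : ℕ} {s : State}
    {κ : Rates} (𝓐 : Set (ℕ × ℕ)) {𝓕c 𝓓c 𝓕d 𝓓d : Set (ℕ × ℕ)} (hp : CanMultiply p σ T M)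
    (hB : Bdd M s) (hx : Ctx n σ s) (hκ : κ.Valid) (hκq : κ.q = σ * σ) (hκV : κ.V = σ * T)
    (hκR : κ.R = 2 * p.callFactor + 11000)
    (h0 : NodeRep n fc s 0 0 0 0 {0} {0} {(0, n)} {0})
    (hc : Comp n 𝓐 κ.r fc s c 𝓕c 𝓓c xc mc bc) (hd : Comp n 𝓐 κ.r fc s d 𝓕d 𝓓d xd md bd)
    (h30 : s.reg 30 = v) (h31 : s.reg 31 = c) (h32 : s.reg 32 = d) (h33 : s.reg 33 = w)
    (h42 : s.reg 42 = fc) (h99 : s.reg 99 + 4 * calls n σ ≤ M) (hM : 8 * (n + σ * σ) + 8 ≤ M)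
    (hcn : c ≤ n) (hdn : d ≤ n) (hvn : v ≤ n) (hcv : c ≠ v) (hdv : d ≠ v)
    (hfc : (fc + n + 4) * (n + 1) ≤ M) (hw : w ≤ 1)
    (hxc : xc < κ.r) (hxd : xd < κ.r) (hsz : xc + mc + 1 + (xd + md) ≤ n)
    (hA : {(1, w)} + 𝓕c ⊆ 𝓐) (hjunk : ∀ a : ℕ × ℕ, n ≤ a.2 → a ∈ 𝓐) :
    Runs M (join p) s fun s' t => ∃ x m b fc' 𝓓,
      Comp n 𝓐 κ.r fc' s' v (optional w 𝓕c + 𝓕d) 𝓓 x m b ∧ x + m = xc + mc + 1 + (xd + md) ∧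
      fc ≤ fc' ∧ fc' ≤ fc + 2 ∧ s'.reg 42 = fc' ∧
      Progress n 𝓐 (𝓓c ∪ 𝓓d ∪ ({(1, w)} + 𝓕c)) 𝓓 (s.mem 28) (s'.mem 28) ∧
      Keep n fc {n + 1, n + 2, v} s s' ∧
      Fresh s' ∧ s'.reg 99 ≤ s.reg 99 + 4 * calls n σ ∧
      κ.Charge x m b t (κ.pot bc xc mc + κ.pot bd xd md) := by
  obtain ⟨Pc, Qc, Ac, Fc, hNc, rfl, rfl, hAc, hmc⟩ := hc
  obtain ⟨Pd, Qd, Ad, Fd, hNd, rfl, rfl, hAd, hmd⟩ := hd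
  have hfcM : fc + n + 4 ≤ M := (Nat.le_mul_of_pos_right _ (by omega)).trans hfc
  have hmulM : ∀ y, y ≤ fc + n + 4 → y * (n + 1) ≤ M := fun y hy =>
    (Nat.mul_le_mul_right _ hy).trans hfc
  by_cases hb : bc ≠ 0 ∧ bd ≠ 0
  · refine Runs.seq (Runs.ite_pos hB (by simp [h31, h32, hNc.base, hNd.base, hb.1, hb.2])
      (settle_runs 𝓐 hp hB hx h0 hNc hNd h31 h32 h42 h99 hM hcn hdn hfc)) ?_
    rintro s₁ _ hB₁ hF₁ ⟨t₁, rfl, hNc₁, hNd₁, hG₁, k₁, f31, f32, f42, fr, f99, ht₁⟩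
    have r1 : ∀ y, y < 31 ∨ y = 33 → s₁.reg y = s.reg y := fun y hy =>
      hF₁.reg y fun hh => by
        have := settle_regs (p := p) y (by simpa [Program.regs] using hh); omega
    refine (Runs.ite_pos hB₁ (by simp [f31, hNc₁.base]; have := hNc.base_lt; omega)
      (joinHeavy_runs (w := w) (v := v) 𝓐 hB₁ (by rw [r1 _ (by omega), hx.reg2])
        (by rw [r1 _ (by omega), hx.reg9]) hNc₁ hNd₁ (by rw [r1 _ (by omega), h30]) f31 f32
        (by rw [r1 _ (by omega), h33]) hw (by omega) (by omega) (hmulM _ (by omega))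
        (hmulM _ (by omega)) (hmulM _ (by omega)) (by omega) (by have := hNc.base_lt; omega)
        rfl)).mono ?_
    rintro s₂ _ hB₂ hF₂ ⟨t₂, rfl, hN₂, hG₂, k₂, ht₂⟩
    have r2 : ∀ y, (y < 34 ∨ (39 < y ∧ y < 60) ∨ 67 < y) → s₂.reg y = s₁.reg y := fun y hy =>
      hF₂.reg y fun hh => by have := joinIte_regs y hh; omega
    have m2 : ∀ a, 100 ≤ a → s₂.mem a = s₁.mem a := fun y hy =>
      hF₂.mem y fun hh => by have := joinIte_arrs y hh; omega
    have hone' : ({(1, w)} : Set (ℕ × ℕ)) + {0} = {(1, w)} := by simp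
    have hone : ({(1, w)} : Set (ℕ × ℕ)) + {0} + (Pc ∪ (Qc + Fc)) = {(1, w)} + (Pc ∪ (Qc + Fc)) := by
      rw [hone']
    -- Combinations with the dummy pair have at least n ones, and such pairs belong to 𝓐 by `hjunk`.
    have hjF : ({(0, n)} : Set (ℕ × ℕ)) + (Pc ∪ (Qc + Fc)) ⊆ 𝓐 := by
      rintro _ ⟨a, rfl, e, -, rfl⟩
      exact hjunk _ (by simp)
    refine ⟨_, _, _, fc + 2, _, ⟨_, _, _, _, hN₂, ?_, rfl, ?_, ?_⟩, by omega, by omega, le_rfl,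
      by rw [r2 _ (by omega), f42], ?_,
      (k₁.trans k₂ (by omega)).mono (by intro y; simp; tauto), fr.of_eq m2 (r2 _ (by omega)),
      by rw [r2 _ (by omega)]; exact f99, ?_⟩
    · have e : ({0} : Set (ℕ × ℕ)) ∪ ({0} + (Pc ∪ (Qc + Fc))) = Pc ∪ (Qc + Fc) := by
        simpa [Set.singleton_add] using Or.inl hNc.zeroP
      have := heavy_family w {0} {0} (Pc ∪ (Qc + Fc)) (Pd ∪ (Qd + Fd))
      rwa [e] at this
    · rw [Set.union_add, hone]
      exact Set.union_subset hjF hA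
    · have := hmc hb.1; omega
    · refine ⟨fun i => (hG₂.le i).trans (hG₁.le i), fun hS => hG₂.sound (hG₁.sound hS ?_) ?_, ?_⟩
      · exact Set.union_subset hAc hAd
      · rw [hone']
        rintro _ rfl
        exact hA ⟨(1, w), rfl, 0, .inl hNc.zeroP, by simp⟩
      · rw [if_neg hb.1, if_neg hb.2, if_neg (by have := hNc.base_lt; omega), Set.union_add, hone]
        refine Set.union_subset ((hG₁.done.trans (done_mono hG₂.le)).trans Set.subset_union_left) ?_
        exact Set.subset_union_right.trans Set.subset_union_right
    · refine κ.charge_settle hκ hxc hxd hb.1 hb.2 (hmc hb.1) (hmd hb.2) (t₁ := t₁) (t₂ := t₂) ?_ ht₂ ?_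
      · rw [hκq, hκV, hκR]; exact ht₁
      · simp; omega
  · refine Runs.seq (Runs.ite_neg hB (by simp [h31, h32, hNc.base, hNd.base]; tauto)
      (Runs.skip hB (Q := fun s' t => s' = s ∧ t = 1) ⟨rfl, rfl⟩)) ?_
    rintro _ _ - - ⟨_, rfl, rfl, rfl⟩
    by_cases hbc : bc = 0
    · obtain ⟨rfl, rfl, hPQ⟩ := hNc.light hbc
      have e : Pc ∪ (Qc + {0}) = Qc := by simpa [Set.add_singleton] using hPQ
      refine (Runs.ite_neg hB (by simp [h31, hNc.base, hbc])
        (joinLight_runs (w := w) (v := v) 𝓐 hB hx.reg2 hx.reg9 hNc hNd h30 h31 h32 h33 hw (by omega)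
          (by omega) (hmulM _ (by omega)) (hmulM _ (by omega)) (hmulM _ (by omega)) hdv hbc)).mono ?_
      rintro s₂ _ hB₂ hF₂ ⟨t₂, rfl, hN₂, hG₂, k₂, ht₂⟩
      refine ⟨_, _, _, fc, _, ⟨_, _, _, _, hN₂, light_family w hPQ _ _ _, rfl, hAd, hmd⟩, by omega,
        le_rfl, by omega, (hF₂.reg 42 fun hh => by have := joinIte_regs _ hh; omega).trans h42,
        ⟨hG₂.le, fun hS => hG₂.sound hS (by rwa [e] at hA), ?_⟩, k₂.mono (by simp),
        hx.fresh.of_eq (fun a ha => hF₂.mem a fun hh => by have := joinIte_arrs _ hh; omega)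
          (hF₂.reg 99 fun hh => by have := joinIte_regs _ hh; omega),
        (hF₂.reg 99 fun hh => by have := joinIte_regs _ hh; omega).le.trans (Nat.le_add_right _ _), ?_⟩
      · rw [if_pos hbc, e, Set.empty_union, Set.union_comm]
        exact Set.union_subset_union_left _ hG₂.done
      · rw [hbc]
        refine κ.charge_join hκ hxc hxd (fun h => (hNd.light h).1) hmd (.inl ?_)
        simp; omega
    · have hbd : bd = 0 := by by_contra h; exact hb ⟨hbc, h⟩
      obtain ⟨rfl, rfl, hPQ⟩ := hNd.light hbd
      have e : Pd ∪ (Qd + {0}) = Qd := by simpa [Set.add_singleton] using hPQ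
      refine (Runs.ite_pos hB (by simp [h31, hNc.base, hbc])
        (joinHeavy_runs (w := w) (v := v) 𝓐 hB hx.reg2 hx.reg9 hNc hNd h30 h31 h32 h33 hw (by omega)
          (by omega) (hmulM _ (by omega)) (hmulM _ (by omega)) (hmulM _ (by omega)) hcv hbc
          hbd)).mono ?_
      rintro s₂ _ hB₂ hF₂ ⟨t₂, rfl, hN₂, hG₂, k₂, ht₂⟩
      rw [Set.add_union] at hA
      have hA₁ := Set.subset_union_left.trans hA
      have hA₂ := Set.subset_union_right.trans hA
      rw [← add_assoc] at hA₂
      refine ⟨_, _, _, fc, _, ⟨_, _, _, _, hN₂, by rw [e]; exact heavy_family w _ _ _ _, rfl, ?_, hmc⟩,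
        by omega, le_rfl, by omega,
        (hF₂.reg 42 fun hh => by have := joinIte_regs _ hh; omega).trans h42,
        ⟨hG₂.le, fun hS => hG₂.sound hS hA₁, ?_⟩, k₂.mono (by simp),
        hx.fresh.of_eq (fun a ha => hF₂.mem a fun hh => by have := joinIte_arrs _ hh; omega)
          (hF₂.reg 99 fun hh => by have := joinIte_regs _ hh; omega),
        (hF₂.reg 99 fun hh => by have := joinIte_regs _ hh; omega).le.trans (Nat.le_add_right _ _), ?_⟩
      · rw [Set.union_add]
        exact Set.union_subset hAc hA₂
      · rw [if_neg hbc, if_neg hbc, if_pos hbd, Set.union_empty, Set.union_add, Set.add_union, ← add_assoc]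
        refine Set.union_subset (Set.subset_union_left.trans Set.subset_union_right)
          (Set.union_subset (hG₂.done.trans Set.subset_union_left)
            (Set.subset_union_right.trans Set.subset_union_right))
      · rw [hbd, add_comm (κ.pot bc xc mc), show xc + 1 + xd = xd + 1 + xc by omega]
        refine κ.charge_join hκ hxd hxc (fun h => absurd h hbc) hmc (.inr ?_)
        simp; omega

/-- Add a node, and combine the new component with its base if many nodes are pending. -/
def addNode (p : Program) : Program :=
  join p ;; .ite (.op .lt (.cell 24 (.reg 30)) (.reg 1)) .skip
    (.assign 40 (.reg 30) ;; .assign 41 (.reg 30) ;; rebase p)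

theorem addNode_regs {p : Program} : ∀ x ∈ (addNode p).regs,
    x = 31 ∨ x = 32 ∨ (34 ≤ x ∧ x ≤ 67) ∨ 96 ≤ x := by
  intro x hx
  rw [addNode, Program.regs, List.mem_append] at hx
  rcases hx with h | h
  · exact join_regs x h
  · simp only [Program.regs, List.nil_append, List.mem_append, List.mem_singleton] at h
    rcases h with h | h | h
    · omega
    · omega
    · have := rebase_regs x h; omega

theorem addNode_arrs {p : Program} :
    ∀ x ∈ (addNode p).arrs, (20 ≤ x ∧ x ≤ 26) ∨ x = 28 ∨ 50 ≤ x := by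
  intro x hx
  rw [addNode, Program.arrs, List.mem_append] at hx
  rcases hx with h | h
  · exact join_arrs x h
  · simp only [Program.arrs, List.nil_append] at h
    exact rebase_arrs x h

/-- The rebase restores the bound x < r. The two halves of `Charge` are the two branches of the
test. -/
theorem addNode_runs {p : Program} {n σ T M fc v c d xc xd mc md bc bd w : ℕ} {s : State}
    {κ : Rates} (𝓐 : Set (ℕ × ℕ)) {𝓕c 𝓓c 𝓕d 𝓓d : Set (ℕ × ℕ)} (hp : CanMultiply p σ T M)
    (hB : Bdd M s) (hx : Ctx n σ s) (hκ : κ.Valid) (hκq : κ.q = σ * σ) (hκV : κ.V = σ * T)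
    (hκR : κ.R = 2 * p.callFactor + 11000)
    (h0 : NodeRep n fc s 0 0 0 0 {0} {0} {(0, n)} {0})
    (hc : Comp n 𝓐 κ.r fc s c 𝓕c 𝓓c xc mc bc) (hd : Comp n 𝓐 κ.r fc s d 𝓕d 𝓓d xd md bd)
    (h1 : s.reg 1 = κ.r)
    (h30 : s.reg 30 = v) (h31 : s.reg 31 = c) (h32 : s.reg 32 = d) (h33 : s.reg 33 = w)
    (h42 : s.reg 42 = fc) (h99 : s.reg 99 + 6 * calls n σ ≤ M) (hM : 8 * (n + σ * σ) + 8 ≤ M)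
    (hcn : c ≤ n) (hdn : d ≤ n) (hvn : v ≤ n) (hcv : c ≠ v) (hdv : d ≠ v)
    (hfc : (fc + n + 5) * (n + 1) ≤ M) (hw : w ≤ 1)
    (hxc : xc < κ.r) (hxd : xd < κ.r) (hsz : xc + mc + 1 + (xd + md) ≤ n)
    (hA : {(1, w)} + 𝓕c ⊆ 𝓐) (hjunk : ∀ a : ℕ × ℕ, n ≤ a.2 → a ∈ 𝓐) :
    Runs M (addNode p) s fun s' t => ∃ x m b fc' 𝓓,
      Comp n 𝓐 κ.r fc' s' v (optional w 𝓕c + 𝓕d) 𝓓 x m b ∧ x < κ.r ∧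
      x + m = xc + mc + 1 + (xd + md) ∧
      fc ≤ fc' ∧ fc' ≤ fc + 3 ∧ s'.reg 42 = fc' ∧
      Progress n 𝓐 (𝓓c ∪ 𝓓d ∪ ({(1, w)} + 𝓕c)) 𝓓 (s.mem 28) (s'.mem 28) ∧
      Keep n fc {n + 1, n + 2, v} s s' ∧
      Fresh s' ∧ s'.reg 99 ≤ s.reg 99 + 6 * calls n σ ∧
      κ.q * κ.q * t + (κ.pot bc xc mc + κ.pot bd xd md) ≤
        κ.pot b x m + 50000 * (κ.q * κ.q * κ.r) := by
  have hmulM : ∀ y, y ≤ fc + n + 5 → y * (n + 1) ≤ M := fun y hy =>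
    (Nat.mul_le_mul_right _ hy).trans hfc
  have hfcM : fc + n + 5 ≤ M := (Nat.le_mul_of_pos_right _ (by omega)).trans hfc
  refine Runs.seq (join_runs 𝓐 hp hB hx hκ hκq hκV hκR h0 hc hd h30 h31 h32 h33 h42 (by omega) hM
    hcn hdn hvn hcv hdv (hmulM _ (by omega)) hw hxc hxd hsz hA hjunk) ?_
  rintro s₁ t₁ hB₁ hF₁ ⟨x, m, b, fc₁, 𝓓, hC₁, hsz₁, hle₁, hle₁', f42, hP₁, k₁, fr, f99, hch⟩
  have r1 : ∀ y, y < 31 ∨ y = 33 ∨ (67 < y ∧ y < 96) → s₁.reg y = s.reg y := fun y hy =>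
    hF₁.reg y fun hh => by have := join_regs y hh; omega
  obtain ⟨P, Q, A, Fb, hN, hF, h𝓓, hAF, hmr⟩ := hC₁
  -- The constantly many extra instructions are paid for by enlarging the allowance per node from
  -- 40000 to 50000.
  have hqq : κ.q * κ.q * 1 ≤ κ.q * κ.q * κ.r := Nat.mul_le_mul_left _ (hκ.one_le.trans hκ.le_r)
  by_cases hxr : x < κ.r
  · refine (Runs.ite_pos hB₁ (by simp [r1, h30, h1, hN.pend, hxr])
      (Runs.skip hB₁ (Q := fun s' t => s' = s₁ ∧ t = 1) ⟨rfl, rfl⟩)).mono ?_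
    rintro _ _ - - ⟨_, rfl, rfl, rfl⟩
    refine ⟨x, m, b, fc₁, 𝓓, ⟨P, Q, A, Fb, hN, hF, h𝓓, hAF, hmr⟩, hxr, hsz₁, hle₁, by omega, f42,
      hP₁, k₁, fr, by omega, ?_⟩
    have := hch.1 hxr
    simp [mul_add]
    linarith [Nat.zero_le (κ.q * κ.q * κ.r)]
  · refine (Runs.ite_neg hB₁ (by simp [r1, h30, h1, hN.pend]; omega)
      (Q := fun s' t => (NodeRep n (fc₁ + 1) s' v 0 (x + m) fc₁ {0} {0} {(0, n)} (P ∪ (Q + Fb)) ∧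
        Improved n 𝓐 (A + Fb) (s₁.mem 28) (s'.mem 28) ∧ Keep n fc₁ {v} s₁ s' ∧
        s'.reg 42 = fc₁ + 1 ∧ Fresh s' ∧ s'.reg 99 ≤ s₁.reg 99 + 2 * calls n σ) ∧
        ∃ t', t = 2 + (2 + t') ∧ κ.q * κ.q * t' ≤ κ.R * ((x + κ.q) * (m + 2 * κ.q) * κ.V)) ?_).mono ?_
    · refine Runs.assign_eq v hB₁ (by simp [r1, h30]) (by omega) fun hB => ?_
      refine Runs.assign_eq v hB (by simp [r1, h30]) (by omega) fun hB => ?_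
      refine (rebase_runs (id := v) (d := v) (fc := fc₁) 𝓐 hp hB
        ⟨by simp [r1, hx.reg0], by simp [r1, hx.reg2], by simp [r1, hx.reg9], by simp [r1, hx.reg80],
          fr.of_eq (by simp) (by simp)⟩ (hN.keep (V := ∅) (.of_mem (by simp)) (by simp) le_rfl)
        (by simp) (by simp) (by simp [f42]) (by simp; omega) hM (by omega) (by omega)
        (hmulM _ (by omega))).mono ?_
      rintro s₂ t₂ - - ⟨h1, h2, h3, h4, h5, h6, h7⟩
      refine ⟨⟨h1, h2, ⟨h3.row, h3.pend, h3.base, h3.full, h3.size⟩, h4, h5, by simpa using h6⟩, t₂,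
        rfl, ?_⟩
      rw [hκq, hκV, hκR]
      exact h7.trans (Nat.mul_le_mul_right _ (by omega))
    · rintro s₂ _ - - ⟨_, rfl, ⟨hN₂, hG₂, k₂, f42₂, fr₂, f99₂⟩, t', rfl, ht'⟩
      have e : ({0} : Set (ℕ × ℕ)) ∪ ({0} + (P ∪ (Q + Fb))) = P ∪ (Q + Fb) := by
        simpa [Set.singleton_add] using Or.inl hN.zeroP
      refine ⟨0, x + m, fc₁, fc₁ + 1, _, ⟨_, _, _, _, hN₂, hF.trans e.symm, rfl, ?_, fun _ => by omega⟩,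
        by omega, by omega, by omega, by omega, f42₂, ⟨fun i => (hG₂.le i).trans (hP₁.le i),
          fun hS => hG₂.sound (hP₁.sound hS) hAF, ?_⟩, (k₁.trans k₂ (by omega)).mono (by simp), fr₂,
          by omega, ?_⟩
      · rintro _ ⟨a, rfl, e, -, rfl⟩
        exact hjunk _ (by simp)
      · refine hP₁.cover.trans (Set.union_subset ?_ ?_)
        · exact (done_mono hG₂.le).trans Set.subset_union_left
        · rw [h𝓓]
          split
          · exact Set.empty_subset _
          · exact hG₂.done.trans Set.subset_union_left
      · have := hch.2 (by omega) t' ht'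
        rw [κ.pot_of_ne (b := fc₁) (by have := hN.base_lt; omega), ← κ.pot_of_ne one_ne_zero]
        simp [mul_add] at this ⊢
        linarith [Nat.zero_le (κ.q * κ.q * κ.r)]

/-! ### Processing a tree from the leaves to the root -/

/-- The pairs (size, number of ones) of the unions of subtrees at children of `u`, when the first `k`
nodes have been added. -/
def fam (par w : ℕ → ℕ) : ℕ → ℕ → Set (ℕ × ℕ)
  | 0, _ => {0}
  | k + 1, u => if u = par k then optional (w k) (fam par w k k) + fam par w k u else fam par w k u

/-- The pairs of the subtrees of the tree. -/
def subtreePairs (par w : ℕ → ℕ) (n : ℕ) : Set (ℕ × ℕ) :=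
  {a | ∃ t < n, a ∈ ({(1, w t)} + fam par w t t : Set (ℕ × ℕ))}

/-- The pairs of subtrees, and all pairs with at least `n` ones. -/
def answers (par w : ℕ → ℕ) (n : ℕ) : Set (ℕ × ℕ) := {a | n ≤ a.2} ∪ subtreePairs par w n

/-- The state after `k` nodes have been added; `u` stands for the component formed by the children
of `u` added so far. -/
structure Snapshot (n : ℕ) (κ : Rates) (par w : ℕ → ℕ) (k fc : ℕ) (s : State)
    (x m b : ℕ → ℕ) (𝓓 : ℕ → Set (ℕ × ℕ)) : Prop where
  comp : ∀ u, k ≤ u → u ≤ n → Comp n (answers par w n) κ.r fc s (s.mem 27 u) (fam par w k u) (𝓓 u)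
    (x u) (m u) (b u)
  lt : ∀ u, k ≤ u → u ≤ n → x u < κ.r
  cur_le : ∀ u, k ≤ u → u ≤ n → s.mem 27 u ≤ k
  nil : NodeRep n fc s 0 0 0 0 {0} {0} {(0, n)} {0}
  reg42 : s.reg 42 = fc
  fc_le : fc ≤ 3 * k + 1
  size : ∑ u ∈ Finset.Ico k (n + 1), (x u + m u) ≤ k
  sound : Sound n (answers par w n) (s.mem 28)
  cover : ∀ t < k, ∀ a ∈ ({(1, w t)} + fam par w t t : Set (ℕ × ℕ)),
    s.mem 28 a.1 ≤ a.2 ∨ ∃ u, k ≤ u ∧ u ≤ n ∧ a ∈ 𝓓 u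

/-- Sizes and potentials are both sums over the current components. Processing node k removes its
summand and changes only that of its parent. -/
theorem sum_merge {k n p : ℕ} (hkp : k < p) (hpn : p ≤ n) (F F' : ℕ → ℕ)
    (h : ∀ u, u ≠ p → F' u = F u) :
    ∑ u ∈ Finset.Ico (k + 1) (n + 1), F' u + (F k + F p) = ∑ u ∈ Finset.Ico k (n + 1), F u + F' p := by
  have hp : p ∈ Finset.Ico (k + 1) (n + 1) := by simp; omega
  rw [Finset.sum_eq_sum_Ico_succ_bot (by omega : k < n + 1), ← Finset.add_sum_erase _ F hp,
    ← Finset.add_sum_erase _ F' hp, Finset.sum_congr rfl fun u hu => h u (Finset.ne_of_mem_erase hu)]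
  ring

/-- The component of the parent takes over all deferred pairs of the two merged ones. Its row k+1 is
new, because all names in use are at most k. -/
theorem Snapshot.step {n k fc fc' x' m' b' : ℕ} {κ : Rates} {par w x m b : ℕ → ℕ}
    {𝓓 : ℕ → Set (ℕ × ℕ)} {𝓓' : Set (ℕ × ℕ)} {s s' : State}
    (h : Snapshot n κ par w k fc s x m b 𝓓) (hk : k < n) (hp : k < par k) (hpn : par k ≤ n)
    (hC : Comp n (answers par w n) κ.r fc' s' (k + 1)
      (optional (w k) (fam par w k k) + fam par w k (par k)) 𝓓' x' m' b')
    (hx' : x' < κ.r) (hsz : x' + m' = x k + m k + 1 + (x (par k) + m (par k)))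
    (hfc : fc ≤ fc') (hfc' : fc' ≤ fc + 3) (h42 : s'.reg 42 = fc')
    (hP : Progress n (answers par w n) (𝓓 k ∪ 𝓓 (par k) ∪ ({(1, w k)} + fam par w k k)) 𝓓' (s.mem 28)
      (s'.mem 28))
    (hK : Keep n fc {n + 1, n + 2, k + 1} s s')
    (hcur : s'.mem 27 = Function.update (s.mem 27) (par k) (k + 1)) :
    Snapshot n κ par w (k + 1) fc' s' (Function.update x (par k) x') (Function.update m (par k) m')
      (Function.update b (par k) b') (Function.update 𝓓 (par k) 𝓓') := by
  refine ⟨fun u hu hun => ?_, fun u hu hun => ?_, fun u hu hun => ?_, h.nil.keep hK ?_ hfc, h42, ?_,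
    ?_, hP.sound h.sound, fun t ht a ha => ?_⟩
  · by_cases hup : u = par k
    · subst hup
      simpa [hcur, fam] using hC
    · have hc := h.cur_le u (by omega) hun
      simp only [hcur, Function.update_of_ne hup, fam, if_neg hup]
      exact (h.comp u (by omega) hun).keep hK (by simp; omega) hfc
  · by_cases hup : u = par k
    · simpa [hup] using hx'
    · rw [Function.update_of_ne hup]; exact h.lt u (by omega) hun
  · by_cases hup : u = par k
    · simp [hcur, hup]
    · rw [hcur, Function.update_of_ne hup]; have := h.cur_le u (by omega) hun; omega
  · simp
  · have := h.fc_le; omega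
  · have := sum_merge hp hpn (fun u => x u + m u)
      (fun u => Function.update x (par k) x' u + Function.update m (par k) m' u)
      (fun u hu => by simp [hu])
    have := h.size
    simp at *
    omega
  · have key : ∀ u, k ≤ u → u ≤ n → a ∈ 𝓓 u → s'.mem 28 a.1 ≤ a.2 ∨
        ∃ u, k + 1 ≤ u ∧ u ≤ n ∧ a ∈ Function.update 𝓓 (par k) 𝓓' u := by
      intro u hu hun hau
      by_cases hcase : u = k ∨ u = par k
      · rcases hP.cover (.inl (hcase.elim (fun e => .inl (e ▸ hau)) fun e => .inr (e ▸ hau))) with h' | h'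
        · exact .inl h'
        · exact .inr ⟨par k, hp, hpn, by simpa using h'⟩
      · push Not at hcase
        exact .inr ⟨u, by omega, hun, by rwa [Function.update_of_ne hcase.2]⟩
    rcases Nat.lt_succ_iff_lt_or_eq.mp ht with ht | rfl
    · rcases h.cover t ht a ha with h' | ⟨u, hu, hun, hau⟩
      · exact .inl ((hP.le _).trans h')
      · exact key u hu hun hau
    · rcases hP.cover (.inr ha) with h' | h'
      · exact .inl h'
      · exact .inr ⟨par t, hp, hpn, by simpa using h'⟩

/-- One round of the main loop: add node `reg 8`. -/
def solveBody (p : Program) : Program :=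
  .assign 30 (.reg 8 + 1) ;; .assign 33 (.cell 11 (.reg 8)) ;; .assign 31 (.cell 27 (.reg 8)) ;;
  .assign 32 (.cell 27 (.cell 10 (.reg 8))) ;; addNode p ;;
  .store 27 (.cell 10 (.reg 8)) (.reg 30)

theorem solveBody_regs {p : Program} : ∀ x ∈ (solveBody p).regs, (30 ≤ x ∧ x ≤ 67) ∨ 96 ≤ x := by
  intro x hx
  simp only [solveBody, Program.regs, List.mem_append, List.mem_singleton, List.not_mem_nil,
    or_false] at hx
  rcases hx with h | h | h | h | h <;> first | omega | (have := addNode_regs x h; omega)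

theorem solveBody_arrs {p : Program} : ∀ x ∈ (solveBody p).arrs, (20 ≤ x ∧ x ≤ 28) ∨ 50 ≤ x := by
  intro x hx
  simp only [solveBody, Program.arrs, List.mem_append, List.mem_singleton, List.not_mem_nil,
    false_or] at hx
  rcases hx with h | h <;> first | omega | (have := addNode_arrs x h; omega)

theorem Snapshot.congr {n k fc : ℕ} {κ : Rates} {par w x m b : ℕ → ℕ}
    {𝓓 : ℕ → Set (ℕ × ℕ)} {s s' : State} (h : Snapshot n κ par w k fc s x m b 𝓓)
    (hm : ∀ a, 20 ≤ a → a ≤ 28 → s'.mem a = s.mem a) (h42 : s'.reg 42 = s.reg 42) :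
    Snapshot n κ par w k fc s' x m b 𝓓 := by
  have hK : Keep n fc ∅ s s' := .of_mem fun a ha ha' => hm a ha (by omega)
  have h27 := hm 27 (by omega) (by omega)
  have h28 := hm 28 (by omega) (by omega)
  exact { h with
    comp := fun u hu hun => by rw [h27]; exact (h.comp u hu hun).keep hK (by simp) le_rfl
    cur_le := fun u hu hun => by rw [h27]; exact h.cur_le u hu hun
    nil := h.nil.keep hK (by simp) le_rfl
    reg42 := h42.trans h.reg42
    sound := by rw [h28]; exact h.sound
    cover := by rw [h28]; exact h.cover }

/-- The total potential. -/
def Rates.total (κ : Rates) (n k : ℕ) (x m b : ℕ → ℕ) : ℕ :=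
  ∑ u ∈ Finset.Ico k (n + 1), κ.pot (b u) (x u) (m u)

theorem solveBody_runs {p : Program} {n σ T M fc k : ℕ} {s : State} {κ : Rates}
    {par w x m b : ℕ → ℕ} {𝓓 : ℕ → Set (ℕ × ℕ)} (hp : CanMultiply p σ T M)
    (hB : Bdd M s) (hx : Ctx n σ s) (hκ : κ.Valid) (hκq : κ.q = σ * σ) (hκV : κ.V = σ * T)
    (hκR : κ.R = 2 * p.callFactor + 11000) (h1 : s.reg 1 = κ.r) (h8 : s.reg 8 = k)
    (h10 : s.mem 10 k = par k) (h11 : s.mem 11 k = w k)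
    (hpar : k < par k) (hparn : par k ≤ n) (hw : w k ≤ 1)
    (hS : Snapshot n κ par w k fc s x m b 𝓓) (hk : k < n)
    (h99 : s.reg 99 + 6 * calls n σ ≤ M) (hM : 8 * (n + σ * σ) + 8 ≤ M)
    (hM' : (4 * n + 10) * (n + 1) ≤ M) :
    Runs M (solveBody p) s fun s' t => (∃ fc x' m' b' 𝓓,
      Snapshot n κ par w (k + 1) fc s' x' m' b' 𝓓 ∧ κ.q * κ.q * t + κ.total n k x m b ≤
        κ.total n (k + 1) x' m' b' + 50030 * (κ.q * κ.q * κ.r)) ∧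
      Fresh s' ∧ s'.reg 99 ≤ s.reg 99 + 6 * calls n σ := by
  have hk27 := hS.cur_le k le_rfl hk.le
  have hp27 := hS.cur_le (par k) hpar.le hparn
  refine Runs.assign_eq (k + 1) hB (by simp [h8]) (by omega) fun hB => ?_
  refine Runs.assign_eq (w k) hB (by simp [h8, h11]) (by omega) fun hB => ?_
  refine Runs.assign_eq (s.mem 27 k) hB (by simp [h8]) (by omega) fun hB => ?_
  refine Runs.assign_eq (s.mem 27 (par k)) hB (by simp [h8, h10]) (by omega) fun hB => ?_
  generalize hs₁ : ((((s.setReg 30 _).setReg 33 _).setReg 31 _).setReg 32 _) = s₁ at hB ⊢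
  have m1 : s₁.mem = s.mem := by simp [← hs₁]
  have r1 : ∀ y, y < 30 ∨ 33 < y → s₁.reg y = s.reg y := by
    intro y hy
    simp only [← hs₁, State.setReg_reg]
    rw [if_neg (by omega), if_neg (by omega), if_neg (by omega), if_neg (by omega)]
  have hK₁ : Keep n fc ∅ s s₁ := .of_mem (by simp [m1])
  -- The two components are part of a total of at most k < n nodes; replacing the summand of the
  -- parent by 0 isolates them.
  have hsz : x k + m k + 1 + (x (par k) + m (par k)) ≤ n := by
    have h1 := sum_merge hpar hparn (fun u => x u + m u)
      (Function.update (fun u => x u + m u) (par k) 0) (fun u hu => Function.update_of_ne hu _ _)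
    have h2 := hS.size
    simp at h1
    omega
  have hcn := hS.fc_le
  have hfcM : (fc + n + 5) * (n + 1) ≤ M := (Nat.mul_le_mul_right _ (by omega)).trans hM'
  have h42 := hS.reg42
  refine Runs.seq (addNode_runs (w := w k) (v := k + 1) (answers par w n) hp hB
    ⟨by rw [r1 _ (by omega), hx.reg0], by rw [r1 _ (by omega), hx.reg2],
      by rw [r1 _ (by omega), hx.reg9], by rw [r1 _ (by omega), hx.reg80],
      hx.fresh.of_eq (by simp [m1]) (r1 _ (by omega))⟩ hκ hκq hκV hκR
    (hS.nil.keep hK₁ (by simp) le_rfl) ((hS.comp k le_rfl hk.le).keep hK₁ (by simp) le_rfl)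
    ((hS.comp (par k) hpar.le hparn).keep hK₁ (by simp) le_rfl) (by rw [r1 _ (by omega), h1])
    (by simp [← hs₁]) (by simp [← hs₁]) (by simp [← hs₁]) (by simp [← hs₁])
    (by rw [r1 _ (by omega), h42]) (by rw [r1 _ (by omega)]; exact h99) hM (by omega) (by omega)
    (by omega) (by omega) (by omega) hfcM hw (hS.lt k le_rfl hk.le) (hS.lt _ hpar.le hparn) hsz
    (fun a ha => .inr ⟨k, hk, ha⟩) (fun a ha => .inl ha)) ?_
  rintro s₂ t₂ hB₂ hF₂ ⟨x', m', b', fc', 𝓓', hC, hx', hsz', hfc1, hfc2, h42', hP, hK, hFr, h99', ht⟩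
  have r2 : s₂.reg 8 = k :=
    (hF₂.reg 8 fun hh => by have := addNode_regs _ hh; omega).trans ((r1 _ (by omega)).trans h8)
  have r2' : s₂.reg 30 = k + 1 :=
    (hF₂.reg 30 fun hh => by have := addNode_regs _ hh; omega).trans (by simp [← hs₁])
  have m2 : ∀ a, a = 10 ∨ a = 27 → s₂.mem a = s.mem a := fun a ha =>
    (hF₂.mem a fun hh => by have := addNode_arrs _ hh; omega).trans (by rw [m1])
  refine Runs.store hB₂ (hB₂.reg _) ?_
  simp only [Expr.val_cell, Expr.val_reg, r2, r2', m2 10 (by omega), h10]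
  generalize hs₃ : s₂.setMem 27 (par k) (k + 1) = s₃
  have m3 : ∀ a, a ≠ 27 → s₃.mem a = s₂.mem a := by
    intro a ha; rw [← hs₃, State.setMem_mem_ne _ _ _ ha]
  have e3 : s₃.reg = s₂.reg := by simp [← hs₃]
  have hK₃ : Keep n fc' ∅ s₂ s₃ := .of_mem fun a _ _ => m3 a (by omega)
  rw [m1] at hP
  refine ⟨⟨fc', _, _, _, _, hS.step (s' := s₃) hk hpar hparn (hC.keep hK₃ (by simp) le_rfl) hx' hsz'
    hfc1 hfc2 (by rw [e3, h42']) (by rw [m3 _ (by omega)]; exact hP)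
    (((hK₁.trans hK le_rfl).trans hK₃ hfc1).mono (by simp)) ?_, ?_⟩,
    hFr.of_eq (fun a ha => m3 a (by omega)) (by rw [e3]), ?_⟩
  · rw [← hs₃, State.setMem_mem_same, m2 _ (by omega)]
  · have h3 := sum_merge hpar hparn (fun u => κ.pot (b u) (x u) (m u))
      (fun u => κ.pot (Function.update b (par k) b' u) (Function.update x (par k) x' u)
        (Function.update m (par k) m' u)) (fun u hu => by simp [hu])
    have hqq : κ.q * κ.q * 1 ≤ κ.q * κ.q * κ.r := Nat.mul_le_mul_left _ (hκ.one_le.trans hκ.le_r)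
    simp at h3
    simp [Rates.total, mul_add]
    linarith [Nat.zero_le (κ.q * κ.q * κ.r)]
  · rw [e3, ← r1 99 (by omega)]; exact h99'

/-- The potential differences telescope over the rounds, which leaves the final potential and O(q²r)
for each node. -/
theorem solveLoop_runs {p : Program} {n σ T M : ℕ} {s : State} {κ : Rates} {par w : ℕ → ℕ}
    {𝓓 : ℕ → Set (ℕ × ℕ)} (hp : CanMultiply p σ T M) (hB : Bdd M s) (hx : Ctx n σ s)
    (hκ : κ.Valid) (hκq : κ.q = σ * σ) (hκV : κ.V = σ * T) (hκR : κ.R = 2 * p.callFactor + 11000)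
    (h1 : s.reg 1 = κ.r) (h10 : ∀ k < n, s.mem 10 k = par k) (h11 : ∀ k < n, s.mem 11 k = w k)
    (hpar : ∀ k < n, k < par k ∧ par k ≤ n) (hw : ∀ k < n, w k ≤ 1)
    (hS : Snapshot n κ par w 0 1 s 0 0 0 𝓓) (h99 : s.reg 99 + n * (6 * calls n σ) ≤ M)
    (hM : 8 * (n + σ * σ) + 8 ≤ M) (hM' : (4 * n + 10) * (n + 1) ≤ M) :
    Runs M (.for_ 8 (.reg 0) (solveBody p)) s fun s' t => (∃ fc x m b 𝓓,
      Snapshot n κ par w n fc s' x m b 𝓓 ∧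
        κ.q * κ.q * t ≤ κ.total n n x m b + (n + 1) * (50050 * (κ.q * κ.q * κ.r))) ∧
      Fresh s' ∧ s'.reg 99 ≤ s.reg 99 + n * (6 * calls n σ) := by
  have hqq : κ.q * κ.q * 1 ≤ κ.q * κ.q * κ.r := Nat.mul_le_mul_left _ (hκ.one_le.trans hκ.le_r)
  have hreg : ∀ y, y ≤ 1 ∨ y = 2 ∨ y = 9 ∨ y = 80 → ∀ s', Frame (.for_ 8 (.reg 0) (solveBody p)) s s' →
      s'.reg y = s.reg y := fun y hy s' hF => hF.reg y fun hh => by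
    rw [Program.mem_regs_for] at hh
    rcases hh with hh | hh
    · omega
    · have := solveBody_regs y hh; omega
  have hmem : ∀ a, a = 10 ∨ a = 11 → ∀ s', Frame (.for_ 8 (.reg 0) (solveBody p)) s s' →
      s'.mem a = s.mem a := fun a ha s' hF => hF.mem a fun hh => by
    rw [Program.arrs_for] at hh
    have := solveBody_arrs a hh; omega
  refine Runs.for_time (fun k s' t => (∃ fc x m b 𝓓, Snapshot n κ par w k fc s' x m b 𝓓 ∧
      κ.q * κ.q * t ≤ κ.total n k x m b + k * (50050 * (κ.q * κ.q * κ.r))) ∧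
      Fresh s' ∧ s'.reg 99 ≤ s.reg 99 + k * (6 * calls n σ)) n hB (by omega)
    (fun hh => by have := solveBody_regs _ hh; omega)
    (fun s' hF => by rw [Expr.val_reg, hreg 0 (by omega) s' hF, hx.reg0]) ?_ ?_ ?_
  · exact ⟨⟨1, 0, 0, 0, 𝓓, hS.congr (by simp) (by simp), by simp⟩,
      hx.fresh.of_eq (by simp) (by simp), by simp⟩
  · rintro k s' t hk hB' hF h8 ⟨⟨fc, x, m, b, 𝓓, hS, ht⟩, hfr, h99'⟩
    have hcalls : k * (6 * calls n σ) + 6 * calls n σ ≤ n * (6 * calls n σ) := by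
      rw [← Nat.succ_mul]; exact Nat.mul_le_mul_right _ hk
    refine (solveBody_runs hp hB' ⟨(hreg 0 (by omega) s' hF).trans hx.reg0,
      (hreg 2 (by omega) s' hF).trans hx.reg2, (hreg 9 (by omega) s' hF).trans hx.reg9,
      (hreg 80 (by omega) s' hF).trans hx.reg80, hfr⟩ hκ hκq hκV hκR
      ((hreg 1 (by omega) s' hF).trans h1) h8 (by rw [hmem 10 (by omega) s' hF, h10 k hk])
      (by rw [hmem 11 (by omega) s' hF, h11 k hk]) (hpar k hk).1 (hpar k hk).2 (hw k hk) hS hk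
      (by omega) hM hM').mono ?_
    rintro s₁ t₁ - - ⟨⟨fc', x', m', b', 𝓓', hS', ht'⟩, hfr', h99''⟩
    refine ⟨⟨fc', x', m', b', 𝓓', hS'.congr (by simp) (by simp), ?_⟩,
      hfr'.of_eq (by simp) (by simp), ?_⟩
    · rw [Expr.cost_reg, mul_add, mul_add, add_mul]
      linarith [Nat.zero_le (κ.q * κ.q * κ.r)]
    · rw [add_mul]; simp; omega
  · rintro s' t hB' hF h8 ⟨⟨fc, x, m, b, 𝓓, hS, ht⟩, hfr, h99'⟩
    refine ⟨⟨fc, x, m, b, 𝓓, hS, ?_⟩, hfr, h99'⟩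
    rw [Expr.cost_reg, mul_add, mul_add, add_mul]
    linarith [Nat.zero_le (κ.q * κ.q * κ.r)]

/-- Account for the family of the root. -/
def finish (p : Program) : Program :=
  .assign 40 (.cell 27 (.reg 0)) ;; .assign 41 (.reg 40) ;;
  .ite (.cell 26 (.reg 40)) (rebase p) .skip

/-- Only one component is left, with x + m ≤ n and x < r: so x² ≤ rn and m² ≤ n² bound the final
potential, and the last rebase adds O(Vn²). -/
theorem finish_time {q r V R n x m b t t' : ℕ} {κ : Rates} (hκ : κ.Valid) (hq : κ.q = q)
    (hr : κ.r = r) (hV : κ.V = V) (hR : κ.R = R) (hxm : x + m ≤ n) (hx : x < r) (hn : 1 ≤ n)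
    (ht : q * q * t ≤ κ.pot b x m + (n + 1) * (50050 * (q * q * r)))
    (hb : b ≠ 0 → r ≤ m)
    (ht' : t' ≤ 1 ∨ (b ≠ 0 ∧ q * q * t' ≤ R * ((x + q) * (m + 2 * q) * V))) :
    q * q * (t + (t' + 20)) ≤ 120000 * (q * q * r * n) + 36 * (R * (V * (n * n))) := by
  subst hq hr hV hR
  have hqq : κ.q * κ.q * 1 ≤ κ.q * κ.q * κ.r := Nat.mul_le_mul_left _ (hκ.one_le.trans hκ.le_r)
  have hqn : κ.q * κ.q * κ.r * 1 ≤ κ.q * κ.q * κ.r * n := Nat.mul_le_mul_left _ hn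
  have e0 : (n + 1) * (50050 * (κ.q * κ.q * κ.r)) ≤ 100100 * (κ.q * κ.q * κ.r * n) := by
    linarith [mul_comm (κ.q * κ.q * κ.r) n]
  have e1 : κ.pot b x m ≤ 10000 * (κ.q * κ.q * κ.r * n) + 30 * (κ.R * (κ.V * (n * n))) := by
    by_cases h0 : b = 0
    · subst h0
      have : κ.q * κ.q * (x * x) ≤ κ.q * κ.q * (κ.r * n) := by gcongr; omega
      rw [Rates.pot_zero]
      nlinarith [Nat.zero_le (κ.R * (κ.V * (n * n)))]
    · rw [Rates.pot_of_ne _ h0]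
      have h1 : κ.q * κ.q * (κ.r * (x + m)) ≤ κ.q * κ.q * (κ.r * n) := by gcongr
      have h2 : κ.R * (κ.V * (m * m)) ≤ κ.R * (κ.V * (n * n)) := by gcongr <;> omega
      nlinarith
  have e2 : κ.q * κ.q * t' ≤ κ.q * κ.q * κ.r * n + 6 * (κ.R * (κ.V * (n * n))) := by
    rcases ht' with h | ⟨h0, h⟩
    · have := Nat.mul_le_mul_left (κ.q * κ.q) h
      linarith [Nat.zero_le (κ.R * (κ.V * (n * n)))]
    · have h3 := hb h0
      have h4 := hκ.le_r
      have : (x + κ.q) * (m + 2 * κ.q) * κ.V ≤ (2 * n) * (3 * n) * κ.V := by gcongr <;> omega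
      have := Nat.mul_le_mul_left κ.R this
      nlinarith [Nat.zero_le (κ.q * κ.q * κ.r * n)]
  rw [mul_add, mul_add]
  linarith [Nat.zero_le (κ.R * (κ.V * (n * n))), Nat.zero_le (κ.q * κ.q * κ.r * n)]

/-- Index n stands for a virtual parent of the root, and its component is the only one left. Pairs
are still owed only if it has a base, and then one more rebase settles them. -/
theorem finish_runs {p : Program} {n σ T M fc t₀ : ℕ} {s : State} {κ : Rates} {par w x m b : ℕ → ℕ}
    {𝓓 : ℕ → Set (ℕ × ℕ)} (hp : CanMultiply p σ T M) (hB : Bdd M s) (hx : Ctx n σ s)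
    (hκ : κ.Valid) (hκq : κ.q = σ * σ) (hκV : κ.V = σ * T) (hκR : κ.R = 2 * p.callFactor + 11000)
    (hn : 1 ≤ n) (hS : Snapshot n κ par w n fc s x m b 𝓓)
    (ht : κ.q * κ.q * t₀ ≤ κ.total n n x m b + (n + 1) * (50050 * (κ.q * κ.q * κ.r)))
    (h99 : s.reg 99 + 2 * calls n σ ≤ M)
    (hM : 8 * (n + σ * σ) + 8 ≤ M) (hM' : (4 * n + 10) * (n + 1) ≤ M) :
    Runs M (finish p) s fun s' t =>
      Sound n (answers par w n) (s'.mem 28) ∧ subtreePairs par w n ⊆ done (s'.mem 28) ∧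
      Fresh s' ∧ s'.reg 99 ≤ s.reg 99 + 2 * calls n σ ∧
      κ.q * κ.q * (t₀ + t) ≤
        120000 * (κ.q * κ.q * κ.r * n) + 36 * (κ.R * (κ.V * (n * n))) := by
  have hcn := hS.cur_le n le_rfl le_rfl
  have hfcn := hS.fc_le
  have hsz : x n + m n ≤ n := by simpa using hS.size
  have htot : κ.total n n x m b = κ.pot (b n) (x n) (m n) := by simp [Rates.total]
  have hlt := hS.lt n le_rfl le_rfl
  obtain ⟨P, Q, A, Fb, hN, -, hD, hA, hb⟩ := hS.comp n le_rfl le_rfl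
  have hcov : ∀ t < n, ∀ a ∈ ({(1, w t)} + fam par w t t : Set (ℕ × ℕ)),
      s.mem 28 a.1 ≤ a.2 ∨ a ∈ 𝓓 n := by
    intro t ht a ha
    rcases hS.cover t ht a ha with h | ⟨u, hu, hun, h⟩
    · exact .inl h
    · obtain rfl : u = n := by omega
      exact .inr h
  rw [htot] at ht
  refine Runs.assign_eq (s.mem 27 n) hB (by simp [hx.reg0]) (by omega) fun hB => ?_
  refine Runs.assign_eq (s.mem 27 n) hB (by simp) (by omega) fun hB => ?_
  generalize hs₁ : (s.setReg 40 _).setReg 41 _ = s₁ at hB ⊢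
  have m1 : s₁.mem = s.mem := by simp [← hs₁]
  have r1 : ∀ y, y ≠ 40 → y ≠ 41 → s₁.reg y = s.reg y := by
    intro y h h'
    simp [← hs₁, h, h']
  have hN₁ : NodeRep n fc s₁ (s.mem 27 n) (x n) (m n) (b n) P Q A Fb :=
    hN.keep (.of_mem (V := ∅) (by simp [m1])) (by simp) le_rfl
  have h40 : s₁.reg 40 = s.mem 27 n := by simp [← hs₁]
  have h41 : s₁.reg 41 = s.mem 27 n := by simp [← hs₁]
  have hbs : (Expr.cell 26 (.reg 40)).val s₁ = b n := by simp [h40, hN₁.base]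
  by_cases h0 : b n = 0
  · refine (Runs.ite_neg (Q := fun s' t => s' = s₁ ∧ t = 1) hB (hbs.trans h0)
      (Runs.skip hB ⟨rfl, rfl⟩)).mono ?_
    rintro _ _ - - ⟨_, rfl, rfl, rfl⟩
    rw [if_pos h0] at hD
    refine ⟨by rw [m1]; exact hS.sound, ?_, hx.fresh.of_eq (by simp [m1]) (r1 _ (by omega) (by omega)),
      by rw [r1 _ (by omega) (by omega)]; omega, ?_⟩
    · rintro a ⟨t, ht, ha⟩
      rw [m1]
      simpa [hD, done] using hcov t ht a ha
    · refine le_trans ?_ (finish_time (t' := 1) hκ rfl rfl rfl rfl hsz hlt hn ht hb (.inl le_rfl))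
      simp
      gcongr
      omega
  · refine (Runs.ite_pos hB (by rw [hbs]; exact h0) (rebase_runs (answers par w n) hp hB
      ⟨by rw [r1 _ (by omega) (by omega), hx.reg0], by rw [r1 _ (by omega) (by omega), hx.reg2],
        by rw [r1 _ (by omega) (by omega), hx.reg9], by rw [r1 _ (by omega) (by omega), hx.reg80],
        hx.fresh.of_eq (by simp [m1]) (r1 _ (by omega) (by omega))⟩ hN₁ h40 h41
      (by rw [r1 _ (by omega) (by omega), hS.reg42]) (by rwa [r1 _ (by omega) (by omega)]) hM
      (by omega) (by omega) ((Nat.mul_le_mul_right _ (by omega)).trans hM'))).mono ?_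
    rintro s₂ _ - - ⟨t', rfl, -, hI, -, -, hfr, h99', ht'⟩
    rw [if_neg h0] at hD
    rw [m1] at hI
    rw [r1 _ (by omega) (by omega)] at h99'
    refine ⟨hI.sound hS.sound hA, ?_, hfr, h99', ?_⟩
    · rintro a ⟨t, ht, ha⟩
      rcases hcov t ht a ha with h | h
      · exact (hI.le _).trans h
      · rw [hD] at h
        exact hI.done h
    · refine le_trans ?_ (finish_time (t' := t') hκ rfl rfl rfl rfl hsz hlt hn ht hb (.inr ⟨h0, ?_⟩))
      · refine Nat.mul_le_mul_left _ ?_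
        simp only [Expr.cost_cell, Expr.cost_reg]
        omega
      · rw [← hκq, ← hκV] at ht'
        refine ht'.trans (Nat.mul_le_mul_right _ ?_)
        omega

/-- Compute in array `28` the least numbers of ones in the subtrees of all sizes, for the tree with
parents in array `10` and labels in array `11`. -/
def solve (p : Program) : Program :=
  .assign 2 (.reg 0 + 1) ;; .sweep 67 27 0 (.reg 0 + 1) 0 ;;
  .sweep 67 28 0 (.reg 0 + 1) (.reg 0) ;;
  .store 20 0 0 ;; .store 21 0 0 ;; .store 22 0 0 ;; .store 23 0 (.reg 0) ;; .store 24 0 0 ;;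
  .store 25 0 0 ;; .store 26 0 0 ;; .assign 42 1 ;;
  .for_ 8 (.reg 0) (solveBody p) ;; finish p

theorem solve_regs {p : Program} : ∀ x ∈ (solve p).regs,
    x = 2 ∨ x = 8 ∨ (30 ≤ x ∧ x ≤ 67) ∨ 96 ≤ x := by
  intro x hx
  simp only [solve, finish, Program.regs, List.mem_append, List.mem_singleton, List.not_mem_nil,
    or_false, false_or, Program.mem_regs_sweep, Program.mem_regs_for] at hx
  rcases hx with h | h | h | h | (h | h) | h | h | h <;>
    first | omega | (have := solveBody_regs x h; omega) | (have := rebase_regs x h; omega)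

theorem solve_arrs {p : Program} : ∀ x ∈ (solve p).arrs, (20 ≤ x ∧ x ≤ 28) ∨ 50 ≤ x := by
  intro x hx
  simp only [solve, finish, Program.arrs, List.mem_append, List.mem_singleton, List.not_mem_nil,
    or_false, false_or, Program.arrs_sweep, Program.arrs_for] at hx
  rcases hx with h | h | h | h | h | h | h | h | h | h | h
  iterate 9 · omega
  · have := solveBody_arrs x h; omega
  · have := rebase_arrs x h; omega

/-- All nodes start with the same empty component in row 0, which no round overwrites. The answers
start at n, a value justified by the dummy pairs in `answers`. -/
theorem snapshot_zero {n : ℕ} {κ : Rates} {par w : ℕ → ℕ} {s : State} (hκ : κ.Valid)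
    (h27 : ∀ u ≤ n, s.mem 27 u = 0) (h28 : ∀ u ≤ n, s.mem 28 u = n)
    (h0 : ∀ a, 20 ≤ a → a ≤ 26 → a ≠ 23 → s.mem a 0 = 0) (h23 : s.mem 23 0 = n)
    (h42 : s.reg 42 = 1) : Snapshot n κ par w 0 1 s 0 0 0 fun _ => ∅ := by
  have hrow : ∀ a, 20 ≤ a → a ≤ 22 → Row n (s.mem a) (0 * (n + 1)) 0 {0} := fun a h h' =>
    row_zero (Nat.zero_le _) (by rw [zero_mul]; exact h0 a h (by omega) (by omega))
  have hnil : NodeRep n 1 s 0 0 0 0 {0} {0} {(0, n)} {0} :=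
    ⟨h0 24 (by omega) (by omega) (by omega), h0 26 (by omega) (by omega) (by omega), by omega,
      h0 25 (by omega) (by omega) (by omega), hrow 21 (by omega) (by omega),
      hrow 22 (by omega) (by omega), row_zero le_rfl (by rw [zero_mul]; exact h23),
      hrow 20 (by omega) (by omega), by omega, rfl, rfl, tame_zero, tame_zero, tame_zero, by simp⟩
  have hA : ({(0, n)} + {0} : Set (ℕ × ℕ)) ⊆ answers par w n := by
    simp [answers]
  have hr := hκ.le_r
  have hq := hκ.one_le
  refine ⟨fun u _ hu => ⟨{0}, {0}, {(0, n)}, {0}, by rw [h27 u hu]; exact hnil, by simp [fam], by simp,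
    hA, by simp⟩, fun u _ _ => by simp; omega, fun u _ hu => (h27 u hu).le, hnil, h42, by omega,
    by simp, fun i hi => ?_, by simp⟩
  have := env_le (a := (i, n)) (show (i, n) ∈ answers par w n from .inl (le_refl n)) i
  rw [h28 i hi]
  simpa using this

theorem solve_runs {p : Program} {n σ T M : ℕ} {s : State} {κ : Rates} {par w : ℕ → ℕ}
    (hp : CanMultiply p σ T M) (hB : Bdd M s) (hκ : κ.Valid) (hκq : κ.q = σ * σ)
    (hκV : κ.V = σ * T) (hκR : κ.R = 2 * p.callFactor + 11000) (h0 : s.reg 0 = n)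
    (h1 : s.reg 1 = κ.r) (h9 : s.reg 9 = 0) (h80 : s.reg 80 = σ) (hfr : Fresh s)
    (h10 : ∀ k < n, s.mem 10 k = par k) (h11 : ∀ k < n, s.mem 11 k = w k)
    (hpar : ∀ k < n, k < par k ∧ par k ≤ n) (hw : ∀ k < n, w k ≤ 1) (hn : 1 ≤ n)
    (h99 : s.reg 99 + (6 * n + 2) * calls n σ ≤ M)
    (hM : 8 * (n + σ * σ) + 8 ≤ M) (hM' : (4 * n + 10) * (n + 1) ≤ M) :
    Runs M (solve p) s fun s' t =>
      Sound n (answers par w n) (s'.mem 28) ∧ subtreePairs par w n ⊆ done (s'.mem 28) ∧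
      Fresh s' ∧ s'.reg 99 ≤ s.reg 99 + (6 * n + 2) * calls n σ ∧
      κ.q * κ.q * t ≤ 130000 * (κ.q * κ.q * κ.r * n) + 36 * (κ.R * (κ.V * (n * n))) := by
  have hcalls : (6 * n + 2) * calls n σ = n * (6 * calls n σ) + 2 * calls n σ := by ring
  rw [hcalls] at h99 ⊢
  refine Runs.assign_eq (n + 1) hB (by simp [h0]) (by omega) fun hB => ?_
  refine Runs.seq (Q₁ := fun s' t => s' = (s.setReg 2 (n + 1)).fill 67 27 0 (n + 1) (fun _ => 0) ∧
    t ≤ 20 * (n + 1) + 10) (Runs.sweep 0 (n + 1) (fun _ => 0) hB (by omega) (by simp [h0]) (by simp)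
    (by simp) (by simp) fun t _ ht => ⟨rfl, by simp at ht; omega⟩) ?_
  rintro _ t₁ hB - ⟨rfl, ht₁⟩
  refine Runs.seq (Q₁ := fun s' t => s' = ((s.setReg 2 (n + 1)).fill 67 27 0 (n + 1)
      (fun _ => 0)).fill 67 28 0 (n + 1) (fun _ => n) ∧ t ≤ 20 * (n + 1) + 10)
    (Runs.sweep 0 (n + 1) (fun _ => n) hB (by omega) (by simp [h0]) (by simp)
    (by simp [h0]) (by intros; omega) fun t _ ht => ⟨rfl, by simp at ht; omega⟩) ?_
  rintro _ t₂ hB - ⟨rfl, ht₂⟩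
  refine Runs.store_eq 0 0 hB rfl rfl (by omega) fun hB => ?_
  refine Runs.store_eq 0 0 hB rfl rfl (by omega) fun hB => ?_
  refine Runs.store_eq 0 0 hB rfl rfl (by omega) fun hB => ?_
  refine Runs.store_eq 0 n hB rfl (by simp [h0]) (by omega) fun hB => ?_
  refine Runs.store_eq 0 0 hB rfl rfl (by omega) fun hB => ?_
  refine Runs.store_eq 0 0 hB rfl rfl (by omega) fun hB => ?_
  refine Runs.store_eq 0 0 hB rfl rfl (by omega) fun hB => ?_
  refine Runs.assign_eq 1 hB rfl (by omega) fun hB => ?_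
  generalize hs₁ : State.setReg _ 42 1 = s₁ at hB ⊢
  have r1 : ∀ y, y ≠ 2 → y ≠ 42 → y ≠ 67 → s₁.reg y = s.reg y := by
    intro y h h' h''
    simp [← hs₁, h, h', h'']
  have m1 : ∀ a, a < 20 ∨ 28 < a → s₁.mem a = s.mem a := by
    intro a ha
    simp only [← hs₁, State.setReg_mem]
    iterate 7 rw [State.setMem_mem_ne _ _ _ (by omega)]
    rw [State.fill_mem_ne _ _ _ _ _ _ (by omega), State.fill_mem_ne _ _ _ _ _ _ (by omega),
      State.setReg_mem]
  have hS : Snapshot n κ par w 0 1 s₁ 0 0 0 fun _ => ∅ := by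
    refine snapshot_zero hκ (fun u hu => ?_) (fun u hu => ?_) (fun a h h' h'' => ?_) ?_ ?_
    · simp only [← hs₁, State.setReg_mem]
      iterate 7 rw [State.setMem_mem_ne _ _ _ (by omega)]
      rw [State.fill_mem_ne _ _ _ _ _ _ (by omega), State.fill_mem_same,
        splice_zero_left _ _ (by omega)]
    · simp only [← hs₁, State.setReg_mem]
      iterate 7 rw [State.setMem_mem_ne _ _ _ (by omega)]
      rw [State.fill_mem_same, splice_zero_left _ _ (by omega)]
    · obtain rfl | rfl | rfl | rfl | rfl | rfl : a = 20 ∨ a = 21 ∨ a = 22 ∨ a = 24 ∨ a = 25 ∨ a = 26 := by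
        omega
      all_goals simp [← hs₁, State.setMem_mem]
    · simp [← hs₁, State.setMem_mem]
    · simp [← hs₁]
  have hx : Ctx n σ s₁ := ⟨by rw [r1 _ (by omega) (by omega) (by omega), h0], by simp [← hs₁],
    by rw [r1 _ (by omega) (by omega) (by omega), h9], by rw [r1 _ (by omega) (by omega) (by omega), h80],
    hfr.of_eq (fun a ha => m1 a (by omega)) (r1 _ (by omega) (by omega) (by omega))⟩
  have h99₁ := r1 99 (by omega) (by omega) (by omega)
  refine Runs.seq (solveLoop_runs hp hB hx hκ hκq hκV hκR
    (by rw [r1 _ (by omega) (by omega) (by omega), h1]) (by rwa [m1 _ (by omega)])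
    (by rwa [m1 _ (by omega)]) hpar hw hS (by omega) hM hM') ?_
  rintro s₂ t₃ hB₂ hF₂ ⟨⟨fc, x, m, b, 𝓓, hS₂, ht₃⟩, hfr₂, h99₂⟩
  have hreg : ∀ y, y ≤ 2 ∨ y = 9 ∨ y = 80 → s₂.reg y = s₁.reg y :=
    fun y hy => hF₂.reg y fun hh => by
      rw [Program.mem_regs_for] at hh
      rcases hh with hh | hh
      · omega
      · have := solveBody_regs y hh; omega
  refine (finish_runs hp hB₂ ⟨(hreg 0 (by omega)).trans hx.reg0, (hreg 2 (by omega)).trans hx.reg2,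
    (hreg 9 (by omega)).trans hx.reg9, (hreg 80 (by omega)).trans hx.reg80, hfr₂⟩ hκ hκq hκV hκR hn hS₂
    ht₃ (by omega) hM hM').mono ?_
  rintro s₃ t₄ - - ⟨hs, hd, hfr₃, h99₃, ht₄⟩
  refine ⟨hs, hd, hfr₃, by omega, ?_⟩
  have hqq : κ.q * κ.q * 1 ≤ κ.q * κ.q * κ.r := Nat.mul_le_mul_left _ (hκ.one_le.trans hκ.le_r)
  have hqn : κ.q * κ.q * κ.r * 1 ≤ κ.q * κ.q * κ.r * n := Nat.mul_le_mul_left _ hn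
  have hsum : κ.q * κ.q * (t₁ + t₂ + 100) ≤ 200 * (κ.q * κ.q * κ.r * n) := by
    calc _ ≤ κ.q * κ.q * (200 * n) := by gcongr; omega
      _ = 200 * (κ.q * κ.q * 1 * n) := by ring
      _ ≤ _ := by gcongr
  refine le_trans ?_ (show κ.q * κ.q * (t₁ + t₂ + 100) + κ.q * κ.q * (t₃ + t₄) ≤ _ by
    linarith [Nat.zero_le (κ.q * κ.q * κ.r * n)])
  rw [← mul_add]
  refine Nat.mul_le_mul_left _ ?_
  simp only [Expr.cost_add, Expr.cost_reg, Expr.cost_zero, Expr.cost_one]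
  norm_num only [← add_assoc]
  omega

/-! ### The subtrees as sets of nodes -/

/-- The parents of the nodes in `X` belong to `X`, or are `u`. -/
def Hangs (par : ℕ → ℕ) (X : Finset ℕ) (u : ℕ) : Prop := ∀ x ∈ X, par x ∈ X ∨ par x = u

/-- The greatest common node has a greater parent, which cannot be common. So the parent would be u
or v, and in each case one of the last three hypotheses is violated. -/
theorem Hangs.disjoint {par : ℕ → ℕ} {X Y : Finset ℕ} {u v : ℕ} (hX : Hangs par X u)
    (hY : Hangs par Y v) (hpar : ∀ x ∈ X, x < par x) (huv : u ≠ v) (hu : u ∉ Y) (hv : v ∉ X) :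
    Disjoint X Y := by
  rw [Finset.disjoint_iff_inter_eq_empty]
  by_contra h
  obtain ⟨x, hx, hmax⟩ := Finset.exists_max_image (X ∩ Y) id (Finset.nonempty_iff_ne_empty.mpr h)
  rw [Finset.mem_inter] at hx
  rcases hX x hx.1 with h1 | h1 <;> rcases hY x hx.2 with h2 | h2
  · have := hmax _ (Finset.mem_inter.mpr ⟨h1, h2⟩)
    have := hpar x hx.1
    simp at *; omega
  · exact hv (h2 ▸ h1)
  · exact hu (h1 ▸ h2)
  · exact huv (h1.symm.trans h2)

/-- The nodes are inserted in decreasing order. The smallest node is nobody's parent, so the others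
split by induction, and it joins the side determined by its own parent. -/
theorem exists_split {par : ℕ → ℕ} {u v : ℕ} (X : Finset ℕ) :
    (∀ x ∈ X, x < par x) → (∀ x ∈ X, par x ∈ X ∨ par x = u ∨ par x = v) →
    ∃ Y Z, X = Y ∪ Z ∧ Disjoint Y Z ∧ Hangs par Y u ∧ Hangs par Z v := by
  induction X using Finset.induction_on_min with
  | empty => exact fun _ _ => ⟨∅, ∅, by simp, by simp, by simp [Hangs], by simp [Hangs]⟩
  | insert x X hlt ih =>
    intro hpar hX
    have hne : ∀ y ∈ X, par y ≠ x := fun y hy h => by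
      have := hpar y (by simp [hy])
      have := hlt y hy
      omega
    have hxX : x ∉ X := fun h => (hlt x h).false
    obtain ⟨Y, Z, rfl, hd, hY, hZ⟩ := ih (fun y hy => hpar y (by simp [hy])) fun y hy => by
      simpa [hne y hy] using hX y (Finset.mem_insert_of_mem hy)
    have hx := hX x (by simp)
    have := hpar x (by simp)
    simp only [Finset.mem_insert, Finset.mem_union, show par x ≠ x by omega, false_or] at hx
    simp only [Finset.mem_union, not_or] at hxX
    have hcase : (par x ∈ Y ∨ par x = u) ∨ (par x ∈ Z ∨ par x = v) := by tauto
    rcases hcase with h | h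
    · refine ⟨insert x Y, Z, by simp, by simp [hd, hxX], ?_, hZ⟩
      intro y hy
      rcases Finset.mem_insert.mp hy with rfl | hy
      · exact h.imp_left (Finset.mem_insert_of_mem ·)
      · exact (hY y hy).imp_left (Finset.mem_insert_of_mem ·)
    · refine ⟨Y, insert x Z, by simp, by simp [hd, hxX], hY, ?_⟩
      intro y hy
      rcases Finset.mem_insert.mp hy with rfl | hy
      · exact h.imp_left (Finset.mem_insert_of_mem ·)
      · exact (hZ y hy).imp_left (Finset.mem_insert_of_mem ·)

/-- The pair (size, number of ones) of a set of nodes. -/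
def pairOf (w : ℕ → ℕ) (X : Finset ℕ) : ℕ × ℕ := (X.card, ∑ x ∈ X, w x)

theorem pairOf_union (w : ℕ → ℕ) {X Y : Finset ℕ} (h : Disjoint X Y) :
    pairOf w (X ∪ Y) = pairOf w X + pairOf w Y := by
  rw [pairOf, Finset.card_union_of_disjoint h, Finset.sum_union h]; rfl

theorem pairOf_insert (w : ℕ → ℕ) {X : Finset ℕ} {t : ℕ} (h : t ∉ X) :
    pairOf w (insert t X) = (1, w t) + pairOf w X := by
  rw [pairOf, Finset.card_insert_of_notMem h, Finset.sum_insert h, add_comm X.card]; rfl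

/-- Parents have greater numbers, so the last node k can belong to a set hanging from u only if u is
its parent. The rest then splits into a part hanging from k and a part hanging from u; conversely,
such parts are disjoint. -/
theorem mem_fam {par w : ℕ → ℕ} {k : ℕ} : ∀ {u : ℕ} {a : ℕ × ℕ}, (∀ x < k, x < par x) → k ≤ u →
    (a ∈ fam par w k u ↔ ∃ X ⊆ Finset.range k, Hangs par X u ∧ a = pairOf w X) := by
  induction k with
  | zero =>
    intro u a _ _
    simp only [fam, Set.mem_singleton_iff, Finset.range_zero, Finset.subset_empty]
    exact ⟨fun h => ⟨∅, rfl, by simp [Hangs], h⟩, fun ⟨_, h, _, h'⟩ => by subst h; exact h'⟩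
  | succ k ih =>
    intro u a hpar hu
    have hpar' : ∀ x < k, x < par x := fun x hx => hpar x (by omega)
    have hsub : ∀ {X}, X ⊆ Finset.range k → X ⊆ Finset.range (k + 1) := fun h =>
      h.trans (by simp)
    have hnot : ∀ {X : Finset ℕ} {y}, X ⊆ Finset.range k → k ≤ y → y ∉ X := fun h hy hm => by
      have := Finset.mem_range.mp (h hm); omega
    by_cases hup : u = par k
    · rw [fam, if_pos hup, Set.mem_add]
      constructor
      · rintro ⟨c, hc, d, hd, rfl⟩
        obtain ⟨Y, hYs, hY, rfl⟩ := (ih hpar' (by omega)).mp hd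
        rcases hc with rfl | ⟨_, rfl, c, hc, rfl⟩
        · exact ⟨Y, hsub hYs, hY, by simp⟩
        obtain ⟨X, hXs, hX, rfl⟩ := (ih hpar' le_rfl).mp hc
        have hk : k ∉ X := hnot hXs le_rfl
        refine ⟨insert k X ∪ Y, ?_, ?_, ?_⟩
        · rw [Finset.union_subset_iff, Finset.insert_subset_iff]
          exact ⟨⟨by simp, hsub hXs⟩, hsub hYs⟩
        · intro x hx
          simp only [Finset.mem_union, Finset.mem_insert] at hx ⊢
          rcases hx with (rfl | hx) | hx
          · exact .inr hup.symm
          · rcases hX x hx with h | h <;> simp [h]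
          · rcases hY x hx with h | h <;> simp [h]
        · rw [pairOf_union, pairOf_insert w hk]
          rw [Finset.disjoint_insert_left]
          exact ⟨hnot hYs le_rfl, hX.disjoint hY (fun x hx => hpar' x (Finset.mem_range.mp (hXs hx)))
            (by omega) (hnot hYs le_rfl) (hnot hXs (by omega))⟩
      · rintro ⟨X, hXs, hX, rfl⟩
        by_cases hk : k ∈ X
        · have hXe : ∀ x ∈ X.erase k, x < k := fun x hx => by
            have := Finset.mem_range.mp (hXs (Finset.mem_of_mem_erase hx))
            have := Finset.ne_of_mem_erase hx
            omega
          obtain ⟨Y, Z, he, hd, hY, hZ⟩ := exists_split (par := par) (u := k) (v := u) (X.erase k)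
            (fun x hx => hpar' x (hXe x hx)) fun x hx => by
              rcases hX x (Finset.mem_of_mem_erase hx) with h | h
              · by_cases hk' : par x = k
                · exact .inr (.inl hk')
                · exact .inl (Finset.mem_erase.mpr ⟨hk', h⟩)
              · exact .inr (.inr h)
          rw [he] at hXe
          refine ⟨(1, w k) + pairOf w Y, .inr ⟨_, rfl, _, (ih hpar' le_rfl).mpr
            ⟨Y, fun y hy => by simp [hXe y (by simp [hy])], hY, rfl⟩, rfl⟩, pairOf w Z,
            (ih hpar' (by omega)).mpr ⟨Z, fun y hy => by simp [hXe y (by simp [hy])], hZ, rfl⟩, ?_⟩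
          rw [← Finset.insert_erase hk, pairOf_insert w (by simp), he, pairOf_union w hd, add_assoc]
        · refine ⟨0, .inl rfl, _, (ih hpar' (by omega)).mpr ⟨X, fun x hx => ?_, hX, rfl⟩, zero_add _⟩
          have := Finset.mem_range.mp (hXs hx)
          have : x ≠ k := fun h => hk (h ▸ hx)
          simp; omega
    · rw [fam, if_neg hup, ih hpar' (by omega)]
      refine ⟨fun ⟨X, h, h'⟩ => ⟨X, hsub h, h'⟩, fun ⟨X, h, hX, ha⟩ => ⟨X, fun x hx => ?_, hX, ha⟩⟩
      have hk := hpar k (by omega)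
      have := Finset.mem_range.mp (h hx)
      have : x ≠ k := by
        rintro rfl
        rcases hX x hx with h' | h'
        · have := Finset.mem_range.mp (h h'); omega
        · exact hup h'.symm
      simp; omega

/-- `X` is nonempty, and contains the parents of all its nodes except one. -/
def IsSubtree (par : ℕ → ℕ) (X : Finset ℕ) : Prop := ∃ t ∈ X, ∀ x ∈ X, x ≠ t → par x ∈ X

/-- The greatest node has its parent outside X, so it is the exceptional node t. -/
theorem IsSubtree.le_top {par : ℕ → ℕ} {X : Finset ℕ} {t : ℕ} (h : ∀ x ∈ X, x ≠ t → par x ∈ X)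
    (hpar : ∀ x ∈ X, x < par x) : ∀ x ∈ X, x ≤ t := by
  intro x hx
  obtain ⟨y, hy, hmax⟩ := Finset.exists_max_image X id ⟨x, hx⟩
  have h1 : y = t := by
    by_contra hne
    have := hmax _ (h y hy hne)
    have := hpar y hy
    simp at *; omega
  exact h1 ▸ hmax x hx

theorem mem_subtreePairs {par w : ℕ → ℕ} {n : ℕ} {a : ℕ × ℕ} (hpar : ∀ x < n, x < par x) :
    a ∈ subtreePairs par w n ↔ ∃ X ⊆ Finset.range n, IsSubtree par X ∧ a = pairOf w X := by
  constructor
  · rintro ⟨t, ht, _, rfl, a, ha, rfl⟩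
    obtain ⟨X, hXs, hX, rfl⟩ := (mem_fam (fun x hx => hpar x (by omega)) le_rfl).mp ha
    have htX : t ∉ X := fun h => by simpa using hXs h
    refine ⟨insert t X, fun x hx => ?_, ⟨t, by simp, fun x hx hxt => ?_⟩, (pairOf_insert w htX).symm⟩
    · rcases Finset.mem_insert.mp hx with rfl | hx
      · simpa using ht
      · have := Finset.mem_range.mp (hXs hx); simp; omega
    · rcases hX x ((Finset.mem_insert.mp hx).resolve_left hxt) with h | h <;> simp [h]
  · rintro ⟨X, hXs, ⟨t, ht, hX⟩, rfl⟩
    have hle := IsSubtree.le_top hX fun x hx => hpar x (Finset.mem_range.mp (hXs hx))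
    have htn := Finset.mem_range.mp (hXs ht)
    refine ⟨t, htn, _, rfl, pairOf w (X.erase t),
      (mem_fam (fun x hx => hpar x (by omega)) le_rfl).mpr ⟨X.erase t, fun x hx => ?_, fun x hx => ?_, rfl⟩,
      ?_⟩
    · have := hle x (Finset.mem_of_mem_erase hx)
      have := Finset.ne_of_mem_erase hx
      simp; omega
    · have := hX x (Finset.mem_of_mem_erase hx) (Finset.ne_of_mem_erase hx)
      by_cases h : par x = t <;> simp [h, this]
    · simp [← pairOf_insert]
      rw [Finset.insert_erase ht]

/-- If the top has a parent in the tree, that parent is added. Otherwise the top is the root, and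
the greatest missing node is added: its parent is greater, hence present. -/
theorem IsSubtree.grow {par w : ℕ → ℕ} {n : ℕ} {X : Finset ℕ} (hpar : ∀ x < n, x < par x)
    (hroot : ∀ x, x + 1 < n → par x < n) (hw : ∀ x < n, w x ≤ 1) (hX : IsSubtree par X)
    (hXs : X ⊆ Finset.range n) (hc : X.card < n) : ∃ Y ⊆ Finset.range n, IsSubtree par Y ∧
      Y.card = X.card + 1 ∧ (pairOf w Y).2 ≤ (pairOf w X).2 + 1 := by
  suffices h : ∃ y < n, y ∉ X ∧ IsSubtree par (insert y X) by
    obtain ⟨y, hy, hyX, h⟩ := h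
    refine ⟨_, Finset.insert_subset (by simpa using hy) hXs, h, Finset.card_insert_of_notMem hyX, ?_⟩
    rw [pairOf_insert w hyX, Prod.snd_add, add_comm]
    exact Nat.add_le_add_left (hw y hy) _
  obtain ⟨t, ht, hX⟩ := hX
  have hle := IsSubtree.le_top hX fun x hx => hpar x (Finset.mem_range.mp (hXs hx))
  have htn := Finset.mem_range.mp (hXs ht)
  have htp := hpar t htn
  by_cases hp : par t < n
  · refine ⟨par t, hp, fun h => by have := hle _ h; omega, par t, by simp, fun x hx hxt => ?_⟩
    have hx := (Finset.mem_insert.mp hx).resolve_left hxt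
    by_cases h : x = t <;> simp [h, hX x hx]
  · obtain ⟨z, hz, hzX⟩ : ∃ z ∈ Finset.range n, z ∉ X := by
      by_contra! h
      have := Finset.card_le_card (show Finset.range n ⊆ X from h)
      simp at this; omega
    obtain ⟨y, hy, hmax⟩ := Finset.exists_max_image (Finset.range n \ X) id
      ⟨z, Finset.mem_sdiff.mpr ⟨hz, hzX⟩⟩
    simp only [Finset.mem_sdiff, Finset.mem_range, id] at hy hmax
    have htop : t + 1 = n := by
      by_contra h
      exact hp (hroot t (by omega))
    have hyt : y ≠ t := fun h => hy.2 (h ▸ ht)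
    refine ⟨y, hy.1, hy.2, t, by simp [ht], fun x hx hxt => Finset.mem_insert_of_mem ?_⟩
    rcases Finset.mem_insert.mp hx with rfl | hx
    · by_contra h
      have := hmax (par x) ⟨hroot x (by omega), h⟩
      have := hpar x hy.1
      omega
    · exact hX x hx hxt

/-- The smallest node is nobody's parent, and it is not the top because there are at least two
nodes; so it can be removed. -/
theorem IsSubtree.shrink {par w : ℕ → ℕ} {n : ℕ} {X : Finset ℕ} (hpar : ∀ x < n, x < par x)
    (hX : IsSubtree par X) (hXs : X ⊆ Finset.range n) (hc : 1 < X.card) :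
    ∃ Y ⊆ Finset.range n, IsSubtree par Y ∧ Y.card + 1 = X.card ∧ (pairOf w Y).2 ≤ (pairOf w X).2 := by
  obtain ⟨t, ht, hX⟩ := hX
  have hle := IsSubtree.le_top hX fun x hx => hpar x (Finset.mem_range.mp (hXs hx))
  obtain ⟨y, hy, hmin⟩ := Finset.exists_min_image X id ⟨t, ht⟩
  simp only [id] at hmin
  have hyt : y ≠ t := by
    rintro rfl
    have : X ⊆ {y} := fun x hx => Finset.mem_singleton.mpr (le_antisymm (hle x hx) (hmin x hx))
    have := Finset.card_le_card this
    simp at this; omega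
  refine ⟨X.erase y, (Finset.erase_subset _ _).trans hXs, ⟨t, by simp [ht, hyt.symm], fun x hx hxt => ?_⟩,
    Finset.card_erase_add_one hy, Finset.sum_le_sum_of_subset (Finset.erase_subset _ _)⟩
  have hx := Finset.mem_of_mem_erase hx
  have := hmin x hx
  have := hpar x (Finset.mem_range.mp (hXs hx))
  exact Finset.mem_erase.mpr ⟨by omega, hX x hx hxt⟩

/-- Every value that the envelope uses, with shrinking free and enlarging at cost 1, is an upper
bound for an actual subtree of the right size. This makes the envelope exact. -/
theorem exists_subtree_card {par w : ℕ → ℕ} {n : ℕ} {X : Finset ℕ} (hpar : ∀ x < n, x < par x)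
    (hroot : ∀ x, x + 1 < n → par x < n) (hw : ∀ x < n, w x ≤ 1) (hX : IsSubtree par X)
    (hXs : X ⊆ Finset.range n) {i : ℕ} (hi : 1 ≤ i) (hin : i ≤ n) : ∃ Y ⊆ Finset.range n,
      IsSubtree par Y ∧ Y.card = i ∧ (pairOf w Y).2 ≤ (pairOf w X).2 + (i - X.card) := by
  rcases le_total X.card i with h | h
  · induction i, h using Nat.le_induction with
    | base => exact ⟨X, hXs, hX, rfl, by simp⟩
    | succ i h ih =>
      obtain ⟨t, ht, -⟩ := hX
      have : 0 < X.card := Finset.card_pos.mpr ⟨t, ht⟩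
      obtain ⟨Y, hYs, hY, hc, hle⟩ := ih (by omega) (by omega)
      obtain ⟨Z, hZs, hZ, hc', hle'⟩ := hY.grow hpar hroot hw hYs (by omega)
      exact ⟨Z, hZs, hZ, by omega, by omega⟩
  · obtain ⟨d, hd⟩ := Nat.exists_eq_add_of_le h
    induction d generalizing X with
    | zero => exact ⟨X, hXs, hX, hd, by omega⟩
    | succ d ih =>
      obtain ⟨Z, hZs, hZ, hc, hle⟩ := hX.shrink (w := w) hpar hXs (by omega)
      obtain ⟨Y, hYs, hY, hc', hle'⟩ := ih hZ hZs (by omega) (by omega)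
      exact ⟨Y, hYs, hY, hc', by omega⟩

/-- An array that accounts for all subtrees and is sound contains the least numbers of ones. -/
theorem isLeast_subtreePairs {par w G : ℕ → ℕ} {n : ℕ} (hpar : ∀ x < n, x < par x)
    (hroot : ∀ x, x + 1 < n → par x < n) (hw : ∀ x < n, w x ≤ 1)
    (hs : Sound n (answers par w n) G) (hd : subtreePairs par w n ⊆ done G) {i : ℕ} (hi : 1 ≤ i)
    (hin : i ≤ n) : IsLeast {m | (i, m) ∈ subtreePairs par w n} (G i) := by
  have hlow : ∀ m, (i, m) ∈ subtreePairs par w n → G i ≤ m := fun m hm => hd hm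
  suffices h : ∃ m ≤ G i, (i, m) ∈ subtreePairs par w n by
    obtain ⟨m, hm, h⟩ := h
    exact ⟨by rwa [Set.mem_ofPred_eq, le_antisymm (hlow m h) hm], fun m hm => hlow m hm⟩
  have key : ∀ X ⊆ Finset.range n, IsSubtree par X → (pairOf w X).2 + (i - X.card) ≤ G i →
      ∃ m ≤ G i, (i, m) ∈ subtreePairs par w n := by
    intro X hXs hX hle
    obtain ⟨Y, hYs, hY, hc, h⟩ := exists_subtree_card hpar hroot hw hX hXs hi hin
    refine ⟨(pairOf w Y).2, h.trans hle, (mem_subtreePairs hpar).mpr ⟨Y, hYs, hY, ?_⟩⟩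
    rw [← hc]; rfl
  obtain ⟨a, ha, he⟩ := exists_env (𝓟 := answers par w n) ⟨(0, n), .inl (le_refl n)⟩ i
  have hG := hs i hin
  rcases ha with ha | ha
  -- Here the envelope is attained by a dummy pair, so the entry is at least n. A single node,
  -- enlarged to i nodes, has at most i ≤ n ones.
  · refine key {0} (by simp; omega) ⟨0, by simp, by simp⟩ ?_
    have := hw 0 (by omega)
    simp [pairOf] at ha ⊢
    omega
  · obtain ⟨X, hXs, hX, rfl⟩ := (mem_subtreePairs hpar).mp ha
    exact key X hXs hX (he.symm.trans_le hG)

/-! ### Removing the leaves of a tree one by one -/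

open Classical in
/-- The sum of `f` over the neighbours of `v` in `U`. -/
noncomputable def nbrSum (A : ℕ → ℕ → Prop) (U : Finset ℕ) (f : ℕ → ℕ) (v : ℕ) : ℕ :=
  ∑ x ∈ U with A v x, f x

/-- The graph with adjacency relation `A` is a tree on the nodes in `U`: every cut is crossed by an
edge, and the sum of the degrees is right. -/
structure TreeOn (A : ℕ → ℕ → Prop) (U : Finset ℕ) : Prop where
  symm : ∀ x y, A x y → A y x
  irrefl : ∀ x, ¬ A x x
  cut : ∀ X ⊆ U, X.Nonempty → X ≠ U → ∃ x ∈ X, ∃ y ∈ U, y ∉ X ∧ A x y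
  sum : ∑ v ∈ U, nbrSum A U 1 v + 2 = 2 * U.card

section
variable {A : ℕ → ℕ → Prop} {U : Finset ℕ}

theorem nbrSum_erase_add (f : ℕ → ℕ) {v : ℕ} (hv : v ∈ U) (x : ℕ) [Decidable (A x v)] :
    nbrSum A (U.erase v) f x + (if A x v then f v else 0) = nbrSum A U f x := by
  classical
  rw [nbrSum, nbrSum, Finset.sum_filter, Finset.sum_filter, ← Finset.add_sum_erase U _ hv, add_comm]
  congr

/-- The average degree is below 2. -/
theorem TreeOn.exists_leaf (h : TreeOn A U) : ∃ v ∈ U, nbrSum A U 1 v ≤ 1 := by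
  by_contra! hc
  have : ∑ v ∈ U, 2 ≤ ∑ v ∈ U, nbrSum A U 1 v := Finset.sum_le_sum fun v hv => hc v hv
  have := h.sum
  simp at *; omega

theorem TreeOn.exists_nbr (h : TreeOn A U) {v : ℕ} (hv : v ∈ U) (hU : 2 ≤ U.card)
    (hd : nbrSum A U 1 v ≤ 1) : ∃ p ∈ U, p ≠ v ∧ (∀ x ∈ U, A v x ↔ x = p) ∧
      ∀ f, nbrSum A U f v = f p := by
  classical
  obtain ⟨x, hx, p, hp, hpv, hA⟩ := h.cut {v} (by simpa using hv) (by simp) (by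
    rintro rfl; simp at hU)
  obtain rfl := Finset.mem_singleton.mp hx
  have hpf : p ∈ U.filter (A x) := by simp [hp, hA]
  have hcard : (U.filter (A x)).card ≤ 1 := by
    simpa [nbrSum] using hd
  have he : U.filter (A x) = {p} := Finset.eq_singleton_iff_unique_mem.mpr
    ⟨hpf, fun y hy => Finset.card_le_one.mp hcard y hy p hpf⟩
  refine ⟨p, hp, by simpa using hpv, fun y hy => ?_, fun f => ?_⟩
  · have : y ∈ U.filter (A x) ↔ y ∈ ({p} : Finset ℕ) := by rw [he]
    simpa [hy] using this
  · rw [nbrSum]; convert Finset.sum_singleton f p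

/-- Put the leaf v on the side of the cut that contains its neighbour p: an edge across the enlarged
cut then avoids v. The sum of the degrees drops by 2, once for v and once for p. -/
theorem TreeOn.erase (h : TreeOn A U) {v p : ℕ} (hv : v ∈ U) (hp : p ∈ U)
    (hA : ∀ x ∈ U, A v x ↔ x = p) : TreeOn A (U.erase v) := by
  classical
  have hA' : ∀ x ∈ U, A x v ↔ x = p := fun x hx =>
    ⟨fun hx' => (hA x hx).mp (h.symm _ _ hx'), fun hx' => h.symm _ _ ((hA x hx).mpr hx')⟩
  have hpv : p ≠ v := by
    rintro rfl
    exact h.irrefl _ ((hA p hp).mpr rfl)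
  refine ⟨h.symm, h.irrefl, fun X hX hne hXU => ?_, ?_⟩
  · have hXU' : X ⊆ U := hX.trans (Finset.erase_subset _ _)
    have hvX : v ∉ X := fun hh => by simpa using hX hh
    by_cases hpX : p ∈ X
    · obtain ⟨x, hx, y, hy, hyX, hxy⟩ := h.cut (insert v X) (Finset.insert_subset hv hXU') (by simp)
        (by rintro rfl; exact hXU (by simp [hvX]))
      simp only [Finset.mem_insert, not_or] at hx hyX
      refine ⟨x, hx.resolve_left ?_, y, Finset.mem_erase.mpr ⟨hyX.1, hy⟩, hyX.2, hxy⟩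
      rintro rfl
      exact hyX.2 ((hA y hy).mp hxy ▸ hpX)
    · obtain ⟨x, hx, y, hy, hyX, hxy⟩ := h.cut X hXU' hne (by rintro rfl; exact hvX hv)
      refine ⟨x, hx, y, Finset.mem_erase.mpr ⟨?_, hy⟩, hyX, hxy⟩
      rintro rfl
      exact hpX ((hA' x (hXU' hx)).mp hxy ▸ hx)
  · have h1 : ∑ x ∈ U.erase v, (nbrSum A (U.erase v) 1 x + if A x v then 1 else 0) =
        ∑ x ∈ U.erase v, nbrSum A U 1 x := Finset.sum_congr rfl fun x _ => nbrSum_erase_add 1 hv x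
    have h2 : ∑ x ∈ U.erase v, (if A x v then 1 else 0) = 1 := by
      calc _ = ∑ x ∈ U.erase v, (if x = p then 1 else 0) := Finset.sum_congr rfl fun x hx => by
            simp only [hA' x (Finset.mem_of_mem_erase hx)]
        _ = 1 := by simp [hp, hpv]
    have h3 : nbrSum A U 1 v = 1 := by
      rw [nbrSum, Finset.filter_congr hA]
      simp [Finset.filter_eq', hp]
    have h4 := Finset.add_sum_erase U (nbrSum A U 1) hv
    have h5 := h.sum
    have h6 := Finset.card_erase_add_one hv
    rw [Finset.sum_add_distrib, h2] at h1
    omega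

theorem nbrSum_erase_of_ne (h : TreeOn A U) {v p : ℕ} (hv : v ∈ U)
    (hA : ∀ x ∈ U, A v x ↔ x = p) (f : ℕ → ℕ) {x : ℕ} (hx : x ∈ U) (hxp : x ≠ p) :
    nbrSum A (U.erase v) f x = nbrSum A U f x := by
  classical
  rw [← nbrSum_erase_add f hv x, if_neg fun hh => hxp ((hA x hx).mp (h.symm _ _ hh)), add_zero]

theorem nbrSum_erase_nbr (h : TreeOn A U) {v p : ℕ} (hv : v ∈ U) (hp : p ∈ U)
    (hA : ∀ x ∈ U, A v x ↔ x = p) (f : ℕ → ℕ) :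
    nbrSum A (U.erase v) f p + f v = nbrSum A U f p := by
  classical
  rw [← nbrSum_erase_add f hv p, if_pos (h.symm _ _ ((hA p hp).mpr rfl))]

end

/-- The nodes that are not among the first `k` nodes in the order `o`. -/
def remaining (n : ℕ) (o : ℕ → ℕ) (k : ℕ) : Finset ℕ := Finset.range n \ (Finset.range k).image o

theorem mem_remaining {n k x : ℕ} {o : ℕ → ℕ} :
    x ∈ remaining n o k ↔ x < n ∧ ∀ i < k, o i ≠ x := by
  simp [remaining]

theorem remaining_zero (n : ℕ) (o : ℕ → ℕ) : remaining n o 0 = Finset.range n := by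
  ext; simp [mem_remaining]

theorem remaining_succ (n : ℕ) (o : ℕ → ℕ) (k : ℕ) :
    remaining n o (k + 1) = (remaining n o k).erase (o k) := by
  ext x
  simp only [mem_remaining, Finset.mem_erase, Nat.lt_succ_iff_lt_or_eq, or_imp, forall_and,
    forall_eq]
  tauto

theorem remaining_congr {n k : ℕ} {o o' : ℕ → ℕ} (h : ∀ i < k, o i = o' i) :
    remaining n o k = remaining n o' k := by
  ext x
  simp only [mem_remaining]
  exact and_congr_right fun _ => forall₂_congr fun i hi => by rw [h i hi]

/-- `q` is the end of the queue of leaves. -/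
structure Queue (A : ℕ → ℕ → Prop) (n k q : ℕ) (o : ℕ → ℕ) : Prop where
  le : k ≤ q
  lt : ∀ i < q, o i < n
  inj : ∀ i < q, ∀ j < q, o i = o j → i = j
  leaf : ∀ v ∈ remaining n o k, (∃ i < q, o i = v) ↔ nbrSum A (remaining n o k) 1 v ≤ 1

theorem card_remaining {A : ℕ → ℕ → Prop} {n k q : ℕ} {o : ℕ → ℕ} (h : Queue A n k q o) :
    (remaining n o k).card + k = n := by
  have h1 : ((Finset.range k).image o).card = k := by
    rw [Finset.card_image_of_injOn, Finset.card_range]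
    intro i hi j hj hij
    have := h.le
    simp at hi hj
    exact h.inj i (by omega) j (by omega) hij
  have h2 : (Finset.range k).image o ⊆ Finset.range n := by
    intro x hx
    obtain ⟨i, hi, rfl⟩ := Finset.mem_image.mp hx
    have := h.le
    simp at hi ⊢
    exact h.lt i (by omega)
  have h3 := Finset.card_sdiff_add_card_eq_card h2
  rw [Finset.card_range, h1] at h3
  exact h3

theorem Queue.le_size {A : ℕ → ℕ → Prop} {n k q : ℕ} {o : ℕ → ℕ} (h : Queue A n k q o) : q ≤ n := by
  have := Finset.card_le_card_of_injOn (s := Finset.range q) (t := Finset.range n) o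
    (fun i hi => by simpa using h.lt i (by simpa using hi))
    fun i hi j hj => h.inj i (by simpa using hi) j (by simpa using hj)
  simpa using this

theorem Queue.lt_end {A : ℕ → ℕ → Prop} {n k q : ℕ} {o : ℕ → ℕ} (h : Queue A n k q o)
    (hT : TreeOn A (remaining n o k)) : k < q := by
  obtain ⟨v, hv, hd⟩ := hT.exists_leaf
  obtain ⟨i, hi, rfl⟩ := (h.leaf v hv).mpr hd
  by_contra hc
  exact (mem_remaining.mp hv).2 i (by omega) rfl

theorem Queue.mem {A : ℕ → ℕ → Prop} {n k q : ℕ} {o : ℕ → ℕ} (h : Queue A n k q o) (hk : k < q) :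
    o k ∈ remaining n o k :=
  mem_remaining.mpr ⟨h.lt k hk, fun i hi he => by have := h.inj i (by omega) k hk he; omega⟩

/-- `π` gives, for each node but the last in the order `o`, its only neighbour later in the order. -/
def Peels (A : ℕ → ℕ → Prop) (n k : ℕ) (o π : ℕ → ℕ) : Prop :=
  ∀ i < k, π i ∈ remaining n o (i + 1) ∧ ∀ x ∈ remaining n o (i + 1), A (o i) x ↔ x = π i

theorem Peels.congr {A : ℕ → ℕ → Prop} {n k : ℕ} {o o' π π' : ℕ → ℕ} (h : Peels A n k o π)
    (ho : ∀ i < k, o' i = o i) (hπ : ∀ i < k, π' i = π i) : Peels A n k o' π' := by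
  intro i hi
  rw [ho i hi, hπ i hi, remaining_congr fun j hj => ho j (by omega)]
  exact h i hi

theorem Peels.succ {A : ℕ → ℕ → Prop} {n k p : ℕ} {o π : ℕ → ℕ} (h : Peels A n k o π)
    (hp : p ∈ remaining n o (k + 1)) (hA : ∀ x ∈ remaining n o (k + 1), A (o k) x ↔ x = p)
    (hπ : π k = p) : Peels A n (k + 1) o π := by
  intro i hi
  rcases Nat.lt_succ_iff_lt_or_eq.mp hi with hi | rfl
  · exact h i hi
  · rw [hπ]; exact ⟨hp, hA⟩

/-- The arrays for the remaining nodes. -/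
structure Peel (A : ℕ → ℕ → Prop) (n k : ℕ) (s : State) : Prop where
  tree : TreeOn A (remaining n (s.mem 14) k)
  queue : Queue A n k (s.reg 4) (s.mem 14)
  peels : Peels A n k (s.mem 14) (s.mem 15)
  deg : ∀ v ∈ remaining n (s.mem 14) k, s.mem 12 v = nbrSum A (remaining n (s.mem 14) k) 1 v
  nbr : ∀ v ∈ remaining n (s.mem 14) k, s.mem 13 v = nbrSum A (remaining n (s.mem 14) k) id v

/-- One round: remove the next leaf in the queue. -/
def peelBody : Program :=
  .assign 5 (.cell 14 (.reg 3)) ;; .assign 6 (.cell 13 (.reg 5)) ;; .store 15 (.reg 3) (.reg 6) ;;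
  .store 13 (.reg 6) (.cell 13 (.reg 6) - .reg 5) ;; .store 12 (.reg 6) (.cell 12 (.reg 6) - 1) ;;
  .ite (.op .eq (.cell 12 (.reg 6)) 1)
    (.store 14 (.reg 4) (.reg 6) ;; .assign 4 (.reg 4 + 1)) .skip

/-- Adjacency lists are not needed: for each node only the degree and the sum of the neighbours are
stored, and for a leaf this sum is its only neighbour. -/
theorem peelBody_runs {A : ℕ → ℕ → Prop} {n k M : ℕ} {s : State} (hB : Bdd M s)
    (h : Peel A n k s) (hk : k + 1 < n) (h3 : s.reg 3 = k) (hnM : n ≤ M) :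
    Runs M peelBody s fun s' t => Peel A n (k + 1) s' ∧ t ≤ 40 := by
  obtain ⟨hT, hQ, hP, hdeg, hnbr⟩ := h
  have hcard := card_remaining hQ
  have hkq := hQ.lt_end hT
  have hvm := hQ.mem hkq
  have hsucc := remaining_succ n (s.mem 14) k
  generalize hU : remaining n (s.mem 14) k = U at *
  generalize hv : s.mem 14 k = v at *
  have hvn : v < n := hv ▸ hQ.lt k hkq
  obtain ⟨p, hp, hpv, hA, hsum⟩ := hT.exists_nbr hvm (by omega)
    ((hQ.leaf v (hU ▸ hvm)).mp ⟨k, hkq, hv⟩ |> fun h => by rwa [hU] at h)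
  have hpn : p < n := (mem_remaining.mp (hU ▸ hp)).1
  have hpU : p ∈ U.erase v := Finset.mem_erase.mpr ⟨hpv, hp⟩
  have hvp : s.mem 13 v = p := (hnbr v hvm).trans (hsum id)
  have hsubM : ∀ a i d, s.mem a i - d ≤ M := fun a i d => (Nat.sub_le _ _).trans (hB.mem a i)
  have hleaf := hQ.leaf
  rw [hU] at hleaf
  have hdp : nbrSum A (U.erase v) 1 p + 1 = s.mem 12 p := by
    rw [hdeg p hp]; exact nbrSum_erase_nbr hT hvm hp hA 1
  have hsp : nbrSum A (U.erase v) id p + v = s.mem 13 p := by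
    rw [hnbr p hp]; exact nbrSum_erase_nbr hT hvm hp hA id
  refine Runs.assign_eq v hB (by simp [h3, hv]) (by omega) fun hB => ?_
  refine Runs.assign_eq p hB (by simp [hvp]) (by omega) fun hB => ?_
  refine Runs.store_eq k p hB (by simp [h3]) (by simp) (by omega) fun hB => ?_
  refine Runs.store_eq p (s.mem 13 p - v) hB (by simp) (by simp [State.setMem_mem]) (hsubM _ _ _)
    fun hB => ?_
  refine Runs.store_eq p (s.mem 12 p - 1) hB (by simp) (by simp [State.setMem_mem]) (hsubM _ _ _)
    fun hB => ?_
  generalize hs₁ : State.setMem _ 12 _ _ = s₁ at hB ⊢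
  have r6 : s₁.reg 6 = p := by simp [← hs₁]
  have r4 : s₁.reg 4 = s.reg 4 := by simp [← hs₁]
  have m12 : s₁.mem 12 = Function.update (s.mem 12) p (s.mem 12 p - 1) := by
    simp [← hs₁, State.setMem_mem]
  have m13 : s₁.mem 13 = Function.update (s.mem 13) p (s.mem 13 p - v) := by
    simp [← hs₁, State.setMem_mem]
  have m14 : s₁.mem 14 = s.mem 14 := by simp [← hs₁, State.setMem_mem]
  have m15 : s₁.mem 15 = Function.update (s.mem 15) k p := by simp [← hs₁, State.setMem_mem]
  have hdeg' : ∀ x ∈ U.erase v, s₁.mem 12 x = nbrSum A (U.erase v) 1 x := by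
    intro x hx
    have hxU := Finset.mem_of_mem_erase hx
    by_cases hxp : x = p
    · subst hxp; rw [m12, Function.update_self]; omega
    · rw [m12, Function.update_of_ne hxp, hdeg x hxU, nbrSum_erase_of_ne hT hvm hA 1 hxU hxp]
  have hnbr' : ∀ x ∈ U.erase v, s₁.mem 13 x = nbrSum A (U.erase v) id x := by
    intro x hx
    have hxU := Finset.mem_of_mem_erase hx
    by_cases hxp : x = p
    · subst hxp; rw [m13, Function.update_self]; omega
    · rw [m13, Function.update_of_ne hxp, hnbr x hxU, nbrSum_erase_of_ne hT hvm hA id hxU hxp]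
  have hT' := hT.erase hvm hp hA
  have hleaf' : ∀ x ∈ U.erase v, x ≠ p →
      ((∃ i < s.reg 4, s.mem 14 i = x) ↔ nbrSum A (U.erase v) 1 x ≤ 1) := by
    intro x hx hxp
    have hxU := Finset.mem_of_mem_erase hx
    rw [hleaf x hxU, nbrSum_erase_of_ne hT hvm hA 1 hxU hxp]
  have hpeels : ∀ o, (∀ i ≤ k, o i = s.mem 14 i) → Peels A n (k + 1) o (s₁.mem 15) := by
    intro o ho
    refine Peels.congr (o := s.mem 14) (π := s₁.mem 15) ?_ (fun i hi => ho i (by omega))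
      fun i _ => rfl
    refine Peels.succ (p := p) (hP.congr (fun _ _ => rfl) fun i hi => ?_) (hsucc ▸ hpU) ?_
      (by rw [m15, Function.update_self])
    · rw [m15, Function.update_of_ne (by omega)]
    · rw [hsucc, hv]
      exact fun x hx => hA x (Finset.mem_of_mem_erase hx)
  have hptest : (Expr.op .eq (.cell 12 (.reg 6)) 1).val s₁ =
      if nbrSum A (U.erase v) 1 p = 1 then 1 else 0 := by
    simp only [Expr.val_eq, Expr.val_cell, Expr.val_reg, Expr.val_one, r6, hdeg' p hpU]
  refine Runs.ite hB (fun ht => ?_) (fun ht => ?_)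
  · have hd1 : nbrSum A (U.erase v) 1 p = 1 := by
      by_contra hc
      exact ht (by rw [hptest, if_neg hc])
    -- The degree of p has just dropped from 2 to 1, so p was not a leaf before and is not queued
    -- yet.
    have hpq : ∀ i < s.reg 4, s.mem 14 i ≠ p := by
      intro i hi he
      have := (hleaf p hp).mp ⟨i, hi, he⟩
      rw [← hdeg p hp] at this
      omega
    have hrem : remaining n (Function.update (s.mem 14) (s.reg 4) p) (k + 1) = U.erase v := by
      rw [← hsucc]
      exact remaining_congr fun i hi => Function.update_of_ne (by omega) _ _
    have hQ' : Queue A n (k + 1) (s.reg 4 + 1) (Function.update (s.mem 14) (s.reg 4) p) := by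
      refine ⟨by omega, fun i hi => ?_, fun i hi j hj hij => ?_, fun x hx => ?_⟩
      · rcases Nat.lt_succ_iff_lt_or_eq.mp hi with hi | rfl
        · rw [Function.update_of_ne hi.ne]; exact hQ.lt i hi
        · rwa [Function.update_self]
      · rcases Nat.lt_succ_iff_lt_or_eq.mp hi with hi | rfl <;>
          rcases Nat.lt_succ_iff_lt_or_eq.mp hj with hj | rfl
        · rw [Function.update_of_ne hi.ne, Function.update_of_ne hj.ne] at hij
          exact hQ.inj i hi j hj hij
        · rw [Function.update_of_ne hi.ne, Function.update_self] at hij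
          exact absurd hij (hpq i hi)
        · rw [Function.update_of_ne hj.ne, Function.update_self] at hij
          exact absurd hij.symm (hpq j hj)
        · rfl
      · rw [hrem] at hx ⊢
        by_cases hxp : x = p
        · subst hxp
          exact ⟨fun _ => hd1.le, fun _ => ⟨s.reg 4, by omega, Function.update_self ..⟩⟩
        · rw [← hleaf' x hx hxp]
          constructor
          · rintro ⟨i, hi, he⟩
            rcases Nat.lt_succ_iff_lt_or_eq.mp hi with hi | rfl
            · exact ⟨i, hi, by rwa [Function.update_of_ne hi.ne] at he⟩
            · rw [Function.update_self] at he; exact absurd he.symm hxp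
          · rintro ⟨i, hi, he⟩
            exact ⟨i, by omega, by rwa [Function.update_of_ne hi.ne]⟩
    have hqn := hQ'.le_size
    refine Runs.store_eq (s.reg 4) p hB (by simp [r4]) (by simp [r6]) (by omega) fun hB => ?_
    refine Runs.assign hB (by simp [r4]; omega) ?_
    have m14' : ((s₁.setMem 14 (s.reg 4) p).setReg 4 ((Expr.reg 4 + 1).val
        (s₁.setMem 14 (s.reg 4) p))).mem 14 = Function.update (s.mem 14) (s.reg 4) p := by
      simp [m14]
    refine ⟨⟨?_, ?_, ?_, ?_, ?_⟩, ?_⟩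
    · rw [m14', hrem]; exact hT'
    · rw [m14']; simpa [r4] using hQ'
    · rw [m14']
      simpa [State.setMem_mem] using hpeels _ fun i hi => Function.update_of_ne (by omega) _ _
    · rw [m14', hrem]; simpa [State.setMem_mem] using hdeg'
    · rw [m14', hrem]; simpa [State.setMem_mem] using hnbr'
    · simp
  · have hd1 : nbrSum A (U.erase v) 1 p ≠ 1 := by
      intro hc
      rw [hptest, if_pos hc] at ht
      exact one_ne_zero ht
    refine Runs.skip hB ⟨⟨?_, ?_, ?_, ?_, ?_⟩, ?_⟩
    · rw [m14, hsucc]; exact hT'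
    · rw [m14, r4]
      refine ⟨hkq, hQ.lt, hQ.inj, ?_⟩
      rw [hsucc]
      intro x hx
      by_cases hxp : x = p
      -- The new degree is not 1: it is 0, and the neighbour was already queued as a leaf, or at
      -- least 2, and it was not a leaf before either.
      · subst hxp
        rw [hleaf x hp, ← hdeg x hp]
        omega
      · exact hleaf' x hx hxp
    · exact hpeels _ (by simp [m14])
    · rw [m14, hsucc]; exact hdeg'
    · rw [m14, hsucc]; exact hnbr'
    · simp

/-! ### From the edge list to a numbering with parents after children -/

/-- What the first `j` edges contribute to the sum of `f` over the neighbours of `v`. -/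
def edgeSum (e₁ e₂ f : ℕ → ℕ) (j v : ℕ) : ℕ :=
  ∑ i ∈ Finset.range j, ((if e₁ i = v then f (e₂ i) else 0) + if e₂ i = v then f (e₁ i) else 0)

theorem edgeSum_succ (e₁ e₂ f : ℕ → ℕ) (j v : ℕ) : edgeSum e₁ e₂ f (j + 1) v =
    edgeSum e₁ e₂ f j v + (if e₁ j = v then f (e₂ j) else 0) + if e₂ j = v then f (e₁ j) else 0 := by
  rw [edgeSum, Finset.sum_range_succ, ← add_assoc]; rfl

theorem edgeSum_mono (e₁ e₂ f : ℕ → ℕ) {j k : ℕ} (h : j ≤ k) (v : ℕ) :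
    edgeSum e₁ e₂ f j v ≤ edgeSum e₁ e₂ f k v :=
  Finset.sum_le_sum_of_subset (by simpa using h)

theorem nbrSum_le {A : ℕ → ℕ → Prop} {n c : ℕ} {f : ℕ → ℕ} (hf : ∀ x < n, f x ≤ c) (v : ℕ) :
    nbrSum A (Finset.range n) f v ≤ n * c := by
  calc _ ≤ ∑ x ∈ Finset.range n, f x := Finset.sum_le_sum_of_subset (by
        classical exact Finset.filter_subset _ _)
    _ ≤ ∑ x ∈ Finset.range n, c := Finset.sum_le_sum fun x hx => hf x (by simpa using hx)
    _ = n * c := by simp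

/-- Compute the degrees, and the sums of the neighbours. -/
def edgePass : Program :=
  .for_ 3 (.reg 0 - 1) (.assign 5 (.cell 1 (.reg 3)) ;; .assign 6 (.cell 2 (.reg 3)) ;;
    .store 12 (.reg 5) (.cell 12 (.reg 5) + 1) ;; .store 12 (.reg 6) (.cell 12 (.reg 6) + 1) ;;
    .store 13 (.reg 5) (.cell 13 (.reg 5) + .reg 6) ;;
    .store 13 (.reg 6) (.cell 13 (.reg 6) + .reg 5))

theorem edgePass_runs {A : ℕ → ℕ → Prop} {n M : ℕ} {e₁ e₂ : ℕ → ℕ} {s : State} (hB : Bdd M s)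
    (h0 : s.reg 0 = n) (h1 : s.mem 1 = e₁) (h2 : s.mem 2 = e₂)
    (h12 : ∀ v, s.mem 12 v = 0) (h13 : ∀ v, s.mem 13 v = 0)
    (he : ∀ v < n, ∀ f, edgeSum e₁ e₂ f (n - 1) v = nbrSum A (Finset.range n) f v)
    (he₁ : ∀ j < n - 1, e₁ j < n) (he₂ : ∀ j < n - 1, e₂ j < n) (hM : n * n ≤ M) (hM' : n ≤ M) :
    Runs M edgePass s fun s' t => (∀ v < n, s'.mem 12 v = nbrSum A (Finset.range n) 1 v) ∧
      (∀ v < n, s'.mem 13 v = nbrSum A (Finset.range n) id v) ∧ t ≤ 60 * n + 10 := by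
  -- Partial sums never exceed the final degrees and neighbour sums, so they fit into a word.
  have hb1 : ∀ j ≤ n - 1, ∀ v < n, edgeSum e₁ e₂ 1 j v ≤ M := fun j hj v hv =>
    (edgeSum_mono _ _ _ hj v).trans ((he v hv 1).le.trans
      ((nbrSum_le (c := 1) (by simp) v).trans (by omega)))
  have hb2 : ∀ j ≤ n - 1, ∀ v < n, edgeSum e₁ e₂ id j v ≤ M := fun j hj v hv =>
    (edgeSum_mono _ _ _ hj v).trans ((he v hv id).le.trans
      ((nbrSum_le (c := n) (fun x hx => hx.le) v).trans hM))
  refine Runs.for_unif (fun j s' => (∀ v, s'.mem 12 v = edgeSum e₁ e₂ 1 j v) ∧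
    ∀ v, s'.mem 13 v = edgeSum e₁ e₂ id j v) (n - 1) 40 hB (by omega)
    (by simp [Program.regs]) (fun s' hF => ?_) ?_ ?_ ?_
  · simp [hF.reg 0 (by simp [Program.mem_regs_for, Program.regs]), h0]
  · simp [h12, h13, edgeSum]
  · rintro j s' hj hB' hF h3 ⟨h12, h13⟩
    have e1 : s'.mem 1 = e₁ := by rw [hF.mem 1 (by simp [Program.arrs_for, Program.arrs]), h1]
    have e2 : s'.mem 2 = e₂ := by rw [hF.mem 2 (by simp [Program.arrs_for, Program.arrs]), h2]
    have hx := he₁ j hj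
    have hy := he₂ j hj
    have b1 := hb1 (j + 1) (by omega)
    have b2 := hb2 (j + 1) (by omega)
    simp only [edgeSum_succ, Pi.one_apply, id] at b1 b2
    have b1x := b1 _ hx
    have b1y := b1 _ hy
    have b2x := b2 _ hx
    have b2y := b2 _ hy
    rw [if_pos rfl] at b1x b2x
    rw [if_pos (rfl : e₂ j = _)] at b1y b2y
    have c1 : edgeSum e₁ e₂ 1 j (e₂ j) + 1 ≤ M := by omega
    have c2 : edgeSum e₁ e₂ id j (e₂ j) + e₁ j ≤ M := by omega
    refine Runs.assign_eq (e₁ j) hB' (by simp [h3, e1]) (by omega) fun hB' => ?_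
    refine Runs.assign_eq (e₂ j) hB' (by simp [h3, e2]) (by omega) fun hB' => ?_
    refine Runs.store_seq hB' (by simp [h12]; omega) fun hB' => ?_
    refine Runs.store_seq hB' (by simp [h12, Function.update_apply]; split <;> simp_all) fun hB' => ?_
    refine Runs.store_seq hB' (by simp [h13, State.setMem_mem]; omega) fun hB' => ?_
    refine Runs.store hB' (by
      simp [h13, State.setMem_mem, Function.update_apply]; split <;> simp_all) ?_
    refine ⟨⟨fun v => ?_, fun v => ?_⟩, by simp⟩
    · simp [State.setMem_mem, Function.update_apply, h12, edgeSum_succ]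
      grind
    · simp [State.setMem_mem, Function.update_apply, h13, edgeSum_succ]
      grind
  · rintro s' t - - - ⟨h12, h13⟩ ht
    refine ⟨fun v hv => (h12 v).trans (he v hv 1), fun v hv => (h13 v).trans (he v hv id), ?_⟩
    simp at ht
    omega

/-- Put the leaves into the queue. -/
def leafPass : Program :=
  .for_ 3 (.reg 0) (.ite (.op .lt (.cell 12 (.reg 3)) 2)
    (.store 14 (.reg 4) (.reg 3) ;; .assign 4 (.reg 4 + 1)) .skip)

theorem leafPass_runs {A : ℕ → ℕ → Prop} {n M : ℕ} {s : State} (hB : Bdd M s)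
    (h0 : s.reg 0 = n) (h4 : s.reg 4 = 0)
    (h12 : ∀ v < n, s.mem 12 v = nbrSum A (Finset.range n) 1 v) (hM : n ≤ M) :
    Runs M leafPass s fun s' t => Queue A n 0 (s'.reg 4) (s'.mem 14) ∧ t ≤ 60 * n + 10 := by
  refine Runs.for_unif (fun j s' => s'.reg 4 ≤ j ∧ (∀ i < s'.reg 4, s'.mem 14 i < j) ∧
    (∀ i < s'.reg 4, ∀ i' < s'.reg 4, s'.mem 14 i = s'.mem 14 i' → i = i') ∧
    ∀ v < j, (∃ i < s'.reg 4, s'.mem 14 i = v) ↔ nbrSum A (Finset.range n) 1 v ≤ 1) n 30 hB hM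
    (by simp [Program.regs]) (fun s' hF => ?_) ?_ ?_ ?_
  · simp [hF.reg 0 (by simp [Program.mem_regs_for, Program.regs]), h0]
  · simp [h4]
  · rintro j s' hj hB' hF h3 ⟨hq, hlt, hinj, hleaf⟩
    have e12 : s'.mem 12 j = nbrSum A (Finset.range n) 1 j := by
      rw [hF.mem 12 (by simp [Program.arrs_for, Program.arrs]), h12 j hj]
    have hnot : ∀ i < s'.reg 4, s'.mem 14 i ≠ j := fun i hi => (hlt i hi).ne
    refine Runs.ite hB' (fun ht => ?_) (fun ht => ?_)
    · have hd : nbrSum A (Finset.range n) 1 j ≤ 1 := by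
        simp [h3, e12] at ht; omega
      refine Runs.store_eq (s'.reg 4) j hB' (by simp) (by simp [h3]) (by omega) fun hB' => ?_
      refine Runs.assign hB' (by simp; omega) ?_
      simp only [Expr.val_add, Expr.val_reg, Expr.val_one, State.setMem_reg, State.setReg_reg,
        State.setReg_mem, State.setMem_mem_same, if_true, if_neg (show 4 ≠ 3 by omega)]
      refine ⟨⟨by omega, fun i hi => ?_, fun i hi i' hi' hii => ?_, fun v hv => ?_⟩, by simp⟩
      · rcases Nat.lt_succ_iff_lt_or_eq.mp hi with hi | rfl
        · rw [Function.update_of_ne hi.ne]; have := hlt i hi; omega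
        · simp
      · rcases Nat.lt_succ_iff_lt_or_eq.mp hi with hi | rfl <;>
          rcases Nat.lt_succ_iff_lt_or_eq.mp hi' with hi' | rfl
        · rw [Function.update_of_ne hi.ne, Function.update_of_ne hi'.ne] at hii
          exact hinj i hi i' hi' hii
        · rw [Function.update_of_ne hi.ne, Function.update_self] at hii
          exact absurd hii (hnot i hi)
        · rw [Function.update_of_ne hi'.ne, Function.update_self] at hii
          exact absurd hii.symm (hnot i' hi')
        · rfl
      · rcases Nat.lt_succ_iff_lt_or_eq.mp hv with hv | rfl
        · rw [← hleaf v hv]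
          constructor
          · rintro ⟨i, hi, he⟩
            rcases Nat.lt_succ_iff_lt_or_eq.mp hi with hi | rfl
            · exact ⟨i, hi, by rwa [Function.update_of_ne hi.ne] at he⟩
            · rw [Function.update_self] at he; omega
          · rintro ⟨i, hi, he⟩
            exact ⟨i, by omega, by rwa [Function.update_of_ne hi.ne]⟩
        · exact ⟨fun _ => hd, fun _ => ⟨s'.reg 4, by omega, Function.update_self ..⟩⟩
    · have hd : ¬ nbrSum A (Finset.range n) 1 j ≤ 1 := by
        simp [h3, e12] at ht; omega
      refine Runs.skip hB' ?_
      simp only [State.setReg_reg, State.setReg_mem, if_neg (show 4 ≠ 3 by omega)]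
      refine ⟨⟨by omega, fun i hi => by have := hlt i hi; omega, hinj, fun v hv => ?_⟩, by simp⟩
      rcases Nat.lt_succ_iff_lt_or_eq.mp hv with hv | rfl
      · exact hleaf v hv
      · exact ⟨fun ⟨i, hi, he⟩ => absurd he (hnot i hi), fun h => absurd h hd⟩
  · rintro s' t - - - ⟨hq, hlt, hinj, hleaf⟩ ht
    refine ⟨⟨by omega, hlt, hinj, ?_⟩, ?_⟩
    · rw [remaining_zero]
      exact fun v hv => hleaf v (by simpa using hv)
    · simp at ht; omega

/-- Remove the leaves in the order of the queue. -/
def peelPass : Program := .for_ 3 (.reg 0 - 1) peelBody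

theorem peelPass_runs {A : ℕ → ℕ → Prop} {n M : ℕ} {s : State} (hB : Bdd M s)
    (h0 : s.reg 0 = n) (h : Peel A n 0 s) (hM : n ≤ M) :
    Runs M peelPass s fun s' t => Peel A n (n - 1) s' ∧ t ≤ 60 * n + 10 := by
  refine Runs.for_unif (fun j s' => Peel A n j s') (n - 1) 40 hB (by omega)
    (by simp [Program.regs, peelBody]) (fun s' hF => ?_) ?_ ?_ ?_
  · simp [hF.reg 0 (by simp [Program.mem_regs_for, Program.regs, peelBody]), h0]
  · exact ⟨h.tree, h.queue, h.peels, h.deg, h.nbr⟩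
  · rintro j s' hj hB' hF h3 h
    refine (peelBody_runs hB' h (by omega) h3 hM).mono ?_
    rintro s'' t - - ⟨h, ht⟩
    exact ⟨⟨h.tree, h.queue, h.peels, h.deg, h.nbr⟩, ht⟩
  · rintro s' t - - - h ht
    refine ⟨h, ?_⟩
    simp at ht; omega

/-- `o` numbers the nodes such that the parent of the node number `i` is the node number `par i`. -/
structure Rooted (A : ℕ → ℕ → Prop) (n : ℕ) (o par : ℕ → ℕ) : Prop where
  lt : ∀ i < n, o i < n
  inj : ∀ i < n, ∀ j < n, o i = o j → i = j
  lt_par : ∀ i < n, i < par i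
  par_le : ∀ i < n, par i ≤ n
  par_lt : ∀ i, i + 1 < n → par i < n
  adj : ∀ i j, i < j → j < n → (A (o i) (o j) ↔ par i = j)

theorem exists_index {n : ℕ} {o : ℕ → ℕ} (hlt : ∀ i < n, o i < n)
    (hinj : ∀ i < n, ∀ j < n, o i = o j → i = j) {x : ℕ} (hx : x < n) : ∃ i < n, o i = x := by
  have := Finset.surj_on_of_inj_on_of_card_le (s := Finset.range n) (t := Finset.range n)
    (fun i _ => o i) (fun i hi => by simpa using hlt i (by simpa using hi))
    (fun i j hi hj h => hinj i (by simpa using hi) j (by simpa using hj) h) le_rfl x (by simpa using hx)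
  obtain ⟨i, hi, h⟩ := this
  exact ⟨i, by simpa using hi, h.symm⟩

/-- Number the nodes in array `14`, and compute the numbers of the parents in array `10`. -/
def rootTree : Program :=
  edgePass ;; leafPass ;; peelPass ;; .for_ 3 (.reg 0) (.store 16 (.cell 14 (.reg 3)) (.reg 3)) ;;
  .sweep 3 10 0 (.reg 0 - 1) (.cell 16 (.cell 15 (.reg 3))) ;; .store 10 (.reg 0 - 1) (.reg 0)

theorem rootTree_regs : ∀ x ∈ rootTree.regs, 3 ≤ x ∧ x ≤ 6 := by
  simp [rootTree, edgePass, leafPass, peelPass, peelBody, Program.regs, Program.for_, Program.sweep]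

theorem rootTree_arrs : ∀ x ∈ rootTree.arrs, 10 ≤ x ∧ x ≤ 16 := by
  simp [rootTree, edgePass, leafPass, peelPass, peelBody, Program.arrs, Program.for_, Program.sweep]

theorem rootTree_runs {A : ℕ → ℕ → Prop} {n M : ℕ} {e₁ e₂ : ℕ → ℕ} {s : State} (hB : Bdd M s)
    (hn : 1 ≤ n) (h0 : s.reg 0 = n) (h4 : s.reg 4 = 0) (h1 : s.mem 1 = e₁) (h2 : s.mem 2 = e₂)
    (h12 : ∀ v, s.mem 12 v = 0) (h13 : ∀ v, s.mem 13 v = 0) (hT : TreeOn A (Finset.range n))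
    (he : ∀ v < n, ∀ f, edgeSum e₁ e₂ f (n - 1) v = nbrSum A (Finset.range n) f v)
    (he₁ : ∀ j < n - 1, e₁ j < n) (he₂ : ∀ j < n - 1, e₂ j < n) (hM : n * n ≤ M) (hM' : n ≤ M) :
    Runs M rootTree s fun s' t => Rooted A n (s'.mem 14) (s'.mem 10) ∧ t ≤ 400 * n := by
  refine Runs.seq (edgePass_runs (A := A) hB h0 h1 h2 h12 h13 he he₁ he₂ hM hM') ?_
  rintro s₁ t₁ hB₁ hF₁ ⟨d₁, b₁, ht₁⟩
  have r₁ : ∀ x, x < 3 ∨ x = 4 → s₁.reg x = s.reg x := fun x hx => hF₁.reg x (by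
    simp [edgePass, Program.mem_regs_for, Program.regs]; omega)
  refine Runs.seq (leafPass_runs hB₁ ((r₁ 0 (by omega)).trans h0) ((r₁ 4 (by omega)).trans h4) d₁ hM') ?_
  rintro s₂ t₂ hB₂ hF₂ ⟨hQ, ht₂⟩
  have r₂ : ∀ x, x < 3 → s₂.reg x = s.reg x := fun x hx => (hF₂.reg x (by
    simp [leafPass, Program.mem_regs_for, Program.regs]; omega)).trans (r₁ x (by omega))
  have m₂ : ∀ a, a ≠ 14 → s₂.mem a = s₁.mem a := fun a ha => hF₂.mem a (by
    simp [leafPass, Program.arrs_for, Program.arrs]; omega)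
  refine Runs.seq (peelPass_runs (A := A) hB₂ ((r₂ 0 (by omega)).trans h0)
    ⟨by rwa [remaining_zero], hQ, by simp [Peels],
      by rw [remaining_zero, m₂ 12 (by omega)]; exact fun v hv => d₁ v (by simpa using hv),
      by rw [remaining_zero, m₂ 13 (by omega)]; exact fun v hv => b₁ v (by simpa using hv)⟩ hM') ?_
  rintro s₃ t₃ hB₃ hF₃ ⟨hP, ht₃⟩
  have r₃ : s₃.reg 0 = n := (hF₃.reg 0 (by
    simp [peelPass, peelBody, Program.mem_regs_for, Program.regs])).trans
    ((r₂ 0 (by omega)).trans h0)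
  have hq := hP.queue.lt_end hP.tree
  have hq' := hP.queue.le_size
  -- The one remaining node is a leaf and hence queued; so the queue has more than n - 1 entries,
  -- and at most n. Thus it lists all nodes.
  have hqn : s₃.reg 4 = n := by omega
  have hlt := hP.queue.lt
  have hinj := hP.queue.inj
  rw [hqn] at hlt hinj
  have hpe := hP.peels
  generalize ho : s₃.mem 14 = o at *
  generalize hπ : s₃.mem 15 = π at *
  refine Runs.seq (Runs.for_unif (Q := fun s' t => s'.reg 0 = n ∧ s'.mem 14 = o ∧ s'.mem 15 = π ∧
      (∀ i < n, s'.mem 16 (o i) = i) ∧ t ≤ 60 * n + 10) (fun j s' => ∀ i < j, s'.mem 16 (o i) = i)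
    n 30 hB₃ hM' (by simp [Program.regs]) (fun s' hF => ?_) (by simp) ?_ ?_) ?_
  · simp [hF.reg 0 (by simp [Program.mem_regs_for, Program.regs]), r₃]
  · rintro j s' hj hB' hF h3 hI
    have e14 : s'.mem 14 = o := by rw [hF.mem 14 (by simp [Program.arrs_for, Program.arrs]), ho]
    refine Runs.store hB' (by simp [h3]; omega) ⟨fun i hi => ?_, by simp⟩
    simp only [State.setReg_mem, State.setMem_mem_same, Expr.val_cell, Expr.val_reg, e14, h3]
    by_cases hij : i = j
    · subst hij; simp
    · rw [Function.update_of_ne fun hh => hij (hinj i (by omega) j hj hh)]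
      exact hI i (by omega)
  · rintro s' t - hF - hI ht
    refine ⟨by rw [hF.reg 0 (by simp [Program.mem_regs_for, Program.regs]), r₃],
      by rw [hF.mem 14 (by simp [Program.arrs_for, Program.arrs]), ho],
      by rw [hF.mem 15 (by simp [Program.arrs_for, Program.arrs]), hπ], hI, ?_⟩
    simp at ht; omega
  rintro s₄ t₄ hB₄ - ⟨r₄, m14, m15, m16, ht₄⟩
  refine Runs.seq (Q₁ := fun s' t => s' = s₄.fill 3 10 0 (n - 1) (fun i => s₄.mem 16 (π i)) ∧
    t ≤ 60 * n + 10) (Runs.sweep 0 (n - 1) (fun i => s₄.mem 16 (π i)) hB₄ (by omega)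
    (by simp [r₄]) (by simp) (by simp [State.fill_mem, m15]) (fun i _ => hB₄.mem _ _)
    fun t _ ht => ⟨rfl, by simp at ht; omega⟩) ?_
  rintro _ t₅ hB₅ - ⟨rfl, ht₅⟩
  refine Runs.store hB₅ (by simp [r₄]; omega) ?_
  simp only [Expr.val_reg, Expr.val_sub, Expr.val_one, State.fill_reg, r₄,
    if_neg (show 0 ≠ 3 by omega)]
  generalize hs₆ : State.setMem _ 10 (n - 1) n = s₆
  have e14 : s₆.mem 14 = o := by
    rw [← hs₆, State.setMem_mem_ne _ _ _ (by omega), State.fill_mem_ne _ _ _ _ _ _ (by omega), m14]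
  have e10 : ∀ i, i + 1 < n → s₆.mem 10 i = s₄.mem 16 (π i) := by
    intro i hi
    rw [← hs₆, State.setMem_mem_same, Function.update_of_ne (by omega), State.fill_mem_same,
      splice_zero_left _ _ (by omega)]
  -- The last node is the root; it receives the virtual parent n.
  have e10' : s₆.mem 10 (n - 1) = n := by
    rw [← hs₆, State.setMem_mem_same, Function.update_self]
  have key : ∀ i, i + 1 < n → i < s₆.mem 10 i ∧ s₆.mem 10 i < n ∧ o (s₆.mem 10 i) = π i := by
    intro i hi
    have hm := mem_remaining.mp (hpe i (by omega)).1
    obtain ⟨j, hj, hoj⟩ := exists_index hlt hinj hm.1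
    rw [e10 i hi, ← hoj, m16 j hj]
    refine ⟨?_, hj, rfl⟩
    by_contra hc
    exact hm.2 j (by omega) hoj
  refine ⟨⟨by rwa [e14], by rwa [e14], fun i hi => ?_, fun i hi => ?_, fun i hi => (key i hi).2.1,
    fun i j hij hj => ?_⟩, ?_⟩
  · by_cases h : i + 1 < n
    · exact (key i h).1
    · rw [show i = n - 1 by omega, e10']; omega
  · by_cases h : i + 1 < n
    · exact (key i h).2.1.le
    · rw [show i = n - 1 by omega, e10']
  · have hk := key i (by omega)
    rw [e14, (hpe i (by omega)).2 (o j) (mem_remaining.mpr ⟨hlt j hj, fun l hl he => by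
      have := hinj l (by omega) j hj he; omega⟩), ← hk.2.2]
    exact ⟨fun h => (hinj j hj _ hk.2.1 h).symm, fun h => by rw [h]⟩
  · simp; omega

/-! ### Trees as graphs -/

section
variable {n : ℕ} {G : SimpleGraph (Fin n)}

/-- The adjacency relation, on natural numbers. -/
def natAdj (G : SimpleGraph (Fin n)) (x y : ℕ) : Prop :=
  ∃ (hx : x < n) (hy : y < n), G.Adj ⟨x, hx⟩ ⟨y, hy⟩

theorem natAdj_fin {x y : Fin n} : natAdj G x y ↔ G.Adj x y :=
  ⟨fun ⟨_, _, h⟩ => h, fun h => ⟨x.2, y.2, h⟩⟩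

theorem nbrSum_natAdj [DecidableRel G.Adj] (f : ℕ → ℕ) (v : Fin n) :
    nbrSum (natAdj G) (Finset.range n) f v = ∑ x : Fin n, if G.Adj v x then f x else 0 := by
  classical
  rw [nbrSum, Finset.sum_filter, Finset.sum_range]
  exact Finset.sum_congr rfl fun x _ => if_congr natAdj_fin rfl rfl

/-- A walk between the two sides of a cut has to cross it, and the degrees add up to twice the
number n - 1 of edges. -/
theorem treeOn_natAdj (hG : G.IsTree) : TreeOn (natAdj G) (Finset.range n) := by
  classical
  refine ⟨fun x y ⟨hx, hy, h⟩ => ⟨hy, hx, h.symm⟩, fun x ⟨hx, _, h⟩ => G.irrefl h,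
    fun X hX ⟨x, hx⟩ hne => ?_, ?_⟩
  · obtain ⟨y, hy, hyX⟩ : ∃ y ∈ Finset.range n, y ∉ X := by
      by_contra! h
      exact hne (hX.antisymm h)
    have hxn : x < n := by simpa using hX hx
    have hyn : y < n := by simpa using hy
    obtain ⟨w⟩ := hG.connected.preconnected ⟨x, hxn⟩ ⟨y, hyn⟩
    obtain ⟨d, -, h1, h2⟩ := w.exists_boundary_dart {v | v.val ∈ X} hx hyX
    exact ⟨_, h1, _, Finset.mem_range.mpr d.snd.2, h2, natAdj_fin.mpr d.adj⟩
  · have h1 := G.sum_degrees_eq_twice_card_edges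
    have h2 := hG.card_edgeFinset
    rw [Fintype.card_fin] at h2
    rw [Finset.sum_range, Finset.card_range, Finset.sum_congr rfl fun v _ =>
      (nbrSum_natAdj 1 v).trans (show _ = G.degree v by
        simp [SimpleGraph.degree, SimpleGraph.neighborFinset_eq_filter]), h1]
    omega

theorem IsEdgeList.length {E : List (Fin n × Fin n)} (hE : IsEdgeList G E) (hG : G.IsTree) :
    E.length + 1 = n := by
  classical
  have h := hG.card_edgeFinset
  rw [Fintype.card_fin] at h
  have : G.edgeFinset = (E.map fun e => s(e.1, e.2)).toFinset := by
    ext e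
    induction e with
    | _ u v => rw [SimpleGraph.mem_edgeFinset, SimpleGraph.mem_edgeSet, hE.2, List.mem_toFinset]
  rw [this, List.toFinset_card_of_nodup hE.1, List.length_map] at h
  exact h

theorem edgeSum_list (E : List (Fin n × Fin n)) (f : ℕ → ℕ) (v : Fin n) :
    edgeSum (fun i => (E.map fun e => (e.1 : ℕ)).getD i 0)
      (fun i => (E.map fun e => (e.2 : ℕ)).getD i 0) f E.length v =
    (E.map fun e => (if e.1 = v then f e.2 else 0) + if e.2 = v then f e.1 else 0).sum := by
  induction E with
  | nil => simp [edgeSum]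
  | cons e E ih =>
    change _ = ((if e.1 = v then f e.2 else 0) + if e.2 = v then f e.1 else 0) +
      List.sum (List.map _ E)
    rw [← ih, edgeSum, List.length_cons, Finset.sum_range_succ', add_comm]
    simp [edgeSum, Fin.ext_iff]

/-- Counting with multiplicity allows induction on the list; for an edge list without repetitions
the multiplicities become the indicator of adjacency. -/
theorem sum_edges (E : List (Fin n × Fin n)) (hE : ∀ e ∈ E, e.1 ≠ e.2) (f : ℕ → ℕ) (v : Fin n) :
    (E.map fun e => (if e.1 = v then f e.2 else 0) + if e.2 = v then f e.1 else 0).sum =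
      ∑ x : Fin n, (E.map fun e => s(e.1, e.2)).count s(v, x) * f x := by
  induction E with
  | nil => simp
  | cons e E ih =>
    rw [List.map_cons, List.sum_cons, ih fun e he => hE e (List.mem_cons_of_mem _ he)]
    have hne := hE e (by simp)
    have h : ∀ x, List.count s(v, x) (List.map (fun e => s(e.1, e.2)) (e :: E)) * f x =
        ((if x = e.2 then (if e.1 = v then f e.2 else 0) else 0) +
          if x = e.1 then (if e.2 = v then f e.1 else 0) else 0) +
        List.count s(v, x) (List.map (fun e => s(e.1, e.2)) E) * f x := by
      intro x
      rw [List.map_cons, List.count_cons, add_mul, add_comm]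
      congr 1
      simp only [beq_iff_eq, Sym2.eq_iff]
      grind
    rw [Finset.sum_congr rfl fun x _ => h x, Finset.sum_add_distrib, Finset.sum_add_distrib]
    simp

theorem IsEdgeList.edgeSum {E : List (Fin n × Fin n)} (hE : IsEdgeList G E) (hG : G.IsTree)
    (f : ℕ → ℕ) {v : ℕ} (hv : v < n) : edgeSum (fun i => (E.map fun e => (e.1 : ℕ)).getD i 0)
      (fun i => (E.map fun e => (e.2 : ℕ)).getD i 0) f (n - 1) v =
      nbrSum (natAdj G) (Finset.range n) f v := by
  classical
  have hl := hE.length hG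
  have h := edgeSum_list E f ⟨v, hv⟩
  rw [show E.length = n - 1 by omega] at h
  refine h.trans ((sum_edges E (fun e he => ?_) f _).trans
    (Eq.trans ?_ (nbrSum_natAdj f ⟨v, hv⟩).symm))
  · exact G.ne_of_adj ((hE.2 e.1 e.2).mpr (List.mem_map_of_mem he))
  · refine Finset.sum_congr rfl fun x _ => ?_
    rw [hE.1.count]
    simp only [← hE.2]
    split <;> simp

theorem getD_map_lt {E : List (Fin n × Fin n)} (g : Fin n × Fin n → Fin n) {j : ℕ}
    (hj : j < E.length) : (E.map fun e => (g e : ℕ)).getD j 0 < n := by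
  rw [List.getD_eq_getElem _ _ (by simpa using hj)]
  simp

/-- The nodes in the order of their numbers. -/
noncomputable def numbering {o par : ℕ → ℕ} (h : Rooted (natAdj G) n o par) : Fin n ≃ Fin n :=
  Equiv.ofBijective (fun i => ⟨o i, h.lt i i.2⟩) (Finite.injective_iff_bijective.mp fun i j hij =>
    Fin.ext (h.inj i i.2 j j.2 (by simpa using hij)))

variable {o par : ℕ → ℕ}

theorem numbering_val (h : Rooted (natAdj G) n o par) (i : Fin n) : (numbering h i : ℕ) = o i := rfl

theorem adj_numbering (h : Rooted (natAdj G) n o par) (i j : Fin n) :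
    G.Adj (numbering h i) (numbering h j) ↔ par i = j ∨ par j = i := by
  rw [← natAdj_fin, numbering_val, numbering_val]
  rcases lt_trichotomy i j with hij | rfl | hij
  · rw [h.adj i j hij j.2]
    have := h.lt_par j j.2
    have : (i : ℕ) < j := hij
    constructor
    · exact .inl
    · rintro (h' | h')
      · exact h'
      · omega
  · have := h.lt_par i i.2
    constructor
    · rintro ⟨_, _, h'⟩; exact absurd h' G.irrefl
    · omega
  · have e : natAdj G (o i) (o j) ↔ natAdj G (o j) (o i) :=
      ⟨fun ⟨h1, h2, h3⟩ => ⟨h2, h1, h3.symm⟩, fun ⟨h1, h2, h3⟩ => ⟨h2, h1, h3.symm⟩⟩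
    rw [e, h.adj j i hij i.2]
    have := h.lt_par i i.2
    have : (j : ℕ) < i := hij
    constructor
    · exact .inr
    · rintro (h' | h')
      · omega
      · exact h'

/-- In a connected subgraph, a walk from x to the greatest node has to leave the set of descendants
of x, and the only edge that leaves this set joins x to its parent. Conversely, following parents
leads from every node of a subtree to its top. -/
theorem exists_connected_iff (h : Rooted (natAdj G) n o par) (Y : Finset (Fin n)) :
    (∃ H : G.Subgraph, H.Connected ∧ H.verts = numbering h '' Y) ↔
      IsSubtree par (Y.map Fin.valEmbedding) := by
  constructor
  · rintro ⟨H, hH, hV⟩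
    have hY : Y.Nonempty := by
      obtain ⟨v, hv⟩ := hH.nonempty
      rw [hV] at hv
      obtain ⟨y, hy, -⟩ := hv
      exact ⟨y, hy⟩
    obtain ⟨t, ht, hmax⟩ := Finset.exists_max_image Y id hY
    refine ⟨t, Finset.mem_map_of_mem _ ht, fun x hx' hxt => ?_⟩
    obtain ⟨x, hx, rfl⟩ := Finset.mem_map.mp hx'
    have hmem : ∀ y ∈ Y, numbering h y ∈ H.verts := fun y hy => hV ▸ ⟨y, hy, rfl⟩
    have hlt : x < t := lt_of_le_of_ne (hmax x hx) fun e => hxt (by simp [e])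
    obtain ⟨p⟩ := hH.coe.preconnected ⟨_, hmem x hx⟩ ⟨_, hmem t ht⟩
    have hle : ∀ a b : ℕ, Relation.ReflTransGen (fun a b => par a = b ∧ a < b) a b → a ≤ b := by
      intro a b hab
      induction hab with
      | refl => exact le_rfl
      | tail _ h ih => exact ih.trans h.2.le
    obtain ⟨d, -, h1, h2⟩ := p.exists_boundary_dart
      {v | Relation.ReflTransGen (fun a b => par a = b ∧ a < b) ((numbering h).symm v) x}
      (by simp [Relation.ReflTransGen.refl]) (fun hc => by
        have := hle _ _ hc
        simp at this
        exact absurd hlt (not_lt.mpr this))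
    have hadj := H.adj_sub d.adj
    have hsnd : (numbering h).symm d.snd.1 ∈ Y := by
      obtain ⟨y, hy, he⟩ := hV.subset d.snd.2
      rw [← he]; simpa using hy
    rw [← (numbering h).apply_symm_apply d.fst.1, ← (numbering h).apply_symm_apply d.snd.1,
      adj_numbering] at hadj
    rw [Set.mem_ofPred_eq] at h1 h2
    generalize (numbering h).symm d.fst.1 = a at *
    generalize (numbering h).symm d.snd.1 = b at *
    rcases hadj with hadj | hadj
    · rcases Relation.ReflTransGen.cases_head h1 with h1 | ⟨c, hc, h1⟩
      · have : par x = b := by rw [← hadj, h1]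
        exact Finset.mem_map.mpr ⟨b, hsnd, this.symm⟩
      · exact absurd (by rwa [← hadj, hc.1]) h2
    · exact absurd (h1.head ⟨hadj, by have := h.lt_par b b.2; omega⟩) h2
  · rintro ⟨t, ht', hX⟩
    obtain ⟨t, ht, rfl⟩ := Finset.mem_map.mp ht'
    refine ⟨(⊤ : G.Subgraph).induce (numbering h '' Y), ?_, rfl⟩
    have hmem : ∀ y ∈ Y, numbering h y ∈ ((⊤ : G.Subgraph).induce (numbering h '' Y)).verts :=
      fun y hy => ⟨y, hy, rfl⟩
    -- Parents have greater numbers, so n - x decreases along the path to the top.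
    have key : ∀ d, ∀ x, ∀ hx : x ∈ Y, n - x.val = d →
        ((⊤ : G.Subgraph).induce (numbering h '' Y)).coe.Reachable ⟨_, hmem t ht⟩ ⟨_, hmem x hx⟩ := by
      intro d
      induction d using Nat.strong_induction_on with
      | _ d ih =>
        rintro x hx rfl
        by_cases hxt : x = t
        · subst hxt; rfl
        · obtain ⟨y, hy, he⟩ := Finset.mem_map.mp
            (hX x (Finset.mem_map_of_mem _ hx) (by simpa [Fin.ext_iff] using hxt))
          have hpar := h.lt_par x x.2
          have hyn := y.2
          simp only [Fin.valEmbedding_apply] at he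
          refine (ih _ (by omega) y hy rfl).trans (SimpleGraph.Adj.reachable ?_)
          rw [SimpleGraph.Subgraph.coe_adj, SimpleGraph.Subgraph.induce_adj]
          exact ⟨⟨y, hy, rfl⟩, ⟨x, hx, rfl⟩, (adj_numbering h y x).mpr (.inr he.symm)⟩
    refine ⟨(SimpleGraph.connected_iff_exists_forall_reachable _).mpr ⟨⟨_, hmem t ht⟩, ?_⟩⟩
    rintro ⟨_, x, hx, rfl⟩
    exact key _ x hx rfl

theorem ncard_numbering (h : Rooted (natAdj G) n o par) {lab : Fin n → Bool} {b : Bool} {w : ℕ → ℕ}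
    (hw : ∀ i : Fin n, w i = if lab (numbering h i) = b then 1 else 0) (Y : Finset (Fin n)) :
    pairOf w (Y.map Fin.valEmbedding) =
      ((numbering h '' Y : Set (Fin n)).ncard,
        {v | v ∈ (numbering h '' Y : Set (Fin n)) ∧ lab v = b}.ncard) := by
  have e : {v | v ∈ (numbering h '' Y : Set (Fin n)) ∧ lab v = b} =
      numbering h '' (Y.filter fun i => lab (numbering h i) = b) := by
    ext v
    constructor
    · rintro ⟨⟨y, hy, rfl⟩, hv⟩
      exact ⟨y, by simpa using ⟨hy, hv⟩, rfl⟩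
    · rintro ⟨y, hy, rfl⟩
      have : y ∈ Y ∧ lab (numbering h y) = b := by simpa using hy
      exact ⟨⟨y, this.1, rfl⟩, this.2⟩
  rw [e, Set.ncard_image_of_injective _ (numbering h).injective,
    Set.ncard_image_of_injective _ (numbering h).injective, Set.ncard_coe_finset,
    Set.ncard_coe_finset, Finset.card_filter, pairOf, Finset.card_map, Finset.sum_map]
  simp [hw]

/-- The numbers of nodes with label `b` in the connected subgraphs with `i` nodes. -/
def labelCounts (G : SimpleGraph (Fin n)) (lab : Fin n → Bool) (b : Bool) (i : ℕ) : Set ℕ :=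
  {m | ∃ H : G.Subgraph, H.Connected ∧ H.verts.ncard = i ∧
    {v | v ∈ H.verts ∧ lab v = b}.ncard = m}

theorem mem_labelCounts (h : Rooted (natAdj G) n o par) {lab : Fin n → Bool} {b : Bool} {w : ℕ → ℕ}
    (hw : ∀ i : Fin n, w i = if lab (numbering h i) = b then 1 else 0) {i m : ℕ} :
    (i, m) ∈ subtreePairs par w n ↔ m ∈ labelCounts G lab b i := by
  rw [mem_subtreePairs h.lt_par]
  constructor
  · rintro ⟨X, hXs, hX, he⟩
    obtain ⟨Y, rfl⟩ : ∃ Y : Finset (Fin n), X = Y.map Fin.valEmbedding := by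
      refine ⟨Finset.univ.filter fun i => (i : ℕ) ∈ X, ?_⟩
      ext x
      simp only [Finset.mem_map, Finset.mem_filter, Finset.mem_univ, true_and,
        Fin.valEmbedding_apply]
      exact ⟨fun hx => ⟨⟨x, by simpa using hXs hx⟩, hx, rfl⟩, fun ⟨y, hy, e⟩ => e ▸ hy⟩
    obtain ⟨H, hH, hV⟩ := (exists_connected_iff h Y).mpr hX
    rw [ncard_numbering h hw, Prod.mk.injEq, ← hV] at he
    exact ⟨H, hH, he.1.symm, he.2.symm⟩
  · rintro ⟨H, hH, hi, hm⟩
    classical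
    have hV : H.verts = numbering h '' (Finset.univ.filter fun i => numbering h i ∈ H.verts) := by
      ext v
      simp only [Finset.coe_filter, Finset.mem_univ, true_and, Set.mem_image, Set.mem_ofPred_eq]
      exact ⟨fun hv => ⟨(numbering h).symm v, by simpa using hv, by simp⟩,
        fun ⟨y, hy, e⟩ => e ▸ hy⟩
    refine ⟨_, fun x hx => ?_, (exists_connected_iff h _).mp ⟨H, hH, hV⟩, ?_⟩
    · obtain ⟨y, -, rfl⟩ := Finset.mem_map.mp hx
      simp
    · rw [ncard_numbering h hw, ← hV, hi, hm]

/-- The zeros and ones of a subgraph with i nodes add up to i. -/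
theorem isGreatest_subgraphOnes {lab : Fin n → Bool} {i v : ℕ}
    (h : IsLeast (labelCounts G lab false i) v) : IsGreatest (subgraphOnes G lab i) (i - v) := by
  have hc : ∀ H : G.Subgraph, {v | v ∈ H.verts ∧ lab v = true}.ncard +
      {v | v ∈ H.verts ∧ lab v = false}.ncard = H.verts.ncard := by
    intro H
    rw [← Set.ncard_union_eq]
    · congr 1
      ext v
      cases hv : lab v <;> simp [hv]
    · rw [Set.disjoint_left]
      rintro v ⟨-, h1⟩ ⟨-, h2⟩
      rw [h1] at h2; cases h2
  constructor
  · obtain ⟨H, hH, hi, hv⟩ := h.1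
    exact ⟨H, hH, hi, by have := hc H; omega⟩
  · rintro m ⟨H, hH, hi, rfl⟩
    have := h.2 ⟨H, hH, hi, rfl⟩
    have := hc H
    omega

end

/-! ### The algorithm for trees and its time bound -/

/-- The algorithm for trees: one pass for the ones and one for the zeros. -/
def treeProgram (p : Program) : Program :=
  rootTree ;; .sqrt 1 ;;
  .sweep 67 11 0 (.reg 0) (.cell 0 (.cell 14 (.reg 67))) ;; solve p ;;
  .sweep 67 3 0 (.reg 0 + 1) (.cell 28 (.reg 67)) ;;
  .sweep 67 11 0 (.reg 0) (1 - .cell 0 (.cell 14 (.reg 67))) ;; solve p ;;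
  .sweep 67 4 0 (.reg 0 + 1) (.reg 67 - .cell 28 (.reg 67))

theorem solve_labelCounts {p : Program} {n σ T M r : ℕ} {s : State} {G : SimpleGraph (Fin n)}
    {o par w : ℕ → ℕ} {lab : Fin n → Bool} {b : Bool} (hp : CanMultiply p σ T M) (hB : Bdd M s)
    (hσ : σ = Nat.sqrt r) (h0 : s.reg 0 = n) (h1 : s.reg 1 = r) (h9 : s.reg 9 = 0)
    (h80 : s.reg 80 = σ) (hfr : Fresh s) (h10 : s.mem 10 = par) (hR : Rooted (natAdj G) n o par)
    (h11 : ∀ k < n, s.mem 11 k = w k)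
    (hw : ∀ i : Fin n, w i = if lab (numbering hR i) = b then 1 else 0) (hn : 1 ≤ n)
    (h99 : s.reg 99 + (6 * n + 2) * calls n σ ≤ M)
    (hM : 8 * (n + σ * σ) + 8 ≤ M) (hM' : (4 * n + 10) * (n + 1) ≤ M) :
    Runs M (solve p) s fun s' t =>
      (∀ i, 1 ≤ i → i ≤ n → IsLeast (labelCounts G lab b i) (s'.mem 28 i)) ∧
      Fresh s' ∧ s'.reg 99 ≤ s.reg 99 + (6 * n + 2) * calls n σ ∧
      σ * σ * (σ * σ) * t ≤ 130000 * (σ * σ * (σ * σ) * (r * n)) +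
        36 * ((2 * p.callFactor + 11000) * (σ * T * (n * n))) := by
  have hq : σ * σ ≤ r := hσ ▸ Nat.sqrt_le r
  have hr' : r ≤ 3 * (σ * σ) := by
    have h1 : r ≤ σ * σ + σ + σ := hσ ▸ Nat.sqrt_le_add r
    have h2 : σ * 1 ≤ σ * σ := Nat.mul_le_mul_left _ hp.pos
    omega
  obtain ⟨κ, κq, κV, κr, κR⟩ : ∃ κ : Rates, κ.q = σ * σ ∧ κ.V = σ * T ∧ κ.r = r ∧
      κ.R = 2 * p.callFactor + 11000 := ⟨⟨_, _, _, _⟩, rfl, rfl, rfl, rfl⟩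
  have hκ : κ.Valid := ⟨κq ▸ Nat.mul_pos hp.pos hp.pos,
    by rw [κq, κV]; exact hp.sq_le_time.trans (Nat.le_mul_of_pos_left _ hp.pos),
    by rw [κq, κr]; exact hq, by rw [κq, κr]; exact hr', by omega⟩
  have hw1 : ∀ k < n, w k ≤ 1 := fun k hk => by
    rw [hw ⟨k, hk⟩]; split <;> omega
  refine (solve_runs hp hB hκ κq κV κR h0 (h1.trans κr.symm) h9 h80 hfr (fun k _ => by rw [h10]) h11
    (fun k hk => ⟨hR.lt_par k hk, hR.par_le k hk⟩) hw1 hn h99 hM hM').mono ?_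
  rintro s' t - - ⟨hS, hD, hfr', h99', ht⟩
  rw [κq, κV, κr, κR, mul_assoc (σ * σ * (σ * σ)) r] at ht
  refine ⟨fun i hi hin => ?_, hfr', h99', ht⟩
  have := isLeast_subtreePairs hR.lt_par hR.par_lt hw1 hS hD hi hin
  simpa only [mem_labelCounts hR hw, Set.ofPred_mem_eq] using this

theorem treeProgram_runs {p : Program} {n r σ T M : ℕ} {G : SimpleGraph (Fin n)}
    {lab : Fin n → Bool} {E : List (Fin n × Fin n)} (hp : CanMultiply p σ T M) (hG : G.IsTree)
    (hE : IsEdgeList G E) (hr : 1 ≤ r) (hσ : σ = Nat.sqrt r)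
    (h99 : 2 * ((6 * n + 2) * calls n σ) ≤ M) (hM : 8 * (n + σ * σ) + 8 ≤ M)
    (hM' : (4 * n + 10) * (n + 1) ≤ M) (hrM : r ≤ M) :
    Runs M (treeProgram p) (treeInput r lab E) fun s' t => TreeOutput G lab s' ∧
      σ * σ * (σ * σ) * t ≤ 270000 * (σ * σ * (σ * σ) * (r * n)) +
        72 * ((2 * p.callFactor + 11000) * (σ * T * (n * n))) := by
  have hlen := hE.length hG
  have hn : 1 ≤ n := by omega
  have hnM : n * n ≤ M := le_trans (by gcongr <;> omega) hM'
  have hlabM : ∀ v, (lab v).toNat ≤ 1 := fun v => Bool.toNat_le _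
  have hgetD : ∀ (g : Fin n × Fin n → Fin n) j, (E.map fun e => (g e : ℕ)).getD j 0 ≤ n := by
    intro g j
    by_cases hj : j < E.length
    · exact (getD_map_lt g hj).le
    · rw [List.getD_eq_default _ _ (by simpa using hj)]; omega
  have hB : Bdd M (treeInput r lab E) := by
    refine ⟨by omega, fun x => ?_, fun a i => ?_⟩
    · simp only [treeInput]; split_ifs <;> omega
    · simp only [treeInput]
      split_ifs
      · exact (hlabM _).trans (by omega)
      · omega
      · exact (hgetD _ i).trans (by omega)
      · exact (hgetD _ i).trans (by omega)
      · omega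
  refine Runs.seq (rootTree_runs (A := natAdj G) hB hn (by simp [treeInput]) (by simp [treeInput])
    rfl rfl (by simp [treeInput]) (by simp [treeInput]) (treeOn_natAdj hG)
    (fun v hv f => by simpa [treeInput] using hE.edgeSum hG f hv)
    (fun j hj => by simpa [treeInput] using getD_map_lt Prod.fst (E := E) (by omega : j < E.length))
    (fun j hj => by simpa [treeInput] using getD_map_lt Prod.snd (E := E) (by omega : j < E.length))
    hnM (by omega)) ?_
  rintro s₁ t₁ hB₁ hF₁ ⟨hR, ht₁⟩
  generalize ho : s₁.mem 14 = o at hR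
  generalize hpar : s₁.mem 10 = par at hR
  have r₁ : ∀ x, x < 3 ∨ 6 < x → s₁.reg x = (treeInput r lab E).reg x := fun x hx =>
    hF₁.reg x fun hh => by have := rootTree_regs x hh; omega
  have m₁ : ∀ a, a < 10 ∨ 16 < a → s₁.mem a = (treeInput r lab E).mem a := fun a ha =>
    hF₁.mem a fun hh => by have := rootTree_arrs a hh; omega
  refine Runs.seq (Runs.sqrt hB₁ (by omega)) ?_
  rintro s₂ t₂ hB₂ hF₂ ⟨h80, ht₂⟩
  have r₂ : ∀ x, x < 3 ∨ (6 < x ∧ x ≠ 70 ∧ x ≠ 80) → s₂.reg x = (treeInput r lab E).reg x :=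
    fun x hx => (hF₂.reg x (by simp [Program.sqrt_regs]; omega)).trans (r₁ x (by omega))
  have m₂ : s₂.mem = s₁.mem := by
    funext a; rw [hF₂.mem a (by simp [Program.sqrt_arrs])]
  have e1 : s₁.reg 1 = r := by rw [r₁ 1 (by omega)]; simp [treeInput]
  rw [e1] at h80 ht₂
  have hlab : ∀ i : Fin n, (treeInput r lab E).mem 0 (o i) = (lab (numbering hR i)).toNat := by
    intro i
    simp only [treeInput, if_true]
    rw [dif_pos (hR.lt i i.2)]; rfl
  refine Runs.seq (Q₁ := fun s' t => s' = s₂.fill 67 11 0 n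
      (fun k => (treeInput r lab E).mem 0 (o k)) ∧ t ≤ 60 * n)
    (Runs.sweep 0 n _ hB₂ (by omega) ?_ (by simp) ?_ (fun k _ => hB.mem 0 _)
      fun t _ ht => ⟨rfl, by simp at ht; omega⟩) ?_
  · intro j _
    simp [r₂ 0 (by omega), treeInput]
  · intro j _
    simp [State.fill_mem, m₂, m₁ 0 (by omega), ho]
  rintro _ t₃ hB₃ - ⟨rfl, ht₃⟩
  have hreg : ∀ x, x ≤ 1 ∨ x = 9 ∨ x = 80 → x ∉ (solve p).regs := fun x hx h => by
    have := solve_regs x h; omega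
  have harr : ∀ a, a < 20 ∨ (28 < a ∧ a < 50) → a ∉ (solve p).arrs := fun a ha h => by
    have := solve_arrs a h; omega
  have hfr : Fresh (treeInput r lab E) := fun a i => by
    simp only [treeInput]
    rw [if_neg (by omega), if_neg (by omega), if_neg (by omega)]
    exact Nat.zero_le _
  refine Runs.seq (solve_labelCounts (r := r) (b := true) (lab := lab)
    (w := fun k => (treeInput r lab E).mem 0 (o k)) hp hB₃ hσ
    (by simp [r₂ 0 (by omega), treeInput]) (by simp [r₂ 1 (by omega), treeInput])
    (by simp [r₂ 9 (by omega), treeInput]) (by simp [h80, hσ])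
    (hfr.of_eq (fun a ha => by
      rw [State.fill_mem_ne _ _ _ _ _ _ (by omega), m₂, m₁ a (by omega)]) (by simp [r₂ 99 (by omega)]))
    (by rw [State.fill_mem_ne _ _ _ _ _ _ (by omega), m₂, hpar]) hR
    (fun k hk => by rw [State.fill_mem_same, splice_zero_left _ _ hk])
    (fun i => by rw [hlab]; cases lab (numbering hR i) <;> rfl) hn
    (by simp [r₂ 99 (by omega), treeInput]; omega) hM hM') ?_
  rintro s₄ t₄ hB₄ hF₄ ⟨hout₄, hfr₄, h99₄, ht₄⟩
  have r₄ : ∀ x, x ≤ 1 ∨ x = 9 → s₄.reg x = (treeInput r lab E).reg x := fun x hx => by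
    rw [hF₄.reg x (hreg x (by omega)), State.fill_reg, if_neg (by omega), r₂ x (by omega)]
  have h80₄ : s₄.reg 80 = σ := by rw [hF₄.reg 80 (hreg 80 (by omega))]; simp [h80, hσ]
  have m₄ : ∀ a, a ≠ 11 → a < 20 → s₄.mem a = s₁.mem a := fun a h h' => by
    rw [hF₄.mem a (harr a (by omega)), State.fill_mem_ne _ _ _ _ _ _ h, m₂]
  rw [State.fill_reg, if_neg (by omega), r₂ 99 (by omega)] at h99₄
  have h00 : (treeInput r lab E).reg 0 = n := by simp [treeInput]
  have h99₀ : (treeInput r lab E).reg 99 = 0 := by simp [treeInput]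
  have e0 : s₄.mem 0 = (treeInput r lab E).mem 0 := by rw [m₄ 0 (by omega) (by omega), m₁ 0 (by omega)]
  have e14 : s₄.mem 14 = o := by rw [m₄ 14 (by omega) (by omega), ho]
  refine Runs.seq (Q₁ := fun s' t => s' = s₄.fill 67 3 0 (n + 1) (fun i => s₄.mem 28 i) ∧ t ≤ 60 * n)
    (Runs.sweep 0 (n + 1) _ hB₄ (by omega) (by simp [r₄, h00]) (by simp) (by simp [State.fill_mem])
    (fun i _ => hB₄.mem 28 i) fun t _ ht => ⟨rfl, by simp at ht; omega⟩) ?_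
  rintro _ t₅ hB₅ - ⟨rfl, ht₅⟩
  refine Runs.seq (Q₁ := fun s' t => s' = (s₄.fill 67 3 0 (n + 1) (fun i => s₄.mem 28 i)).fill 67 11 0 n
      (fun k => 1 - (treeInput r lab E).mem 0 (o k)) ∧ t ≤ 60 * n)
    (Runs.sweep 0 n _ hB₅ (by omega) (by simp [r₄, h00]) (by simp)
      (by simp [State.fill_mem, e0, e14]) (fun k _ => (Nat.sub_le _ _).trans (by omega))
      fun t _ ht => ⟨rfl, by simp at ht; omega⟩) ?_
  rintro _ t₆ hB₆ - ⟨rfl, ht₆⟩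
  refine Runs.seq (solve_labelCounts (r := r) (b := false) (lab := lab)
    (w := fun k => 1 - (treeInput r lab E).mem 0 (o k)) hp hB₆ hσ
    (by simp [r₄, h00]) (by simp [r₄, treeInput]) (by simp [r₄, treeInput]) (by simp [h80₄])
    (hfr₄.of_eq (fun a ha => by
      rw [State.fill_mem_ne _ _ _ _ _ _ (by omega), State.fill_mem_ne _ _ _ _ _ _ (by omega)])
      (by simp))
    (by rw [State.fill_mem_ne _ _ _ _ _ _ (by omega), State.fill_mem_ne _ _ _ _ _ _ (by omega),
      m₄ 10 (by omega) (by omega), hpar]) hR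
    (fun k hk => by rw [State.fill_mem_same, splice_zero_left _ _ hk])
    (fun i => by rw [hlab]; cases lab (numbering hR i) <;> rfl) hn
    (by simp only [State.fill_reg, if_neg (show 99 ≠ 67 by omega)]; omega) hM hM') ?_
  rintro s₇ t₇ hB₇ hF₇ ⟨hout₇, -, -, ht₇⟩
  have e07 : s₇.reg 0 = n := by
    rw [hF₇.reg 0 (hreg 0 (by omega))]; simp [r₄, h00]
  refine Runs.sweep 0 (n + 1) (fun i => i - s₇.mem 28 i) hB₇ (by omega) (by simp [e07]) (by simp)
    (by simp [State.fill_mem]) (fun i hi => (Nat.sub_le _ _).trans (by omega)) ?_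
  intro t₈ _ ht₈
  refine ⟨fun i hi hin => ⟨?_, ?_⟩, ?_⟩
  · rw [State.fill_mem_ne _ _ _ _ _ _ (by omega), hF₇.mem 3 (harr 3 (by omega)),
      State.fill_mem_ne _ _ _ _ _ _ (by omega), State.fill_mem_same, splice_zero_left _ _ (by omega)]
    exact hout₄ i hi hin
  · rw [State.fill_mem_same, splice_zero_left _ _ (by omega)]
    exact isGreatest_subgraphOnes (hout₇ i hi hin)
  · have hrn : r * 1 ≤ r * n := Nat.mul_le_mul_left _ hn
    have hrn' : 1 * n ≤ r * n := Nat.mul_le_mul_right _ hr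
    have ht₈' : t₈ ≤ 60 * n := by simp at ht₈; omega
    have hrest : t₁ + t₂ + t₃ + t₅ + t₆ + t₈ ≤ 1000 * (r * n) := by omega
    have := Nat.mul_le_mul_left (σ * σ * (σ * σ)) hrest
    calc _ = σ * σ * (σ * σ) * (t₁ + t₂ + t₃ + t₅ + t₆ + t₈) + σ * σ * (σ * σ) * t₄ +
          σ * σ * (σ * σ) * t₇ := by ring
      _ ≤ _ := by linarith [Nat.zero_le (σ * σ * (σ * σ) * (r * n))]

/-- The third bound concerns the stamps: each of the two passes makes at most (6n+2) · `calls n σ`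
calls of the product. The second pass continues with the stamps of the first. -/
theorem tree_bounds {n r σ k : ℕ} (hn : 1 ≤ n) (hr : 1 ≤ r) (hσ : σ = Nat.sqrt r) :
    (σ + 2) ^ k ≤ (n + r + 2) ^ (k + 8) ∧ σ * σ ≤ (n + r + 2) ^ (k + 8) ∧
    2 * ((6 * n + 2) * calls n σ) ≤ (n + r + 2) ^ (k + 8) ∧
    8 * (n + σ * σ) + 8 ≤ (n + r + 2) ^ (k + 8) ∧
    (4 * n + 10) * (n + 1) ≤ (n + r + 2) ^ (k + 8) ∧ r ≤ (n + r + 2) ^ (k + 8) := by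
  have hq : σ * σ ≤ r := hσ ▸ Nat.sqrt_le r
  have hσr : σ ≤ r := hσ ▸ Nat.sqrt_le_self r
  obtain ⟨X, hX⟩ : ∃ X, X = n + r + 2 := ⟨_, rfl⟩
  rw [← hX]
  have hX4 : 4 ≤ X := by omega
  have hpow : ∀ j, j ≤ k + 8 → X ^ j ≤ X ^ (k + 8) := fun j hj => Nat.pow_le_pow_right (by omega) hj
  have h2 : 4 * 4 ≤ X * X := Nat.mul_le_mul hX4 hX4
  have h1 : X ≤ X ^ (k + 8) := (pow_one X).symm.le.trans (hpow 1 (by omega))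
  refine ⟨(Nat.pow_le_pow_left (by omega) k).trans (hpow k (by omega)), by omega, ?_, ?_, ?_, by omega⟩
  · refine le_trans ?_ (hpow 6 (by omega))
    calc 2 * ((6 * n + 2) * calls n σ) ≤ (2 * (6 * X)) * (X * (X * X)) := by
          rw [calls, ← mul_assoc]; gcongr <;> omega
      _ = 12 * X ^ 4 := by ring
      _ ≤ X * X * X ^ 4 := by gcongr; omega
      _ = X ^ 6 := by ring
  · refine le_trans ?_ (hpow 3 (by omega))
    calc 8 * (n + σ * σ) + 8 ≤ 16 * X := by omega
      _ ≤ X * X * X := by gcongr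
      _ = X ^ 3 := by ring
  · refine le_trans ?_ (hpow 3 (by omega))
    calc (4 * n + 10) * (n + 1) ≤ (4 * X) * X := by gcongr <;> omega
      _ ≤ X * X * X := by gcongr
      _ = X ^ 3 := by ring

theorem exists_solvesTrees {ℓ : ℕ → ℝ} (hℓ : ∀ n : ℕ, 1 ≤ n → 0 < ℓ n) {p : Program} {C : ℝ}
    (h : ComputesMinPlus p fun n => C * ((n : ℝ) ^ 3 / ℓ n)) :
    ∃ (p : Program) (C : ℝ), SolvesTrees p fun n r =>
      C * ((n : ℝ) * (r : ℝ) + (n : ℝ) ^ 2 / ℓ (Nat.sqrt r)) := by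
  obtain ⟨k, hk⟩ := h.canMultiply
  refine ⟨treeProgram p, (270000 : ℕ) + (72 * (2 * p.callFactor + 11000) : ℕ) * C, (k + 8) * 64,
    fun n r G lab E hG hE hr => ?_⟩
  have hn : 1 ≤ n := by have := hE.length hG; omega
  obtain ⟨σ, hσ⟩ : ∃ σ, σ = Nat.sqrt r := ⟨_, rfl⟩
  have hσ1 : 1 ≤ σ := by rw [hσ]; exact Nat.le_sqrt.mpr (by omega)
  obtain ⟨b1, b2, b3, b4, b5, b6⟩ := tree_bounds (k := k) hn hr hσ
  obtain ⟨s', t, hex, -, hout, ht⟩ := treeProgram_runs (lab := lab) (hk σ _ hσ1 b1 b2) hG hE hr hσ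
    b3 b4 b5 b6
  refine ⟨s', t, by rwa [pow_mul], ?_, hout⟩
  beta_reduce
  rw [← hσ]
  have hℓσ := hℓ σ hσ1
  have hpos : 0 ≤ C * ((σ : ℝ) ^ 3 / ℓ σ) :=
    le_trans (by positivity) (WordRAM.ComputesMinPlus.sq_le h hσ1)
  have hfl := Nat.floor_le hpos
  have hσ3 : 0 < (σ : ℝ) ^ 3 := by positivity
  have hCσ : 0 ≤ C / ℓ σ := by
    have e : C * ((σ : ℝ) ^ 3 / ℓ σ) = C / ℓ σ * (σ : ℝ) ^ 3 := by ring
    rw [e] at hpos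
    exact nonneg_of_mul_nonneg_left hpos hσ3
  -- Nonnegativity of C is needed because the two constants are merged into one that multiplies both
  -- terms.
  have hC : 0 ≤ C := by
    have := mul_nonneg hCσ hℓσ.le
    rwa [div_mul_cancel₀ _ hℓσ.ne'] at this
  obtain ⟨F, hF⟩ : ∃ F, F = 2 * p.callFactor + 11000 := ⟨_, rfl⟩
  obtain ⟨c, hc⟩ : ∃ c, c = 270000 := ⟨_, rfl⟩
  rw [← hF, ← hc] at ht ⊢
  have ht' : (σ : ℝ) ^ 4 * t ≤ c * ((σ : ℝ) ^ 4 * (r * n)) +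
      72 * (F * (σ * ⌊C * ((σ : ℝ) ^ 3 / ℓ σ)⌋₊ * (n * n))) := by
    calc (σ : ℝ) ^ 4 * t = ((σ * σ * (σ * σ) * t : ℕ) : ℝ) := by push_cast; ring
      _ ≤ _ := Nat.cast_le.mpr ht
      _ = _ := by push_cast; ring
  -- The factor σ of the shifts and the time Cσ³/ℓ(σ) of a product give Cσ⁴/ℓ(σ), so that σ⁴
  -- cancels.
  have h4 : (σ : ℝ) ^ 4 * t ≤ (σ : ℝ) ^ 4 * (c * (r * n) + 72 * F * (C / ℓ σ) * (n * n)) := by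
    calc (σ : ℝ) ^ 4 * t ≤ _ := ht'
      _ ≤ c * ((σ : ℝ) ^ 4 * (r * n)) + 72 * (F * (σ * (C * ((σ : ℝ) ^ 3 / ℓ σ)) * (n * n))) := by
          gcongr
      _ = _ := by ring
  have h5 := le_of_mul_le_mul_left h4 (by positivity)
  have e1 : 0 ≤ (72 * F : ℝ) * C * (n * r) := by positivity
  have e2 : 0 ≤ (c : ℝ) * ((n : ℝ) ^ 2 / ℓ σ) := by positivity
  calc (t : ℝ) ≤ _ := h5
    _ ≤ c * (r * n) + 72 * F * (C / ℓ σ) * (n * n) + ((72 * F : ℝ) * C * (n * r) +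
          (c : ℝ) * ((n : ℝ) ^ 2 / ℓ σ)) := by linarith
    _ = _ := by push_cast; ring

end Jumbled

theorem theorem1 (ℓ : ℕ → ℝ) (hℓ : ∀ n : ℕ, 1 ≤ n → 0 < ℓ n)
    (hminplus : ∃ (p : WordRAM.Program) (C : ℝ),
      Jumbled.ComputesMinPlus p fun n => C * ((n : ℝ) ^ 3 / ℓ n)) :
    (∃ (p : WordRAM.Program) (C : ℝ),
      Jumbled.SolvesStrings p fun n => C * ((n : ℝ) ^ 2 / ℓ (Nat.sqrt n))) ∧
    (∃ (p : WordRAM.Program) (C : ℝ),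
      Jumbled.SolvesTrees p fun n r =>
        C * ((n : ℝ) * (r : ℝ) + (n : ℝ) ^ 2 / ℓ (Nat.sqrt r))) := by
  obtain ⟨p, C, h⟩ := hminplus
  exact ⟨Jumbled.exists_solvesStrings hℓ h, Jumbled.exists_solvesTrees hℓ h⟩
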